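/- Let $M$ be a $W^*$-algebra and let $E$ be a $W^*$-correspondence over $M$: a self-dual right Hilbert $M$-module with inner product $\langle\cdot,\cdot\rangle$ (linear in the second variable) and a unital, normal left action $\varphi$ of $M$ by adjointable operators. Let $E^{\otimes k}$, $k\ge 0$, be the self-dual tensor powers of $E$ balanced over $M$ ($E^{\otimes 0}=M$), with left action $\varphi_k$; let $\mathcal L(E^{\otimes k})$ be the algebra of bounded module maps of $E^{\otimes k}$ and $\varphi_k(M)^c$ the commutant of $\varphi_k(M)$ in it. A sequence $X=\{X_k\}_{k\ge1}$ is *admissible* if $X_k\in\varphi_k(M)^c$ and $X_k\ge0$ for all $k\ge1$, $X_1$ is invertible, and $\limsup_k\|X_k\|^{1/k}<\infty$. A *weight sequence* is a sequence $Z=\{Z_k\}_{k\ge0}$ of invertible elements $Z_k\in\varphi_k(M)^c$ with $Z_0=I$ and $\sup_k\|Z_k\|<\infty$; put $Z^{(0)}=I$ and $Z^{(m)}=Z_m(I_E\otimes Z_{m-1})\cdots(I_{E^{\otimes(m-1)}}\otimes Z_1)$, and $R_m=(Z^{(m)})^{-1}$. For a normal unital representation $\sigma$ of $M$ on a Hilbert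 space $H$, let $\mathfrak I(\sigma^E\circ\varphi,\sigma)$ be the space of bounded operators $\mathfrak z:E\otimes_\sigma H\to H$ with $\mathfrak z(\varphi(a)\otimes I_H)=\sigma(a)\mathfrak z$ for $a\in M$, and let $\mathfrak z^{(k)}:E^{\otimes k}\otimes_\sigma H\to H$ be given by $\mathfrak z^{(0)}=I_H$, $\mathfrak z^{(k+1)}=\mathfrak z(I_E\otimes\mathfrak z^{(k)})$. The disc $D(X,\sigma)$ is the set of $\mathfrak z\in\mathfrak I(\sigma^E\circ\varphi,\sigma)$ for which $\sum_{k\ge1}\mathfrak z^{(k)}(X_k\otimes I_H)\mathfrak z^{(k)*}$ converges in norm and has norm less than $1$. For $\mathfrak z\in D(X,\sigma)$ the *prepotential* is the map $\Phi_{\mathfrak z}(a)=\sum_{k\ge1}\mathfrak z^{(k)}(X_k\otimes a)\mathfrak z^{(k)*}$ on $\sigma(M)'$. **Theorem.** Let $X=\{X_k\}_{k\ge1}$ be an admissible sequence. Then there is a unique weight sequence $Z=\{Z_k\}_{k\ge0}$ (in particular, the $Z_k$ are uniformly bounded) with the following four properties: 1. $Z_k\in\varphi_k(M)^c$ for all $k\ge0$;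 2. $Z^{(m)}\ge0$ for all $m\ge1$; 3. for every normal representation $\sigma$ of $M$ on a Hilbert space $H$ and every $\mathfrak z\in D(X,\sigma)$, the series $\sum_{k\ge0}\mathfrak z^{(k)}(R_k^2\otimes I_H)\mathfrak z^{(k)*}$ converges in norm; 4. for all such $\sigma$ and $\mathfrak z$, the formulas $\Phi_{\mathfrak z}(a)=\sum_{k\ge1}\mathfrak z^{(k)}(X_k\otimes a)\mathfrak z^{(k)*}$ and $\Theta^R_{\mathfrak z}(a)=\sum_{k\ge0}\mathfrak z^{(k)}(R_k^2\otimes a)\mathfrak z^{(k)*}$ (norm convergent) define bounded completely positive maps on $\sigma(M)'$, and $\Theta^R_{\mathfrak z}$ is the potential of $\Phi_{\mathfrak z}$, that is, $\Theta^R_{\mathfrak z}=\iota+\Phi_{\mathfrak z}+\Phi_{\mathfrak z}^2+\cdots=(\iota-\Phi_{\mathfrak z})^{-1}$, where $\iota$ is the identity map of $\sigma(M)'$ and the series converges in operator norm. Moreover, for this $Z$ every $Z^{(m)}$ is invertible and, for every $k\ge1$, $$R_k=\Bigl(\sum_{l=1}^{k}\ \sum_{\substack{i_1,\dots,i_l\ge1\\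 i_1+\cdots+i_l=k}}X_{i_1}\otimes\cdots\otimes X_{i_l}\Bigr)^{1/2}$$ (the positive square root). -/

import Mathlib

open scoped ComplexOrder

universe u

noncomputable section

set_option linter.unusedSectionVars false

/-! ### `W*`-correspondences -/

/-- A `W*`-correspondence `E` over the `W*`-algebra `M`: a self-dual right Hilbert `M`-module with a
unital left action of `M` by adjointable operators which is normal.  The right action is the
`Mᵐᵒᵖ`-module structure, the left action `φ` is the `M`-module structure, and `ip` is the
`M`-valued inner product, linear in the second variable.

Normality of `φ : M → 𝓛(E)` is preservation of suprema of increasing nets; suprema of increasing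
nets in `𝓛(E)` are computed in the quadratic forms `ξ ↦ ⟨ξ, Tξ⟩`. -/
class WStarCorrespondence (M E : Type u) [CStarAlgebra M] [PartialOrder M] [StarOrderedRing M]
    [NormedAddCommGroup E] [NormedSpace ℂ E] [CompleteSpace E] [Module M E] [Module Mᵐᵒᵖ E] where
  /-- the `M`-valued inner product -/
  ip : E → E → M
  ip_add_right : ∀ ξ η ζ, ip ξ (η + ζ) = ip ξ η + ip ξ ζ
  ip_smul_right : ∀ (c : ℂ) ξ η, ip ξ (c • η) = c • ip ξ η
  ip_mul_right : ∀ ξ η (a : M), ip ξ (MulOpposite.op a • η) = ip ξ η * a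
  star_ip : ∀ ξ η, star (ip ξ η) = ip η ξ
  ip_self_nonneg : ∀ ξ, 0 ≤ ip ξ ξ
  norm_sq_eq : ∀ ξ, ‖ξ‖ ^ 2 = ‖ip ξ ξ‖
  self_dual : ∀ f : E →L[ℂ] M, (∀ ξ (a : M), f (MulOpposite.op a • ξ) = f ξ * a) →
    ∃ η, ∀ ξ, f ξ = ip η ξ
  smul_assoc_left : ∀ (c : ℂ) (a : M) (ξ : E), (c • a) • ξ = c • (a • ξ)
  ip_left_smul : ∀ (a : M) ξ η, ip (a • ξ) η = ip ξ (star a • η)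
  normal_left : ∀ ξ, ScottContinuous fun a : M => ip ξ (a • ξ)

namespace WStar

open WStarCorrespondence

/-! ### Positivity of Gram matrices -/

section Gram

variable {M : Type u} [CStarAlgebra M]

/-- `A` is of the form `B* B` for some rectangular matrix `B` over `M`. -/
def IsGram {ι : Type u} (A : ι → ι → M) : Prop :=
  ∃ (κ : Type u) (_ : Fintype κ) (b : κ → ι → M), ∀ i j, A i j = ∑ l, star (b l i) * b l j

lemma exists_negPart_factor {B : Type u} [CStarAlgebra B] (T : B) (hT : IsSelfAdjoint T) :
    ∃ N S : B, star N = N ∧ N = star S * S ∧ N * T * N = - (star (S * N) * (S * N)) ∧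
      (S * N = 0 → ∃ R : B, T = star R * R) := by
  let _ : PartialOrder B := CStarAlgebra.spectralOrder _
  have _ : StarOrderedRing B := CStarAlgebra.spectralOrderedRing _
  have hN0 : 0 ≤ T⁻ := CFC.negPart_nonneg T
  have hNs : star T⁻ = T⁻ := IsSelfAdjoint.of_nonneg hN0
  obtain ⟨S, hS⟩ := CStarAlgebra.nonneg_iff_eq_star_mul_self.mp hN0
  have hTN : T * T⁻ = - (T⁻ * T⁻) := by
    have h1 : T = T⁺ - T⁻ := (CFC.posPart_sub_negPart T hT).symm
    have h2 : T⁺ * T⁻ = 0 := CFC.posPart_mul_negPart T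
    calc T * T⁻ = (T⁺ - T⁻) * T⁻ := by rw [← h1]
      _ = - (T⁻ * T⁻) := by rw [sub_mul, h2, zero_sub]
  refine ⟨T⁻, S, hNs, hS, ?_, fun hSN => ?_⟩
  · rw [mul_assoc, hTN, star_mul, hNs, mul_assoc, ← mul_assoc (star S), ← hS, mul_neg]
  · have hNN : T⁻ = 0 := by
      have : star T⁻ * T⁻ = 0 := by
        rw [hNs]; nth_rewrite 1 [hS]; rw [mul_assoc, hSN, mul_zero]
      exact (CStarRing.star_mul_self_eq_zero_iff _).mp this
    have hT0 : 0 ≤ T := by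
      rw [← CFC.posPart_sub_negPart T hT, hNN, sub_zero]
      exact CFC.posPart_nonneg T
    exact CStarAlgebra.nonneg_iff_eq_star_mul_self.mp hT0

lemma IsGram.of_quadratic [PartialOrder M] [StarOrderedRing M] {ι : Type u} [Fintype ι]
    (A : ι → ι → M) (hs : ∀ i j, star (A i j) = A j i)
    (hA : ∀ x : ι → M, 0 ≤ ∑ i, ∑ j, star (x i) * A i j * x j) :
    IsGram A := by
  classical
  let T : CStarMatrix ι ι M := CStarMatrix.ofMatrix (Matrix.of A)
  have hT : IsSelfAdjoint T := by
    ext i j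
    exact hs j i
  obtain ⟨N, S, hNs, -, hNTN, hR⟩ := exists_negPart_factor T hT
  have hSN : S * N = 0 := by
    ext l i
    have e1 : (N * T * N) i i = ∑ j, ∑ k, star (N j i) * A j k * N k i := by
      rw [CStarMatrix.mul_apply]
      simp_rw [CStarMatrix.mul_apply, Finset.sum_mul]
      rw [Finset.sum_comm]
      refine Finset.sum_congr rfl fun j _ => Finset.sum_congr rfl fun k _ => ?_
      have : star (N j i) = N i j := by
        conv_rhs => rw [← hNs]
        rfl
      rw [this]; rfl
    have e2 : (star (S * N) * (S * N)) i i = ∑ j, star ((S * N) j i) * (S * N) j i := by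
      rw [CStarMatrix.mul_apply]; rfl
    have h3 : 0 ≤ - ∑ j, star ((S * N) j i) * (S * N) j i := by
      rw [← e2]
      have := hA (fun j => N j i)
      rw [← e1, hNTN] at this
      exact this
    have h4 : ∑ j, star ((S * N) j i) * (S * N) j i = 0 :=
      le_antisymm (by simpa using h3) (Finset.sum_nonneg fun j _ => star_mul_self_nonneg _)
    have h5 := (Finset.sum_eq_zero_iff_of_nonneg
      (fun j _ => star_mul_self_nonneg ((S * N) j i))).mp h4 l (Finset.mem_univ l)
    exact (CStarRing.star_mul_self_eq_zero_iff _).mp h5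
  obtain ⟨R, hR⟩ := hR hSN
  refine ⟨ι, inferInstance, fun l i => R l i, fun i j => ?_⟩
  have : T i j = (star R * R) i j := by rw [← hR]
  rw [CStarMatrix.mul_apply] at this
  exact this

lemma isGram_one {ι : Type u} : IsGram fun _ _ : ι => (1 : M) :=
  ⟨PUnit, inferInstance, fun _ _ => 1, fun _ _ => by simp⟩

end Gram

variable {M E : Type u} [CStarAlgebra M] [PartialOrder M] [StarOrderedRing M]
  [NormedAddCommGroup E] [NormedSpace ℂ E] [CompleteSpace E] [Module M E] [Module Mᵐᵒᵖ E]
  [WStarCorrespondence M E]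

section Inner

lemma ip_add_left (ξ η ζ : E) : (ip (ξ + η) ζ : M) = ip ξ ζ + ip η ζ := by
  rw [← star_ip, ip_add_right, star_add, star_ip, star_ip]

lemma ip_mul_left (ξ η : E) (a : M) : (ip (MulOpposite.op a • ξ) η : M) = star a * ip ξ η := by
  rw [← star_ip, ip_mul_right, star_mul, star_ip]

/-- `ip ξ` as an additive map. -/
def ipRight (M : Type u) {E : Type u} [CStarAlgebra M] [PartialOrder M] [StarOrderedRing M]
    [NormedAddCommGroup E] [NormedSpace ℂ E] [CompleteSpace E] [Module M E] [Module Mᵐᵒᵖ E]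
    [WStarCorrespondence M E] (ξ : E) : E →+ M :=
  AddMonoidHom.mk' (ip ξ) (ip_add_right ξ)

/-- `ip · η` as an additive map. -/
def ipLeft (M : Type u) {E : Type u} [CStarAlgebra M] [PartialOrder M] [StarOrderedRing M]
    [NormedAddCommGroup E] [NormedSpace ℂ E] [CompleteSpace E] [Module M E] [Module Mᵐᵒᵖ E]
    [WStarCorrespondence M E] (η : E) : E →+ M :=
  AddMonoidHom.mk' (fun ξ => ip ξ η) (fun ξ ζ => ip_add_left ξ ζ η)

lemma ip_sum_right {ι : Type*} (s : Finset ι) (ξ : E) (f : ι → E) :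
    (ip ξ (∑ i ∈ s, f i) : M) = ∑ i ∈ s, ip ξ (f i) := map_sum (ipRight M ξ) f s

lemma ip_sum_left {ι : Type*} (s : Finset ι) (η : E) (f : ι → E) :
    (ip (∑ i ∈ s, f i) η : M) = ∑ i ∈ s, ip (f i) η := map_sum (ipLeft M η) f s

lemma isGram_ip {ι : Type u} [Fintype ι] (ξ : ι → E) :
    IsGram fun i j => (ip (ξ i) (ξ j) : M) := by
  refine IsGram.of_quadratic _ (fun i j => star_ip _ _) fun x => ?_
  have : ∑ i, ∑ j, star (x i) * (ip (ξ i) (ξ j) : M) * x j =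
      ip (∑ i, MulOpposite.op (x i) • ξ i) (∑ j, MulOpposite.op (x j) • ξ j) := by
    simp_rw [ip_sum_left, ip_sum_right, ip_mul_left, ip_mul_right, mul_assoc]
  rw [this]
  exact ip_self_nonneg _

end Inner

/-! ### The tensor powers of `E` -/

/-- `kernel k a (ξ₁, …, ξₖ) (η₁, …, ηₖ) = ⟨ξ₁ ⊗ ⋯ ⊗ ξₖ, φₖ(a) (η₁ ⊗ ⋯ ⊗ ηₖ)⟩`, computed from
`⟨ξ ⊗ x, φ(a) η ⊗ y⟩ = ⟨x, φ(⟨ξ, φ(a) η⟩) y⟩`; for `k = 0` (where `E^{⊗0} = M`, with the empty tensor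
standing for `1`) it is `a`. -/
def kernel : (k : ℕ) → M → (Fin k → E) → (Fin k → E) → M
  | 0, a, _, _ => a
  | k + 1, a, u, v => kernel k (ip (u 0) (a • v 0)) (Fin.tail u) (Fin.tail v)

lemma kernel_add (k : ℕ) (a b : M) (u v : Fin k → E) :
    kernel k (a + b) u v = kernel k a u v + kernel k b u v := by
  induction k generalizing a b with
  | zero => rfl
  | succ k ih => simp only [kernel, add_smul, ip_add_right, ih]

/-- the kernel as an additive function of the middle argument -/
def kernelHom (k : ℕ) (u v : Fin k → E) : M →+ M :=
  AddMonoidHom.mk' (fun a => kernel k a u v) (fun a b => kernel_add k a b u v)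

lemma kernel_sub (k : ℕ) (a b : M) (u v : Fin k → E) :
    kernel k (a - b) u v = kernel k a u v - kernel k b u v := map_sub (kernelHom k u v) a b

lemma kernel_smul (k : ℕ) (c : ℂ) (a : M) (u v : Fin k → E) :
    kernel k (c • a) u v = c • kernel k a u v := by
  induction k generalizing a with
  | zero => rfl
  | succ k ih => simp only [kernel, smul_assoc_left, ip_smul_right, ih]

lemma star_kernel (k : ℕ) (a : M) (u v : Fin k → E) :
    star (kernel k a u v) = kernel k (star a) v u := by
  induction k generalizing a with
  | zero => rfl
  | succ k ih =>
    simp only [kernel, ih, star_ip]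
    rw [ip_left_smul]

lemma isGram_kernel (k : ℕ) {ι : Type u} [Fintype ι] (A : ι → ι → M) (hA : IsGram A)
    (u : ι → Fin k → E) : IsGram fun i j => kernel k (A i j) (u i) (u j) := by
  induction k generalizing A with
  | zero => exact hA
  | succ k ih =>
    refine ih _ ?_ (fun i => Fin.tail (u i))
    obtain ⟨κ, _, b, hb⟩ := hA
    choose κ' i' b' hb' using fun l : κ => isGram_ip (M := M) (fun i => b l i • u i 0)
    refine ⟨Σ l, κ' l, inferInstance, fun p i => b' p.1 p.2 i, fun i j => ?_⟩
    change (ip (u i 0) (A i j • u j 0) : M) = _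
    rw [Fintype.sum_sigma, hb, Finset.sum_smul, ip_sum_right]
    refine Finset.sum_congr rfl fun l _ => ?_
    refine Eq.trans ?_ (hb' l i j)
    change _ = (ip (b l i • u i 0) (b l j • u j 0) : M)
    rw [ip_left_smul, mul_smul]

lemma isGram_const {ι : Type u} {p : M} (hp : 0 ≤ p) : IsGram fun _ _ : ι => p := by
  obtain ⟨d, hd⟩ := CStarAlgebra.nonneg_iff_eq_star_mul_self.mp hp
  exact ⟨PUnit, inferInstance, fun _ _ => d, fun _ _ => by simp [hd]⟩

/-- Algebraic tensors `∑ ξ₁ ⊗ ⋯ ⊗ ξₖ · a`, written as finitely supported functions assigning to a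
tuple `(ξ₁, …, ξₖ)` its coefficient `a`.  `form p c d = ⟨c, φₖ(p) d⟩`. -/
def form {k : ℕ} (p : M) (c d : (Fin k → E) →₀ M) : M :=
  c.sum fun u a => d.sum fun v b => star a * kernel k p u v * b

/-- The value at `c` of the conjugate-linear extension of `f`: the formal inner product
`⟨∑ u · a, f⟩ = ∑ a* f(u)`. -/
def pairing {k : ℕ} (c : (Fin k → E) →₀ M) (f : (Fin k → E) → M) : M :=
  c.sum fun u a => star a * f u

lemma form_nonneg {k : ℕ} {p : M} (hp : 0 ≤ p) (c : (Fin k → E) →₀ M) : 0 ≤ form p c c := by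
  classical
  obtain ⟨κ, _, b, hb⟩ := isGram_kernel k (ι := c.support) _ (isGram_const hp) (fun i => i.1)
  have : form p c c = ∑ l, star (∑ i : c.support, b l i * c i) * (∑ i : c.support, b l i * c i) := by
    simp only [form, Finsupp.sum]
    rw [← Finset.sum_coe_sort c.support]
    simp_rw [← Finset.sum_coe_sort c.support, hb, star_sum, star_mul, Finset.sum_mul_sum,
      Finset.mul_sum, Finset.sum_mul]
    rw [Finset.sum_comm' (t' := Finset.univ) (s' := fun _ => Finset.univ) (by simp)]
    conv_rhs => rw [Finset.sum_comm]
    rw [Finset.sum_comm]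
    refine Finset.sum_congr rfl fun i _ => ?_
    rw [Finset.sum_comm]
    refine Finset.sum_congr rfl fun l _ => Finset.sum_congr rfl fun j _ => ?_
    simp only [mul_assoc]
  rw [this]
  exact Finset.sum_nonneg fun l _ => star_mul_self_nonneg _

lemma form_sub {k : ℕ} (p q : M) (c d : (Fin k → E) →₀ M) :
    form (p - q) c d = form p c d - form q c d := by
  simp only [form, Finsupp.sum, kernel_sub, mul_sub, sub_mul, Finset.sum_sub_distrib]

lemma form_smul {k : ℕ} (r : ℂ) (p : M) (c d : (Fin k → E) →₀ M) :
    form (r • p) c d = r • form p c d := by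
  simp only [form, Finsupp.sum, kernel_smul, mul_smul_comm, smul_mul_assoc, Finset.smul_sum]

lemma norm_form_le {k : ℕ} {p : M} (hp : 0 ≤ p) (c : (Fin k → E) →₀ M) :
    ‖form p c c‖ ≤ ‖p‖ * ‖form 1 c c‖ := by
  have h1 : p ≤ ((‖p‖ : ℝ) : ℂ) • (1 : M) := by
    have := IsSelfAdjoint.le_algebraMap_norm_self (a := p) (IsSelfAdjoint.of_nonneg hp)
    rwa [IsScalarTower.algebraMap_apply ℝ ℂ M, Algebra.algebraMap_eq_smul_one] at this
  have h2 := form_nonneg (sub_nonneg.mpr h1) c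
  rw [form_sub, form_smul, sub_nonneg] at h2
  refine (CStarAlgebra.norm_le_norm_of_nonneg_of_le (form_nonneg hp c) h2).trans ?_
  rw [norm_smul]; simp

lemma norm_sum_star_mul_le {κ : Type u} [Fintype κ] (x y : κ → M) :
    ‖∑ l, star (x l) * y l‖ ≤
      √‖∑ l, star (x l) * x l‖ * √‖∑ l, star (y l) * y l‖ := by
  have := CStarModule.norm_inner_le (A := M) (E := WithCStarModule M (κ → M))
    (x := (WithCStarModule.equiv M (κ → M)).symm fun l => star (y l))
    (y := (WithCStarModule.equiv M (κ → M)).symm fun l => star (x l))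
  rw [WithCStarModule.pi_norm, WithCStarModule.pi_norm] at this
  simp only [WithCStarModule.pi_inner, WithCStarModule.equiv_symm_pi_apply,
    WithCStarModule.inner_def, star_star] at this
  rwa [mul_comm] at this

lemma pairing_kernel_le {k : ℕ} (c : (Fin k → E) →₀ M) (v : Fin k → E) :
    ‖pairing c (fun u => kernel k 1 u v)‖ ≤ √‖(kernel k 1 v v : M)‖ * √‖form 1 c c‖ := by
  classical
  let s : Finset (Fin k → E) := insert v c.support
  obtain ⟨κ, _, b, hb⟩ := isGram_kernel k (ι := s) _ (isGram_one (M := M)) (fun i => i.1)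
  let v' : s := ⟨v, Finset.mem_insert_self _ _⟩
  let x : κ → M := fun l => ∑ i : s, b l i * c i
  have hsub : c.support ⊆ s := Finset.subset_insert _ _
  have h1 : pairing c (fun u => kernel k 1 u v) = ∑ l, star (x l) * b l v' := by
    rw [pairing, Finsupp.sum_of_support_subset c hsub _ (by simp), ← Finset.sum_coe_sort s]
    simp_rw [x, star_sum, star_mul, Finset.sum_mul]
    rw [Finset.sum_comm]
    refine Finset.sum_congr rfl fun i _ => ?_
    rw [show kernel k (1 : M) i.1 v = _ from hb i v', Finset.mul_sum]
    simp only [mul_assoc]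
  have h2 : form 1 c c = ∑ l, star (x l) * x l := by
    rw [form, Finsupp.sum_of_support_subset c hsub _ (by simp), ← Finset.sum_coe_sort s]
    simp_rw [x, star_sum, star_mul, Finset.sum_mul]
    rw [Finset.sum_comm]
    refine Finset.sum_congr rfl fun i _ => ?_
    rw [Finsupp.sum_of_support_subset c hsub _ (by simp), ← Finset.sum_coe_sort s]
    simp_rw [Finset.mul_sum, hb, Finset.mul_sum, Finset.sum_mul]
    rw [Finset.sum_comm]
    simp only [mul_assoc]
  rw [h1, h2, show (kernel k (1 : M) v v) = _ from hb v' v', mul_comm]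
  exact norm_sum_star_mul_le _ _

lemma pairing_add {k : ℕ} (c : (Fin k → E) →₀ M) (f g : (Fin k → E) → M) :
    pairing c (f + g) = pairing c f + pairing c g := by
  simp only [pairing, Finsupp.sum, Pi.add_apply, mul_add, Finset.sum_add_distrib]

lemma pairing_smul {k : ℕ} (c : (Fin k → E) →₀ M) (r : ℂ) (f : (Fin k → E) → M) :
    pairing c (r • f) = r • pairing c f := by
  simp only [pairing, Finsupp.sum, Pi.smul_apply, mul_smul_comm, Finset.smul_sum]

lemma pairing_single {k : ℕ} (u : Fin k → E) (a : M) (f : (Fin k → E) → M) :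
    pairing (Finsupp.single u a) f = star a * f u := by
  simp [pairing]

/-- `f` defines a bounded functional on the algebraic tensors, with bound `C`. -/
def BoundedBy {k : ℕ} (f : (Fin k → E) → M) (C : ℝ) : Prop :=
  ∀ c : (Fin k → E) →₀ M, ‖pairing c f‖ ≤ C * √‖form 1 c c‖

variable (M E) in
/-- The bounded conjugate-`M`-linear `M`-valued functionals `f` on the algebraic tensor power, each given
by its values `f (ξ₁, …, ξₖ) = ⟨ξ₁ ⊗ ⋯ ⊗ ξₖ, f⟩` on elementary tensors.  `BoundedBy` says that these values
extend to a bounded functional on all algebraic tensors (in particular `f` is then conjugate linear in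
each variable, balanced over `M`, and kills null vectors). -/
def boundedFunctionals (k : ℕ) : Submodule ℂ ((Fin k → E) → M) where
  carrier := {f | ∃ C : ℝ, 0 ≤ C ∧ BoundedBy f C}
  zero_mem' := ⟨0, le_rfl, fun c => by simp [pairing]⟩
  add_mem' := by
    rintro f g ⟨C, hC, hf⟩ ⟨D, hD, hg⟩
    refine ⟨C + D, add_nonneg hC hD, fun c => ?_⟩
    rw [pairing_add, add_mul]
    exact (norm_add_le _ _).trans (add_le_add (hf c) (hg c))
  smul_mem' := by
    rintro r f ⟨C, hC, hf⟩
    refine ⟨‖r‖ * C, by positivity, fun c => ?_⟩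
    rw [pairing_smul, norm_smul, mul_assoc]
    exact mul_le_mul_of_nonneg_left (hf c) (norm_nonneg _)

variable (M E) in
/-- The tensor power `E^{⊗k}` (balanced over `M`), as a self-dual module: Paschke's self-dual
completion of the algebraic tensor power, that is, the space of all bounded conjugate-`M`-linear
`M`-valued functionals on it, with the functional norm. -/
def TensPow (k : ℕ) : Type u := ↥(boundedFunctionals M E k)

namespace TensPow

variable {k : ℕ}

instance : AddCommGroup (TensPow M E k) := inferInstanceAs (AddCommGroup (boundedFunctionals M E k))

instance : Module ℂ (TensPow M E k) := inferInstanceAs (Module ℂ (boundedFunctionals M E k))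

/-- the functional with given values on elementary tensors -/
def mk (f : (Fin k → E) → M) (hf : ∃ C : ℝ, 0 ≤ C ∧ BoundedBy f C) : TensPow M E k :=
  (⟨f, hf⟩ : boundedFunctionals M E k)

/-- `f.val (ξ₁, …, ξₖ) = ⟨ξ₁ ⊗ ⋯ ⊗ ξₖ, f⟩` -/
def val (f : TensPow M E k) : (Fin k → E) → M := Subtype.val (p := (· ∈ boundedFunctionals M E k)) f

lemma val_bounded (f : TensPow M E k) : ∃ C : ℝ, 0 ≤ C ∧ BoundedBy f.val C :=
  Subtype.property (p := (· ∈ boundedFunctionals M E k)) f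

@[simp] lemma val_zero : (0 : TensPow M E k).val = 0 := rfl

@[ext] lemma ext {f g : TensPow M E k} (h : ∀ u, f.val u = g.val u) : f = g :=
  Subtype.ext (funext h)

/-- The norm of `f` in `E^{⊗k}` is the norm of the functional. -/
instance : Norm (TensPow M E k) := ⟨fun f => sInf {C : ℝ | 0 ≤ C ∧ BoundedBy f.val C}⟩

lemma bddBelow (f : TensPow M E k) : BddBelow {C : ℝ | 0 ≤ C ∧ BoundedBy f.val C} :=
  ⟨0, fun _ h => h.1⟩

lemma norm_le_of (f : TensPow M E k) {C : ℝ} (hC : 0 ≤ C) (h : BoundedBy f.val C) : ‖f‖ ≤ C :=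
  csInf_le (bddBelow f) ⟨hC, h⟩

lemma norm_nonneg' (f : TensPow M E k) : 0 ≤ ‖f‖ := Real.sInf_nonneg fun _ h => h.1

lemma boundedBy_norm (f : TensPow M E k) : BoundedBy f.val ‖f‖ := by
  intro c
  by_cases h0 : √‖(form 1 c c : M)‖ = 0
  · obtain ⟨C, -, hC⟩ := f.val_bounded
    have := hC c
    rw [h0, mul_zero] at this ⊢
    exact this
  · have hpos : 0 < √‖(form 1 c c : M)‖ := lt_of_le_of_ne (Real.sqrt_nonneg _) (Ne.symm h0)
    rw [← div_le_iff₀ hpos]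
    obtain ⟨C, hC⟩ := f.val_bounded
    exact le_csInf ⟨C, hC⟩ fun D hD => (div_le_iff₀ hpos).mpr (hD.2 c)

lemma core : NormedSpace.Core ℂ (TensPow M E k) where
  norm_nonneg := norm_nonneg'
  norm_smul r f := by
    have key : ∀ (r : ℂ) (f : TensPow M E k), ‖r • f‖ ≤ ‖r‖ * ‖f‖ := fun r f => by
      refine norm_le_of _ (mul_nonneg (norm_nonneg _) (norm_nonneg' f)) fun c => ?_
      change ‖pairing c (r • f.val)‖ ≤ _
      rw [pairing_smul, norm_smul, mul_assoc]
      exact mul_le_mul_of_nonneg_left (boundedBy_norm f c) (norm_nonneg _)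
    refine le_antisymm (key r f) ?_
    by_cases hr : r = 0
    · subst hr
      rw [norm_zero, zero_mul]
      exact norm_nonneg' _
    · have := key r⁻¹ (r • f)
      rw [smul_smul, inv_mul_cancel₀ hr, one_smul, norm_inv] at this
      calc ‖r‖ * ‖f‖ ≤ ‖r‖ * (‖r‖⁻¹ * ‖r • f‖) := mul_le_mul_of_nonneg_left this (norm_nonneg _)
        _ = ‖r • f‖ := by
          rw [← mul_assoc, mul_inv_cancel₀ (norm_ne_zero_iff.mpr hr), one_mul]
  norm_triangle f g := by
    refine norm_le_of _ (add_nonneg (norm_nonneg' f) (norm_nonneg' g)) fun c => ?_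
    change ‖pairing c (f.val + g.val)‖ ≤ _
    rw [pairing_add, add_mul]
    exact (norm_add_le _ _).trans (add_le_add (boundedBy_norm f c) (boundedBy_norm g c))
  norm_eq_zero_iff f := by
    constructor
    · intro h
      ext u
      have := boundedBy_norm f (Finsupp.single u 1)
      rw [h, zero_mul, pairing_single, star_one, one_mul] at this
      exact norm_le_zero_iff.mp this
    · rintro rfl
      exact le_antisymm (norm_le_of _ le_rfl fun c => by simp [pairing]) (norm_nonneg' _)

instance : NormedAddCommGroup (TensPow M E k) := NormedAddCommGroup.ofCore core

instance : NormedSpace ℂ (TensPow M E k) := NormedSpace.ofCore core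

/-- The elementary tensor `v₁ ⊗ ⋯ ⊗ vₖ` as an element of `E^{⊗k}`. -/
def tens (v : Fin k → E) : TensPow M E k :=
  mk (fun u => kernel k 1 u v)
    ⟨√‖(kernel k 1 v v : M)‖, Real.sqrt_nonneg _,
    fun c => pairing_kernel_le c v⟩

/-- The right action of `M` on `E^{⊗k}`. -/
def rmul (f : TensPow M E k) (a : M) : TensPow M E k :=
  mk (fun u => f.val u * a)
    ⟨‖f‖ * ‖a‖, by positivity, fun c => by
    have : pairing c (fun u => f.val u * a) = pairing c f.val * a := by
      simp only [pairing, Finsupp.sum, Finset.sum_mul, mul_assoc]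
    rw [this, mul_right_comm]
    exact (norm_mul_le _ _).trans (mul_le_mul_of_nonneg_right (boundedBy_norm f c) (norm_nonneg _))⟩

lemma sqrt_form_le (a : M) (c : (Fin k → E) →₀ M) :
    √‖form (a * star a) c c‖ ≤ ‖a‖ * √‖form 1 c c‖ := by
  refine (Real.sqrt_le_sqrt (norm_form_le (mul_star_self_nonneg a) c)).trans ?_
  rw [CStarRing.norm_self_mul_star, Real.sqrt_mul (by positivity),
    Real.sqrt_mul_self (norm_nonneg _)]

/-- The values of `φₖ(a) f` on elementary tensors: `⟨x, φₖ(a) f⟩ = ⟨φₖ(a*) x, f⟩`. -/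
def lmulFun : (k : ℕ) → M → ((Fin k → E) → M) → (Fin k → E) → M
  | 0, a, f => fun u => a * f u
  | _ + 1, a, f => fun u => f (Fin.cons (star a • u 0) (Fin.tail u))

lemma boundedBy_lmulFun (k : ℕ) (a : M) (f : (Fin k → E) → M) {C : ℝ} (hC : 0 ≤ C)
    (hf : BoundedBy f C) : BoundedBy (lmulFun k a f) (C * ‖a‖) := by
  classical
  intro c
  rw [mul_assoc]
  refine le_trans ?_ (mul_le_mul_of_nonneg_left (sqrt_form_le a c) hC)
  cases k with
  | zero =>
    have h1 : pairing c (lmulFun 0 a f) = pairing (c.mapRange (star a * ·) (mul_zero _)) f := by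
      rw [pairing, pairing, Finsupp.sum_mapRange_index (by simp)]
      simp [lmulFun, mul_assoc]
    have h2 : form (a * star a) c c = form 1 (c.mapRange (star a * ·) (mul_zero _))
        (c.mapRange (star a * ·) (mul_zero _)) := by
      rw [form, form, Finsupp.sum_mapRange_index (by simp)]
      refine Finsupp.sum_congr fun u _ => ?_
      rw [Finsupp.sum_mapRange_index (by simp)]
      simp [kernel, mul_assoc]
    rw [h1, h2]
    exact hf _
  | succ k =>
    let m : (Fin (k + 1) → E) → (Fin (k + 1) → E) := fun u => Fin.cons (star a • u 0) (Fin.tail u)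
    have h1 : pairing c (lmulFun (k + 1) a f) = pairing (c.mapDomain m) f := by
      rw [pairing, pairing, Finsupp.sum_mapDomain_index (by simp) (by simp [add_mul])]
      rfl
    have h2 : form (a * star a) c c = form 1 (c.mapDomain m) (c.mapDomain m) := by
      rw [form, form, Finsupp.sum_mapDomain_index (by simp)
        (by simp [add_mul, Finsupp.sum_add])]
      refine Finsupp.sum_congr fun u _ => ?_
      rw [Finsupp.sum_mapDomain_index (by simp) (by simp [mul_add])]
      refine Finsupp.sum_congr fun v _ => ?_
      simp [kernel, m, ip_left_smul, mul_smul]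
    rw [h1, h2]
    exact hf _

/-- The left action `φₖ(a)` of `a ∈ M` on `E^{⊗k}`. -/
def lmul (a : M) (f : TensPow M E k) : TensPow M E k :=
  mk (lmulFun k a f.val)
    ⟨‖f‖ * ‖a‖, by positivity,
    boundedBy_lmulFun k a f.val (norm_nonneg f) (boundedBy_norm f)⟩

/-- `L_ξ^* : E^{⊗(k+1)} → E^{⊗k}`, the adjoint of the insertion `x ↦ ξ ⊗ x`:
`⟨x, L_ξ^* f⟩ = ⟨ξ ⊗ x, f⟩`. -/
def coinsert (ξ : E) (f : TensPow M E (k + 1)) : TensPow M E k :=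
  mk (fun u => f.val (Fin.cons ξ u))
    ⟨‖f‖ * √‖(ip ξ ξ : M)‖, by positivity, fun c => by
    classical
    have h1 : pairing c (fun u => f.val (Fin.cons ξ u)) =
        pairing (c.mapDomain fun u => (Fin.cons ξ u : Fin (k + 1) → E)) f.val := by
      rw [pairing, pairing, Finsupp.sum_mapDomain_index (by simp) (by simp [add_mul])]
    have h2 : form (ip ξ ξ) c c = form 1 (c.mapDomain fun u => (Fin.cons ξ u : Fin (k + 1) → E))
        (c.mapDomain fun u => (Fin.cons ξ u : Fin (k + 1) → E)) := by
      rw [form, form, Finsupp.sum_mapDomain_index (by simp)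
        (by simp [add_mul, Finsupp.sum_add])]
      refine Finsupp.sum_congr fun u _ => ?_
      rw [Finsupp.sum_mapDomain_index (by simp) (by simp [mul_add])]
      refine Finsupp.sum_congr fun v _ => ?_
      simp [kernel]
    rw [h1, mul_assoc]
    refine (boundedBy_norm f _).trans (mul_le_mul_of_nonneg_left ?_ (norm_nonneg f))
    rw [← h2, ← Real.sqrt_mul (norm_nonneg _)]
    exact Real.sqrt_le_sqrt (norm_form_le (ip_self_nonneg ξ) c)⟩

end TensPow

open TensPow

/-! ### The algebras `𝓛(E^{⊗k})` -/

variable (M E) in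
/-- `𝓛(E^{⊗k})`: the bounded right `M`-module maps of the self-dual module `E^{⊗k}` (on a self-dual
module these are automatically adjointable). -/
def Endo (k : ℕ) : Subalgebra ℂ (TensPow M E k →L[ℂ] TensPow M E k) where
  carrier := {A | ∀ f a, A (rmul f a) = rmul (A f) a}
  mul_mem' := fun {A B} hA hB f a => by
    change A (B (rmul f a)) = rmul (A (B f)) a
    rw [hB, hA]
  add_mem' := fun {A B} hA hB f a => by
    change A (rmul f a) + B (rmul f a) = rmul (A f + B f) a
    rw [hA, hB]
    ext u
    exact (add_mul _ _ _).symm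
  algebraMap_mem' := fun r f a => by
    change r • rmul f a = rmul (r • f) a
    ext u
    exact (smul_mul_assoc r (f.val u) a).symm

/-- The matrix coefficient `⟨u₁ ⊗ ⋯ ⊗ uₖ, A (v₁ ⊗ ⋯ ⊗ vₖ)⟩` of `A ∈ 𝓛(E^{⊗k})`. -/
def coeff {k : ℕ} (A : Endo M E k) (u v : Fin k → E) : M := (A.1 (tens v)).val u

/-- `A ≥ 0` in `𝓛(E^{⊗k})`: `⟨x, A x⟩ ≥ 0` for all algebraic tensors `x` (which are ultraweakly dense in
`E^{⊗k}`). -/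
def IsPos {k : ℕ} (A : Endo M E k) : Prop :=
  ∀ c : (Fin k → E) →₀ M, 0 ≤ c.sum fun u a => c.sum fun v b => star a * coeff A u v * b

variable (M E) in
/-- The relative commutant `φₖ(M)ᶜ` of `φₖ(M)` in `𝓛(E^{⊗k})`. -/
def relCommutant (k : ℕ) : Set (Endo M E k) :=
  {A | ∀ a f, A.1 (lmul a f) = lmul a (A.1 f)}

/-- `B = I_E ⊗ A`: equivalently `L_ξ^* B = A L_ξ^*` for every `ξ ∈ E`. -/
def IsIdTensor {k : ℕ} (A : Endo M E k) (B : Endo M E (k + 1)) : Prop :=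
  ∀ ξ f, coinsert ξ (B.1 f) = A.1 (coinsert ξ f)

open Classical in
/-- `I_E ⊗ A ∈ 𝓛(E^{⊗(k+1)})`, the unique operator with `IsIdTensor A`; it exists for
`A ∈ φₖ(M)ᶜ`, the only case in which it is used. -/
def idTensor {k : ℕ} (A : Endo M E k) : Endo M E (k + 1) :=
  if h : ∃ B, IsIdTensor A B then h.choose else 0

/-- `C = A ⊗ B`, through its matrix coefficients
`⟨u ⊗ v, (A ⊗ B)(u' ⊗ v')⟩ = ⟨v, φ_l(⟨u, A u'⟩) B v'⟩`. -/
def IsTensor {k l : ℕ} (A : Endo M E k) (B : Endo M E l) (C : Endo M E (k + l)) : Prop :=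
  ∀ (u u' : Fin k → E) (v v' : Fin l → E),
    coeff C (Fin.append u v) (Fin.append u' v') = (lmul (coeff A u u') (B.1 (tens v'))).val v

open Classical in
/-- `A ⊗ B ∈ 𝓛(E^{⊗(k+l)})`, the unique operator with `IsTensor A B`; it exists for
`B ∈ φ_l(M)ᶜ`, the only case in which it is used. -/
def tensor {k l : ℕ} (A : Endo M E k) (B : Endo M E l) : Endo M E (k + l) :=
  if h : ∃ C, IsTensor A B C then h.choose else 0

/-- `X_{i₁} ⊗ ⋯ ⊗ X_{i_l} ∈ 𝓛(E^{⊗(i₁ + ⋯ + i_l)})`. -/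
def wordTensor (X : (k : ℕ) → Endo M E k) : (w : List ℕ) → Endo M E w.sum
  | [] => 1
  | i :: w => tensor (X i) (wordTensor X w)

/-- `∑ X_{i₁} ⊗ ⋯ ⊗ X_{i_l}` over all `l` and all positive integers `i₁, …, i_l` with sum `k`. -/
def compositionSum (X : (k : ℕ) → Endo M E k) (k : ℕ) : Endo M E k :=
  ∑ c : Composition k, c.blocks_sum ▸ wordTensor X c.blocks

/-- `Z^{(k)} = Z_k (I_E ⊗ Z_{k-1}) ⋯ (I_{E^{⊗(k-1)}} ⊗ Z_1)`. -/
def weightPow (Z : (k : ℕ) → Endo M E k) : (k : ℕ) → Endo M E k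
  | 0 => 1
  | k + 1 => Z (k + 1) * idTensor (weightPow Z k)

/-- `R_k = (Z^{(k)})⁻¹`. -/
def invWeight (Z : (k : ℕ) → Endo M E k) (k : ℕ) : Endo M E k := Ring.inverse (weightPow Z k)

/-- Weight sequences. -/
structure IsWeightSequence (Z : (k : ℕ) → Endo M E k) : Prop where
  mem : ∀ k, Z k ∈ relCommutant M E k
  zero : Z 0 = 1
  bdd : BddAbove (Set.range fun k => ‖(Z k).1‖)
  isUnit : ∀ k, IsUnit (Z k)

/-- Admissible sequences `X₁, X₂, …`; the entry `X 0` is a placeholder that plays no role. -/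
structure IsAdmissible (X : (k : ℕ) → Endo M E k) : Prop where
  mem : ∀ k, 1 ≤ k → X k ∈ relCommutant M E k
  pos : ∀ k, 1 ≤ k → IsPos (X k)
  isUnit : IsUnit (X 1)
  limsup_lt_top :
    Filter.limsup (fun k : ℕ => ENNReal.ofReal (‖(X k).1‖ ^ (1 / (k : ℝ)))) Filter.atTop < ⊤

/-! ### The Hilbert spaces `E^{⊗k} ⊗_σ H` -/

section Hilbert

variable {H : Type u} [NormedAddCommGroup H] [InnerProductSpace ℂ H] [CompleteSpace H]

/-- The algebraic tensors `∑ ξ₁ ⊗ ⋯ ⊗ ξₖ ⊗ h` of `E^{⊗k} ⊗_σ H`, written as finitely supported functions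
assigning `h` to the tuple `(ξ₁, …, ξₖ)`. -/
@[nolint unusedArguments]
def PreHTensor (E : Type u) (_σ : M →⋆ₐ[ℂ] (H →L[ℂ] H)) (k : ℕ) : Type u := (Fin k → E) →₀ H

instance (σ : M →⋆ₐ[ℂ] (H →L[ℂ] H)) (k : ℕ) : AddCommGroup (PreHTensor E σ k) :=
  inferInstanceAs (AddCommGroup ((Fin k → E) →₀ H))

instance (σ : M →⋆ₐ[ℂ] (H →L[ℂ] H)) (k : ℕ) : Module ℂ (PreHTensor E σ k) :=
  inferInstanceAs (Module ℂ ((Fin k → E) →₀ H))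

/-- `⟨u ⊗ h, v ⊗ g⟩ = ⟨h, σ(⟨u, v⟩) g⟩`. -/
def preInner (σ : M →⋆ₐ[ℂ] (H →L[ℂ] H)) {k : ℕ} (c d : (Fin k → E) →₀ H) : ℂ :=
  c.sum fun u h => d.sum fun v g => inner ℂ h (σ (kernel k 1 u v) g)

lemma preInner_self (σ : M →⋆ₐ[ℂ] (H →L[ℂ] H)) {k : ℕ} (c : (Fin k → E) →₀ H) :
    0 ≤ preInner σ c c := by
  classical
  obtain ⟨κ, _, b, hb⟩ := isGram_kernel k (ι := c.support) _ (isGram_one (M := M)) (fun i => i.1)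
  have : preInner σ c c = ∑ l, inner ℂ (∑ i : c.support, σ (b l i) (c i))
      (∑ i : c.support, σ (b l i) (c i)) := by
    simp only [preInner, Finsupp.sum]
    rw [← Finset.sum_coe_sort c.support]
    simp_rw [← Finset.sum_coe_sort c.support, hb, map_sum, map_mul, map_star, sum_inner, inner_sum]
    conv_rhs => rw [Finset.sum_comm]
    refine Finset.sum_congr rfl fun i _ => ?_
    conv_rhs => rw [Finset.sum_comm]
    refine Finset.sum_congr rfl fun j _ => ?_
    rw [sum_apply, inner_sum]
    refine Finset.sum_congr rfl fun l _ => ?_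
    rw [mul_apply_eq_comp, ContinuousLinearMap.star_eq_adjoint,
      ContinuousLinearMap.adjoint_inner_right]
  rw [this]
  refine Finset.sum_nonneg fun l _ => ?_
  rw [inner_self_eq_norm_sq_to_K]
  exact pow_nonneg (RCLike.ofReal_nonneg.mpr (norm_nonneg _)) 2

lemma preInner_add_left (σ : M →⋆ₐ[ℂ] (H →L[ℂ] H)) {k : ℕ} (c d e : (Fin k → E) →₀ H) :
    preInner σ (c + d) e = preInner σ c e + preInner σ d e := by
  classical
  rw [preInner, Finsupp.sum_add_index' (by simp) (by simp [Finsupp.sum_add])]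
  rfl

lemma preInner_smul_left (σ : M →⋆ₐ[ℂ] (H →L[ℂ] H)) {k : ℕ} (c d : (Fin k → E) →₀ H) (r : ℂ) :
    preInner σ (r • c) d = (starRingEnd ℂ) r * preInner σ c d := by
  rw [preInner, Finsupp.sum_smul_index' (by simp)]
  simp only [inner_smul_left, preInner, Finsupp.sum, Finset.mul_sum]

/-- The semi-inner product on the algebraic tensors. -/
@[reducible]
def preCore (E : Type u) [NormedAddCommGroup E] [NormedSpace ℂ E] [CompleteSpace E] [Module M E]
    [Module Mᵐᵒᵖ E] [WStarCorrespondence M E] (σ : M →⋆ₐ[ℂ] (H →L[ℂ] H)) (k : ℕ) :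
    PreInnerProductSpace.Core ℂ (PreHTensor E σ k) where
  inner c d := preInner σ c d
  conj_inner_symm c d := by
    simp only [preInner, Finsupp.sum, map_sum]
    rw [Finset.sum_comm]
    refine Finset.sum_congr rfl fun u _ => Finset.sum_congr rfl fun v _ => ?_
    rw [inner_conj_symm, ← ContinuousLinearMap.adjoint_inner_right,
      ← ContinuousLinearMap.star_eq_adjoint, ← map_star, star_kernel, star_one]
  re_inner_nonneg c := (Complex.nonneg_iff.mp (preInner_self σ c)).1
  add_left c d e := by
    classical
    exact preInner_add_left σ c d e
  smul_left c d r := by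
    exact preInner_smul_left σ c d r

instance (σ : M →⋆ₐ[ℂ] (H →L[ℂ] H)) (k : ℕ) : SeminormedAddCommGroup (PreHTensor E σ k) :=
  @InnerProductSpace.Core.toSeminormedAddCommGroup ℂ _ _ _ _ (preCore E σ k)

instance (σ : M →⋆ₐ[ℂ] (H →L[ℂ] H)) (k : ℕ) : InnerProductSpace ℂ (PreHTensor E σ k) :=
  InnerProductSpace.ofCore (preCore E σ k)

/-- The Hilbert space `E^{⊗k} ⊗_σ H`: the Hausdorff completion of the algebraic tensors. -/
abbrev HTensor (E : Type u) [NormedAddCommGroup E] [NormedSpace ℂ E] [CompleteSpace E] [Module M E]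
    [Module Mᵐᵒᵖ E] [WStarCorrespondence M E] (σ : M →⋆ₐ[ℂ] (H →L[ℂ] H)) (k : ℕ) : Type u :=
  UniformSpace.Completion (PreHTensor E σ k)

/-- The elementary tensor `u₁ ⊗ ⋯ ⊗ uₖ ⊗ h`. -/
def htens (σ : M →⋆ₐ[ℂ] (H →L[ℂ] H)) {k : ℕ} (u : Fin k → E) (h : H) : HTensor E σ k :=
  UniformSpace.Completion.coe' (α := PreHTensor E σ k) (Finsupp.single u h : (Fin k → E) →₀ H)

variable (E) in
/-- The intertwiner space `𝔍(σ^E ∘ φ, σ)`: bounded operators `z : E ⊗_σ H → H` such that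
`z (φ(a) ⊗ I_H) = σ(a) z` for all `a ∈ M`. -/
def intertwiners (σ : M →⋆ₐ[ℂ] (H →L[ℂ] H)) : Set (HTensor E σ 1 →L[ℂ] H) :=
  {z | ∀ (a : M) (ξ : E) (h : H), z (htens σ ![a • ξ] h) = σ a (z (htens σ ![ξ] h))}

/-- `S = I_E ⊗ T` for `T : E^{⊗k} ⊗_σ H → H`, i.e. `S (ξ ⊗ u ⊗ h) = ξ ⊗ T (u ⊗ h)`. -/
def IsIdTensorH {σ : M →⋆ₐ[ℂ] (H →L[ℂ] H)} {k : ℕ} (T : HTensor E σ k →L[ℂ] H)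
    (S : HTensor E σ (k + 1) →L[ℂ] HTensor E σ 1) : Prop :=
  ∀ (ξ : E) (u : Fin k → E) (h : H),
    S (htens σ (Fin.cons ξ u : Fin (k + 1) → E) h) = htens σ ![ξ] (T (htens σ u h))

open Classical in
/-- `I_E ⊗ T`, the unique bounded operator with `IsIdTensorH T`; it exists when `T` intertwines
`φₖ(·) ⊗ I_H` and `σ`, the only case in which it is used. -/
def idTensorH {σ : M →⋆ₐ[ℂ] (H →L[ℂ] H)} {k : ℕ} (T : HTensor E σ k →L[ℂ] H) :
    HTensor E σ (k + 1) →L[ℂ] HTensor E σ 1 :=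
  if h : ∃ S, IsIdTensorH T S then h.choose else 0

open Classical in
/-- The identification `M ⊗_σ H = H`, `a ⊗ h ↦ σ(a) h`; here `E^{⊗0} = M` is spanned by the empty
tensor `1`. -/
def unitMap (σ : M →⋆ₐ[ℂ] (H →L[ℂ] H)) : HTensor E σ 0 →L[ℂ] H :=
  if h : ∃ S : HTensor E σ 0 →L[ℂ] H, ∀ (u : Fin 0 → E) (x : H), S (htens σ u x) = x
  then h.choose else 0

/-- The tensorial powers `z^{(k)} : E^{⊗k} ⊗_σ H → H` with `z^{(k+1)} = z (I_E ⊗ z^{(k)})`; `z^{(0)}` is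
the identification `M ⊗_σ H = H`, so that `z^{(1)} = z`. -/
def tensorialPow {σ : M →⋆ₐ[ℂ] (H →L[ℂ] H)} (z : HTensor E σ 1 →L[ℂ] H) :
    (k : ℕ) → HTensor E σ k →L[ℂ] H
  | 0 => unitMap σ
  | k + 1 => z ∘L idTensorH (tensorialPow z k)

/-- `T = S ⊗ a` on `E^{⊗k} ⊗_σ H`, through `⟨u ⊗ h, (S ⊗ a)(v ⊗ g)⟩ = ⟨h, σ(⟨u, S v⟩) a g⟩`. -/
def IsTensorOp {σ : M →⋆ₐ[ℂ] (H →L[ℂ] H)} {k : ℕ} (S : Endo M E k) (a : H →L[ℂ] H)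
    (T : HTensor E σ k →L[ℂ] HTensor E σ k) : Prop :=
  ∀ (u v : Fin k → E) (h g : H),
    inner ℂ (htens σ u h) (T (htens σ v g)) = inner ℂ h (σ (coeff S u v) (a g))

open Classical in
/-- `S ⊗ a` on `E^{⊗k} ⊗_σ H`, the unique bounded operator with `IsTensorOp S a`; it exists for
`S ∈ 𝓛(E^{⊗k})` and `a ∈ σ(M)'`, the only case in which it is used. -/
def tensorOp (σ : M →⋆ₐ[ℂ] (H →L[ℂ] H)) {k : ℕ} (S : Endo M E k) (a : H →L[ℂ] H) :
    HTensor E σ k →L[ℂ] HTensor E σ k :=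
  if h : ∃ T, IsTensorOp S a T then h.choose else 0

/-- `z^{(k)} (S ⊗ a) z^{(k)*}`. -/
def cpTerm {σ : M →⋆ₐ[ℂ] (H →L[ℂ] H)} (z : HTensor E σ 1 →L[ℂ] H) {k : ℕ} (S : Endo M E k)
    (a : H →L[ℂ] H) : H →L[ℂ] H :=
  tensorialPow z k ∘L tensorOp σ S a ∘L ContinuousLinearMap.adjoint (tensorialPow z k)

/-- The disc `D(X, σ)`: all intertwiners `z` for which `∑_{k ≥ 1} z^{(k)} (X_k ⊗ I_H) z^{(k)*}` converges in
norm to an operator of norm less than one. -/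
def disc (X : (k : ℕ) → Endo M E k) (σ : M →⋆ₐ[ℂ] (H →L[ℂ] H)) : Set (HTensor E σ 1 →L[ℂ] H) :=
  {z | z ∈ intertwiners E σ ∧ ∃ T : H →L[ℂ] H,
    HasSum (fun k : ℕ => cpTerm z (X (k + 1)) 1) T ∧ ‖T‖ < 1}

/-- The commutant `σ(M)'`. -/
abbrev commutant (σ : M →⋆ₐ[ℂ] (H →L[ℂ] H)) : StarSubalgebra ℂ (H →L[ℂ] H) :=
  StarSubalgebra.centralizer ℂ (Set.range σ)

/-- Complete positivity of a map `Ψ` on `σ(M)'`: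
`∑ᵢⱼ ⟨hᵢ, Ψ(aᵢ* aⱼ) hⱼ⟩ ≥ 0` for all finite families `aᵢ ∈ σ(M)'`, `hᵢ ∈ H`. -/
def IsCompletelyPositive {σ : M →⋆ₐ[ℂ] (H →L[ℂ] H)} (Ψ : commutant σ →L[ℂ] commutant σ) : Prop :=
  ∀ (n : ℕ) (a : Fin n → commutant σ) (h : Fin n → H),
    0 ≤ ∑ i, ∑ j, inner ℂ (h i) ((Ψ (star (a i) * a j) : H →L[ℂ] H) (h j))

/-- `Φ = Φ_z`, the prepotential `Φ_z(a) = ∑_{k ≥ 1} z^{(k)} (X_k ⊗ a) z^{(k)*}` on `σ(M)'`. -/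
def IsPrepotential {σ : M →⋆ₐ[ℂ] (H →L[ℂ] H)} (X : (k : ℕ) → Endo M E k)
    (z : HTensor E σ 1 →L[ℂ] H) (Φ : commutant σ →L[ℂ] commutant σ) : Prop :=
  ∀ a : commutant σ, HasSum (fun k : ℕ => cpTerm z (X (k + 1)) (a : H →L[ℂ] H)) (Φ a : H →L[ℂ] H)

/-- `Θ = Θ_z^R`, the map `Θ_z^R(a) = ∑_{k ≥ 0} z^{(k)} (R_k² ⊗ a) z^{(k)*}` on `σ(M)'`. -/
def IsThetaR {σ : M →⋆ₐ[ℂ] (H →L[ℂ] H)} (R : (k : ℕ) → Endo M E k)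
    (z : HTensor E σ 1 →L[ℂ] H) (Θ : commutant σ →L[ℂ] commutant σ) : Prop :=
  ∀ a : commutant σ, HasSum (fun k : ℕ => cpTerm z (R k * R k) (a : H →L[ℂ] H)) (Θ a : H →L[ℂ] H)

/-- `Θ` is the potential of `Φ`: `Θ = ι + Φ + Φ² + ⋯ = (ι - Φ)⁻¹`. -/
def IsPotential {σ : M →⋆ₐ[ℂ] (H →L[ℂ] H)} (Θ Φ : commutant σ →L[ℂ] commutant σ) : Prop :=
  HasSum (fun l : ℕ => Φ ^ l) Θ ∧ (1 - Φ) * Θ = 1 ∧ Θ * (1 - Φ) = 1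

end Hilbert

/-- For every normal representation `σ` of `M` on a Hilbert space `H` and every `z ∈ D(X, σ)`, the series
`∑_{k ≥ 0} z^{(k)} (R_k² ⊗ I_H) z^{(k)*}` converges in norm. -/
def SeriesConverges (X R : (k : ℕ) → Endo M E k) : Prop :=
  ∀ (H : Type u) [NormedAddCommGroup H] [InnerProductSpace ℂ H] [CompleteSpace H]
    (σ : M →⋆ₐ[ℂ] (H →L[ℂ] H)), ScottContinuous σ → ∀ z ∈ disc X σ,
      Summable fun k : ℕ => cpTerm z (R k * R k) (1 : H →L[ℂ] H)

/-- For every normal representation `σ` of `M` on a Hilbert space `H` and every `z ∈ D(X, σ)`, the maps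
`Φ_z` and `Θ_z^R` on `σ(M)'` exist, are completely positive, and `Θ_z^R` is the potential of `Φ_z`. -/
def ThetaIsPotential (X R : (k : ℕ) → Endo M E k) : Prop :=
  ∀ (H : Type u) [NormedAddCommGroup H] [InnerProductSpace ℂ H] [CompleteSpace H]
    (σ : M →⋆ₐ[ℂ] (H →L[ℂ] H)), ScottContinuous σ → ∀ z ∈ disc X σ,
      ∃ Φ Θ : commutant σ →L[ℂ] commutant σ, IsPrepotential X z Φ ∧ IsThetaR R z Θ ∧
        IsCompletelyPositive Φ ∧ IsCompletelyPositive Θ ∧ IsPotential Θ Φ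

/-- The four properties that characterise the weight sequence `Z` attached to `X`. -/
structure IsCanonicalWeight (X Z : (k : ℕ) → Endo M E k) : Prop where
  weight : IsWeightSequence Z
  mem : ∀ k, Z k ∈ relCommutant M E k
  pos : ∀ m, 1 ≤ m → IsPos (weightPow Z m)
  converges : SeriesConverges X (invWeight Z)
  potential : ThetaIsPotential X (invWeight Z)

end WStar

end

/-! Write S_k for the sum of X_{i₁} ⊗ ⋯ ⊗ X_{i_l} over all compositions of k (`compositionSum`), so
that S_0 = 1. The identity z^{(k+l)}(A ⊗ B ⊗ a)z^{(k+l)*} = z^{(k)}(A ⊗ b)z^{(k)*} with b =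
z^{(l)}(B ⊗ a)z^{(l)*} (`cpTerm_tensor`) turns tensor products into compositions of maps on σ(M)'.
Formally, then, ι + Φ + Φ² + ⋯ is the series with coefficients S_k. This forces R_k = S_k^{1/2} and
Z_{k+1} = R_{k+1}⁻¹(I_E ⊗ R_k), for which Z^{(k)} telescopes to R_k⁻¹.

Boundedness of Z. The compositions of k+1 that begin with 1 give S_{k+1} ≥ X_1 ⊗ S_k ≥ c(I_E ⊗ S_k),
where c > 0 is a lower bound of the positive invertible operator X_1. By induction every S_k is
invertible, and Z_{k+1}Z_{k+1}^* ≤ 1/c (`norm_canonicalWeight_le`).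

The potential. On the disc ‖Φ‖ < 1, because such series of completely positive maps are controlled
by their value at 1 (`norm_sum_cpTerm_le`); so Θ = (ι - Φ)⁻¹ is a Neumann series. Boundedness of the
partial sums would not give norm convergence of the series with coefficients S_k. Splitting off the
first block of a composition shows instead that its terms satisfy a renewal equation with a positive
kernel of norm less than one, and `hasSum_renewal` yields norm convergence to Θ(a) for a ≥ 0;
polarisation extends this to all a.

Uniqueness. On the truncated Fock space, the direct sum of E^{⊗n} ⊗_σ H for n ≤ k, a small multiple
of the shift lies in the disc. Applying Θ to the projection onto degree zero and compressing to
degree k returns a nonzero multiple of R_k² ⊗ 1 (`ThetaIsPotential.mul_self_eq`). So R_k² is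
determined, positivity then determines Z^{(k)}, and the Z^{(k)} determine Z.

Foundations. E^{⊗k} is given as a space of functionals, without an inner product or adjoints. Both
come from Hilbert space. Separation in the predual shows that the normal representations of M detect
positivity (`nonneg_of_normalRep`). Each f in E^{⊗k} acts as an operator `rho σ f`, and ρ(f)^*ρ(f)
is the image of an element of M that does not depend on the representation, being the supremum of an
increasing net (`exists_rho_adjoint_mul_self`). This gives the inner product `tip`, the
representations A ↦ A ⊗ 1 (`amp`) and the C*-structure of 𝓛(E^{⊗k}); all later operator identities
are checked in the representations `amp`. -/

open scoped ComplexOrder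

noncomputable section

set_option linter.unusedSectionVars false

namespace WStar

/-! ### Separation in dual Banach spaces -/

section KreinSmulian

variable {V : Type u} [NormedAddCommGroup V] [NormedSpace ℂ V]

/-- A point outside a compact convex set for the weak-* topology is separated from it by a vector of
the predual. -/
lemma exists_re_lt_of_notMem_compact {K : Set (WeakBilin (topDualPairing ℂ V))} (hK : IsCompact K)
    (hc : Convex ℝ K) {x : WeakBilin (topDualPairing ℂ V)} (hx : x ∉ K) :
    ∃ (v : V) (s : ℝ), (topDualPairing ℂ V x v).re < s ∧
      ∀ y ∈ K, s < (topDualPairing ℂ V y v).re := by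
  have _ : T2Space (WeakBilin (topDualPairing ℂ V)) :=
    inferInstanceAs (T2Space (WeakDual ℂ V))
  obtain ⟨f, s, h1, h2⟩ := RCLike.geometric_hahn_banach_point_closed (𝕜 := ℂ) hc hK.isClosed hx
  obtain ⟨v, hv⟩ := LinearMap.dualEmbedding_surjective (topDualPairing ℂ V) f
  have hv' : ∀ y, f y = topDualPairing ℂ V y v := fun y => by rw [← hv]; rfl
  refine ⟨v, s, ?_, fun y hy => ?_⟩
  · have := h1; rw [hv'] at this; exact this
  · have := h2 y hy; rw [hv'] at this; exact this

/-- Weak-* compactness of a set of functionals. -/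
def IsWeakStarCompact (K : Set (StrongDual ℂ V)) : Prop :=
  IsCompact (WeakDual.toStrongDual ⁻¹' K : Set (WeakDual ℂ V))

lemma IsWeakStarCompact.add {K L : Set (StrongDual ℂ V)} (hK : IsWeakStarCompact K)
    (hL : IsWeakStarCompact L) : IsWeakStarCompact {x | ∃ y ∈ K, ∃ z ∈ L, y + z = x} := by
  have := IsCompact.image (hK.prod hL)
    (f := fun p : WeakDual ℂ V × WeakDual ℂ V => p.1 + p.2) continuous_add
  refine (congrArg IsCompact ?_).mp this
  ext x
  constructor
  · rintro ⟨⟨y, z⟩, ⟨hy, hz⟩, rfl⟩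
    exact ⟨_, hy, _, hz, rfl⟩
  · rintro ⟨y, hy, z, hz, h⟩
    exact ⟨(StrongDual.toWeakDual y, StrongDual.toWeakDual z), ⟨hy, hz⟩, h⟩

lemma IsWeakStarCompact.exists_re_lt {K : Set (StrongDual ℂ V)} (hK : IsWeakStarCompact K)
    (hc : ∀ x ∈ K, ∀ y ∈ K, ∀ s t : ℝ, 0 ≤ s → 0 ≤ t → s + t = 1 →
      (s : ℂ) • x + (t : ℂ) • y ∈ K) {x : StrongDual ℂ V} (hx : x ∉ K) :
    ∃ (v : V) (s : ℝ), (x v).re < s ∧ ∀ y ∈ K, s < (y v).re := by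
  refine exists_re_lt_of_notMem_compact (K := K) hK ?_ hx
  intro y hy z hz s t hs ht hst
  exact hc y hy z hz s t hs ht hst

lemma isWeakStarCompact_closedBall (r : ℝ) :
    IsWeakStarCompact (Metric.closedBall (0 : StrongDual ℂ V) r) :=
  WeakDual.isCompact_closedBall 0 r

variable {P : Set (StrongDual ℂ V)} (hadd : ∀ x ∈ P, ∀ y ∈ P, x + y ∈ P)
  (hsmul : ∀ c : ℝ, 0 ≤ c → ∀ x ∈ P, (c : ℂ) • x ∈ P)
  (hP : ∀ r, IsWeakStarCompact (P ∩ Metric.closedBall 0 r))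

include hadd hsmul in
lemma cone_inter_ball_convex (r : ℝ) : ∀ x ∈ P ∩ Metric.closedBall 0 r,
    ∀ y ∈ P ∩ Metric.closedBall 0 r, ∀ s t : ℝ, 0 ≤ s → 0 ≤ t → s + t = 1 →
      (s : ℂ) • x + (t : ℂ) • y ∈ P ∩ Metric.closedBall 0 r := by
  rintro x ⟨hx, hx'⟩ y ⟨hy, hy'⟩ s t hs ht hst
  refine ⟨hadd _ (hsmul s hs x hx) _ (hsmul t ht y hy), ?_⟩
  rw [mem_closedBall_zero_iff] at *
  calc ‖(s : ℂ) • x + (t : ℂ) • y‖ ≤ s * ‖x‖ + t * ‖y‖ := by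
        refine (norm_add_le _ _).trans (le_of_eq ?_)
        simp [norm_smul, abs_of_nonneg hs, abs_of_nonneg ht]
    _ ≤ s * r + t * r := by gcongr
    _ = r := by rw [← add_mul, hst, one_mul]

-- The part of `P` in a large ball, thickened by r/2, is weak-* compact and convex and misses `a`,
-- so a vector v separates them. The thickening supplies the margin r/2 in the value at `a`. The
-- size of the large ball makes v almost nonnegative on the unit part of `P`.
include hadd hsmul hP in
lemma exists_almost_nonneg (h0 : (0 : StrongDual ℂ V) ∈ P) (a : StrongDual ℂ V) {r : ℝ} (hr : 0 < r)
    (ha : ∀ x ∈ P, r ≤ ‖a - x‖) {ε : ℝ} (hε : 0 < ε) :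
    ∃ v : V, (a v).re ≤ -(r / 2) ∧ ∀ x ∈ P, ‖x‖ ≤ 1 → -ε ≤ (x v).re := by
  -- For x in `P` of norm at most 1 the separation will be applied to n·x; it bounds n·Re x(v) below
  -- by about -‖a‖‖v‖, so this n produces the error ε.
  let n : ℝ := (‖a‖ + 1) / ε
  have hn : 0 < n := by positivity
  have hK := (hP n).add (isWeakStarCompact_closedBall (V := V) (r / 2))
  have haK : a ∉ {x | ∃ y ∈ P ∩ Metric.closedBall 0 n,
      ∃ z ∈ Metric.closedBall (0 : StrongDual ℂ V) (r / 2), y + z = x} := by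
    rintro ⟨y, ⟨hy, -⟩, z, hz, rfl⟩
    have := ha y hy
    rw [add_sub_cancel_left] at this
    rw [mem_closedBall_zero_iff] at hz
    linarith
  obtain ⟨v, s, h1, h2⟩ := hK.exists_re_lt (by
    rintro x ⟨y, hy, z, hz, rfl⟩ x' ⟨y', hy', z', hz', rfl⟩ s t hs ht hst
    refine ⟨_, cone_inter_ball_convex hadd hsmul n y hy y' hy' s t hs ht hst,
      (s : ℂ) • z + (t : ℂ) • z', ?_, ?_⟩
    · exact (cone_inter_ball_convex (P := Set.univ) (by simp) (by simp) (r / 2) z (by simpa using hz)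
        z' (by simpa using hz') s t hs ht hst).2
    · simp only [smul_add]; abel) haK
  -- Moving by -(r/2)g, with g norming v, inside the small ball converts the separation into a gain
  -- of (r/2)‖v‖.
  obtain ⟨g, hg, hgv⟩ := exists_dual_vector'' ℂ v
  have h3 : ∀ x ∈ P, ‖x‖ ≤ n → (a v).re + r / 2 * ‖v‖ < (x v).re := by
    intro x hx hxn
    have := h2 _ ⟨x, ⟨hx, by simpa using hxn⟩, ((-(r / 2) : ℝ) : ℂ) • g, by
      rw [mem_closedBall_zero_iff, norm_smul, Complex.norm_real, norm_neg, Real.norm_of_nonneg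
        (by positivity)]
      exact mul_le_of_le_one_right (by positivity) hg, rfl⟩
    have e : ((x + ((-(r / 2) : ℝ) : ℂ) • g) v).re = (x v).re - r / 2 * ‖v‖ := by
      simp [hgv]; ring
    rw [e] at this
    linarith
  have h4 := h3 0 h0 (by simpa using hn.le)
  simp only [zero_apply, Complex.zero_re] at h4
  have hv : 0 < ‖v‖ := by
    rcases (norm_nonneg v).lt_or_eq with h | h
    · exact h
    · rw [norm_eq_zero.mp h.symm] at h4; simp at h4
  refine ⟨((‖v‖⁻¹ : ℝ) : ℂ) • v, ?_, fun x hx hx1 => ?_⟩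
  · have e : (a (((‖v‖⁻¹ : ℝ) : ℂ) • v)).re = ‖v‖⁻¹ * (a v).re := by
      rw [map_smul, smul_eq_mul, Complex.re_ofReal_mul]
    rw [e, inv_mul_le_iff₀ hv]
    linarith
  · have e : (x (((‖v‖⁻¹ : ℝ) : ℂ) • v)).re = ‖v‖⁻¹ * (x v).re := by
      rw [map_smul, smul_eq_mul, Complex.re_ofReal_mul]
    have h5 := h3 ((n : ℂ) • x) (hsmul n hn.le x hx) (by
      rw [norm_smul, Complex.norm_real, Real.norm_of_nonneg hn.le]
      exact mul_le_of_le_one_right hn.le hx1)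
    have e2 : (((n : ℂ) • x) v).re = n * (x v).re := by simp
    rw [e2] at h5
    have h6 : -(‖a‖ * ‖v‖) ≤ (a v).re :=
      (neg_le_neg (a.le_opNorm v)).trans (abs_le.mp (Complex.abs_re_le_norm (a v))).1
    have h7 : -(‖a‖ + 1) * ‖v‖ ≤ n * (x v).re := by nlinarith
    have h8 : n * ε = ‖a‖ + 1 := div_mul_cancel₀ _ hε.ne'
    rw [e, le_inv_mul_iff₀ hv]
    refine le_of_mul_le_mul_left ?_ hn
    calc n * (‖v‖ * -ε) = -(n * ε) * ‖v‖ := by ring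
      _ = -(‖a‖ + 1) * ‖v‖ := by rw [h8]
      _ ≤ _ := h7

-- If no vector near v were δ-nonnegative on `P`, Hahn–Banach in V itself would separate the ball of
-- radius 2ε around v from the convex set of δ-nonnegative vectors by a functional f. By a bipolar
-- argument f lies in `P`, so Re f(v) ≥ -ε‖f‖. But Re f is negative on the whole ball, which costs
-- about 2ε‖f‖. The displacement depends only on ε and not on δ, which makes iteration possible.
include hadd hsmul hP in
lemma exists_near_almost_nonneg (h0 : (0 : StrongDual ℂ V) ∈ P) (v : V) {ε δ : ℝ} (hε : 0 < ε)
    (hδ : 0 < δ) (hv : ∀ x ∈ P, ‖x‖ ≤ 1 → -ε ≤ (x v).re) :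
    ∃ w : V, dist v w < 2 * ε ∧ ∀ x ∈ P, ‖x‖ ≤ 1 → -δ ≤ (x w).re := by
  by_contra! hcon
  let A : Set V := {w | ∀ x ∈ P, ‖x‖ ≤ 1 → -δ ≤ (x w).re}
  have hA : Convex ℝ A := by
    intro w hw w' hw' s t hs ht hst x hx hx1
    have e : (x (s • w + t • w')).re = s * (x w).re + t * (x w').re := by
      rw [← Complex.coe_smul, ← Complex.coe_smul, map_add, map_smul, map_smul]; simp
    rw [e]
    have h1 := mul_le_mul_of_nonneg_left (hw x hx hx1) hs
    have h2 := mul_le_mul_of_nonneg_left (hw' x hx hx1) ht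
    have h3 : -δ = s * -δ + t * -δ := by rw [← add_mul, hst, one_mul]
    linarith
  have hdisj : Disjoint (Metric.ball v (2 * ε)) A := by
    rw [Set.disjoint_left]
    intro w hw hwA
    obtain ⟨x, hx, hx1, hlt⟩ := hcon w (by rwa [dist_comm])
    exact absurd (hwA x hx hx1) (not_le.mpr hlt)
  obtain ⟨f, s, hf1, hf2⟩ := RCLike.geometric_hahn_banach_open (𝕜 := ℂ) (convex_ball v (2 * ε))
    Metric.isOpen_ball hA hdisj
  have hs0 : s ≤ 0 := by
    have := hf2 0 (fun x _ _ => by simpa using hδ.le)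
    simpa using this
  -- Otherwise some u separates f from the part of `P` in the ball of radius R. Rescaled by δ/κ, u
  -- is δ-nonnegative, yet f takes at it a value below -δR = s - δ, against f ≥ s on `A`.
  have hfP : f ∈ P := by
    by_contra hf
    let R : ℝ := -s / δ + 1
    have hR : 0 < R := by
      have : 0 ≤ -s / δ := div_nonneg (by linarith) hδ.le
      positivity
    obtain ⟨u, s', hu1, hu2⟩ := (hP R).exists_re_lt (cone_inter_ball_convex hadd hsmul R)
      (x := f) (fun h => hf h.1)
    have hs' : s' < 0 := by simpa using hu2 0 ⟨h0, by simpa using hR.le⟩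
    let κ : ℝ := -s' / R
    have hκ : 0 < κ := div_pos (by linarith) hR
    have := hf2 (((δ / κ : ℝ) : ℂ) • u) (fun x hx hx1 => by
      have h1 := hu2 ((R : ℂ) • x) ⟨hsmul R hR.le x hx, by
        rw [mem_closedBall_zero_iff, norm_smul, Complex.norm_real, Real.norm_of_nonneg hR.le]
        exact mul_le_of_le_one_right hR.le hx1⟩
      have e1 : (((R : ℂ) • x) u).re = R * (x u).re := by simp
      rw [e1] at h1
      have e2 : (x (((δ / κ : ℝ) : ℂ) • u)).re = δ / κ * (x u).re := by
        rw [map_smul, smul_eq_mul, Complex.re_ofReal_mul]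
      have h2 : -κ ≤ (x u).re := by
        rw [show -κ = s' / R by simp only [κ]; ring, div_le_iff₀ hR]
        linarith
      rw [e2]
      calc -δ = δ / κ * -κ := by field_simp
        _ ≤ _ := mul_le_mul_of_nonneg_left h2 (by positivity))
    have e3 : RCLike.re (f (((δ / κ : ℝ) : ℂ) • u)) = δ / κ * (f u).re := by
      rw [map_smul, smul_eq_mul]; exact Complex.re_ofReal_mul _ _
    rw [e3] at this
    have h4 : δ / κ * (f u).re < δ / κ * s' := mul_lt_mul_of_pos_left hu1 (by positivity)
    have h5 : δ / κ * s' = -(δ * R) := by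
      have : s' ≠ 0 := hs'.ne
      simp only [κ]; field_simp
    have h6 : δ * R = -s + δ := by simp only [R]; field_simp
    linarith
  have hfv : -(ε * ‖f‖) ≤ (f v).re := by
    rcases (norm_nonneg f).lt_or_eq with h | h
    · have h1 := hv (((‖f‖⁻¹ : ℝ) : ℂ) • f) (hsmul _ (by positivity) f hfP) (by
        rw [norm_smul, Complex.norm_real, norm_inv, norm_norm, inv_mul_cancel₀ h.ne'])
      have e1 : ((((‖f‖⁻¹ : ℝ) : ℂ) • f) v).re = ‖f‖⁻¹ * (f v).re := by
        rw [smul_apply, smul_eq_mul, Complex.re_ofReal_mul]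
      rw [e1, le_inv_mul_iff₀ h] at h1
      linarith
    · rw [norm_eq_zero.mp h.symm]; simp
  have hball : ∀ y : V, ‖y‖ < 2 * ε → (f y).re < ε * ‖f‖ := by
    intro y hy
    have h1 := hf1 (v + y) (by simpa [Metric.mem_ball, dist_eq_norm] using hy)
    have h2 : RCLike.re (f (v + y)) = (f v).re + (f y).re := by rw [map_add]; rfl
    rw [h2] at h1
    linarith
  have hnorm : ‖f‖ ≤ 2 / 3 * ‖f‖ := by
    refine ContinuousLinearMap.opNorm_le_bound _ (by positivity) fun z => ?_
    rcases eq_or_ne z 0 with rfl | hz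
    · simp
    rcases eq_or_ne (f z) 0 with hfz | hfz
    · rw [hfz, norm_zero]; positivity
    have hz' : 0 < ‖z‖ := norm_pos_iff.mpr hz
    have hfz' : 0 < ‖f z‖ := norm_pos_iff.mpr hfz
    -- c·z has norm 3ε/2, strictly between ε and 2ε, and f is real and positive there; this yields
    -- ‖f‖ ≤ (2/3)‖f‖.
    let c : ℂ := ((3 * ε / 2 / ‖z‖ / ‖f z‖ : ℝ) : ℂ) * star (f z)
    have hc : ‖c‖ = 3 * ε / 2 / ‖z‖ := by
      simp only [c, norm_mul, norm_star, Complex.norm_real]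
      rw [Real.norm_of_nonneg (by positivity)]
      field_simp
    have h1 := hball (c • z) (by rw [norm_smul, hc, div_mul_cancel₀ _ hz'.ne']; linarith)
    have h2 : (f (c • z)).re = 3 * ε / 2 / ‖z‖ * ‖f z‖ := by
      rw [map_smul, smul_eq_mul, mul_assoc, Complex.star_def, mul_comm (starRingEnd ℂ (f z)),
        Complex.mul_conj, Complex.normSq_eq_norm_sq, ← Complex.ofReal_mul, Complex.ofReal_re]
      field_simp
    rw [h2] at h1
    have h3 : 3 * ε / 2 / ‖z‖ * ‖f z‖ = ε * (3 / 2 * ‖f z‖ / ‖z‖) := by ring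
    rw [h3] at h1
    have h4 := lt_of_mul_lt_mul_left h1 hε.le
    rw [div_lt_iff₀ hz'] at h4
    linarith
  have hf0 : f = 0 := by
    have : ‖f‖ ≤ 0 := by linarith
    exact norm_le_zero_iff.mp this
  have := hf1 v (Metric.mem_ball_self (by positivity))
  rw [hf0] at this
  simp only [zero_apply, map_zero] at this
  linarith

include hadd hsmul hP in
/-- A convex cone of functionals whose bounded parts are weak-* compact is separated from every point
at positive distance by a vector of the predual. -/
theorem exists_separating_of_cone [CompleteSpace V] (h0 : (0 : StrongDual ℂ V) ∈ P)
    (a : StrongDual ℂ V) {r : ℝ} (hr : 0 < r) (ha : ∀ x ∈ P, r ≤ ‖a - x‖) :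
    ∃ v : V, (a v).re < 0 ∧ ∀ x ∈ P, 0 ≤ (x v).re := by
  -- The corrections with tolerances ε/2ⁿ move the vector by at most 4ε in total. This changes the
  -- value at `a` by at most 4ε‖a‖ ≤ r/4, less than the margin r/2.
  let ε : ℝ := r / (16 * (‖a‖ + 1))
  have hε : 0 < ε := by positivity
  obtain ⟨v0, hv0, hv0'⟩ := exists_almost_nonneg hadd hsmul hP h0 a hr ha hε
  have step : ∀ (n : ℕ) (v : V), (∀ x ∈ P, ‖x‖ ≤ 1 → -(ε / 2 ^ n) ≤ (x v).re) →
      ∃ w : V, dist v w < 2 * (ε / 2 ^ n) ∧ ∀ x ∈ P, ‖x‖ ≤ 1 → -(ε / 2 ^ (n + 1)) ≤ (x w).re :=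
    fun n v hv => exists_near_almost_nonneg hadd hsmul hP h0 v (by positivity) (by positivity) hv
  choose! g hg1 hg2 using step
  let w : ℕ → V := fun n => Nat.rec v0 (fun n v => g n v) n
  have hw : ∀ n, ∀ x ∈ P, ‖x‖ ≤ 1 → -(ε / 2 ^ n) ≤ (x (w n)).re := by
    intro n
    induction n with
    | zero => simpa [w] using hv0'
    | succ n ih => exact hg2 n (w n) ih
  have hdist : ∀ n, dist (w n) (w (n + 1)) ≤ 4 * ε / 2 / 2 ^ n := by
    intro n
    have := (hg1 n (w n) (hw n)).le
    refine this.trans (le_of_eq ?_)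
    ring
  obtain ⟨v, hv⟩ := cauchySeq_tendsto_of_complete (cauchySeq_of_le_geometric_two hdist)
  have hv0d : dist v0 v ≤ 4 * ε := dist_le_of_le_geometric_two_of_tendsto₀ hdist hv
  have hlim : ∀ x : StrongDual ℂ V, Filter.Tendsto (fun n => (x (w n)).re) Filter.atTop
      (nhds (x v).re) := fun x =>
    ((Complex.continuous_re.comp x.continuous).tendsto v).comp hv
  have hpos1 : ∀ x ∈ P, ‖x‖ ≤ 1 → 0 ≤ (x v).re := by
    intro x hx hx1
    refine le_of_tendsto_of_tendsto' (f := fun n : ℕ => -(ε / 2 ^ n)) ?_ (hlim x)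
      (fun n => hw n x hx hx1)
    have := (tendsto_pow_atTop_nhds_zero_of_lt_one (r := (1 / 2 : ℝ)) (by norm_num)
      (by norm_num)).const_mul (-ε)
    rw [mul_zero] at this
    refine this.congr fun n => ?_
    rw [one_div, inv_pow]; ring
  refine ⟨v, ?_, fun x hx => ?_⟩
  · have h1 : ‖a (v - v0)‖ ≤ ‖a‖ * (4 * ε) := by
      refine (a.le_opNorm _).trans ?_
      rw [← dist_eq_norm, dist_comm]
      gcongr
    have h2 : (a v).re = (a v0).re + (a (v - v0)).re := by rw [← Complex.add_re, ← map_add]; simp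
    have h3 := (Complex.abs_re_le_norm (a (v - v0))).trans h1
    have h4 : ε * (16 * (‖a‖ + 1)) = r := div_mul_cancel₀ _ (by positivity)
    have h5 := (abs_le.mp h3).2
    nlinarith
  · rcases (norm_nonneg x).lt_or_eq with h | h
    · have h1 := hpos1 (((‖x‖⁻¹ : ℝ) : ℂ) • x) (hsmul _ (by positivity) x hx) (by
        rw [norm_smul, Complex.norm_real, norm_inv, norm_norm, inv_mul_cancel₀ h.ne'])
      have e1 : ((((‖x‖⁻¹ : ℝ) : ℂ) • x) v).re = ‖x‖⁻¹ * (x v).re := by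
        rw [smul_apply, smul_eq_mul, Complex.re_ofReal_mul]
      rw [e1] at h1
      exact (mul_nonneg_iff_of_pos_left (inv_pos.mpr h)).mp h1
    · rw [norm_eq_zero.mp h.symm]; simp

end KreinSmulian

end WStar

namespace WStar

open Filter Topology

/-! ### W*-algebras with a predual: the positive cone, suprema and normal functionals -/

section Sakai

variable {M : Type u} [CStarAlgebra M] [PartialOrder M] [StarOrderedRing M]

/-- Norm balls are weak-* closed, whereas the involution is not known to be weak-* continuous; so
self-adjointness is expressed through balls. For the converse let c be the imaginary part of a. Then
(c + t)² ≤ r² + t², hence 2tc ≤ r² for every real t, and dividing by t → ±∞ gives c = 0. -/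
lemma isSelfAdjoint_iff_forall_norm_le {r : ℝ} {a : M} (ha : ‖a‖ ≤ r) :
    IsSelfAdjoint a ↔ ∀ t : ℝ, ‖a + (Complex.I * t) • (1 : M)‖ ≤ √(r ^ 2 + t ^ 2) := by
  have hr : 0 ≤ r := (norm_nonneg a).trans ha
  rcases subsingleton_or_nontrivial M with hM | hM
  · exact ⟨fun _ t => by rw [Subsingleton.elim (a + _) 0, norm_zero]; positivity,
      fun _ => Subsingleton.elim _ _⟩
  constructor
  · intro h t
    refine Real.le_sqrt_of_sq_le ?_
    have e : star (a + (Complex.I * t) • (1 : M)) * (a + (Complex.I * t) • (1 : M)) =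
        a * a + ((t ^ 2 : ℝ) : ℂ) • (1 : M) := by
      rw [star_add, h.star_eq, star_smul, star_one]
      simp only [star_mul, Complex.star_def, Complex.conj_I, Complex.conj_ofReal, add_mul, mul_add,
        smul_mul_assoc, mul_smul_comm, one_mul, mul_one]
      match_scalars
      · ring
      · ring
      · linear_combination (-(t : ℂ) ^ 2) * Complex.I_mul_I
    rw [sq, ← CStarRing.norm_star_mul_self, e]
    refine (norm_add_le _ _).trans (add_le_add ?_ ?_)
    · refine (norm_mul_le _ _).trans ?_
      rw [← sq]; gcongr
    · rw [norm_smul, norm_one, mul_one, Complex.norm_real, Real.norm_of_nonneg (by positivity)]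
  · intro h
    let c : M := (-(Complex.I / 2)) • (a - star a)
    have hc : IsSelfAdjoint c := by
      rw [IsSelfAdjoint, star_smul, star_sub, star_star, ← neg_sub a, smul_neg, ← neg_smul]
      congr 1
      simp [neg_div]
    have h1 : ∀ t : ℝ, ‖c + (t : ℂ) • (1 : M)‖ ≤ √(r ^ 2 + t ^ 2) := by
      intro t
      let x := a + (Complex.I * t) • (1 : M)
      have e : c + (t : ℂ) • (1 : M) = (-(Complex.I / 2)) • (x - star x) := by
        simp only [x, c, star_add, star_smul, star_one, star_mul, Complex.star_def, Complex.conj_I,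
          Complex.conj_ofReal]
        match_scalars
        · ring
        · ring
        · linear_combination (t : ℂ) * Complex.I_mul_I
      rw [e, norm_smul]
      refine le_trans ?_ (h t)
      have h2 : ‖x - star x‖ ≤ ‖x‖ + ‖x‖ := (norm_sub_le _ _).trans (by rw [norm_star])
      have h3 : ‖(-(Complex.I / 2))‖ = 1 / 2 := by simp
      rw [h3]
      linarith
    have h2 : ∀ t : ℝ, (2 * t : ℝ) • c ≤ algebraMap ℝ M (r ^ 2) := by
      intro t
      have hs : IsSelfAdjoint (c + (t : ℂ) • (1 : M)) := by
        rw [IsSelfAdjoint, star_add, hc.star_eq, star_smul, star_one, Complex.star_def,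
          Complex.conj_ofReal]
      have h3 : (c + (t : ℂ) • (1 : M)) * (c + (t : ℂ) • (1 : M)) ≤ algebraMap ℝ M (r ^ 2 + t ^ 2) := by
        have h4 : IsSelfAdjoint ((c + (t : ℂ) • (1 : M)) * (c + (t : ℂ) • (1 : M))) := by
          rw [IsSelfAdjoint, star_mul, hs.star_eq]
        refine h4.le_algebraMap_norm_self.trans (algebraMap_mono M ?_)
        refine (norm_mul_le _ _).trans ?_
        rw [← sq]
        exact (Real.le_sqrt (norm_nonneg _) (by positivity)).mp (h1 t)
      have e : (c + (t : ℂ) • (1 : M)) * (c + (t : ℂ) • (1 : M)) =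
          c * c + (2 * t : ℝ) • c + algebraMap ℝ M (t ^ 2) := by
        rw [Algebra.algebraMap_eq_smul_one, ← Complex.coe_smul, ← Complex.coe_smul]
        simp only [add_mul, mul_add, smul_mul_assoc, mul_smul_comm, one_mul, mul_one]
        match_scalars <;> ring
      rw [e, map_add, add_le_add_iff_right] at h3
      refine le_trans ?_ h3
      have := star_mul_self_nonneg c
      rw [hc.star_eq] at this
      exact le_add_of_nonneg_left this
    have h5 : c = 0 := by
      have lim : Tendsto (fun t : ℝ => algebraMap ℝ M (t⁻¹ * (r ^ 2 / 2))) atTop (𝓝 0) := by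
        have h7 := (algebraMap_isometry ℝ M).continuous.tendsto (0 * (r ^ 2 / 2))
        rw [zero_mul, map_zero] at h7
        refine h7.comp ?_
        have := tendsto_inv_atTop_zero (𝕜 := ℝ) |>.mul_const (r ^ 2 / 2)
        rwa [zero_mul] at this
      have scale : ∀ (s t : ℝ), 0 < t → (2 * t * s) • c ≤ algebraMap ℝ M (r ^ 2) →
          s • c ≤ algebraMap ℝ M (t⁻¹ * (r ^ 2 / 2)) := by
        intro s t ht h
        have := smul_le_smul_of_nonneg_left h (show 0 ≤ (2 * t)⁻¹ by positivity)
        rw [smul_smul, Algebra.algebraMap_eq_smul_one, smul_smul] at this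
        rw [Algebra.algebraMap_eq_smul_one]
        refine le_of_eq_of_le ?_ (this.trans_eq ?_) <;> congr 1 <;> field_simp
      refine le_antisymm ?_ ?_
      · refine ge_of_tendsto lim ((eventually_gt_atTop 0).mono fun t ht => ?_)
        simpa using scale 1 t ht (by simpa using h2 t)
      · have : -c ≤ 0 := by
          refine ge_of_tendsto lim ((eventually_gt_atTop 0).mono fun t ht => ?_)
          simpa using scale (-1) t ht (by simpa using h2 (-t))
        exact neg_nonpos.mp this
    have h6 : a - star a = 0 := by
      have := smul_eq_zero.mp h5
      simpa using this
    exact (sub_eq_zero.mp h6).symm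

lemma nonneg_iff_norm_sub_le [Nontrivial M] {r : ℝ} {a : M} (ha : ‖a‖ ≤ r) :
    0 ≤ a ↔ IsSelfAdjoint a ∧ ‖algebraMap ℝ M r - a‖ ≤ r := by
  have hr : 0 ≤ r := (norm_nonneg a).trans ha
  rw [nonneg_iff_isSelfAdjoint_and_quasispectrumRestricts]
  exact and_congr_right fun h => SpectrumRestricts.nnreal_iff_nnnorm (t := ⟨r, hr⟩) h ha

variable {V : Type u} [NormedAddCommGroup V] [NormedSpace ℂ V]
  (e : StrongDual ℂ V ≃ₗᵢ⋆[ℂ] M)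

lemma isClosed_preimage_closedBall (b : M) (r : ℝ) :
    IsClosed {x : WeakDual ℂ V | ‖e (WeakDual.toStrongDual x) - b‖ ≤ r} := by
  have h := WeakDual.isClosed_closedBall (𝕜 := ℂ) (e.symm b) r
  refine (congrArg IsClosed ?_).mp h
  ext x
  simp only [Set.mem_preimage, mem_closedBall_iff_norm, Set.mem_ofPred_eq]
  rw [← e.norm_map, map_sub, e.apply_symm_apply]

/-- The two norm criteria exhibit the positive part of a ball as an intersection of balls, each of
them weak-* closed. -/
lemma isWeakStarCompact_nonneg (r : ℝ) :
    IsWeakStarCompact ({x | 0 ≤ e x} ∩ Metric.closedBall 0 r) := by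
  rcases subsingleton_or_nontrivial M with hM | hM
  · have : {x | 0 ≤ e x} = Set.univ := by
      ext x; simp
    rw [this, Set.univ_inter]
    exact isWeakStarCompact_closedBall r
  have hset : (WeakDual.toStrongDual ⁻¹' ({x | 0 ≤ e x} ∩ Metric.closedBall 0 r) :
      Set (WeakDual ℂ V)) = (WeakDual.toStrongDual ⁻¹' Metric.closedBall 0 r) ∩
      ((⋂ t : ℝ, {x : WeakDual ℂ V | ‖e (WeakDual.toStrongDual x) - -((Complex.I * t) • (1 : M))‖ ≤
        √(r ^ 2 + t ^ 2)}) ∩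
        {x | ‖e (WeakDual.toStrongDual x) - algebraMap ℝ M r‖ ≤ r}) := by
    ext x
    simp only [Set.mem_preimage, Set.mem_inter_iff, Set.mem_ofPred_eq, mem_closedBall_zero_iff,
      Set.mem_iInter, sub_neg_eq_add]
    rw [and_comm]
    refine and_congr_right fun h => ?_
    have h' : ‖e (WeakDual.toStrongDual x)‖ ≤ r := by rwa [e.norm_map]
    rw [nonneg_iff_norm_sub_le h', isSelfAdjoint_iff_forall_norm_le h', norm_sub_rev]
  rw [IsWeakStarCompact, hset]
  exact (WeakDual.isCompact_closedBall 0 r).inter_right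
    ((isClosed_iInter fun t => isClosed_preimage_closedBall e _ _).inter
      (isClosed_preimage_closedBall e _ _))

lemma continuous_weakDual_add (b : StrongDual ℂ V) :
    Continuous fun x : WeakDual ℂ V => x + StrongDual.toWeakDual b :=
  continuous_id.add continuous_const

/-- The order interval is (p + K) ∩ (q - K), where K is the positive part of the ball of radius ‖q -
p‖. -/
lemma isClosed_le_preimage (p q : M) :
    IsCompact {x : WeakDual ℂ V | p ≤ e (WeakDual.toStrongDual x) ∧ e (WeakDual.toStrongDual x) ≤ q} := by
  let R := ‖q - p‖
  let K : Set (WeakDual ℂ V) := WeakDual.toStrongDual ⁻¹' ({x | 0 ≤ e x} ∩ Metric.closedBall 0 R)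
  have hK : IsCompact K := isWeakStarCompact_nonneg e R
  have h1 : IsCompact ((fun x : WeakDual ℂ V => x + StrongDual.toWeakDual (e.symm p)) '' K) :=
    hK.image (continuous_weakDual_add _)
  have h2 : IsClosed ((fun x : WeakDual ℂ V => StrongDual.toWeakDual (e.symm q) - x) ⁻¹' K) :=
    hK.isClosed.preimage (continuous_const.sub continuous_id)
  refine (congrArg IsCompact ?_).mp (h1.inter_right h2)
  have bound : ∀ y : M, 0 ≤ y → y ≤ q - p → ‖y‖ ≤ R := fun y hy hyq =>
    CStarAlgebra.norm_le_norm_of_nonneg_of_le hy hyq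
  ext x
  simp only [Set.mem_inter_iff, Set.mem_image, Set.mem_preimage, K, Set.mem_ofPred_eq,
    mem_closedBall_zero_iff]
  constructor
  · rintro ⟨⟨y, ⟨hy1, hy2⟩, rfl⟩, h3, -⟩
    rw [map_sub, map_sub, StrongDual.toStrongDual_toWeakDual, e.apply_symm_apply] at h3
    refine ⟨?_, sub_nonneg.mp h3⟩
    rw [map_add, map_add, StrongDual.toStrongDual_toWeakDual, e.apply_symm_apply]
    exact le_add_of_nonneg_left hy1
  · rintro ⟨h3, h4⟩
    have e1 : e (WeakDual.toStrongDual (x - StrongDual.toWeakDual (e.symm p))) =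
        e (WeakDual.toStrongDual x) - p := by
      rw [map_sub, map_sub, StrongDual.toStrongDual_toWeakDual, e.apply_symm_apply]
    have e2 : e (WeakDual.toStrongDual (StrongDual.toWeakDual (e.symm q) - x)) =
        q - e (WeakDual.toStrongDual x) := by
      rw [map_sub, map_sub, StrongDual.toStrongDual_toWeakDual, e.apply_symm_apply]
    refine ⟨⟨x - StrongDual.toWeakDual (e.symm p), ⟨?_, ?_⟩, sub_add_cancel _ _⟩, ?_, ?_⟩
    · rw [e1]; exact sub_nonneg.mpr h3
    · rw [← e.norm_map, e1]
      exact bound _ (sub_nonneg.mpr h3) (sub_le_sub_right h4 _)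
    · rw [e2]; exact sub_nonneg.mpr h4
    · rw [← e.norm_map, e2]
      exact bound _ (sub_nonneg.mpr h4) (sub_le_sub_left h3 _)

/-- The intervals [d, b], with d in `D` and b an upper bound, are weak-* compact and shrink as d
grows. By compactness they have a common point, which is the supremum. Carrying `F` along shows that
the supremum lies in every weak-* closed set containing `D`; this makes positive predual functionals
order continuous. -/
lemma exists_isLUB_mem {D : Set M} (hne : D.Nonempty) (hdir : DirectedOn (· ≤ ·) D)
    (hbdd : BddAbove D) {F : Set (WeakDual ℂ V)} (hF : IsClosed F)
    (hDF : ∀ d ∈ D, StrongDual.toWeakDual (e.symm d) ∈ F) :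
    ∃ a, IsLUB D a ∧ StrongDual.toWeakDual (e.symm a) ∈ F := by
  obtain ⟨b0, hb0⟩ := hbdd
  have _ : Nonempty D := hne.to_subtype
  let C : D → Set (WeakDual ℂ V) := fun d => (⋂ b : upperBounds D,
    {x : WeakDual ℂ V | d ≤ e (WeakDual.toStrongDual x) ∧ e (WeakDual.toStrongDual x) ≤ b}) ∩ F
  have hCc : ∀ d, IsClosed (C d) := fun d =>
    (isClosed_iInter fun b => (isClosed_le_preimage e _ _).isClosed).inter hF
  have hmem : ∀ d : D, StrongDual.toWeakDual (e.symm d) ∈ C d := fun d => by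
    refine ⟨Set.mem_iInter.mpr fun b => ?_, hDF d d.2⟩
    rw [Set.mem_ofPred_eq, StrongDual.toStrongDual_toWeakDual, e.apply_symm_apply]
    exact ⟨le_rfl, b.2 d.2⟩
  have hanti : ∀ d d' : D, d ≤ d' → C d' ⊆ C d := fun d d' h x hx => by
    refine ⟨Set.mem_iInter.mpr fun b => ?_, hx.2⟩
    have := Set.mem_iInter.mp hx.1 b
    exact ⟨le_trans (show (d : M) ≤ d' from h) this.1, this.2⟩
  obtain ⟨x, hx⟩ := IsCompact.nonempty_iInter_of_directed_nonempty_isCompact_isClosed C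
    (fun d d' => by
      obtain ⟨c, hc, h1, h2⟩ := hdir d d.2 d' d'.2
      exact ⟨⟨c, hc⟩, hanti _ _ h1, hanti _ _ h2⟩)
    (fun d => ⟨_, hmem d⟩)
    (fun d => (isClosed_le_preimage e d b0).of_isClosed_subset (hCc d) fun x hx =>
      Set.mem_iInter.mp hx.1 ⟨b0, hb0⟩)
    hCc
  rw [Set.mem_iInter] at hx
  refine ⟨e (WeakDual.toStrongDual x), ⟨fun d hd => ?_, fun b hb => ?_⟩, ?_⟩
  · exact (Set.mem_iInter.mp (hx ⟨d, hd⟩).1 ⟨b0, hb0⟩).1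
  · obtain ⟨d, hd⟩ := hne
    exact (Set.mem_iInter.mp (hx ⟨d, hd⟩).1 ⟨b, hb⟩).2
  · obtain ⟨d, hd⟩ := hne
    rw [e.symm_apply_apply]
    exact (hx ⟨d, hd⟩).2

/-- Bounded directed sets of a `W*`-algebra have suprema. -/
theorem exists_isLUB [WStarAlgebra M] {D : Set M} (hne : D.Nonempty)
    (hdir : DirectedOn (· ≤ ·) D) (hbdd : BddAbove D) : ∃ a, IsLUB D a := by
  obtain ⟨V, _, _, _, ⟨e⟩⟩ := WStarAlgebra.exists_predual (M := M)
  obtain ⟨a, ha, -⟩ := exists_isLUB_mem e hne hdir hbdd isClosed_univ (fun _ _ => trivial)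
  exact ⟨a, ha⟩

/-- `f` is order continuous: it converges along increasing nets to the value at the supremum. -/
def IsNormalFun {Q : Type*} [Preorder Q] (f : Q → ℂ) : Prop :=
  ∀ D : Set Q, D.Nonempty → DirectedOn (· ≤ ·) D → ∀ a, IsLUB D a →
    Tendsto (fun d : D => f d) atTop (𝓝 (f a))

/-- The values increase along `D`. A bound s for them defines a weak-* closed half-space containing
`D`, hence also the supremum, so the value at `a` is the least bound. -/
lemma tendsto_re_of_isLUB {D : Set M} (hne : D.Nonempty) (hdir : DirectedOn (· ≤ ·) D) {a : M}
    (ha : IsLUB D a) (v : V) (hv : ∀ x, 0 ≤ e x → 0 ≤ (x v).re) :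
    Tendsto (fun d : D => (e.symm d v).re) atTop (𝓝 (e.symm a v).re) := by
  have hmono : ∀ x y : M, x ≤ y → (e.symm x v).re ≤ (e.symm y v).re := fun x y h => by
    have := hv (e.symm y - e.symm x) (by simpa using h)
    rw [sub_apply, Complex.sub_re] at this
    linarith
  refine tendsto_atTop_isLUB (fun d d' h => hmono _ _ h) ⟨?_, fun s hs => ?_⟩
  · rintro _ ⟨d, rfl⟩
    exact hmono _ _ (ha.1 d.2)
  · obtain ⟨a', ha', h⟩ := exists_isLUB_mem e hne hdir ⟨a, ha.1⟩
      (F := {x : WeakDual ℂ V | (x v).re ≤ s})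
      (isClosed_le (Complex.continuous_re.comp (WeakDual.eval_continuous v)) continuous_const)
      (fun d hd => hs ⟨⟨d, hd⟩, rfl⟩)
    rw [ha.unique ha']
    exact h

lemma exists_normal_of_re_nonneg (v : V) (hv : ∀ x, 0 ≤ e x → 0 ≤ (x v).re) :
    ∃ ω : M →ₚ[ℂ] ℂ, IsNormalFun ω ∧ ∀ m : M, IsSelfAdjoint m → ω m = ((e.symm m v).re : ℂ) := by
  -- `e` is conjugate linear. This average over m and m* is linear in m and equals the real part of
  -- the evaluation at v for self-adjoint m.
  let f : M →ₗ[ℂ] ℂ :=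
    { toFun := fun m => ((starRingEnd ℂ) (e.symm m v) + e.symm (star m) v) / 2
      map_add' := fun m m' => by simp only [map_add, star_add, add_apply]; ring
      map_smul' := fun c m => by
        simp only [map_smulₛₗ, star_smul, smul_apply, smul_eq_mul, map_mul, RingHom.id_apply,
          Complex.star_def, Complex.conj_conj]
        ring }
  have hf : ∀ m : M, IsSelfAdjoint m → f m = ((e.symm m v).re : ℂ) := fun m hm => by
    change ((starRingEnd ℂ) (e.symm m v) + e.symm (star m) v) / 2 = _
    rw [hm.star_eq, add_comm, Complex.add_conj]
    push_cast; ring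
  let ω : M →ₚ[ℂ] ℂ := PositiveLinearMap.mk₀ f fun m hm => by
    rw [hf m (IsSelfAdjoint.of_nonneg hm)]
    exact_mod_cast hv _ (by rwa [e.apply_symm_apply])
  refine ⟨ω, fun D hne hdir a ha => ?_, hf⟩
  obtain ⟨d0, hd0⟩ := hne
  have h1 := tendsto_re_of_isLUB e ⟨d0, hd0⟩ hdir ha v hv
  have h2 : Tendsto (fun d : D => ((((e.symm d v).re - (e.symm d0 v).re : ℝ) : ℂ) + ω d0)) atTop
      (𝓝 ((((e.symm a v).re - (e.symm d0 v).re : ℝ) : ℂ) + ω d0)) :=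
    ((Complex.continuous_ofReal.tendsto _).comp (h1.sub_const _)).add_const _
  -- The elements of `D` need not be self-adjoint, but their differences with `d0` are positive, so
  -- convergence is tested on x - d0.
  have key : ∀ x : M, d0 ≤ x →
      (((e.symm x v).re - (e.symm d0 v).re : ℝ) : ℂ) + ω d0 = ω x := fun x hx => by
    have h3 : ω (x - d0) = _ := hf (x - d0) (IsSelfAdjoint.of_nonneg (sub_nonneg.mpr hx))
    rw [map_sub, map_sub, sub_apply, Complex.sub_re] at h3
    rw [← h3]; ring
  rw [key a (ha.1 hd0)] at h2
  refine h2.congr' ?_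
  filter_upwards [eventually_ge_atTop (⟨d0, hd0⟩ : D)] with d hd using key d hd

/-- The normal positive functionals of a `W*`-algebra detect positivity. -/
theorem exists_normal_functional [WStarAlgebra M] {m : M} (hm : ¬ 0 ≤ m) :
    ∃ ω : M →ₚ[ℂ] ℂ, IsNormalFun ω ∧ ¬ 0 ≤ ω m := by
  obtain ⟨V, _, _, _, ⟨e⟩⟩ := WStarAlgebra.exists_predual (M := M)
  have sa : ∀ m : M, IsSelfAdjoint m → ¬ 0 ≤ m →
      ∃ ω : M →ₚ[ℂ] ℂ, IsNormalFun ω ∧ (ω m).re < 0 := by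
    intro m hms hm
    have hopen : IsOpen {x : M | ¬ 0 ≤ x} := (CStarAlgebra.isClosed_nonneg (A := M)).isOpen_compl
    obtain ⟨r, hr, hball⟩ := Metric.isOpen_iff.mp hopen m hm
    obtain ⟨v, hv1, hv2⟩ := exists_separating_of_cone (P := {x | 0 ≤ e x})
      (fun x hx y hy => by
        rw [Set.mem_ofPred_eq, map_add]; exact add_nonneg hx hy)
      (fun c hc x hx => by
        rw [Set.mem_ofPred_eq, map_smulₛₗ, Complex.conj_ofReal, Complex.coe_smul]
        exact smul_nonneg hc hx)
      (isWeakStarCompact_nonneg e) (by simp) (e.symm m) hr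
      (fun x hx => by
        by_contra! h
        refine hball (a := e x) ?_ hx
        rw [Metric.mem_ball, dist_comm, dist_eq_norm, ← e.symm.norm_map, map_sub,
          e.symm_apply_apply]
        exact h)
    obtain ⟨ω, hω, h⟩ := exists_normal_of_re_nonneg e v hv2
    exact ⟨ω, hω, by rw [h m hms, Complex.ofReal_re]; exact hv1⟩
  by_cases hs : IsSelfAdjoint m
  · obtain ⟨ω, hω, h⟩ := sa m hs hm
    exact ⟨ω, hω, fun h' => absurd (Complex.nonneg_iff.mp h').1 (not_le.mpr h)⟩
  -- A positive functional with ω(m) ≥ 0 satisfies ω(m*) = ω(m) and so annihilates y; it suffices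
  -- that some normal functional does not vanish at y ≠ 0.
  · let y : M := Complex.I • (star m - m)
    have hy : IsSelfAdjoint y := by
      rw [IsSelfAdjoint, star_smul, star_sub, star_star, Complex.star_def, Complex.conj_I]
      module
    have hy0 : y ≠ 0 := fun h => hs (by
      have := smul_eq_zero.mp h
      rw [IsSelfAdjoint]
      simpa [sub_eq_zero] using this)
    have hω : ∃ ω : M →ₚ[ℂ] ℂ, IsNormalFun ω ∧ ω y ≠ 0 := by
      by_cases h0 : 0 ≤ y
      · obtain ⟨ω, hω, h⟩ := sa (-y) hy.neg (fun h => hy0 (le_antisymm (by simpa using h) h0))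
        exact ⟨ω, hω, fun h' => by rw [map_neg, h'] at h; simp at h⟩
      · obtain ⟨ω, hω, h⟩ := sa y hy h0
        exact ⟨ω, hω, fun h' => by rw [h'] at h; simp at h⟩
    obtain ⟨ω, hω, h⟩ := hω
    refine ⟨ω, hω, fun h' => h ?_⟩
    have h1 : ω (star m) = ω m := by
      rw [map_star ω, IsSelfAdjoint.of_nonneg h']
    rw [map_smul, map_sub, h1, sub_self, smul_zero]

end Sakai

end WStar

namespace WStar

open Filter Topology

/-! ### Bounded increasing nets of operators on a Hilbert space -/

section Vigier

variable {H : Type u} [NormedAddCommGroup H] [InnerProductSpace ℂ H] [CompleteSpace H]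

lemma op_nonneg_iff {T : H →L[ℂ] H} : 0 ≤ T ↔ ∀ h, 0 ≤ inner ℂ h (T h) := by
  rw [ContinuousLinearMap.nonneg_iff_isPositive]
  refine ⟨fun h x => h.inner_nonneg_right x, fun h => ?_⟩
  rw [ContinuousLinearMap.isPositive_iff_complex]
  intro x
  have h1 := h x
  rw [← inner_conj_symm] at h1
  have h2 : 0 ≤ inner ℂ (T x) x := by
    have := star_nonneg_iff.mpr h1
    simpa using this
  obtain ⟨h3, h4⟩ := Complex.nonneg_iff.mp h2
  exact ⟨Complex.ext (by simp) (by simpa using h4), h3⟩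

lemma op_le_iff {S T : H →L[ℂ] H} : S ≤ T ↔ ∀ h, inner ℂ h (S h) ≤ inner ℂ h (T h) := by
  rw [← sub_nonneg, op_nonneg_iff]
  refine forall_congr' fun h => ?_
  rw [sub_apply, inner_sub_right, sub_nonneg]

lemma norm_sq_apply_le {T : H →L[ℂ] H} (hT : 0 ≤ T) (h : H) :
    ‖T h‖ ^ 2 ≤ ‖T‖ * (inner ℂ h (T h)).re := by
  obtain ⟨S, rfl⟩ := CStarAlgebra.nonneg_iff_eq_star_mul_self.mp hT
  have h1 : (inner ℂ h ((star S * S) h)).re = ‖S h‖ ^ 2 := by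
    rw [mul_apply_eq_comp, ContinuousLinearMap.star_eq_adjoint,
      ContinuousLinearMap.adjoint_inner_right, inner_self_eq_norm_sq_to_K]
    norm_cast
  rw [h1, CStarRing.norm_star_mul_self, mul_apply_eq_comp, ← sq, ← mul_pow]
  have h2 := (star S).le_opNorm (S h)
  rw [norm_star] at h2
  gcongr

/-- The forms of T - d decrease, and ‖Sh‖² ≤ ‖S‖⟨h, Sh⟩ for S ≥ 0 upgrades their convergence to
strong convergence T - d → Q. Then T - Q is again an upper bound of `D`, which forces Q ≤ 0, while Q
is a limit of positive operators. -/
lemma tendsto_inner_of_isLUB {D : Set (H →L[ℂ] H)} (hne : D.Nonempty)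
    (hdir : DirectedOn (· ≤ ·) D) {T : H →L[ℂ] H} (hT : IsLUB D T) (h : H) :
    Tendsto (fun d : D => inner ℂ h ((d : H →L[ℂ] H) h)) atTop (𝓝 (inner ℂ h (T h))) := by
  obtain ⟨d0, hd0⟩ := hne
  have _ : Nonempty D := ⟨⟨d0, hd0⟩⟩
  have _ : IsDirectedOrder D := ⟨fun a b => by
    obtain ⟨c, hc, h1, h2⟩ := hdir a a.2 b b.2
    exact ⟨⟨c, hc⟩, h1, h2⟩⟩
  let q : H → D → ℝ := fun h d => (inner ℂ h ((T - d) h)).re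
  have hq0 : ∀ h d, 0 ≤ q h d := fun h d =>
    (Complex.nonneg_iff.mp (op_nonneg_iff.mp (sub_nonneg.mpr (hT.1 d.2)) h)).1
  have hqanti : ∀ h, Antitone (q h) := fun h d d' hdd' => by
    have := (op_nonneg_iff.mp (sub_nonneg.mpr (sub_le_sub_left (show (d : H →L[ℂ] H) ≤ d' from hdd') T)) h)
    rw [sub_apply, inner_sub_right] at this
    have := (Complex.nonneg_iff.mp this).1
    rw [Complex.sub_re] at this
    exact sub_nonneg.mp this
  have hqlim : ∀ h, ∃ l, Tendsto (q h) atTop (𝓝 l) := fun h =>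
    ⟨_, tendsto_atTop_ciInf (hqanti h) ⟨0, by rintro _ ⟨d, rfl⟩; exact hq0 h d⟩⟩
  -- strong convergence
  have hstrong : ∀ h, ∃ y, Tendsto (fun d : D => (T - d) h) atTop (𝓝 y) := by
    intro h
    refine cauchySeq_tendsto_of_complete ?_
    obtain ⟨l, hl⟩ := hqlim h
    rw [CauchySeq, Metric.cauchy_iff]
    refine ⟨inferInstance, fun ε hε => ?_⟩
    let C : ℝ := ‖T - d0‖ + 1
    have hC : 0 < C := by positivity
    let η : ℝ := (ε / 2) ^ 2 / C
    have hη : 0 < η := by positivity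
    obtain ⟨d1, hd1⟩ := eventually_atTop.mp ((Metric.tendsto_nhds.mp hl) (η / 2) (by positivity))
    obtain ⟨d2, hd12, hd02⟩ := exists_ge_ge d1 ⟨d0, hd0⟩
    have key : ∀ d : D, d2 ≤ d → dist ((T - d) h) ((T - d2) h) < ε / 2 := by
      intro d hd
      have hp : 0 ≤ (d : H →L[ℂ] H) - d2 := sub_nonneg.mpr hd
      have h1 := norm_sq_apply_le hp h
      have h2 : ‖(d : H →L[ℂ] H) - d2‖ ≤ ‖T - d0‖ :=
        CStarAlgebra.norm_le_norm_of_nonneg_of_le hp (sub_le_sub (hT.1 d.2) hd02)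
      have h3 : (inner ℂ h (((d : H →L[ℂ] H) - d2) h)).re = q h d2 - q h d := by
        simp only [q, sub_apply, inner_sub_right, Complex.sub_re]; ring
      have h4 : q h d2 - q h d < η := by
        have ha := hd1 d2 hd12
        have hb := hd1 d (hd12.trans hd)
        rw [Real.dist_eq, abs_lt] at ha hb
        linarith [ha.2, hb.1]
      have h5 : dist ((T - d) h) ((T - d2) h) = ‖((d : H →L[ℂ] H) - d2) h‖ := by
        rw [dist_comm, dist_eq_norm]; congr 1; simp
      rw [h5]
      refine lt_of_pow_lt_pow_left₀ 2 (by positivity) (h1.trans_lt ?_)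
      rw [h3]
      have h6 : 0 ≤ q h d2 - q h d := sub_nonneg.mpr (hqanti h hd)
      calc ‖(d : H →L[ℂ] H) - d2‖ * (q h d2 - q h d) ≤ C * (q h d2 - q h d) := by
            gcongr; exact h2.trans (by simp [C])
        _ < C * η := by gcongr
        _ = (ε / 2) ^ 2 := by simp only [η]; field_simp
    refine ⟨(fun d : D => (T - d) h) '' Set.Ici d2, image_mem_map (Ici_mem_atTop d2), ?_⟩
    rintro _ ⟨d, hd, rfl⟩ _ ⟨d', hd', rfl⟩
    have := dist_triangle_right ((T - d) h) ((T - d') h) ((T - d2) h)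
    linarith [key d hd, key d' hd']
  choose Q hQ using hstrong
  have hQadd : ∀ x y, Q (x + y) = Q x + Q y := fun x y =>
    tendsto_nhds_unique (hQ (x + y)) (((hQ x).add (hQ y)).congr fun d => (map_add _ _ _).symm)
  have hQsmul : ∀ (c : ℂ) x, Q (c • x) = c • Q x := fun c x =>
    tendsto_nhds_unique (hQ (c • x)) (((hQ x).const_smul c).congr fun d => (map_smul _ _ _).symm)
  have hQbd : ∀ x, ‖Q x‖ ≤ ‖T - d0‖ * ‖x‖ := fun x => by
    refine le_of_tendsto (hQ x).norm ?_
    filter_upwards [eventually_ge_atTop (⟨d0, hd0⟩ : D)] with d hd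
    refine (ContinuousLinearMap.le_opNorm _ _).trans ?_
    gcongr
    exact CStarAlgebra.norm_le_norm_of_nonneg_of_le (sub_nonneg.mpr (hT.1 d.2))
      (sub_le_sub_left (show d0 ≤ (d : H →L[ℂ] H) from hd) T)
  let Q' : H →L[ℂ] H := LinearMap.mkContinuous
    { toFun := Q, map_add' := hQadd, map_smul' := hQsmul } ‖T - d0‖ hQbd
  have hQlim : ∀ x, Tendsto (fun d : D => inner ℂ x ((T - d) x)) atTop (𝓝 (inner ℂ x (Q' x))) :=
    fun x => tendsto_const_nhds.inner (hQ x)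
  have hub : T - Q' ∈ upperBounds D := fun d hd => by
    rw [le_sub_comm, op_le_iff]
    intro x
    refine le_of_tendsto (hQlim x) ?_
    filter_upwards [eventually_ge_atTop (⟨d, hd⟩ : D)] with d' hd'
    exact op_le_iff.mp (sub_le_sub_left (show d ≤ (d' : H →L[ℂ] H) from hd') T) x
  have h1 : Q' ≤ 0 := by
    have := hT.2 hub
    simpa using this
  have h2 : inner ℂ h (Q' h) = 0 := by
    refine le_antisymm (by simpa using op_le_iff.mp h1 h) ?_
    exact ge_of_tendsto' (hQlim h) fun d => op_nonneg_iff.mp (sub_nonneg.mpr (hT.1 d.2)) h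
  have h3 := (hQlim h).const_sub (inner ℂ h (T h))
  rw [h2, sub_zero] at h3
  refine h3.congr fun d => ?_
  rw [sub_apply, inner_sub_right, sub_sub_cancel]

end Vigier

/-! ### Order continuous functions and normal representations -/

section Normal

variable {P Q : Type*} [Preorder P] [Preorder Q]

lemma IsNormalFun.comp {f : Q → ℂ} (hf : IsNormalFun f) {ψ : P → Q} (hψ : ScottContinuous ψ) :
    IsNormalFun (f ∘ ψ) := by
  intro D hne hdir a ha
  have h1 := hf (ψ '' D) (hne.image ψ) (fun x hx y hy => by
    obtain ⟨x, hx, rfl⟩ := hx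
    obtain ⟨y, hy, rfl⟩ := hy
    obtain ⟨z, hz, h1, h2⟩ := hdir x hx y hy
    exact ⟨ψ z, ⟨z, hz, rfl⟩, hψ.monotone h1, hψ.monotone h2⟩) (ψ a) (hψ hne hdir ha)
  refine h1.comp (f := fun d : D => (⟨ψ d, d, d.2, rfl⟩ : ψ '' D)) ?_
  exact tendsto_atTop_atTop_of_monotone (fun d d' h => hψ.monotone h) fun ⟨_, d, hd, h⟩ =>
    ⟨⟨d, hd⟩, h.symm.le⟩

lemma IsNormalFun.add {f g : P → ℂ} (hf : IsNormalFun f) (hg : IsNormalFun g) :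
    IsNormalFun (fun x => f x + g x) := fun D h1 h2 a ha => (hf D h1 h2 a ha).add (hg D h1 h2 a ha)

lemma IsNormalFun.const_mul {f : P → ℂ} (hf : IsNormalFun f) (c : ℂ) :
    IsNormalFun (fun x => c * f x) := fun D h1 h2 a ha => (hf D h1 h2 a ha).const_mul c

lemma IsNormalFun.sum {ι : Type*} (s : Finset ι) {f : ι → P → ℂ} (hf : ∀ i ∈ s, IsNormalFun (f i)) :
    IsNormalFun (fun x => ∑ i ∈ s, f i x) := fun D h1 h2 a ha =>
  tendsto_finsetSum s fun i hi => hf i hi D h1 h2 a ha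

lemma isNormalFun_const (c : ℂ) : IsNormalFun (fun _ : P => c) := fun _ _ _ _ _ => tendsto_const_nhds

end Normal

section Rep

variable {M : Type u} [CStarAlgebra M] [PartialOrder M] [StarOrderedRing M]
  {H : Type u} [NormedAddCommGroup H] [InnerProductSpace ℂ H] [CompleteSpace H]

lemma isNormalFun_polarization (σ : M →ₗ[ℂ] (H →L[ℂ] H)) (hσ : ∀ h, IsNormalFun fun a => inner ℂ h (σ a h))
    (h g : H) : IsNormalFun fun a => inner ℂ h (σ a g) := by
  have e : ∀ a, inner ℂ h (σ a g) = (1 / 4) * inner ℂ (h + g) (σ a (h + g)) +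
      (-1 / 4) * inner ℂ (h - g) (σ a (h - g)) +
      (-Complex.I / 4) * inner ℂ (h + Complex.I • g) (σ a (h + Complex.I • g)) +
      (Complex.I / 4) * inner ℂ (h - Complex.I • g) (σ a (h - Complex.I • g)) := by
    intro a
    simp only [map_add, map_sub, map_smul, inner_add_left, inner_add_right, inner_sub_left,
      inner_sub_right, inner_smul_left, inner_smul_right, Complex.conj_I]
    linear_combination (inner ℂ h (σ a g) / 2 - inner ℂ g (σ a h) / 2) * Complex.I_mul_I
  simp only [e]
  exact ((((hσ _).const_mul _).add ((hσ _).const_mul _)).add ((hσ _).const_mul _)).add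
    ((hσ _).const_mul _)

lemma isNormalFun_inner {σ : M →⋆ₐ[ℂ] (H →L[ℂ] H)} (hσ : ScottContinuous σ) (h g : H) :
    IsNormalFun fun a => inner ℂ h (σ a g) :=
  isNormalFun_polarization σ.toLinearMap (fun h =>
    IsNormalFun.comp (f := fun T : H →L[ℂ] H => inner ℂ h (T h))
      (fun _ hne hdir _ hT => tendsto_inner_of_isLUB hne hdir hT h) hσ) h g

lemma scottContinuous_of_isNormalFun {σ : M →⋆ₐ[ℂ] (H →L[ℂ] H)}
    (hσ : ∀ h, IsNormalFun fun a => inner ℂ h (σ a h)) : ScottContinuous σ := by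
  intro D hne hdir a ha
  have hmono : ∀ x y : M, x ≤ y → σ x ≤ σ y := fun x y h => OrderHomClass.mono σ h
  refine ⟨?_, fun T hT => ?_⟩
  · rintro _ ⟨d, hd, rfl⟩
    exact hmono _ _ (ha.1 hd)
  · rw [op_le_iff]
    intro h
    have _ : Nonempty D := hne.to_subtype
    have _ : IsDirectedOrder D := ⟨fun a b => by
      obtain ⟨c, hc, h1, h2⟩ := hdir a a.2 b b.2
      exact ⟨⟨c, hc⟩, h1, h2⟩⟩
    exact le_of_tendsto' (hσ h D hne hdir a ha) fun d => op_le_iff.mp (hT ⟨d, d.2, rfl⟩) h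

/-- Order continuity passes to norm limits. -/
lemma isNormalFun_of_approx {f : M → ℂ}
    (hf : ∀ ε > 0, ∃ g : M → ℂ, IsNormalFun g ∧ ∀ x, ‖f x - g x‖ ≤ ε * ‖x‖) : IsNormalFun f := by
  intro D hne hdir a ha
  obtain ⟨d0, hd0⟩ := hne
  -- Only the tail of the net above `d0` is norm bounded, and on it the approximation error is
  -- uniform.
  have hbd : ∀ d ∈ D, d0 ≤ d → ‖d‖ ≤ ‖a - d0‖ + ‖d0‖ := fun d hd h => by
    have := CStarAlgebra.norm_le_norm_of_nonneg_of_le (sub_nonneg.mpr h)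
      (sub_le_sub_right (ha.1 hd) d0)
    calc ‖d‖ = ‖(d - d0) + d0‖ := by rw [sub_add_cancel]
      _ ≤ _ := (norm_add_le _ _).trans (by gcongr)
  let C : ℝ := ‖a - d0‖ + ‖d0‖ + ‖a‖ + 1
  have hC : 0 < C := by positivity
  rw [Metric.tendsto_nhds]
  intro ε hε
  obtain ⟨g, hg, hfg⟩ := hf (ε / 3 / C) (by positivity)
  have hsmall : ∀ x : M, ‖x‖ ≤ C → dist (f x) (g x) ≤ ε / 3 := fun x hx => by
    rw [dist_eq_norm]
    calc _ ≤ ε / 3 / C * ‖x‖ := hfg x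
      _ ≤ ε / 3 / C * C := by gcongr
      _ = ε / 3 := by field_simp
  filter_upwards [Metric.tendsto_nhds.mp (hg D ⟨d0, hd0⟩ hdir a ha) (ε / 3) (by positivity),
    eventually_ge_atTop (⟨d0, hd0⟩ : D)] with d hd hd0'
  have h1 := hsmall d ((hbd d d.2 hd0').trans (by simp only [C]; linarith [norm_nonneg a]))
  have h2 := hsmall a (by simp only [C]; linarith [norm_nonneg (a - d0), norm_nonneg d0])
  have h3 := dist_triangle4 (f d) (g d) (g a) (f a)
  rw [dist_comm (g a) (f a)] at h3
  linarith

/-- Order continuity of the matrix coefficients can be checked on a total set. -/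
lemma isNormalFun_inner_of_total {σ : M →⋆ₐ[ℂ] (H →L[ℂ] H)} {S : Set H}
    (hS : Dense (Submodule.span ℂ S : Set H))
    (hσ : ∀ h ∈ S, ∀ g ∈ S, IsNormalFun fun a => inner ℂ h (σ a g)) (h g : H) :
    IsNormalFun fun a => inner ℂ h (σ a g) := by
  have norm_le : ∀ x, ‖σ x‖ ≤ ‖x‖ := fun x => NonUnitalStarAlgHom.norm_apply_le σ x
  have h1 : ∀ h ∈ Submodule.span ℂ S, ∀ g ∈ Submodule.span ℂ S,
      IsNormalFun fun a => inner ℂ h (σ a g) := by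
    intro h hh g hg
    induction hh using Submodule.span_induction with
    | mem h hh =>
      induction hg using Submodule.span_induction with
      | mem g hg => exact hσ h hh g hg
      | zero => simpa using isNormalFun_const 0
      | add x y _ _ hx hy => simpa [inner_add_right] using hx.add hy
      | smul c x _ hx => simpa [inner_smul_right] using hx.const_mul c
    | zero => simpa using isNormalFun_const 0
    | add x y _ _ hx hy => simpa [inner_add_left] using hx.add hy
    | smul c x _ hx => simpa [inner_smul_left, mul_comm] using hx.const_mul (starRingEnd ℂ c)
  refine isNormalFun_of_approx fun ε hε => ?_
  let δ : ℝ := min 1 (ε / (‖h‖ + ‖g‖ + 1))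
  have hδ : 0 < δ := lt_min one_pos (by positivity)
  obtain ⟨h', hh', hd⟩ := Metric.mem_closure_iff.mp (hS h) δ hδ
  obtain ⟨g', hg', hd'⟩ := Metric.mem_closure_iff.mp (hS g) δ hδ
  refine ⟨_, h1 h' hh' g' hg', fun x => ?_⟩
  rw [dist_eq_norm] at hd hd'
  have e : inner ℂ h (σ x g) - inner ℂ h' (σ x g') =
      inner ℂ (h - h') (σ x g') + inner ℂ h (σ x (g - g')) := by
    simp only [inner_sub_left, map_sub, inner_sub_right]; ring
  have b : ∀ u v : H, ‖inner ℂ u (σ x v)‖ ≤ ‖u‖ * (‖x‖ * ‖v‖) := fun u v =>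
    (norm_inner_le_norm _ _).trans (by
      gcongr
      exact ((σ x).le_opNorm v).trans (by gcongr; exact norm_le x))
  have hg'n : ‖g'‖ ≤ ‖g‖ + 1 := by
    have := norm_sub_norm_le g' g
    rw [norm_sub_rev] at this
    linarith [hd'.le.trans (min_le_left 1 _)]
  rw [e]
  calc _ ≤ ‖h - h'‖ * (‖x‖ * ‖g'‖) + ‖h‖ * (‖x‖ * ‖g - g'‖) :=
        (norm_add_le _ _).trans (add_le_add (b _ _) (b _ _))
    _ ≤ δ * (‖x‖ * (‖g‖ + 1)) + ‖h‖ * (‖x‖ * δ) := by gcongr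
    _ = δ * (‖h‖ + ‖g‖ + 1) * ‖x‖ := by ring
    _ ≤ ε / (‖h‖ + ‖g‖ + 1) * (‖h‖ + ‖g‖ + 1) * ‖x‖ := by
        gcongr; exact min_le_right _ _
    _ = ε * ‖x‖ := by field_simp

/-- Conjugation by an invertible element is an order isomorphism, with inverse the conjugation by
u⁻¹; it therefore preserves all suprema that exist. -/
lemma scottContinuous_conj_isUnit {u : M} (hu : IsUnit u) :
    ScottContinuous fun x : M => star u * x * u := by
  obtain ⟨u, rfl⟩ := hu
  have inv1 : ∀ T : M, star (u : M) * (star (↑u⁻¹ : M) * T * ↑u⁻¹) * u = T := fun T => by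
    have : star (u : M) * star (↑u⁻¹ : M) = 1 := by rw [← star_mul, Units.inv_mul, star_one]
    calc _ = (star (u : M) * star (↑u⁻¹ : M)) * T * (↑u⁻¹ * u) := by simp only [mul_assoc]
      _ = T := by rw [this, Units.inv_mul, one_mul, mul_one]
  have inv2 : ∀ T : M, star (↑u⁻¹ : M) * (star (u : M) * T * ↑u) * ↑u⁻¹ = T := fun T => by
    have : star (↑u⁻¹ : M) * star (u : M) = 1 := by rw [← star_mul, Units.mul_inv, star_one]
    calc _ = (star (↑u⁻¹ : M) * star (u : M)) * T * (u * ↑u⁻¹) := by simp only [mul_assoc]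
      _ = T := by rw [this, Units.mul_inv, one_mul, mul_one]
  intro D _ _ a ha
  refine ⟨?_, fun T hT => ?_⟩
  · rintro _ ⟨d, hd, rfl⟩
    exact star_left_conjugate_le_conjugate (ha.1 hd) _
  · rw [← inv1 T]
    refine star_left_conjugate_le_conjugate (ha.2 fun d hd => ?_) _
    rw [← inv2 d]
    exact star_left_conjugate_le_conjugate (hT ⟨d, hd, rfl⟩) _

lemma isUnit_add_of_norm_lt {b : M} {c : ℂ} (h : ‖b‖ * ‖(1 : M)‖ < ‖c‖) : IsUnit (b + c • (1 : M)) := by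
  have := spectrum.mem_resolventSet_of_norm_lt_mul (k := -c) (a := b) (by rwa [norm_neg])
  rw [spectrum.mem_resolventSet_iff] at this
  have h2 := this.neg
  rwa [neg_sub, Algebra.algebraMap_eq_smul_one, neg_smul, sub_neg_eq_add] at h2

/-- For t > ‖b‖‖1‖ the elements b + ct, with c a fourth root of unity, are invertible. Averaging
their conjugations over c gives b*xb + t²x, which reduces a general b to the invertible case. -/
lemma isNormalFun_conj (ω : M →ₗ[ℂ] ℂ) (hω : IsNormalFun ω) (b : M) :
    IsNormalFun fun x => ω (star b * x * b) := by
  let t : ℝ := ‖b‖ * ‖(1 : M)‖ + 1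
  have ht : 0 < t := by positivity
  have hn : ∀ c : ℂ, ‖c‖ = t → IsNormalFun fun x => ω (star (b + c • (1 : M)) * x * (b + c • (1 : M))) :=
    fun c hc => IsNormalFun.comp hω (scottContinuous_conj_isUnit
      (isUnit_add_of_norm_lt (by rw [hc]; simp [t])))
  have e : ∀ x, ω (star b * x * b) =
      (1 / 4) * ω (star (b + (t : ℂ) • (1 : M)) * x * (b + (t : ℂ) • (1 : M))) +
      (1 / 4) * ω (star (b + (-t : ℂ) • (1 : M)) * x * (b + (-t : ℂ) • (1 : M))) +
      (1 / 4) * ω (star (b + (Complex.I * t) • (1 : M)) * x * (b + (Complex.I * t) • (1 : M))) +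
      (1 / 4) * ω (star (b + (-Complex.I * t) • (1 : M)) * x * (b + (-Complex.I * t) • (1 : M))) +
      (-t ^ 2) * ω x := by
    intro x
    simp only [star_add, star_smul, star_one, Complex.star_def, map_mul, map_neg, Complex.conj_I,
      Complex.conj_ofReal, add_mul, mul_add, smul_mul_assoc, mul_smul_comm, one_mul, mul_one,
      map_add, map_smul, smul_eq_mul]
    linear_combination (t ^ 2 / 2 * ω x) * Complex.I_mul_I
  simp only [e]
  refine ((((IsNormalFun.const_mul (hn _ ?_) _).add (IsNormalFun.const_mul (hn _ ?_) _)).add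
    (IsNormalFun.const_mul (hn _ ?_) _)).add (IsNormalFun.const_mul (hn _ ?_) _)).add
    (hω.const_mul _) <;> simp [abs_of_pos ht]

end Rep

/-- The normal unital representations of `M` on Hilbert spaces. -/
structure NormalRep (M : Type u) [CStarAlgebra M] [PartialOrder M] [StarOrderedRing M] where
  /-- the Hilbert space -/
  H : Type u
  [group : NormedAddCommGroup H]
  [inner : InnerProductSpace ℂ H]
  [complete : CompleteSpace H]
  /-- the representation -/
  σ : M →⋆ₐ[ℂ] (H →L[ℂ] H)
  normal : ScottContinuous σ

attribute [instance] NormalRep.group NormalRep.inner NormalRep.complete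

/-! ### GNS representations of normal functionals: normal representations detect the order -/

section Separation

variable {M : Type u} [CStarAlgebra M] [PartialOrder M] [StarOrderedRing M]

lemma gns_apply_coe (ω : M →ₚ[ℂ] ℂ) (a : M) (b : ω.PreGNS) :
    ω.gnsStarAlgHom a (b : ω.GNS) = (ω.toPreGNS (a * ω.ofPreGNS b) : ω.PreGNS) :=
  ω.gnsNonUnitalStarAlgHom_apply_coe

/-- The diagonal coefficient at the class of b is a ↦ ω(b*ab), which is normal by
`isNormalFun_conj`; polarisation and density of these classes give all other coefficients. -/
lemma gns_scottContinuous (ω : M →ₚ[ℂ] ℂ) (hω : IsNormalFun ω) : ScottContinuous ω.gnsStarAlgHom := by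
  have hdense : Dense (Submodule.span ℂ (Set.range ((↑) : ω.PreGNS → ω.GNS)) : Set ω.GNS) :=
    (UniformSpace.Completion.denseRange_coe).mono Submodule.subset_span
  refine scottContinuous_of_isNormalFun fun h => isNormalFun_inner_of_total hdense ?_ h h
  have hdiag : ∀ b : ω.PreGNS, IsNormalFun fun a => inner ℂ (b : ω.GNS) (ω.gnsStarAlgHom a b) := by
    intro b
    have e : ∀ a : M, inner ℂ (b : ω.GNS) (ω.gnsStarAlgHom a b) =
        ω (star (ω.ofPreGNS b) * a * ω.ofPreGNS b) := fun a => by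
      rw [gns_apply_coe, UniformSpace.Completion.inner_coe, PositiveLinearMap.preGNS_inner_def]
      simp [mul_assoc]
    simp only [e]
    exact isNormalFun_conj ω.toLinearMap hω _
  rintro _ ⟨b, rfl⟩ _ ⟨c, rfl⟩
  have key : ∀ z : ℂ, IsNormalFun fun a => inner ℂ ((b : ω.GNS) + z • (c : ω.GNS))
      (ω.gnsStarAlgHom a ((b : ω.GNS) + z • (c : ω.GNS))) := fun z => by
    simpa only [UniformSpace.Completion.coe_add, UniformSpace.Completion.coe_smul] using
      hdiag (b + z • c)
  have e : ∀ a, inner ℂ (b : ω.GNS) (ω.gnsStarAlgHom a c) =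
      (1 / 4) * inner ℂ ((b : ω.GNS) + (1 : ℂ) • (c : ω.GNS))
        (ω.gnsStarAlgHom a ((b : ω.GNS) + (1 : ℂ) • (c : ω.GNS))) +
      (-1 / 4) * inner ℂ ((b : ω.GNS) + (-1 : ℂ) • (c : ω.GNS))
        (ω.gnsStarAlgHom a ((b : ω.GNS) + (-1 : ℂ) • (c : ω.GNS))) +
      (-Complex.I / 4) * inner ℂ ((b : ω.GNS) + Complex.I • (c : ω.GNS))
        (ω.gnsStarAlgHom a ((b : ω.GNS) + Complex.I • (c : ω.GNS))) +
      (Complex.I / 4) * inner ℂ ((b : ω.GNS) + (-Complex.I) • (c : ω.GNS))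
        (ω.gnsStarAlgHom a ((b : ω.GNS) + (-Complex.I) • (c : ω.GNS))) := by
    intro a
    simp only [map_add, map_smul, inner_add_left, inner_add_right, inner_smul_left,
      inner_smul_right, Complex.conj_I, map_neg, map_one]
    linear_combination (inner ℂ (b : ω.GNS) (ω.gnsStarAlgHom a c) / 2 -
      inner ℂ (c : ω.GNS) (ω.gnsStarAlgHom a b) / 2) * Complex.I_mul_I
  simp only [e]
  exact ((((key _).const_mul _).add ((key _).const_mul _)).add ((key _).const_mul _)).add
    ((key _).const_mul _)

/-- The normal representations of a `W*`-algebra detect positivity. -/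
theorem nonneg_of_normalRep [WStarAlgebra M] {m : M} (h : ∀ π : NormalRep M, 0 ≤ π.σ m) : 0 ≤ m := by
  by_contra hm
  obtain ⟨ω, hω, h'⟩ := exists_normal_functional hm
  refine h' ?_
  have := op_nonneg_iff.mp (h ⟨ω.GNS, ω.gnsStarAlgHom, gns_scottContinuous ω hω⟩)
    ((ω.toPreGNS 1 : ω.PreGNS) : ω.GNS)
  change 0 ≤ inner ℂ _ (ω.gnsStarAlgHom m _) at this
  rw [gns_apply_coe, UniformSpace.Completion.inner_coe, PositiveLinearMap.preGNS_inner_def] at this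
  simpa using this

lemma le_of_normalRep [WStarAlgebra M] {m n : M} (h : ∀ π : NormalRep M, π.σ m ≤ π.σ n) : m ≤ n :=
  sub_nonneg.mp (nonneg_of_normalRep fun π => by rw [map_sub]; exact sub_nonneg.mpr (h π))

lemma eq_of_normalRep [WStarAlgebra M] {m n : M} (h : ∀ π : NormalRep M, π.σ m = π.σ n) : m = n :=
  le_antisymm (le_of_normalRep fun π => (h π).le) (le_of_normalRep fun π => (h π).ge)

/-- The C*-identity rewrites the norm bound as m*m ≤ C², an order relation that can be checked
representation by representation. -/
lemma norm_le_of_normalRep [WStarAlgebra M] {m : M} {C : ℝ} (hC : 0 ≤ C)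
    (h : ∀ π : NormalRep M, ‖π.σ m‖ ≤ C) : ‖m‖ ≤ C := by
  have h1 : star m * m ≤ algebraMap ℝ M (C ^ 2) := le_of_normalRep fun π => by
    have h2 := (IsSelfAdjoint.star_mul_self (π.σ m)).le_algebraMap_norm_self
    rw [CStarRing.norm_star_mul_self, ← sq] at h2
    rw [map_mul, map_star]
    refine h2.trans ?_
    have e : π.σ (algebraMap ℝ M (C ^ 2)) = algebraMap ℝ (π.H →L[ℂ] π.H) (C ^ 2) := by
      rw [IsScalarTower.algebraMap_apply ℝ ℂ M, AlgHomClass.commutes,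
        ← IsScalarTower.algebraMap_apply ℝ ℂ]
    rw [e]
    exact algebraMap_mono _ (by gcongr; exact h π)
  have h3 := (CStarAlgebra.norm_le_iff_le_algebraMap (star m * m) (by positivity)
    (star_mul_self_nonneg m)).mpr h1
  rw [CStarRing.norm_star_mul_self, ← sq] at h3
  exact (sq_le_sq₀ (norm_nonneg m) hC).mp h3

end Separation

end WStar

namespace WStar

open Filter Topology WStarCorrespondence

variable {M E : Type u} [CStarAlgebra M] [PartialOrder M] [StarOrderedRing M]
  [NormedAddCommGroup E] [NormedSpace ℂ E] [CompleteSpace E] [Module M E] [Module Mᵐᵒᵖ E]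
  [WStarCorrespondence M E]

/-! ### The Hilbert spaces E^{⊗k} ⊗_σ H and operators defined on elementary tensors -/

lemma ofReal_norm_sum_sq {ι G : Type*} [NormedAddCommGroup G] [InnerProductSpace ℂ G]
    (s : Finset ι) (y : ι → G) :
    ((‖∑ u ∈ s, y u‖ ^ 2 : ℝ) : ℂ) = ∑ u ∈ s, ∑ v ∈ s, inner ℂ (y u) (y v) := by
  push_cast
  rw [← RCLike.ofReal_eq_complex_ofReal, ← inner_self_eq_norm_sq_to_K, sum_inner]
  simp_rw [inner_sum]

lemma norm_sum_sq {ι G : Type*} [NormedAddCommGroup G] [InnerProductSpace ℂ G]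
    (s : Finset ι) (y : ι → G) :
    ‖∑ u ∈ s, y u‖ ^ 2 = (∑ u ∈ s, ∑ v ∈ s, inner ℂ (y u) (y v)).re := by
  rw [← ofReal_norm_sum_sq, Complex.ofReal_re]

section HTensorBasic

variable {H : Type u} [NormedAddCommGroup H] [InnerProductSpace ℂ H] [CompleteSpace H]
  (σ : M →⋆ₐ[ℂ] (H →L[ℂ] H)) {k : ℕ}

/-- The canonical map from algebraic tensors to `E^{⊗k} ⊗_σ H`. -/
def ofPre : ((Fin k → E) →₀ H) →ₗ[ℂ] HTensor E σ k :=
  { toFun := fun c => UniformSpace.Completion.coe' (α := PreHTensor E σ k) c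
    map_add' := fun c d => UniformSpace.Completion.coe_add (α := PreHTensor E σ k) c d
    map_smul' := fun r c => UniformSpace.Completion.coe_smul (X := PreHTensor E σ k) r c }

lemma denseRange_ofPre : DenseRange (ofPre (E := E) (k := k) σ) :=
  UniformSpace.Completion.denseRange_coe (α := PreHTensor E σ k)

lemma ofPre_single (u : Fin k → E) (h : H) : ofPre σ (Finsupp.single u h) = htens σ u h := rfl

lemma ofPre_eq_sum (c : (Fin k → E) →₀ H) : ofPre σ c = ∑ u ∈ c.support, htens σ u (c u) := by
  conv_lhs => rw [← Finsupp.sum_single c]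
  rw [Finsupp.sum, map_sum]
  rfl

lemma inner_ofPre (c d : (Fin k → E) →₀ H) : inner ℂ (ofPre σ c) (ofPre σ d) = preInner σ c d :=
  UniformSpace.Completion.inner_coe (𝕜 := ℂ) (E := PreHTensor E σ k) c d

lemma inner_htens (u v : Fin k → E) (h g : H) :
    inner ℂ (htens σ u h) (htens σ v g) = inner ℂ h (σ (kernel k 1 u v) g) := by
  rw [← ofPre_single, ← ofPre_single, inner_ofPre, preInner, Finsupp.sum_single_index (by simp),
    Finsupp.sum_single_index (by simp)]

lemma htens_add (u : Fin k → E) (h g : H) : htens σ u (h + g) = htens σ u h + htens σ u g := by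
  rw [← ofPre_single, Finsupp.single_add, map_add]; rfl

lemma htens_smul (u : Fin k → E) (c : ℂ) (h : H) : htens σ u (c • h) = c • htens σ u h := by
  rw [← ofPre_single, ← Finsupp.smul_single, map_smul]; rfl

lemma norm_htens_le (u : Fin k → E) (h : H) :
    ‖htens σ u h‖ ≤ √‖(kernel k 1 u u : M)‖ * ‖h‖ := by
  rw [← Real.sqrt_sq (norm_nonneg h), ← Real.sqrt_mul (norm_nonneg _)]
  refine Real.le_sqrt_of_sq_le ?_
  have h1 : ‖htens σ u h‖ ^ 2 = (inner ℂ h (σ (kernel k 1 u u) h)).re := by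
    rw [← inner_htens, inner_self_eq_norm_sq_to_K]; norm_cast
  rw [h1]
  refine (Complex.re_le_norm _).trans ((norm_inner_le_norm _ _).trans ?_)
  calc ‖h‖ * ‖σ (kernel k 1 u u) h‖ ≤ ‖h‖ * (‖(kernel k 1 u u : M)‖ * ‖h‖) := by
        gcongr
        exact ((σ _).le_opNorm h).trans (by gcongr; exact NonUnitalStarAlgHom.norm_apply_le σ _)
    _ = _ := by ring

/-- The insertion `h ↦ u ⊗ h`. -/
def htensL (u : Fin k → E) : H →L[ℂ] HTensor E σ k :=
  LinearMap.mkContinuous { toFun := htens σ u, map_add' := htens_add σ u, map_smul' := htens_smul σ u }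
    _ (norm_htens_le σ u)

@[simp] lemma htensL_apply (u : Fin k → E) (h : H) : htensL σ u h = htens σ u h := rfl

lemma adjoint_htensL_htens (u v : Fin k → E) (h : H) :
    ContinuousLinearMap.adjoint (htensL σ u) (htens σ v h) = σ (kernel k 1 u v) h := by
  refine ext_inner_left ℂ fun g => ?_
  rw [ContinuousLinearMap.adjoint_inner_right, htensL_apply, inner_htens]

lemma dense_span_htens : Dense (Submodule.span ℂ
    {x : HTensor E σ k | ∃ u h, htens σ u h = x} : Set (HTensor E σ k)) := by
  refine (denseRange_ofPre (E := E) (k := k) σ).mono ?_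
  rintro _ ⟨c, rfl⟩
  rw [ofPre_eq_sum]
  exact Submodule.sum_mem _ fun u _ => Submodule.subset_span ⟨u, _, rfl⟩

variable {σ}

lemma HTensor.clm_ext {G : Type*} [NormedAddCommGroup G] [NormedSpace ℂ G]
    {S T : HTensor E σ k →L[ℂ] G} (h : ∀ u x, S (htens σ u x) = T (htens σ u x)) : S = T := by
  refine ContinuousLinearMap.ext_on (dense_span_htens σ) ?_
  rintro _ ⟨u, x, rfl⟩
  exact h u x

lemma HTensor.ext_inner {x y : HTensor E σ k}
    (h : ∀ u g, inner ℂ (htens σ u g) x = inner ℂ (htens σ u g) y) : x = y := by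
  rw [← sub_eq_zero, ← inner_self_eq_zero (𝕜 := ℂ)]
  have h0 : innerSL ℂ (x - y) = 0 := by
    refine HTensor.clm_ext fun u g => ?_
    rw [innerSL_apply_apply, zero_apply, ← inner_conj_symm, inner_sub_right, h, sub_self, map_zero]
  have h1 := congrArg (fun f => f (x - y)) h0
  simp only [zero_apply] at h1
  rwa [innerSL_apply_apply] at h1

lemma HTensor.op_ext {G : Type*} [NormedAddCommGroup G] [NormedSpace ℂ G]
    {S T : G →L[ℂ] HTensor E σ k}
    (h : ∀ x u g, inner ℂ (htens σ u g) (S x) = inner ℂ (htens σ u g) (T x)) : S = T :=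
  ContinuousLinearMap.ext fun x => HTensor.ext_inner fun u g => h x u g

/-- A bounded linear map out of `E^{⊗k} ⊗_σ H` given by its values on elementary tensors. -/
lemma exists_lift {G : Type*} [NormedAddCommGroup G] [NormedSpace ℂ G] [CompleteSpace G]
    (J : (Fin k → E) → H →ₗ[ℂ] G) {C : ℝ} (hC : 0 ≤ C)
    (hJ : ∀ (s : Finset (Fin k → E)) (h : (Fin k → E) → H),
      ‖∑ u ∈ s, J u (h u)‖ ≤ C * ‖∑ u ∈ s, htens σ u (h u)‖) :
    ∃ L : HTensor E σ k →L[ℂ] G, (∀ u h, L (htens σ u h) = J u h) ∧ ‖L‖ ≤ C := by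
  let f : ((Fin k → E) →₀ H) →ₗ[ℂ] G := Finsupp.lsum ℂ J
  have hf : ∀ c, ‖f c‖ ≤ C * ‖ofPre σ c‖ := fun c => by
    rw [ofPre_eq_sum]
    exact hJ c.support c
  refine ⟨f.extendOfNorm (ofPre σ), fun u h => ?_, ?_⟩
  · rw [← ofPre_single, LinearMap.extendOfNorm_eq (denseRange_ofPre σ) ⟨C, hf⟩]
    simp [f]
  · exact LinearMap.opNorm_extendOfNorm_le (denseRange_ofPre σ) hC hf

lemma exists_lift_isometry {G : Type*} [NormedAddCommGroup G] [InnerProductSpace ℂ G]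
    [CompleteSpace G] (J : (Fin k → E) → H →ₗ[ℂ] G)
    (hJ : ∀ u v h g, inner ℂ (J u h) (J v g) = inner ℂ h (σ (kernel k 1 u v) g)) :
    ∃ L : HTensor E σ k →L[ℂ] G, (∀ u h, L (htens σ u h) = J u h) ∧
      ContinuousLinearMap.adjoint L ∘L L = 1 := by
  obtain ⟨L, hL, -⟩ := exists_lift J zero_le_one (fun s h => by
    rw [one_mul]
    refine le_of_eq ?_
    rw [← sq_eq_sq₀ (norm_nonneg _) (norm_nonneg _), norm_sum_sq, norm_sum_sq]
    congr 1
    refine Finset.sum_congr rfl fun u _ => Finset.sum_congr rfl fun v _ => ?_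
    rw [hJ, inner_htens σ])
  refine ⟨L, hL, HTensor.clm_ext fun v g => HTensor.ext_inner fun u h => ?_⟩
  rw [ContinuousLinearMap.comp_apply, ContinuousLinearMap.adjoint_inner_right, hL, hL, hJ]
  exact (inner_htens σ u v h g).symm

/-- Gram matrices over `M` are positive in every representation. -/
lemma IsGram.inner_nonneg {ι : Type u} [Fintype ι] {A : ι → ι → M} (hA : IsGram A)
    (σ : M →⋆ₐ[ℂ] (H →L[ℂ] H)) (h : ι → H) : 0 ≤ ∑ i, ∑ j, inner ℂ (h i) (σ (A i j) (h j)) := by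
  obtain ⟨κ, _, b, hb⟩ := hA
  have : ∑ i, ∑ j, inner ℂ (h i) (σ (A i j) (h j)) =
      ∑ l, inner ℂ (∑ i, σ (b l i) (h i)) (∑ i, σ (b l i) (h i)) := by
    simp_rw [hb, map_sum, map_mul, map_star, sum_inner, inner_sum]
    conv_rhs => rw [Finset.sum_comm]
    refine Finset.sum_congr rfl fun i _ => ?_
    conv_rhs => rw [Finset.sum_comm]
    refine Finset.sum_congr rfl fun j _ => ?_
    rw [sum_apply, inner_sum]
    refine Finset.sum_congr rfl fun l _ => ?_
    rw [mul_apply_eq_comp, ContinuousLinearMap.star_eq_adjoint,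
      ContinuousLinearMap.adjoint_inner_right]
  rw [this]
  refine Finset.sum_nonneg fun l _ => ?_
  rw [inner_self_eq_norm_sq_to_K]
  exact pow_nonneg (RCLike.ofReal_nonneg.mpr (norm_nonneg _)) 2

end HTensorBasic

/-! ### From norm estimates to order estimates -/

section Paschke

/-- If `b* q b` is dominated in norm by `b* p b` for all `b`, then `q ≤ p` up to the constant. -/
lemma le_smul_of_norm_conj_le {p q : M} (hp : 0 ≤ p) (hq : 0 ≤ q) {C : ℝ} (hC : 0 ≤ C)
    (h : ∀ b : M, ‖star b * q * b‖ ≤ C * ‖star b * p * b‖) : q ≤ C • p := by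
  -- With x = p + ε invertible, b = x^{-1/2} gives b*pb ≤ 1, so b*qb ≤ C by the hypothesis;
  -- conjugating back with x^{1/2} yields q ≤ Cx. Then ε tends to 0.
  have key : ∀ ε : ℝ, 0 < ε → q ≤ C • (p + ε • 1) := by
    intro ε hε
    have h1 : IsStrictlyPositive (ε • (1 : M)) := by
      rw [← Algebra.algebraMap_eq_smul_one]
      exact (IsUnit.mk0 ε hε.ne').map (algebraMap ℝ M) |>.isStrictlyPositive
        (algebraMap_nonneg M hε.le)
    have hx : IsStrictlyPositive (p + ε • (1 : M)) := h1.nonneg_add hp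
    set x : M := p + ε • 1 with hxdef
    have hx0 : 0 ≤ x := hx.nonneg
    have hb : x ^ (-(1 / 2) : ℝ) * x * x ^ (-(1 / 2) : ℝ) = 1 :=
      CFC.conjugate_rpow_neg_one_half x
    have hb' : x ^ (1 / 2 : ℝ) * x ^ (-(1 / 2) : ℝ) = 1 := by
      rw [← CFC.rpow_add hx.isUnit, add_neg_cancel, CFC.rpow_zero x]
    have hb'' : x ^ (-(1 / 2) : ℝ) * x ^ (1 / 2 : ℝ) = 1 := by
      rw [← CFC.rpow_add hx.isUnit, neg_add_cancel, CFC.rpow_zero x]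
    have hc : x ^ (1 / 2 : ℝ) * x ^ (1 / 2 : ℝ) = x := by
      rw [← CFC.rpow_add hx.isUnit, add_halves, CFC.rpow_one x]
    set b : M := x ^ (-(1 / 2) : ℝ)
    set c : M := x ^ (1 / 2 : ℝ)
    have hbs : star b = b := IsSelfAdjoint.of_nonneg CFC.rpow_nonneg
    have hcs : star c = c := IsSelfAdjoint.of_nonneg CFC.rpow_nonneg
    have hpx : star b * p * b ≤ 1 := by
      have h2 : p ≤ x := le_add_of_nonneg_right h1.nonneg
      have h3 := star_left_conjugate_le_conjugate h2 b
      rw [hbs, hb] at h3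
      rwa [hbs]
    have hpn : ‖star b * p * b‖ ≤ 1 :=
      (CStarAlgebra.norm_le_one_iff_of_nonneg _ (star_left_conjugate_nonneg hp b)).mpr hpx
    have hq1 : star b * q * b ≤ C • 1 := by
      rw [← Algebra.algebraMap_eq_smul_one]
      exact (CStarAlgebra.norm_le_iff_le_algebraMap _ hC (star_left_conjugate_nonneg hq b)).mp
        ((h b).trans (mul_le_of_le_one_right hC hpn))
    have := star_left_conjugate_le_conjugate hq1 c
    rw [hbs, hcs] at this
    calc q = c * b * q * (b * c) := by rw [hb', hb'']; simp
      _ = c * (b * q * b) * c := by simp only [mul_assoc]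
      _ ≤ c * (C • 1) * c := this
      _ = C • x := by rw [mul_smul_comm, mul_one, smul_mul_assoc, hc]
  refine le_of_tendsto_of_tendsto (f := fun _ => q) (b := 𝓝[>] (0 : ℝ))
    (g := fun ε : ℝ => C • (p + ε • (1 : M))) tendsto_const_nhds ?_
    (eventually_mem_nhdsWithin.mono fun ε hε => key ε hε)
  have : Continuous fun ε : ℝ => C • (p + ε • (1 : M)) := by fun_prop
  simpa using (this.tendsto 0).mono_left nhdsWithin_le_nhds

end Paschke

end WStar

namespace WStar

open Filter Topology WStarCorrespondence TensPow

variable {M E : Type u} [CStarAlgebra M] [PartialOrder M] [StarOrderedRing M]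
  [NormedAddCommGroup E] [NormedSpace ℂ E] [CompleteSpace E] [Module M E] [Module Mᵐᵒᵖ E]
  [WStarCorrespondence M E]

/-! ### Elements of E^{⊗k} as operators H → E^{⊗k} ⊗_σ H -/

section Rho

variable {k : ℕ}

lemma pairing_mapRange (c : (Fin k → E) →₀ M) (f : (Fin k → E) → M) (b : M) :
    pairing (c.mapRange (· * b) (zero_mul b)) f = star b * pairing c f := by
  rw [pairing, Finsupp.sum_mapRange_index (by simp), pairing, Finsupp.sum, Finsupp.sum,
    Finset.mul_sum]
  simp [mul_assoc]

lemma form_mapRange (p : M) (c d : (Fin k → E) →₀ M) (a b : M) :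
    form p (c.mapRange (· * a) (zero_mul a)) (d.mapRange (· * b) (zero_mul b)) =
      star a * form p c d * b := by
  rw [form, Finsupp.sum_mapRange_index (by simp), form]
  simp only [Finsupp.sum, Finset.mul_sum, Finset.sum_mul]
  refine Finset.sum_congr rfl fun u _ => ?_
  have := Finsupp.sum_mapRange_index (f := (· * b)) (hf := zero_mul b) (g := d)
    (h := fun v b => star (c u * a) * kernel k p u v * b) (by simp)
  rw [Finsupp.sum] at this
  rw [this, Finsupp.sum]
  simp [mul_assoc]

/-- Paschke's inequality for bounded functionals. -/
lemma pairing_mul_star_le (f : TensPow M E k) (c : (Fin k → E) →₀ M) :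
    pairing c f.val * star (pairing c f.val) ≤ (‖f‖ ^ 2) • form 1 c c := by
  refine le_smul_of_norm_conj_le (form_nonneg zero_le_one c) (mul_star_self_nonneg _)
    (by positivity) fun b => ?_
  have h1 := boundedBy_norm f (c.mapRange (· * b) (zero_mul b))
  rw [pairing_mapRange, form_mapRange] at h1
  have h2 : star b * (pairing c f.val * star (pairing c f.val)) * b =
      (star b * pairing c f.val) * star (star b * pairing c f.val) := by
    rw [star_mul, star_star]; simp only [mul_assoc]
  rw [h2, CStarRing.norm_self_mul_star, ← sq]
  refine (pow_le_pow_left₀ (norm_nonneg _) h1 2).trans_eq ?_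
  rw [mul_pow, Real.sq_sqrt (norm_nonneg _)]

/-- This is the matrix form of Paschke's inequality. Being a Gram matrix over M it stays positive
under every representation, which the scalar norm bound alone would not ensure. -/
lemma isGram_sub_val (f : TensPow M E k) (s : Finset (Fin k → E)) :
    IsGram fun i j : s => (‖f‖ ^ 2) • kernel k (1 : M) i.1 j.1 - f.val i.1 * star (f.val j.1) := by
  classical
  refine IsGram.of_quadratic _ (fun i j => ?_) fun x => ?_
  · rw [star_sub, star_smul, star_kernel, star_mul, star_star, star_one, star_trivial]
  · let c : (Fin k → E) →₀ M := Finsupp.indicator s fun i hi => x ⟨i, hi⟩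
    have hc : ∀ i : s, c i.1 = x i := fun i => Finsupp.indicator_of_mem i.2 _
    have hsub : c.support ⊆ s := Finsupp.support_indicator_subset _ _
    have h1 : pairing c f.val = ∑ i : s, star (x i) * f.val i.1 := by
      rw [pairing, Finsupp.sum_of_support_subset c hsub _ (by simp), ← Finset.sum_coe_sort s]
      simp_rw [hc]
    have h2 : form 1 c c = ∑ i : s, ∑ j : s, star (x i) * kernel k 1 i.1 j.1 * x j := by
      rw [form, Finsupp.sum_of_support_subset c hsub _ (by simp), ← Finset.sum_coe_sort s]
      refine Finset.sum_congr rfl fun i _ => ?_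
      rw [Finsupp.sum_of_support_subset c hsub _ (by simp), ← Finset.sum_coe_sort s]
      simp_rw [hc]
    have h3 := sub_nonneg.mpr (pairing_mul_star_le f c)
    refine h3.trans_eq ?_
    rw [h1, h2]
    simp_rw [star_sum, Finset.sum_mul_sum, Finset.smul_sum, ← Finset.sum_sub_distrib]
    refine Finset.sum_congr rfl fun i _ => Finset.sum_congr rfl fun j _ => ?_
    rw [star_mul, star_star, mul_sub, sub_mul, mul_smul_comm, smul_mul_assoc]
    simp only [mul_assoc]

variable {H : Type u} [NormedAddCommGroup H] [InnerProductSpace ℂ H] [CompleteSpace H]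
  (σ : M →⋆ₐ[ℂ] (H →L[ℂ] H))

/-- A functional on the algebraic tensors naturally gives an operator out of E^{⊗k} ⊗_σ H, namely
the adjoint of h ↦ f ⊗ h; hence the adjoint is built first. Its boundedness is `isGram_sub_val`
evaluated in σ. -/
lemma exists_adjoint_rho (f : TensPow M E k) : ∃ L : HTensor E σ k →L[ℂ] H,
    (∀ u h, L (htens σ u h) = (σ (star (f.val u)) : H →ₗ[ℂ] H) h) ∧ ‖L‖ ≤ ‖f‖ := by
  refine exists_lift _ (norm_nonneg f) fun s h => ?_
  rw [← pow_le_pow_iff_left₀ (norm_nonneg _) (by positivity) two_ne_zero, mul_pow]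
  have h1 := (isGram_sub_val f s).inner_nonneg σ fun i => h i.1
  have e1 : ((‖∑ u ∈ s, (σ (star (f.val u)) : H →ₗ[ℂ] H) (h u)‖ ^ 2 : ℝ) : ℂ) =
      ∑ i : s, ∑ j : s, inner ℂ (h i) (σ (f.val i.1 * star (f.val j.1)) (h j)) := by
    rw [ofReal_norm_sum_sq, ← Finset.sum_coe_sort s]
    refine Finset.sum_congr rfl fun i _ => ?_
    rw [← Finset.sum_coe_sort s]
    refine Finset.sum_congr rfl fun j _ => ?_
    rw [map_mul, map_star, mul_apply_eq_comp, ContinuousLinearMap.star_eq_adjoint]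
    exact ContinuousLinearMap.adjoint_inner_left _ _ _
  have e2 : ((‖∑ u ∈ s, htens σ u (h u)‖ ^ 2 : ℝ) : ℂ) =
      ∑ i : s, ∑ j : s, inner ℂ (h i) (σ (kernel k 1 i.1 j.1) (h j)) := by
    rw [ofReal_norm_sum_sq, ← Finset.sum_coe_sort s]
    refine Finset.sum_congr rfl fun i _ => ?_
    rw [← Finset.sum_coe_sort s]
    refine Finset.sum_congr rfl fun j _ => ?_
    rw [inner_htens]
  have h2 : (0 : ℂ) ≤ ((‖f‖ ^ 2 * ‖∑ u ∈ s, htens σ u (h u)‖ ^ 2 -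
      ‖∑ u ∈ s, (σ (star (f.val u)) : H →ₗ[ℂ] H) (h u)‖ ^ 2 : ℝ) : ℂ) := by
    rw [Complex.ofReal_sub, Complex.ofReal_mul, e1, e2]
    refine h1.trans_eq ?_
    simp_rw [Finset.mul_sum, ← Finset.sum_sub_distrib]
    refine Finset.sum_congr rfl fun i _ => Finset.sum_congr rfl fun j _ => ?_
    have : ((‖f‖ ^ 2) • kernel k (1 : M) i.1 j.1) =
        (((‖f‖ ^ 2 : ℝ) : ℂ)) • kernel k (1 : M) i.1 j.1 := (Complex.coe_smul _ _).symm
    rw [this, map_sub, map_smul, sub_apply, inner_sub_right, smul_apply, inner_smul_right]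
  exact sub_nonneg.mp (Complex.zero_le_real.mp h2)

/-- The operator `h ↦ f ⊗ h` from `H` to `E^{⊗k} ⊗_σ H`. -/
def rho (f : TensPow M E k) : H →L[ℂ] HTensor E σ k :=
  ContinuousLinearMap.adjoint (exists_adjoint_rho σ f).choose

lemma adjoint_rho_htens (f : TensPow M E k) (u : Fin k → E) (h : H) :
    ContinuousLinearMap.adjoint (rho σ f) (htens σ u h) = σ (star (f.val u)) h := by
  rw [rho, ContinuousLinearMap.adjoint_adjoint]
  exact (exists_adjoint_rho σ f).choose_spec.1 u h

lemma norm_rho_le (f : TensPow M E k) : ‖rho σ f‖ ≤ ‖f‖ := by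
  rw [rho, LinearIsometryEquiv.norm_map]
  exact (exists_adjoint_rho σ f).choose_spec.2

lemma inner_htens_rho (f : TensPow M E k) (u : Fin k → E) (h g : H) :
    inner ℂ (htens σ u h) (rho σ f g) = inner ℂ h (σ (f.val u) g) := by
  rw [← ContinuousLinearMap.adjoint_inner_left, adjoint_rho_htens, map_star,
    ContinuousLinearMap.star_eq_adjoint, ContinuousLinearMap.adjoint_inner_left]

lemma adjoint_htensL_rho (f : TensPow M E k) (u : Fin k → E) :
    ContinuousLinearMap.adjoint (htensL σ u) ∘L rho σ f = σ (f.val u) := by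
  ext g
  refine ext_inner_left ℂ fun h => ?_
  rw [ContinuousLinearMap.comp_apply, ContinuousLinearMap.adjoint_inner_right, htensL_apply,
    inner_htens_rho]

lemma rho_add (f g : TensPow M E k) : rho σ (f + g) = rho σ f + rho σ g :=
  HTensor.op_ext fun x u h => by
    rw [add_apply, inner_add_right, inner_htens_rho, inner_htens_rho, inner_htens_rho,
      ← inner_add_right, ← add_apply, ← map_add]
    rfl

lemma rho_smul (c : ℂ) (f : TensPow M E k) : rho σ (c • f) = c • rho σ f :=
  HTensor.op_ext fun x u h => by
    rw [smul_apply, inner_smul_right, inner_htens_rho, inner_htens_rho, ← inner_smul_right,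
      ← smul_apply, ← map_smul]
    rfl

lemma rho_rmul (f : TensPow M E k) (a : M) : rho σ (rmul f a) = rho σ f ∘L σ a :=
  HTensor.op_ext fun x u h => by
    rw [ContinuousLinearMap.comp_apply, inner_htens_rho, inner_htens_rho, ← mul_apply_eq_comp,
      ← map_mul]
    rfl

lemma rho_tens (v : Fin k → E) : rho σ (tens v : TensPow M E k) = htensL σ v :=
  HTensor.op_ext fun x u h => by
    rw [inner_htens_rho, htensL_apply, inner_htens]
    rfl

lemma rho_tens_apply (v : Fin k → E) (h : H) :
    rho σ (tens v : TensPow M E k) h = htens σ v h := by rw [rho_tens]; rfl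

/-- `rho` as a linear map. -/
def rhoₗ (k : ℕ) : TensPow M E k →ₗ[ℂ] (H →L[ℂ] HTensor E σ k) where
  toFun := rho σ
  map_add' := rho_add σ
  map_smul' := rho_smul σ

lemma rho_sub (f g : TensPow M E k) : rho σ (f - g) = rho σ f - rho σ g := map_sub (rhoₗ σ k) f g

lemma rho_sum {ι : Type*} (s : Finset ι) (f : ι → TensPow M E k) :
    rho σ (∑ i ∈ s, f i) = ∑ i ∈ s, rho σ (f i) := map_sum (rhoₗ σ k) f s

lemma eq_of_rho [WStarAlgebra M] {f g : TensPow M E k}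
    (h : ∀ π : NormalRep M, rho π.σ f = rho π.σ g) : f = g := by
  ext u
  refine eq_of_normalRep fun π => ?_
  rw [← adjoint_htensL_rho, h, adjoint_htensL_rho]

end Rho

/-! ### Resolvents of frame operators and the existence of the inner product -/

section Resolvent

/-- B is (1 + nA)⁻¹ in the matrix algebra over M, which exists because A ≥ 0. It is found over M,
before any representation is chosen. -/
lemma IsGram.exists_resolvent {ι : Type u} [Fintype ι] [DecidableEq ι] {A : ι → ι → M}
    (hA : IsGram A) (n : ℕ) : ∃ B : ι → ι → M, ∀ i j,
      B i j + (n : ℂ) • ∑ l, A i l * B l j = if i = j then 1 else 0 := by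
  classical
  obtain ⟨κ, _, b, hb⟩ := hA
  -- The rectangular factor b is padded with zeros to a square matrix; b'*b' is then A in the lower
  -- right corner, and its other entries in the lower rows vanish, so the corner of the inverse
  -- solves the equation.
  let b' : CStarMatrix (κ ⊕ ι) (κ ⊕ ι) M := CStarMatrix.ofMatrix (Matrix.of
    (Sum.elim (fun l => Sum.elim (fun _ => 0) (b l)) (fun _ _ => 0)))
  let _ : PartialOrder (CStarMatrix (κ ⊕ ι) (κ ⊕ ι) M) := CStarAlgebra.spectralOrder _
  have _ : StarOrderedRing (CStarMatrix (κ ⊕ ι) (κ ⊕ ι) M) := CStarAlgebra.spectralOrderedRing _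
  have h1 : (1 : CStarMatrix (κ ⊕ ι) (κ ⊕ ι) M) ≤ 1 + (n : ℂ) • (star b' * b') := by
    refine le_add_of_nonneg_right ?_
    have : (0 : CStarMatrix (κ ⊕ ι) (κ ⊕ ι) M) ≤ n • (star b' * b') :=
      nsmul_nonneg (star_mul_self_nonneg b') n
    rwa [← Nat.cast_smul_eq_nsmul ℂ] at this
  obtain ⟨x, hx⟩ := (CStarAlgebra.isUnit_of_le _ h1).exists_right_inv
  refine ⟨fun i j => x (Sum.inr i) (Sum.inr j), fun i j => ?_⟩
  have h2 : ((1 + (n : ℂ) • (star b' * b')) * x) (Sum.inr i) (Sum.inr j) =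
      if i = j then (1 : M) else 0 := by
    rw [hx, CStarMatrix.one_apply]
    simp
  rw [add_mul, one_mul, CStarMatrix.add_apply, smul_mul_assoc, CStarMatrix.smul_apply,
    CStarMatrix.mul_apply, Fintype.sum_sum_type] at h2
  have h3 : ∀ p q, (star b' * b') p q = ∑ l, star (b' l p) * b' l q := fun p q => by
    rw [CStarMatrix.mul_apply]; rfl
  have h4 : ∀ l, (star b' * b') (Sum.inr i) (Sum.inl l) = 0 := fun l => by
    rw [h3, Fintype.sum_sum_type]
    simp [b']
  have h5 : ∀ l, (star b' * b') (Sum.inr i) (Sum.inr l) = A i l := fun l => by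
    rw [h3, Fintype.sum_sum_type, hb]
    simp [b']
  simp_rw [h4, h5] at h2
  simpa using h2

end Resolvent

section Frame

variable {k : ℕ} {H : Type u} [NormedAddCommGroup H] [InnerProductSpace ℂ H] [CompleteSpace H]
  (σ : M →⋆ₐ[ℂ] (H →L[ℂ] H))

/-- The frame operator `n ∑_{u ∈ s} L_u L_u^*`, where `L_u h = u ⊗ h`. -/
def frameOp (s : Finset (Fin k → E)) (n : ℕ) : HTensor E σ k →L[ℂ] HTensor E σ k :=
  (n : ℂ) • ∑ u ∈ s, htensL σ u ∘L ContinuousLinearMap.adjoint (htensL σ u)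

lemma inner_frameOp (s : Finset (Fin k → E)) (n : ℕ) (y : HTensor E σ k) :
    inner ℂ y (frameOp σ s n y) =
      ((n * ∑ u ∈ s, ‖ContinuousLinearMap.adjoint (htensL σ u) y‖ ^ 2 : ℝ) : ℂ) := by
  rw [frameOp, smul_apply, inner_smul_right, sum_apply, inner_sum]
  push_cast
  congr 1
  refine Finset.sum_congr rfl fun u _ => ?_
  change inner ℂ y (htensL σ u (ContinuousLinearMap.adjoint (htensL σ u) y)) = _
  rw [← ContinuousLinearMap.adjoint_inner_left, inner_self_eq_norm_sq_to_K]
  rfl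

lemma frameOp_nonneg (s : Finset (Fin k → E)) (n : ℕ) : 0 ≤ frameOp σ s n :=
  op_nonneg_iff.mpr fun y => by
    rw [inner_frameOp]
    exact Complex.zero_le_real.mpr (by positivity)

lemma frameOp_mono {s t : Finset (Fin k → E)} {n m : ℕ} (hst : s ⊆ t) (hnm : n ≤ m) :
    frameOp σ s n ≤ frameOp σ t m :=
  op_le_iff.mpr fun y => by
    rw [inner_frameOp, inner_frameOp]
    refine Complex.real_le_real.mpr ?_
    gcongr

/-- The resolvent `(1 + n ∑_{u ∈ s} L_u L_u^*)⁻¹`. -/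
def frameRes (s : Finset (Fin k → E)) (n : ℕ) : HTensor E σ k →L[ℂ] HTensor E σ k :=
  Ring.inverse (1 + frameOp σ s n)

lemma isStrictlyPositive_one_add_frameOp (s : Finset (Fin k → E)) (n : ℕ) :
    IsStrictlyPositive (1 + frameOp σ s n) :=
  isStrictlyPositive_one.add_nonneg (frameOp_nonneg σ s n)

lemma frameRes_mul (s : Finset (Fin k → E)) (n : ℕ) : frameRes σ s n * (1 + frameOp σ s n) = 1 :=
  Ring.inverse_mul_cancel _ (isStrictlyPositive_one_add_frameOp σ s n).isUnit

lemma mul_frameRes (s : Finset (Fin k → E)) (n : ℕ) : (1 + frameOp σ s n) * frameRes σ s n = 1 :=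
  Ring.mul_inverse_cancel _ (isStrictlyPositive_one_add_frameOp σ s n).isUnit

lemma frameRes_anti {s t : Finset (Fin k → E)} {n m : ℕ} (hst : s ⊆ t) (hnm : n ≤ m) :
    frameRes σ t m ≤ frameRes σ s n :=
  CStarAlgebra.ringInverse_le_ringInverse (by gcongr; exact frameOp_mono σ hst hnm)
    (isStrictlyPositive_one_add_frameOp σ s n)

lemma frameRes_nonneg (s : Finset (Fin k → E)) (n : ℕ) : 0 ≤ frameRes σ s n := by
  have h := isStrictlyPositive_one_add_frameOp σ s n
  have hs : star (frameRes σ s n) = frameRes σ s n := by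
    rw [frameRes, ← Ring.inverse_star, (IsSelfAdjoint.of_nonneg h.nonneg).star_eq]
  have h1 := star_left_conjugate_nonneg h.nonneg (frameRes σ s n)
  rwa [hs, frameRes_mul, one_mul] at h1

lemma frameRes_le_one (s : Finset (Fin k → E)) (n : ℕ) : frameRes σ s n ≤ 1 := by
  have := CStarAlgebra.ringInverse_le_ringInverse
    (le_add_of_nonneg_right (frameOp_nonneg σ s n) : 1 ≤ 1 + frameOp σ s n)
    isStrictlyPositive_one
  rwa [Ring.inverse_one] at this

/-- Pair (1 + F)Ny = y with Ny, where F is the frame operator and N its resolvent, and keep one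
summand of F. Taking adjoints, N shrinks the vectors u ⊗ h with u in s at the rate n^{-1/2}. -/
lemma norm_adjoint_htensL_frameRes_sq_le {s : Finset (Fin k → E)} (n : ℕ) {u : Fin k → E}
    (hu : u ∈ s) (y : HTensor E σ k) :
    n * ‖ContinuousLinearMap.adjoint (htensL σ u) (frameRes σ s n y)‖ ^ 2 ≤ ‖y‖ ^ 2 := by
  set N := frameRes σ s n
  have h1 : inner ℂ (N y) ((1 + frameOp σ s n) (N y)) = inner ℂ (N y) y := by
    rw [← mul_apply_eq_comp (1 + frameOp σ s n) N, mul_frameRes]; rfl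
  have hN : ‖N‖ ≤ 1 := (CStarAlgebra.norm_le_one_iff_of_nonneg _ (frameRes_nonneg σ s n)).mpr
    (frameRes_le_one σ s n)
  have h2 : ‖inner ℂ (N y) y‖ ≤ ‖y‖ ^ 2 := by
    refine (norm_inner_le_norm _ _).trans ?_
    rw [sq]
    gcongr
    exact (N.le_opNorm y).trans (mul_le_of_le_one_left (norm_nonneg _) hN)
  rw [add_apply, inner_add_right, inner_frameOp] at h1
  have h3 : ‖N y‖ ^ 2 + n * ∑ u ∈ s, ‖ContinuousLinearMap.adjoint (htensL σ u) (N y)‖ ^ 2 =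
      (inner ℂ (N y) y).re := by
    rw [← h1, Complex.add_re, Complex.ofReal_re]
    congr 1
    change _ = RCLike.re (inner ℂ (N y) (N y))
    exact (inner_self_eq_norm_sq _).symm
  have h4 : ‖ContinuousLinearMap.adjoint (htensL σ u) (N y)‖ ^ 2 ≤
      ∑ u ∈ s, ‖ContinuousLinearMap.adjoint (htensL σ u) (N y)‖ ^ 2 :=
    Finset.single_le_sum (f := fun u => ‖ContinuousLinearMap.adjoint (htensL σ u) (N y)‖ ^ 2)
      (fun _ _ => by positivity) hu
  have h5 := (Complex.re_le_norm _).trans h2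
  nlinarith [sq_nonneg ‖N y‖, mul_le_mul_of_nonneg_left h4 (Nat.cast_nonneg (α := ℝ) n)]

lemma norm_frameRes_htens_le {s : Finset (Fin k → E)} (n : ℕ) {u : Fin k → E}
    (hu : u ∈ s) (h : H) : ‖frameRes σ s (n + 1) (htens σ u h)‖ ≤ ‖h‖ / √(n + 1) := by
  set N := frameRes σ s (n + 1)
  have hs : ContinuousLinearMap.adjoint N = N := (IsSelfAdjoint.of_nonneg (frameRes_nonneg σ s _))
  have h0 : (0 : ℝ) < √(n + 1) := by positivity
  have h1 : ‖ContinuousLinearMap.adjoint (htensL σ u) ∘L N‖ ≤ (√(n + 1))⁻¹ := by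
    refine ContinuousLinearMap.opNorm_le_bound _ (by positivity) fun y => ?_
    have := norm_adjoint_htensL_frameRes_sq_le σ (n + 1) hu y
    rw [ContinuousLinearMap.comp_apply, inv_mul_eq_div, le_div_iff₀ h0,
      ← pow_le_pow_iff_left₀ (by positivity) (norm_nonneg _) two_ne_zero, mul_pow,
      Real.sq_sqrt (by positivity), mul_comm]
    exact_mod_cast this
  have h2 : N ∘L htensL σ u =
      ContinuousLinearMap.adjoint (ContinuousLinearMap.adjoint (htensL σ u) ∘L N) := by
    rw [ContinuousLinearMap.adjoint_comp, hs, ContinuousLinearMap.adjoint_adjoint]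
  calc ‖N (htens σ u h)‖ = ‖(N ∘L htensL σ u) h‖ := rfl
    _ ≤ ‖N ∘L htensL σ u‖ * ‖h‖ := ContinuousLinearMap.le_opNorm _ _
    _ ≤ (√(n + 1))⁻¹ * ‖h‖ := by
      rw [h2, LinearIsometryEquiv.norm_map]
      gcongr
    _ = _ := inv_mul_eq_div _ _

/-- The resolvents tend weakly to 0. Approximate y by an algebraic tensor x and let s contain the
tuples of x. For large n the resolvent is small on x, on y - x it is bounded by 1, and the
parallelogram law of its form combines the two. -/
lemma exists_inner_frameRes_le (y : HTensor E σ k) {ε : ℝ} (hε : 0 < ε) :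
    ∃ s n, (inner ℂ y (frameRes σ s n y)).re ≤ ε := by
  obtain ⟨c, hc⟩ := (denseRange_ofPre (E := E) (k := k) σ).exists_dist_lt y
    (Real.sqrt_pos.mpr (div_pos hε (show (0:ℝ) < 4 by norm_num)))
  set x : HTensor E σ k := ofPre σ c
  let s := c.support
  let S : ℝ := ∑ u ∈ s, ‖c u‖
  have hS : 0 ≤ S := Finset.sum_nonneg fun _ _ => norm_nonneg _
  obtain ⟨n, hn⟩ : ∃ n : ℕ, 2 * (‖x‖ * (S / √(n + 1))) ≤ ε / 2 := by
    have h1 : Tendsto (fun n : ℕ => 2 * (‖x‖ * (S / √(n + 1)))) atTop (𝓝 (2 * (‖x‖ * 0))) := by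
      refine ((Tendsto.const_div_atTop ?_ S).const_mul _).const_mul _
      exact Real.tendsto_sqrt_atTop.comp
        (tendsto_atTop_add_const_right _ _ tendsto_natCast_atTop_atTop)
    rw [mul_zero, mul_zero] at h1
    exact (h1.eventually (ge_mem_nhds (half_pos hε))).exists
  refine ⟨s, n + 1, ?_⟩
  set N := frameRes σ s (n + 1)
  have hN0 : 0 ≤ N := frameRes_nonneg σ s _
  have hx : ‖N x‖ ≤ S / √(n + 1) := by
    rw [show x = ∑ u ∈ s, htens σ u (c u) from ofPre_eq_sum σ c, map_sum, Finset.sum_div]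
    exact (norm_sum_le _ _).trans
      (Finset.sum_le_sum fun u hu => norm_frameRes_htens_le σ n hu (c u))
  have h1 : (inner ℂ x (N x)).re ≤ ‖x‖ * (S / √(n + 1)) :=
    (Complex.re_le_norm _).trans ((norm_inner_le_norm _ _).trans (by gcongr))
  have h2 : (inner ℂ (y - x) (N (y - x))).re ≤ ε / 4 := by
    have h3 := (Complex.le_def.mp (op_le_iff.mp (frameRes_le_one σ s (n + 1)) (y - x))).1
    refine h3.trans ?_
    change RCLike.re (inner ℂ (y - x) (y - x)) ≤ _
    rw [inner_self_eq_norm_sq, ← dist_eq_norm]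
    exact (Real.lt_sqrt dist_nonneg).mp hc |>.le
  have h3 : 0 ≤ (inner ℂ (y - x - x) (N (y - x - x))).re :=
    (Complex.nonneg_iff.mp (op_nonneg_iff.mp hN0 _)).1
  have h4 : (inner ℂ y (N y)).re + (inner ℂ (y - x - x) (N (y - x - x))).re =
      2 * (inner ℂ (y - x) (N (y - x))).re + 2 * (inner ℂ x (N x)).re := by
    have : ∀ a b : HTensor E σ k, inner ℂ (a + b) (N (a + b)) + inner ℂ (a - b) (N (a - b)) =
        2 * inner ℂ a (N a) + 2 * inner ℂ b (N b) := fun a b => by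
      simp only [map_add, map_sub, inner_add_left, inner_add_right, inner_sub_left,
        inner_sub_right]
      ring
    have := congrArg Complex.re (this (y - x) x)
    rw [sub_add_cancel] at this
    simpa using this
  linarith

variable {σ}

/-- With F the frame operator and K the right-hand side, the equation for B gives (1 + F)K = F, and
multiplying by the resolvent N gives K = NF = 1 - N. The coefficients of K lie in M and are the same
for all σ. -/
lemma one_sub_frameRes_eq {s : Finset (Fin k → E)} {n : ℕ} {B : s → s → M} [DecidableEq s]
    (hB : ∀ i j, B i j + (n : ℂ) • ∑ l : s, kernel k 1 i.1 l.1 * B l j = if i = j then 1 else 0) :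
    1 - frameRes σ s n = (n : ℂ) • ∑ i : s, ∑ j : s, htensL σ i.1 ∘L σ (B i j) ∘L
      ContinuousLinearMap.adjoint (htensL σ j.1) := by
  obtain ⟨K, hK⟩ : ∃ K, K = (n : ℂ) • ∑ i : s, ∑ j : s, htensL σ i.1 ∘L σ (B i j) ∘L
      ContinuousLinearMap.adjoint (htensL σ j.1) := ⟨_, rfl⟩
  rw [← hK]
  have h1 : (1 + frameOp σ s n) * K = frameOp σ s n := by
    have h2 : frameOp σ s n =
        (n : ℂ) • ∑ i : s, htensL σ i.1 ∘L ContinuousLinearMap.adjoint (htensL σ i.1) := by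
      rw [frameOp, ← Finset.sum_coe_sort s]
    ext y
    have h3 : ∀ i : s, ContinuousLinearMap.adjoint (htensL σ i.1) (K y) = (n : ℂ) • ∑ j : s,
        ∑ l : s, σ (kernel k 1 i.1 l.1 * B l j) (ContinuousLinearMap.adjoint (htensL σ j.1) y) := by
      intro i
      simp only [hK, smul_apply, sum_apply, map_smul, map_sum, ContinuousLinearMap.comp_apply,
        htensL_apply, adjoint_htensL_htens, map_mul, mul_apply_eq_comp]
      rw [Finset.sum_comm]
    have h4 : ∀ i : s, (∑ j : s, σ (B i j) (ContinuousLinearMap.adjoint (htensL σ j.1) y)) +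
        ContinuousLinearMap.adjoint (htensL σ i.1) (K y) =
        ContinuousLinearMap.adjoint (htensL σ i.1) y := by
      intro i
      rw [h3, Finset.smul_sum, ← Finset.sum_add_distrib]
      have : ∀ j : s, σ (B i j) (ContinuousLinearMap.adjoint (htensL σ j.1) y) +
          (n : ℂ) • ∑ l : s, σ (kernel k 1 i.1 l.1 * B l j)
            (ContinuousLinearMap.adjoint (htensL σ j.1) y) =
          if i = j then ContinuousLinearMap.adjoint (htensL σ j.1) y else 0 := fun j => by
        rw [← sum_apply, ← smul_apply, ← map_sum, ← map_smul, ← add_apply, ← map_add, hB]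
        split_ifs <;> simp
      rw [Finset.sum_congr rfl fun j _ => this j]
      simp
    rw [mul_apply_eq_comp, add_apply, h2]
    have h5 : K y = (n : ℂ) • ∑ i : s, htensL σ i.1 (∑ j : s, σ (B i j)
        (ContinuousLinearMap.adjoint (htensL σ j.1) y)) := by
      simp only [hK, smul_apply, sum_apply, map_sum, ContinuousLinearMap.comp_apply]
    change K y + _ = _
    rw [smul_apply, smul_apply, sum_apply, sum_apply]
    conv_lhs => rw [h5]
    rw [← smul_add, ← Finset.sum_add_distrib]
    congr 1
    refine Finset.sum_congr rfl fun i _ => ?_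
    rw [ContinuousLinearMap.comp_apply, ContinuousLinearMap.comp_apply, ← h5, ← map_add, h4]
  calc 1 - frameRes σ s n = frameRes σ s n * (1 + frameOp σ s n) - frameRes σ s n := by
        rw [frameRes_mul]
    _ = frameRes σ s n * frameOp σ s n := by rw [mul_add, mul_one, add_sub_cancel_left]
    _ = frameRes σ s n * ((1 + frameOp σ s n) * K) := by rw [h1]
    _ = K := by rw [← mul_assoc, frameRes_mul, one_mul]

lemma map_resolvent_eq (f : TensPow M E k) {s : Finset (Fin k → E)} {n : ℕ} {B : s → s → M}
    [DecidableEq s]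
    (hB : ∀ i j, B i j + (n : ℂ) • ∑ l : s, kernel k 1 i.1 l.1 * B l j = if i = j then 1 else 0) :
    σ ((n : ℂ) • ∑ i : s, ∑ j : s, star (f.val i.1) * B i j * f.val j.1) =
      ContinuousLinearMap.adjoint (rho σ f) ∘L (1 - frameRes σ s n) ∘L rho σ f := by
  rw [one_sub_frameRes_eq hB]
  ext h
  have h1 : ∀ (j : s), ContinuousLinearMap.adjoint (htensL σ j.1) (rho σ f h) = σ (f.val j.1) h :=
    fun j => by rw [← adjoint_htensL_rho]; rfl
  simp only [ContinuousLinearMap.comp_apply, smul_apply, sum_apply, map_smul, map_sum, h1,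
    htensL_apply, adjoint_rho_htens, map_mul, mul_apply_eq_comp]

end Frame

section Inner

variable {k : ℕ} [WStarAlgebra M]

/-- The operators ρ(f)^*(1 - N)ρ(f), N running over the resolvents, increase to ρ(f)^*ρ(f) and are
images of elements of M independent of π. These elements form a bounded increasing net in M, whose
supremum every normal representation preserves; so one m serves all π. -/
lemma exists_rho_adjoint_mul_self (f : TensPow M E k) :
    ∃ m : M, ∀ π : NormalRep M, π.σ m = ContinuousLinearMap.adjoint (rho π.σ f) ∘L rho π.σ f := by
  classical
  choose B hB using fun (s : Finset (Fin k → E)) (n : ℕ) =>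
    (isGram_kernel k (ι := s) _ (isGram_one (M := M)) fun i => i.1).exists_resolvent n
  let m : Finset (Fin k → E) × ℕ → M := fun p =>
    (p.2 : ℂ) • ∑ i : p.1, ∑ j : p.1, star (f.val i.1) * B p.1 p.2 i j * f.val j.1
  have hm : ∀ (π : NormalRep M) p (h : π.H), inner ℂ h (π.σ (m p) h) =
      inner ℂ (rho π.σ f h) (rho π.σ f h) -
        inner ℂ (rho π.σ f h) (frameRes π.σ p.1 p.2 (rho π.σ f h)) := fun π p h => by
    rw [map_resolvent_eq f (hB p.1 p.2), ContinuousLinearMap.comp_apply,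
      ContinuousLinearMap.adjoint_inner_right, ← inner_sub_right]
    rfl
  have hmono : Monotone m := fun p q hpq => le_of_normalRep fun π => op_le_iff.mpr fun h => by
    rw [hm, hm]
    exact sub_le_sub_left (op_le_iff.mp (frameRes_anti π.σ hpq.1 hpq.2) _) _
  have hdir : DirectedOn (· ≤ ·) (Set.range m) := by
    rintro _ ⟨p, rfl⟩ _ ⟨q, rfl⟩
    exact ⟨_, ⟨p ⊔ q, rfl⟩, hmono le_sup_left, hmono le_sup_right⟩
  have hle : ∀ (π : NormalRep M) p,
      π.σ (m p) ≤ ContinuousLinearMap.adjoint (rho π.σ f) ∘L rho π.σ f := fun π p =>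
    op_le_iff.mpr fun h => by
      rw [hm, ContinuousLinearMap.comp_apply, ContinuousLinearMap.adjoint_inner_right]
      exact sub_le_self _ (op_nonneg_iff.mp (frameRes_nonneg π.σ _ _) _)
  have hbdd : BddAbove (Set.range m) := by
    refine ⟨algebraMap ℝ M (‖f‖ ^ 2), ?_⟩
    rintro _ ⟨p, rfl⟩
    refine le_of_normalRep fun π => (hle π p).trans (op_le_iff.mpr fun h => ?_)
    rw [ContinuousLinearMap.comp_apply, ContinuousLinearMap.adjoint_inner_right,
      IsScalarTower.algebraMap_apply ℝ ℂ M, AlgHomClass.commutes, Algebra.algebraMap_eq_smul_one,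
      smul_apply, inner_smul_right, one_apply_eq_self, inner_self_eq_norm_sq_to_K,
      inner_self_eq_norm_sq_to_K]
    have h1 : ‖rho π.σ f h‖ ^ 2 ≤ ‖f‖ ^ 2 * ‖h‖ ^ 2 := by
      rw [← mul_pow]
      gcongr
      exact ((rho π.σ f).le_opNorm h).trans (by gcongr; exact norm_rho_le _ _)
    exact_mod_cast h1
  obtain ⟨a, ha⟩ := exists_isLUB (Set.range_nonempty m) hdir hbdd
  refine ⟨a, fun π => ?_⟩
  have hlub := π.normal (Set.range_nonempty m) hdir ha
  refine le_antisymm (hlub.2 ?_) (op_le_iff.mpr fun h => ?_)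
  · rintro _ ⟨_, ⟨p, rfl⟩, rfl⟩
    exact hle π p
  · have hsa : 0 ≤ π.σ a := by
      have h0 : π.σ (m (∅, 0)) ≤ π.σ a := hlub.1 ⟨_, ⟨_, rfl⟩, rfl⟩
      simpa [m] using h0
    rw [ContinuousLinearMap.comp_apply, ContinuousLinearMap.adjoint_inner_right]
    have h1 := Complex.nonneg_iff.mp (op_nonneg_iff.mp hsa h)
    rw [inner_self_eq_norm_sq_to_K, Complex.le_def]
    refine ⟨?_, ?_⟩
    · refine le_of_forall_pos_le_add fun ε hε => ?_
      obtain ⟨s, n, hsn⟩ := exists_inner_frameRes_le π.σ (rho π.σ f h) hε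
      have h2 : π.σ (m (s, n)) ≤ π.σ a := hlub.1 ⟨_, ⟨_, rfl⟩, rfl⟩
      have h3 := (Complex.le_def.mp (op_le_iff.mp h2 h)).1
      rw [hm, Complex.sub_re, inner_self_eq_norm_sq_to_K] at h3
      linarith
    · rw [← h1.2, ← inner_self_eq_norm_sq_to_K (𝕜 := ℂ)]
      exact inner_self_im (𝕜 := ℂ) (rho π.σ f h)

end Inner

end WStar

namespace WStar

open Filter Topology WStarCorrespondence TensPow

variable {M E : Type u} [CStarAlgebra M] [PartialOrder M] [StarOrderedRing M]
  [NormedAddCommGroup E] [NormedSpace ℂ E] [CompleteSpace E] [Module M E] [Module Mᵐᵒᵖ E]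
  [WStarCorrespondence M E]

/-! ### The M-valued inner product of E^{⊗k} -/

section Tip

variable {k : ℕ} [WStarAlgebra M]

lemma exists_rho_adjoint_mul (f g : TensPow M E k) :
    ∃ m : M, ∀ π : NormalRep M, π.σ m = ContinuousLinearMap.adjoint (rho π.σ f) ∘L rho π.σ g := by
  choose q hq using exists_rho_adjoint_mul_self (M := M) (E := E) (k := k)
  refine ⟨(1 / 4 : ℂ) • (q (f + g) - q (f - g) - Complex.I • q (f + Complex.I • g) +
    Complex.I • q (f - Complex.I • g)), fun π => ?_⟩
  simp only [map_smul, map_add, map_sub, hq, rho_add, rho_sub, rho_smul]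
  ext h
  refine ext_inner_left ℂ fun x => ?_
  simp only [ContinuousLinearMap.comp_apply, add_apply, sub_apply, smul_apply,
    map_smulₛₗ, inner_add_right, inner_sub_right, inner_smul_right,
    ContinuousLinearMap.adjoint_inner_right, Complex.conj_I]
  ring_nf
  simp only [Complex.I_sq]
  ring

/-- The `M`-valued inner product of `E^{⊗k}`. -/
def tip (f g : TensPow M E k) : M := (exists_rho_adjoint_mul f g).choose

lemma map_tip' (π : NormalRep M) (f g : TensPow M E k) :
    π.σ (tip f g) = ContinuousLinearMap.adjoint (rho π.σ f) ∘L rho π.σ g :=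
  (exists_rho_adjoint_mul f g).choose_spec π

lemma map_tip {H : Type u} [NormedAddCommGroup H] [InnerProductSpace ℂ H] [CompleteSpace H]
    {σ : M →⋆ₐ[ℂ] (H →L[ℂ] H)} (hσ : ScottContinuous σ) (f g : TensPow M E k) :
    σ (tip f g) = ContinuousLinearMap.adjoint (rho σ f) ∘L rho σ g :=
  map_tip' ⟨H, σ, hσ⟩ f g

lemma tip_add_right (f g g' : TensPow M E k) : tip f (g + g') = tip f g + tip f g' :=
  eq_of_normalRep fun π => by
    rw [map_add, map_tip', map_tip', map_tip', rho_add, ContinuousLinearMap.comp_add]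

lemma tip_smul_right (c : ℂ) (f g : TensPow M E k) : tip f (c • g) = c • tip f g :=
  eq_of_normalRep fun π => by
    rw [map_smul, map_tip', map_tip', rho_smul, ContinuousLinearMap.comp_smul]

lemma tip_rmul_right (f g : TensPow M E k) (a : M) : tip f (rmul g a) = tip f g * a :=
  eq_of_normalRep fun π => by
    rw [map_mul, map_tip', map_tip', rho_rmul]; rfl

lemma star_tip (f g : TensPow M E k) : star (tip f g) = tip g f :=
  eq_of_normalRep fun π => by
    rw [map_star, map_tip', map_tip', ContinuousLinearMap.star_eq_adjoint,
      ContinuousLinearMap.adjoint_comp, ContinuousLinearMap.adjoint_adjoint]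

lemma tip_add_left (f f' g : TensPow M E k) : tip (f + f') g = tip f g + tip f' g := by
  rw [← star_tip, tip_add_right, star_add, star_tip, star_tip]

lemma tip_rmul_left (f g : TensPow M E k) (a : M) : tip (rmul f a) g = star a * tip f g := by
  rw [← star_tip, tip_rmul_right, star_mul, star_tip]

lemma tip_self_nonneg (f : TensPow M E k) : 0 ≤ tip f f :=
  nonneg_of_normalRep fun π => by
    rw [map_tip']
    refine op_nonneg_iff.mpr fun h => ?_
    rw [ContinuousLinearMap.comp_apply, ContinuousLinearMap.adjoint_inner_right]
    rw [inner_self_eq_norm_sq_to_K]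
    exact pow_nonneg (RCLike.ofReal_nonneg.mpr (norm_nonneg _)) 2

lemma tip_tens_left (u : Fin k → E) (f : TensPow M E k) : tip (tens u) f = f.val u :=
  eq_of_normalRep fun π => by rw [map_tip', rho_tens, adjoint_htensL_rho]

/-- `tip f` as an additive map. -/
def tipRight (f : TensPow M E k) : TensPow M E k →+ M := AddMonoidHom.mk' (tip f) (tip_add_right f)

/-- `tip · g` as an additive map. -/
def tipLeft (g : TensPow M E k) : TensPow M E k →+ M :=
  AddMonoidHom.mk' (fun f => tip f g) (fun f f' => tip_add_left f f' g)

lemma tip_sum_right {ι : Type*} (s : Finset ι) (f : TensPow M E k) (g : ι → TensPow M E k) :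
    tip f (∑ i ∈ s, g i) = ∑ i ∈ s, tip f (g i) := map_sum (tipRight f) g s

lemma tip_sum_left {ι : Type*} (s : Finset ι) (f : ι → TensPow M E k) (g : TensPow M E k) :
    tip (∑ i ∈ s, f i) g = ∑ i ∈ s, tip (f i) g := map_sum (tipLeft g) f s

/-- The element of `E^{⊗k}` defined by an algebraic tensor. -/
def ofAlg (c : (Fin k → E) →₀ M) : TensPow M E k := c.sum fun u a => rmul (tens u) a

lemma tip_ofAlg_left (c : (Fin k → E) →₀ M) (f : TensPow M E k) :
    tip (ofAlg c) f = pairing c f.val := by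
  rw [ofAlg, Finsupp.sum, tip_sum_left, pairing, Finsupp.sum]
  simp_rw [tip_rmul_left, tip_tens_left]

lemma tip_ofAlg (c d : (Fin k → E) →₀ M) : tip (ofAlg c) (ofAlg d) = form 1 c d := by
  rw [ofAlg, Finsupp.sum, tip_sum_left, form, Finsupp.sum]
  refine Finset.sum_congr rfl fun u _ => ?_
  rw [ofAlg, Finsupp.sum, tip_sum_right, Finsupp.sum]
  refine Finset.sum_congr rfl fun v _ => ?_
  rw [tip_rmul_left, tip_rmul_right, tip_tens_left, mul_assoc]
  rfl

lemma norm_rho_le_sqrt_tip (π : NormalRep M) (f : TensPow M E k) :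
    ‖rho π.σ f‖ ≤ √‖tip f f‖ := by
  refine Real.le_sqrt_of_sq_le ?_
  rw [sq, ← ContinuousLinearMap.norm_adjoint_comp_self, ← map_tip']
  exact NonUnitalStarAlgHom.norm_apply_le π.σ _

lemma norm_tip_le_sqrt (f g : TensPow M E k) : ‖tip f g‖ ≤ √‖tip f f‖ * √‖tip g g‖ :=
  norm_le_of_normalRep (by positivity) fun π => by
    rw [map_tip']
    refine (ContinuousLinearMap.opNorm_comp_le _ _).trans ?_
    rw [LinearIsometryEquiv.norm_map]
    gcongr <;> exact norm_rho_le_sqrt_tip π _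

/-- An element of `E^{⊗k}` from compatible operators in all normal representations. -/
lemma exists_tensPow (F : (Fin k → E) → M) {C : ℝ} (hC : 0 ≤ C)
    (hF : ∀ π : NormalRep M, ∃ T : π.H →L[ℂ] HTensor E π.σ k, ‖T‖ ≤ C ∧
      ∀ u, ContinuousLinearMap.adjoint (htensL π.σ u) ∘L T = π.σ (F u)) :
    ∃ f : TensPow M E k, f.val = F ∧ ‖f‖ ≤ C := by
  have hb : BoundedBy F C := fun c => by
    refine norm_le_of_normalRep (by positivity) fun π => ?_
    obtain ⟨T, hTC, hT⟩ := hF π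
    have h1 : π.σ (pairing c F) = ContinuousLinearMap.adjoint (rho π.σ (ofAlg c)) ∘L T := by
      rw [pairing, Finsupp.sum, map_sum, ofAlg, Finsupp.sum, rho_sum, map_sum]
      ext h
      rw [ContinuousLinearMap.comp_apply, sum_apply, sum_apply]
      refine Finset.sum_congr rfl fun u _ => ?_
      rw [rho_rmul, rho_tens, ContinuousLinearMap.adjoint_comp, map_mul, ← hT, map_star]
      rfl
    rw [h1, ← tip_ofAlg, mul_comm]
    refine (ContinuousLinearMap.opNorm_comp_le _ _).trans ?_
    rw [LinearIsometryEquiv.norm_map]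
    gcongr
    exact norm_rho_le_sqrt_tip π _
  exact ⟨mk F ⟨C, hC, hb⟩, rfl, norm_le_of _ hC hb⟩

lemma rho_eq_of_adjoint_htensL {H : Type u} [NormedAddCommGroup H] [InnerProductSpace ℂ H]
    [CompleteSpace H] {σ : M →⋆ₐ[ℂ] (H →L[ℂ] H)} {f : TensPow M E k} {T : H →L[ℂ] HTensor E σ k}
    (h : ∀ u, ContinuousLinearMap.adjoint (htensL σ u) ∘L T = σ (f.val u)) : rho σ f = T :=
  HTensor.op_ext fun x u g => by
    rw [inner_htens_rho, ← h, ContinuousLinearMap.comp_apply,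
      ContinuousLinearMap.adjoint_inner_right]
    rfl

/-- One direction is the Cauchy–Schwarz inequality against algebraic tensors, where `tip` is the
pairing; the other is ‖ρ(f)‖ ≤ ‖f‖ in every normal representation. -/
lemma norm_sq_eq_tip (f : TensPow M E k) : ‖f‖ ^ 2 = ‖tip f f‖ := by
  refine le_antisymm ?_ ?_
  · refine Real.le_sqrt (norm_nonneg _) (norm_nonneg _) |>.mp ?_
    refine norm_le_of f (Real.sqrt_nonneg _) fun c => ?_
    rw [← tip_ofAlg_left, ← tip_ofAlg, mul_comm]
    exact norm_tip_le_sqrt _ _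
  · refine norm_le_of_normalRep (by positivity) fun π => ?_
    rw [map_tip', ContinuousLinearMap.norm_adjoint_comp_self, ← sq]
    gcongr
    exact norm_rho_le _ _

lemma norm_tip_le (f g : TensPow M E k) : ‖tip f g‖ ≤ ‖f‖ * ‖g‖ := by
  have := norm_tip_le_sqrt f g
  rwa [← norm_sq_eq_tip, ← norm_sq_eq_tip, Real.sqrt_sq (norm_nonneg _),
    Real.sqrt_sq (norm_nonneg _)] at this

end Tip

/-! ### Completeness of E^{⊗k} and of 𝓛(E^{⊗k}) -/

section Complete

variable {k : ℕ}

lemma norm_val_le (f : TensPow M E k) (u : Fin k → E) :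
    ‖f.val u‖ ≤ ‖f‖ * √‖(kernel k 1 u u : M)‖ := by
  have := boundedBy_norm f (Finsupp.single u 1)
  rw [pairing_single, star_one, one_mul] at this
  simpa [form] using this

lemma val_add (f g : TensPow M E k) (u : Fin k → E) : (f + g).val u = f.val u + g.val u := rfl

lemma val_smul (c : ℂ) (f : TensPow M E k) (u : Fin k → E) : (c • f).val u = c • f.val u := rfl

lemma val_sub (f g : TensPow M E k) (u : Fin k → E) : (f - g).val u = f.val u - g.val u := rfl

/-- Evaluation at an elementary tensor as a continuous linear map. -/
def valL (u : Fin k → E) : TensPow M E k →L[ℂ] M :=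
  LinearMap.mkContinuous
    { toFun := fun f => f.val u
      map_add' := fun _ _ => rfl
      map_smul' := fun _ _ => rfl } (√‖(kernel k 1 u u : M)‖) fun f => by
    rw [mul_comm]; exact norm_val_le f u

/-- The right action of `a` as a continuous linear map. -/
def rmulL (a : M) : TensPow M E k →L[ℂ] TensPow M E k :=
  LinearMap.mkContinuous
    { toFun := fun f => rmul f a
      map_add' := fun f g => TensPow.ext fun u => add_mul _ _ _
      map_smul' := fun c f => TensPow.ext fun u => smul_mul_assoc _ _ _ } ‖a‖ fun f => by
    rw [mul_comm]
    refine norm_le_of _ (by positivity) fun c => ?_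
    have : pairing c (rmul f a).val = pairing c f.val * a := by
      change pairing c (fun u => f.val u * a) = _
      simp only [pairing, Finsupp.sum, Finset.sum_mul, mul_assoc]
    change ‖pairing c (rmul f a).val‖ ≤ _
    rw [this, mul_right_comm]
    exact (norm_mul_le _ _).trans (mul_le_mul_of_nonneg_right (boundedBy_norm f c) (norm_nonneg _))

instance : CompleteSpace (TensPow M E k) := by
  refine Metric.complete_of_cauchySeq_tendsto fun f hf => ?_
  have h1 : ∀ u, ∃ y, Tendsto (fun n => (f n).val u) atTop (𝓝 y) := fun u =>
    cauchySeq_tendsto_of_complete (u := fun n => (f n).val u)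
      (hf.map (valL (M := M) (E := E) u).uniformContinuous)
  choose g hg using h1
  have hp : ∀ c, Tendsto (fun n => pairing c (f n).val) atTop (𝓝 (pairing c g)) := fun c => by
    simp only [pairing, Finsupp.sum]
    exact tendsto_finsetSum _ fun u _ => (hg u).const_mul _
  have hb : ∀ ε > 0, ∃ N, ∀ n ≥ N, BoundedBy (fun u => g u - (f n).val u) ε := fun ε hε => by
    obtain ⟨N, hN⟩ := Metric.cauchySeq_iff.mp hf ε hε
    refine ⟨N, fun n hn c => ?_⟩
    have h2 : Tendsto (fun m => pairing c (f m - f n).val) atTop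
        (𝓝 (pairing c fun u => g u - (f n).val u)) := by
      have h3 : ∀ a b : (Fin k → E) → M, pairing c (fun u => a u - b u) =
          pairing c a - pairing c b := fun a b => by
        simp only [pairing, Finsupp.sum, mul_sub, Finset.sum_sub_distrib]
      rw [h3]
      refine ((hp c).sub_const _).congr fun m => ?_
      rw [← h3]; rfl
    refine le_of_tendsto h2.norm ((eventually_ge_atTop N).mono fun m hm => ?_)
    refine (boundedBy_norm _ c).trans ?_
    gcongr
    rw [← dist_eq_norm]
    exact (hN m hm n hn).le
  obtain ⟨N, hN⟩ := hb 1 one_pos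
  have hN := hN N le_rfl
  -- Boundedness is known for the difference of the pointwise limit and `f N`; the limit is
  -- recovered as d + f N.
  let d : TensPow M E k := mk _ ⟨1, zero_le_one, hN⟩
  have hd : ∀ u, (d + f N).val u = g u := fun u => sub_add_cancel _ _
  refine ⟨d + f N, Metric.tendsto_atTop.mpr fun ε hε => ?_⟩
  obtain ⟨N', hN'⟩ := hb (ε / 2) (half_pos hε)
  refine ⟨N', fun n hn => ?_⟩
  rw [dist_comm, dist_eq_norm]
  refine (norm_le_of _ (half_pos hε).le ?_).trans_lt (half_lt_self hε)
  have : (d + f N - f n).val = fun u => g u - (f n).val u := by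
    ext u; rw [val_sub, hd]
  rw [this]
  exact hN' n hn

instance : CompleteSpace (Endo M E k) := by
  suffices h : IsClosed (Endo M E k : Set (TensPow M E k →L[ℂ] TensPow M E k)) from
    h.completeSpace_coe
  have : (Endo M E k : Set (TensPow M E k →L[ℂ] TensPow M E k)) =
      ⋂ f : TensPow M E k, ⋂ a : M, {A | A (rmulL a f) = rmulL a (A f)} := by
    ext A
    simp only [Set.mem_iInter]
    rfl
  rw [this]
  refine isClosed_iInter fun f => isClosed_iInter fun a => isClosed_eq ?_ ?_
  · exact (ContinuousLinearMap.apply ℂ (TensPow M E k) (rmulL a f)).continuous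
  · exact (rmulL a).continuous.comp (ContinuousLinearMap.apply ℂ (TensPow M E k) f).continuous

end Complete

end WStar

namespace WStar

open Filter Topology WStarCorrespondence TensPow

variable {M E : Type u} [CStarAlgebra M] [PartialOrder M] [StarOrderedRing M] [WStarAlgebra M]
  [NormedAddCommGroup E] [NormedSpace ℂ E] [CompleteSpace E] [Module M E] [Module Mᵐᵒᵖ E]
  [WStarCorrespondence M E] {k : ℕ}

/-! ### The operators A ⊗ 1 and the C*-algebra 𝓛(E^{⊗k}) -/

section Amp

lemma Endo.map_rmul (A : Endo M E k) (f : TensPow M E k) (a : M) :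
    A.1 (rmul f a) = rmul (A.1 f) a := A.2 f a

/-- The norm bound for A at all the elements f·b, b in M, is exactly the hypothesis of
`le_smul_of_norm_conj_le`, by right linearity of A. -/
lemma Endo.tip_self_le (A : Endo M E k) (f : TensPow M E k) :
    tip (A.1 f) (A.1 f) ≤ (‖A.1‖ ^ 2) • tip f f := by
  refine le_smul_of_norm_conj_le (tip_self_nonneg _) (tip_self_nonneg _) (by positivity) fun b => ?_
  rw [← tip_rmul_left, ← tip_rmul_right, ← tip_rmul_left, ← tip_rmul_right, ← Endo.map_rmul,
    ← norm_sq_eq_tip, ← norm_sq_eq_tip, ← mul_pow]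
  gcongr
  exact A.1.le_opNorm _

lemma Endo.isGram (A : Endo M E k) {ι : Type u} [Fintype ι] (f : ι → TensPow M E k) :
    IsGram fun i j => (‖A.1‖ ^ 2) • tip (f i) (f j) - tip (A.1 (f i)) (A.1 (f j)) := by
  refine IsGram.of_quadratic _ (fun i j => ?_) fun x => ?_
  · rw [star_sub, star_smul, star_tip, star_tip, star_trivial]
  · refine (sub_nonneg.mpr (Endo.tip_self_le A (∑ i, rmul (f i) (x i)))).trans_eq ?_
    rw [map_sum]
    simp_rw [Endo.map_rmul, tip_sum_left, tip_sum_right, Finset.smul_sum, ← Finset.sum_sub_distrib,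
      tip_rmul_left, tip_rmul_right]
    refine Finset.sum_congr rfl fun i _ => Finset.sum_congr rfl fun j _ => ?_
    rw [mul_sub, sub_mul, mul_smul_comm, smul_mul_assoc]
    simp only [mul_assoc]

variable {H : Type u} [NormedAddCommGroup H] [InnerProductSpace ℂ H] [CompleteSpace H]
  {σ : M →⋆ₐ[ℂ] (H →L[ℂ] H)}

lemma ofReal_norm_sum_rho_sq (hσ : ScottContinuous σ) {ι : Type u} [Fintype ι]
    (f : ι → TensPow M E k) (h : ι → H) : ((‖∑ i, rho σ (f i) (h i)‖ ^ 2 : ℝ) : ℂ) =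
      ∑ i, ∑ j, inner ℂ (h i) (σ (tip (f i) (f j)) (h j)) := by
  rw [ofReal_norm_sum_sq]
  refine Finset.sum_congr rfl fun i _ => Finset.sum_congr rfl fun j _ => ?_
  rw [map_tip hσ, ContinuousLinearMap.comp_apply, ContinuousLinearMap.adjoint_inner_right]

lemma norm_sum_rho_le (hσ : ScottContinuous σ) (A : Endo M E k) {ι : Type u} [Fintype ι]
    (f : ι → TensPow M E k) (h : ι → H) :
    ‖∑ i, rho σ (A.1 (f i)) (h i)‖ ≤ ‖A.1‖ * ‖∑ i, rho σ (f i) (h i)‖ := by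
  rw [← pow_le_pow_iff_left₀ (norm_nonneg _) (by positivity) two_ne_zero, mul_pow]
  have h1 := (Endo.isGram A f).inner_nonneg σ h
  have h2 : (0 : ℂ) ≤ ((‖A.1‖ ^ 2 * ‖∑ i, rho σ (f i) (h i)‖ ^ 2 -
      ‖∑ i, rho σ (A.1 (f i)) (h i)‖ ^ 2 : ℝ) : ℂ) := by
    rw [Complex.ofReal_sub, Complex.ofReal_mul, ofReal_norm_sum_rho_sq hσ,
      ofReal_norm_sum_rho_sq hσ]
    refine h1.trans_eq ?_
    simp_rw [Finset.mul_sum, ← Finset.sum_sub_distrib]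
    refine Finset.sum_congr rfl fun i _ => Finset.sum_congr rfl fun j _ => ?_
    rw [map_sub, ← Complex.coe_smul, map_smul, sub_apply, inner_sub_right, smul_apply,
      inner_smul_right]
  exact sub_nonneg.mp (Complex.zero_le_real.mp h2)

lemma exists_amp (hσ : ScottContinuous σ) (A : Endo M E k) :
    ∃ L : HTensor E σ k →L[ℂ] HTensor E σ k,
      (∀ u h, L (htens σ u h) = (rho σ (A.1 (tens u)) : H →ₗ[ℂ] HTensor E σ k) h) ∧
        ‖L‖ ≤ ‖A.1‖ := by
  refine exists_lift _ (norm_nonneg _) fun s h => ?_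
  have := norm_sum_rho_le hσ A (fun i : s => tens i.1) (fun i : s => h i.1)
  simp_rw [rho_tens_apply] at this
  rwa [Finset.sum_coe_sort s fun i => rho σ (A.1 (tens i)) (h i),
    Finset.sum_coe_sort s fun i => htens σ i (h i)] at this

/-- `A ⊗ 1` on `E^{⊗k} ⊗_σ H`. -/
def ampFun (hσ : ScottContinuous σ) (A : Endo M E k) : HTensor E σ k →L[ℂ] HTensor E σ k :=
  (exists_amp hσ A).choose

lemma ampFun_htens (hσ : ScottContinuous σ) (A : Endo M E k) (u : Fin k → E) (h : H) :
    ampFun hσ A (htens σ u h) = rho σ (A.1 (tens u)) h := (exists_amp hσ A).choose_spec.1 u h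

lemma norm_ampFun_le (hσ : ScottContinuous σ) (A : Endo M E k) : ‖ampFun hσ A‖ ≤ ‖A.1‖ :=
  (exists_amp hσ A).choose_spec.2

/-- The operator was built from elementary tensors, and these need not span a norm dense subspace of
E^{⊗k}. They do span one of E^{⊗k} ⊗_σ H, so f ⊗ h is approximated there. -/
lemma ampFun_rho (hσ : ScottContinuous σ) (A : Endo M E k) (f : TensPow M E k) (h : H) :
    ampFun hσ A (rho σ f h) = rho σ (A.1 f) h := by
  refine eq_of_forall_dist_le fun ε hε => ?_
  have hC : 0 < 2 * ‖A.1‖ + 1 := by positivity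
  obtain ⟨c, hc⟩ := (denseRange_ofPre (E := E) (k := k) σ).exists_dist_lt (rho σ f h)
    (div_pos hε hC)
  have h1 : ofPre σ c = ∑ i : c.support, rho σ (tens i.1) (c i) := by
    rw [ofPre_eq_sum, ← Finset.sum_coe_sort c.support]
    simp_rw [rho_tens_apply]
  have h2 : ampFun hσ A (ofPre σ c) = ∑ i : c.support, rho σ (A.1 (tens i.1)) (c i) := by
    rw [h1, map_sum]
    simp_rw [rho_tens_apply, ampFun_htens]
  have h3 : ‖rho σ (A.1 f) h - ampFun hσ A (ofPre σ c)‖ ≤ ‖A.1‖ * ‖rho σ f h - ofPre σ c‖ := by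
    -- Adjoining f to the tuples of c as one more index, and giving these the coefficients -c(u),
    -- bounds the image of f ⊗ h - c under A before it is known that `ampFun` computes it.
    have := norm_sum_rho_le hσ A (fun i : Option c.support => i.elim f fun u => tens u.1)
      (fun i => i.elim h fun u => - c u)
    simp only [Fintype.sum_option, Option.elim, map_neg, Finset.sum_neg_distrib] at this
    rwa [← sub_eq_add_neg, ← sub_eq_add_neg, ← h1, ← h2] at this
  have h4 : ‖ampFun hσ A (rho σ f h) - ampFun hσ A (ofPre σ c)‖ ≤
      ‖A.1‖ * ‖rho σ f h - ofPre σ c‖ := by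
    rw [← map_sub]
    exact ((ampFun hσ A).le_opNorm _).trans (by gcongr; exact norm_ampFun_le hσ A)
  rw [dist_eq_norm] at hc
  calc dist (ampFun hσ A (rho σ f h)) (rho σ (A.1 f) h)
      ≤ ‖ampFun hσ A (rho σ f h) - ampFun hσ A (ofPre σ c)‖ +
        ‖rho σ (A.1 f) h - ampFun hσ A (ofPre σ c)‖ := by
        rw [← dist_eq_norm, ← dist_eq_norm]; exact dist_triangle_right _ _ _
    _ ≤ (2 * ‖A.1‖ + 1) * ‖rho σ f h - ofPre σ c‖ := by
        nlinarith [norm_nonneg (rho σ f h - ofPre σ c)]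
    _ ≤ (2 * ‖A.1‖ + 1) * (ε / (2 * ‖A.1‖ + 1)) := by gcongr
    _ = ε := by field_simp

lemma inner_ampFun (hσ : ScottContinuous σ) (A : Endo M E k) (u v : Fin k → E) (h g : H) :
    inner ℂ (htens σ u h) (ampFun hσ A (htens σ v g)) = inner ℂ h (σ (coeff A u v) g) := by
  rw [ampFun_htens, inner_htens_rho]; rfl

lemma ampFun_comp_rho (hσ : ScottContinuous σ) (A : Endo M E k) (f : TensPow M E k) :
    ampFun hσ A ∘L rho σ f = rho σ (A.1 f) := ContinuousLinearMap.ext (ampFun_rho hσ A f)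

lemma Endo.eq_of_ampFun {A B : Endo M E k}
    (h : ∀ π : NormalRep M, ampFun π.normal A = ampFun π.normal B) : A = B :=
  Subtype.ext (ContinuousLinearMap.ext fun f => eq_of_rho fun π => by
    rw [← ampFun_comp_rho π.normal, h, ampFun_comp_rho])

lemma ampFun_eq_iff (hσ : ScottContinuous σ) {A : Endo M E k}
    {T : HTensor E σ k →L[ℂ] HTensor E σ k} : ampFun hσ A = T ↔ ∀ u v h g,
      inner ℂ (htens σ u h) (T (htens σ v g)) = inner ℂ h (σ (coeff A u v) g) := by
  refine ⟨fun h => h ▸ inner_ampFun hσ A, fun h => HTensor.clm_ext fun v g =>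
    HTensor.ext_inner fun u x => ?_⟩
  rw [h, inner_ampFun]

lemma Endo.eq_of_coeff {A B : Endo M E k} (h : ∀ u v, coeff A u v = coeff B u v) : A = B :=
  Endo.eq_of_ampFun fun π => (ampFun_eq_iff _).mpr fun u v x y => by
    rw [inner_ampFun, h]

/-- An operator in `𝓛(E^{⊗k})` with given coefficients. -/
lemma exists_endo (m : (Fin k → E) → (Fin k → E) → M) {C : ℝ} (hC : 0 ≤ C)
    (hm : ∀ π : NormalRep M, ∃ T : HTensor E π.σ k →L[ℂ] HTensor E π.σ k, ‖T‖ ≤ C ∧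
      ∀ u v h g, inner ℂ (htens π.σ u h) (T (htens π.σ v g)) = inner ℂ h (π.σ (m u v) g)) :
    ∃ A : Endo M E k, (∀ u v, coeff A u v = m u v) ∧ ‖A.1‖ ≤ C := by
  choose T hTC hT using hm
  have hT' : ∀ (π : NormalRep M) u v, ContinuousLinearMap.adjoint (htensL π.σ u) ∘L T π ∘L
      htensL π.σ v = π.σ (m u v) := fun π u v => by
    ext g
    refine ext_inner_left ℂ fun h => ?_
    rw [← hT, ContinuousLinearMap.comp_apply, ContinuousLinearMap.adjoint_inner_right]
    rfl
  have hL : ∀ (π : NormalRep M) (u : Fin k → E), ‖htensL π.σ u‖ ≤ √‖(kernel k 1 u u : M)‖ :=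
    fun π u => LinearMap.mkContinuous_norm_le _ (Real.sqrt_nonneg _) _
  have h1 : ∀ u, ∃ g : TensPow M E k, g.val = (fun v => star (m u v)) ∧
      ‖g‖ ≤ C * √‖(kernel k 1 u u : M)‖ := fun u => by
    refine exists_tensPow _ (by positivity) fun π =>
      ⟨ContinuousLinearMap.adjoint (T π) ∘L htensL π.σ u, ?_, fun v => ?_⟩
    · refine (ContinuousLinearMap.opNorm_comp_le _ _).trans ?_
      rw [LinearIsometryEquiv.norm_map]
      gcongr
      · exact hTC π
      · exact hL π u
    · rw [map_star, ← hT', ContinuousLinearMap.star_eq_adjoint, ContinuousLinearMap.adjoint_comp,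
        ContinuousLinearMap.adjoint_comp, ContinuousLinearMap.adjoint_adjoint]
      rfl
  choose g hg hgC using h1
  have hrg : ∀ (π : NormalRep M) u, rho π.σ (g u) =
      ContinuousLinearMap.adjoint (T π) ∘L htensL π.σ u := fun π u => by
    refine rho_eq_of_adjoint_htensL fun v => ?_
    rw [hg, map_star, ← hT', ContinuousLinearMap.star_eq_adjoint, ContinuousLinearMap.adjoint_comp,
      ContinuousLinearMap.adjoint_comp, ContinuousLinearMap.adjoint_adjoint]
    rfl
  have hval : ∀ (π : NormalRep M) f u, ContinuousLinearMap.adjoint (htensL π.σ u) ∘L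
      (T π ∘L rho π.σ f) = π.σ (tip (g u) f) := fun π f u => by
    rw [map_tip', hrg, ContinuousLinearMap.adjoint_comp, ContinuousLinearMap.adjoint_adjoint]
    rfl
  have h2 : ∀ f : TensPow M E k, ∃ f' : TensPow M E k, f'.val = (fun u => tip (g u) f) ∧
      ‖f'‖ ≤ C * ‖f‖ := fun f => by
    refine exists_tensPow _ (by positivity) fun π => ⟨T π ∘L rho π.σ f, ?_, hval π f⟩
    refine (ContinuousLinearMap.opNorm_comp_le _ _).trans ?_
    gcongr
    · exact hTC π
    · exact norm_rho_le _ _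
  choose A hA hAC using h2
  let A' : TensPow M E k →L[ℂ] TensPow M E k := LinearMap.mkContinuous
    { toFun := A
      map_add' := fun f f' => TensPow.ext fun u => by
        simp only [val_add, hA, tip_add_right]
      map_smul' := fun c f => TensPow.ext fun u => by
        simp only [val_smul, hA, tip_smul_right]; rfl } C hAC
  refine ⟨⟨A', fun f a => TensPow.ext fun u => ?_⟩, fun u v => ?_,
    LinearMap.mkContinuous_norm_le _ hC hAC⟩
  · change (A (rmul f a)).val u = (A f).val u * a
    simp only [hA, tip_rmul_right]
  · change (A (tens v)).val u = _
    rw [hA]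
    change tip (g u) (tens v) = _
    rw [← star_tip, tip_tens_left, hg, star_star]

lemma ampFun_add (hσ : ScottContinuous σ) (A B : Endo M E k) :
    ampFun hσ (A + B) = ampFun hσ A + ampFun hσ B :=
  (ampFun_eq_iff hσ).mpr fun u v h g => by
    rw [add_apply, inner_add_right, inner_ampFun, inner_ampFun, ← inner_add_right, ← add_apply,
      ← map_add]
    rfl

lemma ampFun_smul (hσ : ScottContinuous σ) (c : ℂ) (A : Endo M E k) :
    ampFun hσ (c • A) = c • ampFun hσ A :=
  (ampFun_eq_iff hσ).mpr fun u v h g => by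
    rw [smul_apply, inner_smul_right, inner_ampFun, ← inner_smul_right, ← smul_apply,
      ← map_smul]
    rfl

lemma ampFun_one (hσ : ScottContinuous σ) : ampFun hσ (1 : Endo M E k) = 1 :=
  (ampFun_eq_iff hσ).mpr fun u v h g => inner_htens σ u v h g

lemma ampFun_mul (hσ : ScottContinuous σ) (A B : Endo M E k) :
    ampFun hσ (A * B) = ampFun hσ A * ampFun hσ B :=
  (ampFun_eq_iff hσ).mpr fun u v h g => by
    rw [mul_apply_eq_comp, ampFun_htens hσ B, ampFun_rho, inner_htens_rho]
    rfl

/-- Adjointability is automatic here: the Hilbert space adjoints of A ⊗ 1 have coefficients coming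
from M, the same in all normal representations, so `exists_endo` realises them. -/
lemma exists_star (A : Endo M E k) : ∃ B : Endo M E k, (∀ u v, coeff B u v = star (coeff A v u)) ∧
    ‖B.1‖ ≤ ‖A.1‖ := by
  refine exists_endo _ (norm_nonneg _) fun π =>
    ⟨ContinuousLinearMap.adjoint (ampFun π.normal A), ?_, fun u v h g => ?_⟩
  · rw [LinearIsometryEquiv.norm_map]; exact norm_ampFun_le _ _
  · rw [ContinuousLinearMap.adjoint_inner_right, ← inner_conj_symm, inner_ampFun,
      inner_conj_symm, map_star, ContinuousLinearMap.star_eq_adjoint,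
      ContinuousLinearMap.adjoint_inner_right]

instance : Star (Endo M E k) := ⟨fun A => (exists_star A).choose⟩

lemma coeff_star (A : Endo M E k) (u v : Fin k → E) : coeff (star A) u v = star (coeff A v u) :=
  (exists_star A).choose_spec.1 u v

lemma ampFun_star (hσ : ScottContinuous σ) (A : Endo M E k) :
    ampFun hσ (star A) = star (ampFun hσ A) :=
  (ampFun_eq_iff hσ).mpr fun u v h g => by
    rw [ContinuousLinearMap.star_eq_adjoint, ContinuousLinearMap.adjoint_inner_right,
      ← inner_conj_symm, inner_ampFun, coeff_star, inner_conj_symm, map_star,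
      ContinuousLinearMap.star_eq_adjoint, ContinuousLinearMap.adjoint_inner_right]

lemma Endo.tip_apply (A : Endo M E k) (f g : TensPow M E k) :
    tip f (A.1 g) = tip ((star A).1 f) g :=
  eq_of_normalRep fun π => by
    rw [map_tip', map_tip', ← ampFun_comp_rho π.normal, ← ampFun_comp_rho π.normal, ampFun_star,
      ContinuousLinearMap.adjoint_comp, ContinuousLinearMap.star_eq_adjoint,
      ContinuousLinearMap.adjoint_adjoint]
    rfl

instance : StarRing (Endo M E k) where
  star_involutive A := Endo.eq_of_coeff fun u v => by rw [coeff_star, coeff_star, star_star]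
  star_mul A B := Endo.eq_of_ampFun fun π => by simp only [ampFun_star, ampFun_mul, star_mul]
  star_add A B := Endo.eq_of_ampFun fun π => by simp only [ampFun_star, ampFun_add, star_add]

instance : StarModule ℂ (Endo M E k) where
  star_smul c A := Endo.eq_of_ampFun fun π => by simp only [ampFun_star, ampFun_smul, star_smul]

instance : CStarRing (Endo M E k) where
  norm_mul_self_le A := by
    change ‖A.1‖ * ‖A.1‖ ≤ ‖(star A * A).1‖
    rw [← sq]
    refine (Real.le_sqrt (norm_nonneg _) (norm_nonneg _)).mp ?_
    refine ContinuousLinearMap.opNorm_le_bound _ (Real.sqrt_nonneg _) fun f => ?_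
    rw [← Real.sqrt_sq (norm_nonneg f), ← Real.sqrt_mul (norm_nonneg _)]
    refine Real.le_sqrt_of_sq_le ?_
    rw [norm_sq_eq_tip, Endo.tip_apply, ← star_tip, norm_star]
    refine (norm_tip_le _ _).trans ?_
    rw [mul_comm, sq, ← mul_assoc]
    gcongr
    exact (star A * A).1.le_opNorm f

instance : CStarAlgebra (Endo M E k) where

instance : PartialOrder (Endo M E k) := CStarAlgebra.spectralOrder _

instance : StarOrderedRing (Endo M E k) := CStarAlgebra.spectralOrderedRing _

end Amp

end WStar

namespace WStar

open Filter Topology WStarCorrespondence TensPow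

variable {M E : Type u} [CStarAlgebra M] [PartialOrder M] [StarOrderedRing M] [WStarAlgebra M]
  [NormedAddCommGroup E] [NormedSpace ℂ E] [CompleteSpace E] [Module M E] [Module Mᵐᵒᵖ E]
  [WStarCorrespondence M E] {k : ℕ}

section Amp

variable {H : Type u} [NormedAddCommGroup H] [InnerProductSpace ℂ H] [CompleteSpace H]
  {σ : M →⋆ₐ[ℂ] (H →L[ℂ] H)}

/-- The representation `A ↦ A ⊗ 1` of `𝓛(E^{⊗k})` on `E^{⊗k} ⊗_σ H`. -/
def amp (hσ : ScottContinuous σ) (k : ℕ) : Endo M E k →⋆ₐ[ℂ] (HTensor E σ k →L[ℂ] HTensor E σ k) where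
  toFun := ampFun hσ
  map_one' := ampFun_one hσ
  map_mul' := ampFun_mul hσ
  map_zero' := by simpa using ampFun_smul hσ 0 (0 : Endo M E k)
  map_add' := ampFun_add hσ
  commutes' c := by
    rw [Algebra.algebraMap_eq_smul_one, Algebra.algebraMap_eq_smul_one]
    exact (ampFun_smul hσ c 1).trans (by rw [ampFun_one])
  map_star' := ampFun_star hσ

lemma amp_htens (hσ : ScottContinuous σ) (A : Endo M E k) (u : Fin k → E) (h : H) :
    amp hσ k A (htens σ u h) = rho σ (A.1 (tens u)) h := ampFun_htens hσ A u h

lemma inner_amp (hσ : ScottContinuous σ) (A : Endo M E k) (u v : Fin k → E) (h g : H) :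
    inner ℂ (htens σ u h) (amp hσ k A (htens σ v g)) = inner ℂ h (σ (coeff A u v) g) :=
  inner_ampFun hσ A u v h g

lemma amp_comp_rho (hσ : ScottContinuous σ) (A : Endo M E k) (f : TensPow M E k) :
    amp hσ k A ∘L rho σ f = rho σ (A.1 f) := ampFun_comp_rho hσ A f

lemma amp_eq_iff (hσ : ScottContinuous σ) {A : Endo M E k}
    {T : HTensor E σ k →L[ℂ] HTensor E σ k} : amp hσ k A = T ↔ ∀ u v h g,
      inner ℂ (htens σ u h) (T (htens σ v g)) = inner ℂ h (σ (coeff A u v) g) :=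
  ampFun_eq_iff hσ

lemma Endo.eq_of_amp {A B : Endo M E k}
    (h : ∀ π : NormalRep M, amp π.normal k A = amp π.normal k B) : A = B := Endo.eq_of_ampFun h

lemma amp_mul (hσ : ScottContinuous σ) (A B : Endo M E k) :
    amp hσ k (A * B) = amp hσ k A * amp hσ k B := map_mul (amp hσ k) A B

lemma amp_add (hσ : ScottContinuous σ) (A B : Endo M E k) :
    amp hσ k (A + B) = amp hσ k A + amp hσ k B := map_add (amp hσ k) A B

lemma amp_star (hσ : ScottContinuous σ) (A : Endo M E k) :
    amp hσ k (star A) = star (amp hσ k A) := map_star (amp hσ k) A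

lemma amp_zero (hσ : ScottContinuous σ) : amp hσ k (0 : Endo M E k) = 0 := map_zero (amp hσ k)

lemma amp_one (hσ : ScottContinuous σ) : amp hσ k (1 : Endo M E k) = 1 := map_one (amp hσ k)

lemma amp_neg (hσ : ScottContinuous σ) (A : Endo M E k) : amp hσ k (-A) = -amp hσ k A :=
  eq_neg_of_add_eq_zero_left (by rw [← amp_add, neg_add_cancel, amp_zero])

lemma norm_amp_le (hσ : ScottContinuous σ) (A : Endo M E k) : ‖amp hσ k A‖ ≤ ‖A‖ :=
  norm_ampFun_le hσ A

/-- For the negative part N = S*S of A one has NAN = -(SN)*(SN). In every representation this is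
both positive and negative, so SN = 0 and A has no negative part. -/
lemma Endo.nonneg_of_amp {A : Endo M E k} (h : ∀ π : NormalRep M, 0 ≤ amp π.normal k A) :
    0 ≤ A := by
  have hA : IsSelfAdjoint A := Endo.eq_of_amp fun π => by
    rw [amp_star]
    exact (IsSelfAdjoint.of_nonneg (h π)).star_eq
  obtain ⟨N, S, hN, -, hNA, hR⟩ := exists_negPart_factor A hA
  have hSN : S * N = 0 := by
    refine Endo.eq_of_amp fun π => ?_
    have h1 : 0 ≤ star (amp π.normal k N) * amp π.normal k A * amp π.normal k N :=
      star_left_conjugate_nonneg (h π) (amp π.normal k N)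
    have h3 : star (amp π.normal k N) * amp π.normal k A * amp π.normal k N =
        - (star (amp π.normal k (S * N)) * amp π.normal k (S * N)) := by
      rw [← amp_star, ← amp_mul, ← amp_mul, hN, hNA, amp_neg, amp_mul, amp_star]
    rw [h3] at h1
    have h2 : star (amp π.normal k (S * N)) * amp π.normal k (S * N) = 0 :=
      le_antisymm (neg_nonneg.mp h1) (star_mul_self_nonneg _)
    have h4 : amp π.normal k (S * N) = 0 :=
      (CStarRing.star_mul_self_eq_zero_iff (amp π.normal k (S * N))).mp h2
    rw [h4, amp_zero]
  obtain ⟨R, hR⟩ := hR hSN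
  rw [hR]
  exact star_mul_self_nonneg R

end Amp

/-! ### Positivity tested on algebraic tensors is positivity in the C*-algebra -/

section Pos

lemma isPos_sum_eq (A : Endo M E k) (c : (Fin k → E) →₀ M) :
    (c.sum fun u a => c.sum fun v b => star a * coeff A u v * b) =
      tip (ofAlg c) (A.1 (ofAlg c)) := by
  rw [tip_ofAlg_left, pairing]
  refine Finsupp.sum_congr fun u _ => ?_
  rw [← tip_tens_left, ofAlg, Finsupp.sum, Finsupp.sum, map_sum, tip_sum_right, Finset.mul_sum]
  refine Finset.sum_congr rfl fun v _ => ?_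
  rw [Endo.map_rmul, tip_rmul_right, tip_tens_left, mul_assoc]
  rfl

lemma ofAlg_sum {ι : Type*} (s : Finset ι) (u : ι → Fin k → E) (x : ι → M) :
    ofAlg (∑ i ∈ s, Finsupp.single (u i) (x i)) = ∑ i ∈ s, rmul (tens (u i)) (x i) := by
  classical
  rw [ofAlg, ← Finsupp.sum_finsetSum_index]
  · refine Finset.sum_congr rfl fun i _ => ?_
    rw [Finsupp.sum_single_index]
    exact TensPow.ext fun v => mul_zero _
  · exact fun v => TensPow.ext fun v => mul_zero _
  · exact fun v a b => TensPow.ext fun v => mul_add _ _ _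

/-- Testing on algebraic tensors makes the coefficient matrices Gram, hence makes the form of A ⊗ 1
nonnegative on a dense subspace of each Hilbert space E^{⊗k} ⊗_σ H. Then `Endo.nonneg_of_amp`
applies. -/
lemma isPos_iff (A : Endo M E k) : IsPos A ↔ 0 ≤ A := by
  constructor
  · intro hA
    have hB : ∀ c, 0 ≤ tip (ofAlg c) (A.1 (ofAlg c)) := fun c => by
      rw [← isPos_sum_eq]; exact hA c
    -- Polarisation: the values at u·a + v·b with (a, b) = (1,0), (0,1), (1,1), (1,i) are
    -- self-adjoint, which makes the coefficients Hermitian.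
    have hsa : ∀ u v, star (coeff A u v) = coeff A v u := fun u v => by
      have h1 : ∀ a b : M, 0 ≤ star a * coeff A u u * a + star a * coeff A u v * b +
          (star b * coeff A v u * a + star b * coeff A v v * b) := fun a b => by
        have := hB (∑ i, Finsupp.single (![u, v] i) (![a, b] i))
        rw [ofAlg_sum] at this
        simp only [Fin.sum_univ_two, Matrix.cons_val_zero, Matrix.cons_val_one, map_add,
          Endo.map_rmul, tip_add_left, tip_add_right, tip_rmul_left, tip_rmul_right,
          tip_tens_left] at this
        refine this.trans_eq ?_
        simp only [coeff, mul_assoc, add_mul]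
        abel
      have huu := (IsSelfAdjoint.of_nonneg (h1 1 0)).star_eq
      have hvv := (IsSelfAdjoint.of_nonneg (h1 0 1)).star_eq
      have h2 := (IsSelfAdjoint.of_nonneg (h1 1 1)).star_eq
      have h3 := (IsSelfAdjoint.of_nonneg (h1 1 (Complex.I • 1))).star_eq
      simp only [star_zero, star_one, star_add, star_smul, mul_zero, zero_mul, mul_one, one_mul,
        add_zero, zero_add, Complex.star_def, Complex.conj_I, mul_smul_comm, smul_mul_assoc,
        neg_smul, smul_neg, neg_mul, star_neg, neg_neg, smul_smul, Complex.I_mul_I, one_smul]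
        at huu hvv h2 h3
      rw [huu, hvv] at h2 h3
      have h4 : Complex.I • ((coeff A v u - star (coeff A u v)) +
          (star (coeff A v u) - coeff A u v)) = 0 := by
        rw [← sub_eq_zero] at h3
        rw [← h3]
        module
      have h5 := (smul_eq_zero.mp h4).resolve_left Complex.I_ne_zero
      have h6 : (2 : ℂ) • (star (coeff A u v) - coeff A v u) = 0 := by
        rw [← sub_eq_zero] at h2
        rw [← sub_zero (0 : M)]
        nth_rewrite 1 [← h2]
        rw [← h5]
        module
      exact sub_eq_zero.mp ((smul_eq_zero.mp h6).resolve_left two_ne_zero)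
    refine Endo.nonneg_of_amp fun π => op_nonneg_iff.mpr fun y => ?_
    have hcl : IsClosed {y : HTensor E π.σ k | 0 ≤ inner ℂ y (amp π.normal k A y)} :=
      isClosed_le continuous_const (by fun_prop)
    refine hcl.closure_subset_iff.mpr ?_ ((denseRange_ofPre (E := E) (k := k) π.σ) y)
    rintro _ ⟨c, rfl⟩
    have hG : IsGram fun i j : c.support => coeff A i.1 j.1 := by
      refine IsGram.of_quadratic _ (fun i j => hsa _ _) fun x => ?_
      have := hB (∑ i, Finsupp.single i.1 (x i))
      rw [ofAlg_sum, map_sum, tip_sum_left] at this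
      refine this.trans_eq (Finset.sum_congr rfl fun i _ => ?_)
      rw [tip_sum_right]
      refine Finset.sum_congr rfl fun j _ => ?_
      rw [Endo.map_rmul, tip_rmul_left, tip_rmul_right, tip_tens_left, mul_assoc]
      rfl
    have := hG.inner_nonneg π.σ fun i => c i
    simp_rw [← inner_amp π.normal, ← inner_sum, ← map_sum, ← sum_inner] at this
    rw [Finset.sum_coe_sort c.support fun i => htens π.σ i (c i)] at this
    rwa [Set.mem_ofPred_eq, ofPre_eq_sum]
  · intro hA c
    obtain ⟨S, rfl⟩ := CStarAlgebra.nonneg_iff_eq_star_mul_self.mp hA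
    rw [isPos_sum_eq]
    have : tip (ofAlg c) ((star S * S).1 (ofAlg c)) = tip (S.1 (ofAlg c)) (S.1 (ofAlg c)) := by
      have := Endo.tip_apply (star S) (ofAlg c) (S.1 (ofAlg c))
      rwa [star_star] at this
    rw [this]
    exact tip_self_nonneg _

end Pos

end WStar

namespace WStar

open Filter Topology WStarCorrespondence TensPow

variable {M E : Type u} [CStarAlgebra M] [PartialOrder M] [StarOrderedRing M] [WStarAlgebra M]
  [NormedAddCommGroup E] [NormedSpace ℂ E] [CompleteSpace E] [Module M E] [Module Mᵐᵒᵖ E]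
  [WStarCorrespondence M E]

/-! ### The left action and the induced representations of M -/

section LeftAction

variable {k : ℕ}

lemma norm_lmul_le (a : M) (f : TensPow M E k) : ‖lmul a f‖ ≤ ‖a‖ * ‖f‖ := by
  rw [mul_comm]
  exact norm_le_of _ (by positivity)
    (boundedBy_lmulFun k a f.val (norm_nonneg f) (boundedBy_norm f))

lemma lmul_add (a : M) (f g : TensPow M E k) : lmul a (f + g) = lmul a f + lmul a g := by
  ext u
  cases k with
  | zero => exact mul_add a (f.val u) (g.val u)
  | succ k => rfl

lemma lmul_smul (a : M) (c : ℂ) (f : TensPow M E k) : lmul a (c • f) = c • lmul a f := by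
  ext u
  cases k with
  | zero => exact mul_smul_comm c a (f.val u)
  | succ k => rfl

lemma lmul_rmul (a b : M) (f : TensPow M E k) : lmul a (rmul f b) = rmul (lmul a f) b := by
  ext u
  cases k with
  | zero => exact (mul_assoc a (f.val u) b).symm
  | succ k => rfl

lemma lmul_mul (a b : M) (f : TensPow M E k) : lmul (a * b) f = lmul a (lmul b f) := by
  ext u
  cases k with
  | zero => exact mul_assoc a b (f.val u)
  | succ k =>
    change f.val (Fin.cons (star (a * b) • u 0) (Fin.tail u)) =
      f.val (Fin.cons (star b • (Fin.cons (star a • u 0) (Fin.tail u) : Fin (k + 1) → E) 0)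
        (Fin.tail (Fin.cons (star a • u 0) (Fin.tail u) : Fin (k + 1) → E)))
    rw [Fin.cons_zero, Fin.tail_cons, star_mul, mul_smul]

lemma val_lmul_tens (a : M) (u v : Fin k → E) : (lmul a (tens v)).val u = kernel k a u v := by
  cases k with
  | zero => exact mul_one a
  | succ k =>
    change kernel k (ip (star a • u 0) ((1 : M) • v 0)) (Fin.tail u) (Fin.tail v) = _
    rw [ip_left_smul, star_star, one_smul]
    rfl

lemma lmul_tens_succ (a : M) (ξ : E) (u : Fin k → E) :
    lmul a (tens (Fin.cons ξ u : Fin (k + 1) → E)) =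
      (tens (Fin.cons (a • ξ) u : Fin (k + 1) → E) : TensPow M E (k + 1)) := by
  ext v
  rw [val_lmul_tens]
  change kernel k (ip (v 0) (a • ξ)) (Fin.tail v) u =
    kernel k (ip (v 0) ((1 : M) • a • ξ)) (Fin.tail v) u
  rw [one_smul]

variable (E) in
/-- The left action `φₖ(a)` as an element of `𝓛(E^{⊗k})`. -/
def lmulE (k : ℕ) (a : M) : Endo M E k :=
  ⟨LinearMap.mkContinuous
    { toFun := lmul a
      map_add' := lmul_add a
      map_smul' := lmul_smul a } ‖a‖ (norm_lmul_le a), fun f b => lmul_rmul a b f⟩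

lemma lmulE_apply (a : M) (f : TensPow M E k) : (lmulE E k a).1 f = lmul a f := rfl

lemma coeff_lmulE (a : M) (u v : Fin k → E) : coeff (lmulE E k a) u v = kernel k a u v :=
  val_lmul_tens a u v

lemma mem_relCommutant_iff {A : Endo M E k} :
    A ∈ relCommutant M E k ↔ ∀ a, A * lmulE E k a = lmulE E k a * A := by
  refine forall_congr' fun a => ⟨fun h => Subtype.ext (ContinuousLinearMap.ext h), fun h f => ?_⟩
  exact congrArg (fun B : Endo M E k => B.1 f) h

variable (E) in
/-- The left action as a star homomorphism. -/
def lmulHom (k : ℕ) : M →⋆ₐ[ℂ] Endo M E k where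
  toFun := lmulE E k
  map_one' := Endo.eq_of_coeff fun u v => coeff_lmulE 1 u v
  map_mul' a b := Subtype.ext (ContinuousLinearMap.ext (lmul_mul a b))
  map_zero' := Endo.eq_of_coeff fun u v => (coeff_lmulE 0 u v).trans (map_zero (kernelHom k u v))
  map_add' a b := Endo.eq_of_coeff fun u v => by
    rw [coeff_lmulE, kernel_add, ← coeff_lmulE, ← coeff_lmulE]; rfl
  commutes' c := Endo.eq_of_coeff fun u v => by
    rw [coeff_lmulE, Algebra.algebraMap_eq_smul_one, kernel_smul]; rfl
  map_star' a := Endo.eq_of_coeff fun u v => by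
    rw [coeff_lmulE, coeff_star, coeff_lmulE, star_kernel]

variable {H : Type u} [NormedAddCommGroup H] [InnerProductSpace ℂ H] [CompleteSpace H]
  {σ : M →⋆ₐ[ℂ] (H →L[ℂ] H)}

/-- The representation `a ↦ φₖ(a) ⊗ 1` of `M` on `E^{⊗k} ⊗_σ H`. -/
def ind (E : Type u) [NormedAddCommGroup E] [NormedSpace ℂ E] [CompleteSpace E] [Module M E]
    [Module Mᵐᵒᵖ E] [WStarCorrespondence M E] (hσ : ScottContinuous σ) (k : ℕ) :
    M →⋆ₐ[ℂ] (HTensor E σ k →L[ℂ] HTensor E σ k) :=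
  (amp hσ k).comp (lmulHom E k)

lemma ind_apply (hσ : ScottContinuous σ) (a : M) : ind E hσ k a = amp hσ k (lmulE E k a) := rfl

lemma inner_ind (hσ : ScottContinuous σ) (a : M) (u v : Fin k → E) (h g : H) :
    inner ℂ (htens σ u h) (ind E hσ k a (htens σ v g)) = inner ℂ h (σ (kernel k a u v) g) := by
  rw [ind_apply, inner_amp, coeff_lmulE]

lemma ind_comp_rho (hσ : ScottContinuous σ) (a : M) (f : TensPow M E k) :
    ind E hσ k a ∘L rho σ f = rho σ (lmul a f) := amp_comp_rho hσ _ f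

lemma ind_htens_cons (hσ : ScottContinuous σ) (a : M) (ξ : E) (u : Fin k → E) (h : H) :
    ind E hσ (k + 1) a (htens σ (Fin.cons ξ u : Fin (k + 1) → E) h) =
      htens σ (Fin.cons (a • ξ) u : Fin (k + 1) → E) h := by
  rw [ind_apply, amp_htens, lmulE_apply, lmul_tens_succ, rho_tens_apply]

lemma ind_htens_zero (hσ : ScottContinuous σ) (a : M) (u : Fin 0 → E) (h : H) :
    ind E hσ 0 a (htens σ u h) = htens σ u (σ a h) :=
  HTensor.ext_inner fun v g => by
    rw [inner_ind, inner_htens]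
    simp [kernel]

lemma eq_of_ip {ξ η : E} (h : ∀ ζ, (ip ζ ξ : M) = ip ζ η) : ξ = η := by
  have h1 : (ip (ξ - η) (ξ - η) : M) = 0 :=
    (map_sub (ipRight M (ξ - η)) ξ η).trans (sub_eq_zero.mpr (h _))
  have h2 := norm_sq_eq (M := M) (ξ - η)
  rw [h1, norm_zero, sq_eq_zero_iff, norm_eq_zero] at h2
  exact sub_eq_zero.mp h2

/-- Adjointability of the left action forces its complex linearity in ξ, as the inner product
separates points. -/
lemma smul_smul_comm_left (c : ℂ) (a : M) (ξ : E) : a • c • ξ = c • a • ξ :=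
  eq_of_ip (M := M) fun ζ => by
    have h : ∀ η : E, (ip ζ (a • η) : M) = ip (star a • ζ) η := fun η => by
      rw [ip_left_smul, star_star]
    rw [h, ip_smul_right, ip_smul_right, h]

/-- Induction on k: the kernel peels off the maps a ↦ ⟨u, a·v⟩ one at a time. On the diagonal these
are normal by assumption on E, and polarisation handles u ≠ v. -/
lemma isNormalFun_kernel (k : ℕ) {ψ : M → ℂ} (hψ : IsNormalFun ψ)
    (hadd : ∀ a b, ψ (a + b) = ψ a + ψ b) (hsmul : ∀ (c : ℂ) a, ψ (c • a) = c * ψ a)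
    (u v : Fin k → E) : IsNormalFun fun a => ψ (kernel k a u v) := by
  induction k generalizing ψ with
  | zero => exact hψ
  | succ k ih =>
    have h1 : IsNormalFun fun a => ψ (kernel k a (Fin.tail u) (Fin.tail v)) :=
      ih hψ hadd hsmul (Fin.tail u) (Fin.tail v)
    set χ : M → ℂ := fun a => ψ (kernel k a (Fin.tail u) (Fin.tail v))
    have hχadd : ∀ a b, χ (a + b) = χ a + χ b := fun a b => by simp only [χ, kernel_add, hadd]
    have hχsmul : ∀ (c : ℂ) a, χ (c • a) = c * χ a := fun c a => by
      simp only [χ, kernel_smul, hsmul]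
    have h2 : ∀ ξ : E, IsNormalFun fun a : M => χ (ip ξ (a • ξ)) := fun ξ =>
      IsNormalFun.comp h1 (normal_left ξ)
    have hsm : ∀ (c : ℂ) (a : M) (ξ : E), a • c • ξ = c • a • ξ := smul_smul_comm_left
    have ipl : ∀ (c : ℂ) (ξ η : E), (ip (c • ξ) η : M) = (starRingEnd ℂ) c • ip ξ η := fun c ξ η => by
      rw [← star_ip, ip_smul_right, star_smul, star_ip]; rfl
    have h3 : ∀ a : M, χ (ip (u 0) (a • v 0)) =
        (1 / 4) * χ (ip (u 0 + v 0) (a • (u 0 + v 0))) +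
        (-1 / 4) * χ (ip (u 0 + (-1 : ℂ) • v 0) (a • (u 0 + (-1 : ℂ) • v 0))) +
        (-Complex.I / 4) * χ (ip (u 0 + Complex.I • v 0) (a • (u 0 + Complex.I • v 0))) +
        (Complex.I / 4) * χ (ip (u 0 + (-Complex.I) • v 0) (a • (u 0 + (-Complex.I) • v 0))) := by
      intro a
      simp only [smul_add, ip_add_right, ip_add_left, hχadd, hsm, ip_smul_right, ipl, hχsmul,
        map_neg, map_one, Complex.conj_I]
      ring_nf
      simp only [Complex.I_sq]
      ring
    change IsNormalFun fun a => χ (ip (u 0) (a • v 0))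
    simp_rw [h3]
    exact ((((h2 _).const_mul _).add ((h2 _).const_mul _)).add ((h2 _).const_mul _)).add
      ((h2 _).const_mul _)

/-- Normality allows E^{⊗k} ⊗_σ H with its left action to take the place of H in all the preceding
constructions; the splittings of tensor powers rest on this. -/
lemma ind_normal (hσ : ScottContinuous σ) (k : ℕ) : ScottContinuous (ind E hσ k) := by
  refine scottContinuous_of_isNormalFun fun h => isNormalFun_inner_of_total
    (dense_span_htens (E := E) (k := k) σ) ?_ h h
  rintro _ ⟨u, h, rfl⟩ _ ⟨v, g, rfl⟩
  simp_rw [inner_ind]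
  refine isNormalFun_kernel k (ψ := fun a => inner ℂ h (σ a g)) (isNormalFun_inner hσ h g)
    (fun a b => ?_) (fun c a => ?_) u v
  · rw [map_add, add_apply, inner_add_right]
  · rw [map_smul, smul_apply, inner_smul_right]

end LeftAction

/-! ### The operators 1 ⊗ T for intertwiners T -/

section MapRight

variable {H₁ H₂ H₃ : Type u} [NormedAddCommGroup H₁] [InnerProductSpace ℂ H₁] [CompleteSpace H₁]
  [NormedAddCommGroup H₂] [InnerProductSpace ℂ H₂] [CompleteSpace H₂]
  [NormedAddCommGroup H₃] [InnerProductSpace ℂ H₃] [CompleteSpace H₃]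

/-- `T` intertwines `σ` and `τ`. -/
def Intertwines (σ : M →⋆ₐ[ℂ] (H₁ →L[ℂ] H₁)) (τ : M →⋆ₐ[ℂ] (H₂ →L[ℂ] H₂)) (T : H₁ →L[ℂ] H₂) :
    Prop := ∀ a, T ∘L σ a = τ a ∘L T

variable {σ : M →⋆ₐ[ℂ] (H₁ →L[ℂ] H₁)} {τ : M →⋆ₐ[ℂ] (H₂ →L[ℂ] H₂)} {υ : M →⋆ₐ[ℂ] (H₃ →L[ℂ] H₃)}
  {k : ℕ}

lemma Intertwines.apply {T : H₁ →L[ℂ] H₂} (hT : Intertwines σ τ T) (a : M) (h : H₁) :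
    T (σ a h) = τ a (T h) := congrArg (fun S : H₁ →L[ℂ] H₂ => S h) (hT a)

lemma Intertwines.comp {S : H₂ →L[ℂ] H₃} {T : H₁ →L[ℂ] H₂} (hS : Intertwines τ υ S)
    (hT : Intertwines σ τ T) : Intertwines σ υ (S ∘L T) := fun a =>
  ContinuousLinearMap.ext fun h => by
    simp only [ContinuousLinearMap.comp_apply, hT.apply, hS.apply]

lemma Intertwines.adjoint {T : H₁ →L[ℂ] H₂} (hT : Intertwines σ τ T) :
    Intertwines τ σ (ContinuousLinearMap.adjoint T) := fun a => by
  have h := congrArg ContinuousLinearMap.adjoint (hT (star a))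
  have e1 : ContinuousLinearMap.adjoint (σ (star a)) = σ a := by
    rw [map_star, ContinuousLinearMap.star_eq_adjoint, ContinuousLinearMap.adjoint_adjoint]
  have e2 : ContinuousLinearMap.adjoint (τ (star a)) = τ a := by
    rw [map_star, ContinuousLinearMap.star_eq_adjoint, ContinuousLinearMap.adjoint_adjoint]
  rw [ContinuousLinearMap.adjoint_comp, ContinuousLinearMap.adjoint_comp, e1, e2] at h
  exact h.symm

lemma intertwines_of_mem_commutant {a : H₁ →L[ℂ] H₁} (ha : a ∈ commutant σ) : Intertwines σ σ a :=
  fun m => ((StarSubalgebra.mem_centralizer_iff ℂ).mp ha (σ m) ⟨m, rfl⟩).1.symm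

lemma mem_commutant_of_intertwines {a : H₁ →L[ℂ] H₁} (ha : Intertwines σ σ a) :
    a ∈ commutant σ := by
  refine (StarSubalgebra.mem_centralizer_iff ℂ).mpr ?_
  rintro _ ⟨m, rfl⟩
  refine ⟨(ha m).symm, ?_⟩
  rw [← map_star]
  exact (ha (star m)).symm

/-- The Gram factor b depends on the tuples only and not on σ. An intertwiner T passes through each
σ(b l u), so this formula bounds 1 ⊗ T by ‖T‖. -/
lemma exists_norm_sum_htens_sq (s : Finset (Fin k → E)) :
    ∃ (κ : Type u) (_ : Fintype κ) (b : κ → s → M), ∀ (H : Type u) [NormedAddCommGroup H]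
      [InnerProductSpace ℂ H] [CompleteSpace H] (σ : M →⋆ₐ[ℂ] (H →L[ℂ] H)) (h : (Fin k → E) → H),
      ‖∑ u ∈ s, htens σ u (h u)‖ ^ 2 = ∑ l, ‖∑ u : s, σ (b l u) (h u)‖ ^ 2 := by
  obtain ⟨κ, _, b, hb⟩ := isGram_kernel k (ι := s) _ (isGram_one (M := M)) (fun i => i.1)
  refine ⟨κ, inferInstance, b, fun H _ _ _ σ h => ?_⟩
  have : ((‖∑ u ∈ s, htens σ u (h u)‖ ^ 2 : ℝ) : ℂ) =
      ((∑ l, ‖∑ u : s, σ (b l u) (h u)‖ ^ 2 : ℝ) : ℂ) := by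
    rw [Complex.ofReal_sum]
    simp_rw [ofReal_norm_sum_sq]
    rw [← Finset.sum_coe_sort s]
    simp_rw [← Finset.sum_coe_sort s, inner_htens, hb, map_sum, map_mul, map_star]
    conv_rhs => rw [Finset.sum_comm]
    refine Finset.sum_congr rfl fun i _ => ?_
    conv_rhs => rw [Finset.sum_comm]
    refine Finset.sum_congr rfl fun j _ => ?_
    rw [sum_apply, inner_sum]
    refine Finset.sum_congr rfl fun l _ => ?_
    rw [mul_apply_eq_comp, ContinuousLinearMap.star_eq_adjoint,
      ContinuousLinearMap.adjoint_inner_right]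
  exact_mod_cast this

lemma exists_mapRight {T : H₁ →L[ℂ] H₂} (hT : Intertwines σ τ T) (k : ℕ) :
    ∃ L : HTensor E σ k →L[ℂ] HTensor E τ k,
      (∀ u h, L (htens σ u h) = ((htensL τ u ∘L T : H₁ →L[ℂ] HTensor E τ k) :
        H₁ →ₗ[ℂ] HTensor E τ k) h) ∧ ‖L‖ ≤ ‖T‖ := by
  refine exists_lift _ (norm_nonneg _) fun s h => ?_
  obtain ⟨κ, _, b, hb⟩ := exists_norm_sum_htens_sq (M := M) s
  rw [← pow_le_pow_iff_left₀ (norm_nonneg _) (by positivity) two_ne_zero, mul_pow, hb H₁ σ h]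
  refine (hb H₂ τ fun u => T (h u)).trans_le ?_
  rw [Finset.mul_sum]
  refine Finset.sum_le_sum fun l _ => ?_
  rw [← mul_pow]
  gcongr
  simp_rw [← hT.apply, ← map_sum]
  exact T.le_opNorm _

open Classical in
/-- `1 ⊗ T`, for an intertwiner `T`. -/
def mapRight (E : Type u) [NormedAddCommGroup E] [NormedSpace ℂ E] [CompleteSpace E] [Module M E]
    [Module Mᵐᵒᵖ E] [WStarCorrespondence M E] (σ : M →⋆ₐ[ℂ] (H₁ →L[ℂ] H₁))
    (τ : M →⋆ₐ[ℂ] (H₂ →L[ℂ] H₂)) (k : ℕ) (T : H₁ →L[ℂ] H₂) : HTensor E σ k →L[ℂ] HTensor E τ k :=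
  if hT : Intertwines σ τ T then (exists_mapRight hT k).choose else 0

lemma mapRight_htens {T : H₁ →L[ℂ] H₂} (hT : Intertwines σ τ T) (u : Fin k → E) (h : H₁) :
    mapRight E σ τ k T (htens σ u h) = htens τ u (T h) := by
  rw [mapRight, dif_pos hT]
  exact (exists_mapRight hT k).choose_spec.1 u h

lemma norm_mapRight_le {T : H₁ →L[ℂ] H₂} (hT : Intertwines σ τ T) :
    ‖mapRight E σ τ k T‖ ≤ ‖T‖ := by
  rw [mapRight, dif_pos hT]
  exact (exists_mapRight hT k).choose_spec.2

lemma mapRight_comp {S : H₂ →L[ℂ] H₃} {T : H₁ →L[ℂ] H₂} (hS : Intertwines τ υ S)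
    (hT : Intertwines σ τ T) :
    mapRight E σ υ k (S ∘L T) = mapRight E τ υ k S ∘L mapRight E σ τ k T :=
  HTensor.clm_ext fun u h => by
    rw [ContinuousLinearMap.comp_apply, mapRight_htens hT, mapRight_htens hS,
      mapRight_htens (hS.comp hT), ContinuousLinearMap.comp_apply]

lemma intertwines_one : Intertwines σ σ 1 := fun _ => rfl

lemma mapRight_one : mapRight E σ σ k 1 = 1 :=
  HTensor.clm_ext fun u h => mapRight_htens intertwines_one u h

lemma adjoint_mapRight {T : H₁ →L[ℂ] H₂} (hT : Intertwines σ τ T) :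
    ContinuousLinearMap.adjoint (mapRight E σ τ k T) =
      mapRight E τ σ k (ContinuousLinearMap.adjoint T) :=
  HTensor.clm_ext fun v g => HTensor.ext_inner fun u h => by
    rw [ContinuousLinearMap.adjoint_inner_right, mapRight_htens hT, mapRight_htens hT.adjoint,
      inner_htens, inner_htens, ← hT.adjoint.apply, ContinuousLinearMap.adjoint_inner_right]

lemma mapRight_comp_rho {T : H₁ →L[ℂ] H₂} (hT : Intertwines σ τ T) (f : TensPow M E k) :
    mapRight E σ τ k T ∘L rho σ f = rho τ f ∘L T :=
  HTensor.op_ext fun x u g => by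
    rw [ContinuousLinearMap.comp_apply, ← ContinuousLinearMap.adjoint_inner_left,
      adjoint_mapRight hT, mapRight_htens hT.adjoint, inner_htens_rho,
      ContinuousLinearMap.comp_apply, inner_htens_rho, ContinuousLinearMap.adjoint_inner_left,
      hT.apply]

lemma mapRight_comp_amp {T : H₁ →L[ℂ] H₂} (hT : Intertwines σ τ T) (hσ : ScottContinuous σ)
    (hτ : ScottContinuous τ) (A : Endo M E k) :
    mapRight E σ τ k T ∘L amp hσ k A = amp hτ k A ∘L mapRight E σ τ k T :=
  HTensor.clm_ext fun u h => by
    rw [ContinuousLinearMap.comp_apply, ContinuousLinearMap.comp_apply, mapRight_htens hT,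
      amp_htens, amp_htens, ← ContinuousLinearMap.comp_apply, mapRight_comp_rho hT]
    rfl

lemma intertwines_mapRight {T : H₁ →L[ℂ] H₂} (hT : Intertwines σ τ T) (hσ : ScottContinuous σ)
    (hτ : ScottContinuous τ) : Intertwines (ind E hσ k) (ind E hτ k) (mapRight E σ τ k T) :=
  fun a => mapRight_comp_amp hT hσ hτ (lmulE E k a)

lemma intertwines_amp (hσ : ScottContinuous σ) {A : Endo M E k} (hA : A ∈ relCommutant M E k) :
    Intertwines (ind E hσ k) (ind E hσ k) (amp hσ k A) := fun a => by
  have := congrArg (amp hσ k) (mem_relCommutant_iff.mp hA a)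
  rwa [amp_mul, amp_mul] at this

lemma tensorOp_eq (hσ : ScottContinuous σ) (S : Endo M E k) {a : H₁ →L[ℂ] H₁}
    (ha : Intertwines σ σ a) : tensorOp σ S a = amp hσ k S ∘L mapRight E σ σ k a := by
  have h1 : IsTensorOp S a (amp hσ k S ∘L mapRight E σ σ k a) := fun u v h g => by
    rw [ContinuousLinearMap.comp_apply, mapRight_htens ha, inner_amp]
  have h2 : ∃ T, IsTensorOp (σ := σ) S a T := ⟨_, h1⟩
  rw [tensorOp, dif_pos h2]
  refine HTensor.clm_ext fun v g => HTensor.ext_inner fun u h => ?_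
  rw [h2.choose_spec, h1]

end MapRight

end WStar

namespace WStar

open Filter Topology WStarCorrespondence TensPow

/-! ### Splitting tensor powers and forming A ⊗ B -/

section Split

/-- A splitting `E^{⊗n} = E^{⊗k} ⊗ E^{⊗l}` on the level of elementary tensors. -/
structure Split (M E : Type u) [CStarAlgebra M] [PartialOrder M] [StarOrderedRing M]
    [NormedAddCommGroup E] [NormedSpace ℂ E] [CompleteSpace E] [Module M E] [Module Mᵐᵒᵖ E]
    [WStarCorrespondence M E] (n k l : ℕ) where
  /-- the first `k` factors -/
  left : (Fin n → E) → Fin k → E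
  /-- the last `l` factors -/
  right : (Fin n → E) → Fin l → E
  /-- concatenation -/
  join : (Fin k → E) → (Fin l → E) → Fin n → E
  left_join : ∀ u v, left (join u v) = u
  right_join : ∀ u v, right (join u v) = v
  kernel_eq : ∀ (a : M) w w',
    kernel n a w w' = kernel l (kernel k a (left w) (left w')) (right w) (right w')

variable {M E : Type u} [CStarAlgebra M] [PartialOrder M] [StarOrderedRing M]
  [NormedAddCommGroup E] [NormedSpace ℂ E] [CompleteSpace E] [Module M E] [Module Mᵐᵒᵖ E]
  [WStarCorrespondence M E]

lemma kernel_eq_foldl (k : ℕ) (a : M) (u v : Fin k → E) : kernel k a u v =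
    (List.ofFn fun i => (u i, v i)).foldl (fun a p => ip p.1 (a • p.2)) a := by
  induction k generalizing a with
  | zero => rfl
  | succ k ih =>
    rw [List.ofFn_succ, List.foldl_cons, kernel, ih]
    rfl

variable (M E) in
/-- The splitting of a tuple of length `k + l` into its first `k` and its last `l` entries. -/
def Split.append (k l : ℕ) : Split M E (k + l) k l where
  left w i := w (Fin.castAdd l i)
  right w i := w (Fin.natAdd k i)
  join := Fin.append
  left_join u v := funext fun i => Fin.append_left u v i
  right_join u v := funext fun i => Fin.append_right u v i
  kernel_eq a w w' := by
    rw [kernel_eq_foldl, kernel_eq_foldl, kernel_eq_foldl, ← List.foldl_append,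
      ← List.ofFn_fin_append]
    congr 2
    funext i
    refine Fin.addCases (fun i => ?_) (fun i => ?_) i
    · rw [Fin.append_left]
    · rw [Fin.append_right]

variable (M E) in
/-- The splitting of a tuple of length `l + 1` into its first entry and the rest. -/
def Split.cons (l : ℕ) : Split M E (l + 1) 1 l where
  left w := ![w 0]
  right := Fin.tail
  join u v := Fin.cons (u 0) v
  left_join u v := funext fun i => by rw [Subsingleton.elim i 0]; rfl
  right_join u v := Fin.tail_cons _ _
  kernel_eq a w w' := rfl

variable [WStarAlgebra M] {n k l : ℕ} (S : Split M E n k l)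

variable {H : Type u} [NormedAddCommGroup H] [InnerProductSpace ℂ H] [CompleteSpace H]
  {σ : M →⋆ₐ[ℂ] (H →L[ℂ] H)}

/-- V is isometric because iterating the kernel computes the inner products on both sides, and it is
onto because `join` reaches every u ⊗ (v ⊗ h). The target is a tensor product over the induced
representation, so `amp` acts on the first factor and `mapRight` on the second. -/
lemma Split.exists_unitary (hσ : ScottContinuous σ) :
    ∃ V : HTensor E σ n →L[ℂ] HTensor E (ind E hσ l) k,
      (∀ w h, V (htens σ w h) = htens (ind E hσ l) (S.left w) (htens σ (S.right w) h)) ∧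
      ContinuousLinearMap.adjoint V ∘L V = 1 ∧ V ∘L ContinuousLinearMap.adjoint V = 1 := by
  obtain ⟨V, hV, h1⟩ := exists_lift_isometry (σ := σ) (k := n)
    (fun w => ((htensL (ind E hσ l) (S.left w) ∘L htensL σ (S.right w) :
      H →L[ℂ] HTensor E (ind E hσ l) k) : H →ₗ[ℂ] HTensor E (ind E hσ l) k)) (fun w w' h g => by
      refine (inner_htens (ind E hσ l) (S.left w) (S.left w') _ _).trans ?_
      refine (inner_ind hσ _ _ _ h g).trans ?_
      rw [← S.kernel_eq])
  refine ⟨V, hV, h1, HTensor.clm_ext fun u x => ?_⟩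
  have h2 : (V ∘L ContinuousLinearMap.adjoint V) ∘L htensL (ind E hσ l) u =
      htensL (ind E hσ l) u := HTensor.clm_ext fun v h => by
    have h3 : htensL (ind E hσ l) u (htens σ v h) = V (htens σ (S.join u v) h) := by
      refine Eq.trans ?_ (hV _ _).symm
      rw [S.left_join]
      change htens (ind E hσ l) u (htens σ v h) =
        htens (ind E hσ l) u (htens σ (S.right (S.join u v)) h)
      rw [S.right_join]
    rw [ContinuousLinearMap.comp_apply, h3, ContinuousLinearMap.comp_apply,
      ← ContinuousLinearMap.comp_apply _ V, h1]
    rfl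
  exact congrArg (fun T : HTensor E σ l →L[ℂ] HTensor E (ind E hσ l) k => T x) h2

/-- The identification `E^{⊗n} ⊗_σ H = E^{⊗k} ⊗ (E^{⊗l} ⊗_σ H)`. -/
def Split.V (hσ : ScottContinuous σ) : HTensor E σ n →L[ℂ] HTensor E (ind E hσ l) k :=
  (S.exists_unitary hσ).choose

lemma Split.V_htens (hσ : ScottContinuous σ) (w : Fin n → E) (h : H) :
    S.V hσ (htens σ w h) = htens (ind E hσ l) (S.left w) (htens σ (S.right w) h) :=
  (S.exists_unitary hσ).choose_spec.1 w h

lemma Split.adjoint_comp_V (hσ : ScottContinuous σ) :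
    ContinuousLinearMap.adjoint (S.V hσ) ∘L S.V hσ = 1 := (S.exists_unitary hσ).choose_spec.2.1

lemma Split.V_comp_adjoint (hσ : ScottContinuous σ) :
    S.V hσ ∘L ContinuousLinearMap.adjoint (S.V hσ) = 1 := (S.exists_unitary hσ).choose_spec.2.2

lemma Split.norm_V_le (hσ : ScottContinuous σ) : ‖S.V hσ‖ ≤ 1 := by
  have h1 : ‖S.V hσ‖ * ‖S.V hσ‖ ≤ 1 := by
    rw [← ContinuousLinearMap.norm_adjoint_comp_self, S.adjoint_comp_V hσ]
    exact ContinuousLinearMap.norm_id_le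
  nlinarith [norm_nonneg (S.V hσ)]

lemma Split.V_conj_eq_iff (hσ : ScottContinuous σ) {T : HTensor E σ n →L[ℂ] HTensor E σ n}
    {T' : HTensor E (ind E hσ l) k →L[ℂ] HTensor E (ind E hσ l) k} :
    T = ContinuousLinearMap.adjoint (S.V hσ) ∘L T' ∘L S.V hσ ↔ S.V hσ ∘L T = T' ∘L S.V hσ := by
  constructor
  · rintro rfl
    rw [← ContinuousLinearMap.comp_assoc, S.V_comp_adjoint]
    rfl
  · intro h
    rw [← h, ← ContinuousLinearMap.comp_assoc, S.adjoint_comp_V]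
    rfl

/-- `(A ⊗ 1)(1 ⊗ B)` on `E^{⊗n} ⊗_σ H`. -/
def Split.op (hσ : ScottContinuous σ) (A : Endo M E k) (B : Endo M E l) :
    HTensor E σ n →L[ℂ] HTensor E σ n :=
  ContinuousLinearMap.adjoint (S.V hσ) ∘L (amp (ind_normal hσ l) k A ∘L
    mapRight E (ind E hσ l) (ind E hσ l) k (amp hσ l B)) ∘L S.V hσ

lemma Split.inner_op (hσ : ScottContinuous σ) (A : Endo M E k) {B : Endo M E l}
    (hB : B ∈ relCommutant M E l) (w w' : Fin n → E) (h g : H) :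
    inner ℂ (htens σ w h) (S.op hσ A B (htens σ w' g)) = inner ℂ h
      (σ ((lmul (coeff A (S.left w) (S.left w')) (B.1 (tens (S.right w')))).val (S.right w)) g) := by
  rw [Split.op, ContinuousLinearMap.comp_apply, ContinuousLinearMap.adjoint_inner_right,
    ContinuousLinearMap.comp_apply, ContinuousLinearMap.comp_apply, S.V_htens, S.V_htens,
    mapRight_htens (intertwines_amp hσ hB), inner_amp, amp_htens, ← ContinuousLinearMap.comp_apply,
    ind_comp_rho, inner_htens_rho]

lemma Split.norm_op_le (hσ : ScottContinuous σ) (A : Endo M E k) {B : Endo M E l}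
    (hB : B ∈ relCommutant M E l) : ‖S.op hσ A B‖ ≤ ‖A‖ * ‖B‖ := by
  have h1 := S.norm_V_le hσ
  have h2 : ‖ContinuousLinearMap.adjoint (S.V hσ)‖ ≤ 1 := by rwa [LinearIsometryEquiv.norm_map]
  have h3 : ‖amp (ind_normal hσ l) k A ∘L
      mapRight E (ind E hσ l) (ind E hσ l) k (amp hσ l B)‖ ≤ ‖A‖ * ‖B‖ := by
    refine (ContinuousLinearMap.opNorm_comp_le _ _).trans ?_
    gcongr
    · exact norm_amp_le _ A
    · exact (norm_mapRight_le (intertwines_amp hσ hB)).trans (norm_amp_le _ B)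
  calc ‖S.op hσ A B‖ ≤ ‖ContinuousLinearMap.adjoint (S.V hσ)‖ * (‖amp (ind_normal hσ l) k A ∘L
      mapRight E (ind E hσ l) (ind E hσ l) k (amp hσ l B)‖ * ‖S.V hσ‖) :=
        (ContinuousLinearMap.opNorm_comp_le _ _).trans
          (by gcongr; exact ContinuousLinearMap.opNorm_comp_le _ _)
    _ ≤ 1 * ((‖A‖ * ‖B‖) * 1) := by gcongr
    _ = _ := by ring

lemma Split.exists_tensor (A : Endo M E k) {B : Endo M E l} (hB : B ∈ relCommutant M E l) :
    ∃ C : Endo M E n, ∀ w w', coeff C w w' =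
      (lmul (coeff A (S.left w) (S.left w')) (B.1 (tens (S.right w')))).val (S.right w) :=
  (exists_endo _ (mul_nonneg (norm_nonneg A) (norm_nonneg B)) fun π =>
    ⟨S.op π.normal A B, S.norm_op_le π.normal A hB, S.inner_op π.normal A hB⟩).imp fun _ h => h.1

open Classical in
/-- `A ⊗ B` along a splitting, for `B ∈ φ_l(M)ᶜ`. -/
def Split.tensor (A : Endo M E k) (B : Endo M E l) : Endo M E n :=
  if hB : B ∈ relCommutant M E l then (S.exists_tensor A hB).choose else 0

lemma Split.coeff_tensor (A : Endo M E k) {B : Endo M E l} (hB : B ∈ relCommutant M E l)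
    (w w' : Fin n → E) : coeff (S.tensor A B) w w' =
      (lmul (coeff A (S.left w) (S.left w')) (B.1 (tens (S.right w')))).val (S.right w) := by
  rw [Split.tensor, dif_pos hB]
  exact (S.exists_tensor A hB).choose_spec w w'

lemma Split.amp_tensor (hσ : ScottContinuous σ) (A : Endo M E k) {B : Endo M E l}
    (hB : B ∈ relCommutant M E l) : amp hσ n (S.tensor A B) = S.op hσ A B :=
  (amp_eq_iff hσ).mpr fun w w' h g => by rw [S.inner_op hσ A hB, S.coeff_tensor A hB]

lemma Split.V_comp_op (hσ : ScottContinuous σ) (A : Endo M E k) (B : Endo M E l) :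
    S.V hσ ∘L S.op hσ A B = (amp (ind_normal hσ l) k A ∘L
      mapRight E (ind E hσ l) (ind E hσ l) k (amp hσ l B)) ∘L S.V hσ :=
  (S.V_conj_eq_iff hσ).mp rfl

lemma Split.V_comp_amp_tensor (hσ : ScottContinuous σ) (A : Endo M E k) {B : Endo M E l}
    (hB : B ∈ relCommutant M E l) : S.V hσ ∘L amp hσ n (S.tensor A B) =
      (amp (ind_normal hσ l) k A ∘L
        mapRight E (ind E hσ l) (ind E hσ l) k (amp hσ l B)) ∘L S.V hσ := by
  rw [S.amp_tensor hσ A hB, S.V_comp_op]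

lemma Split.V_comp_ind (hσ : ScottContinuous σ) (a : M) :
    S.V hσ ∘L ind E hσ n a = ind E (ind_normal hσ l) k a ∘L S.V hσ := by
  refine (S.V_conj_eq_iff hσ).mp (HTensor.clm_ext fun w' g => HTensor.ext_inner fun w h => ?_)
  rw [inner_ind, ContinuousLinearMap.comp_apply, ContinuousLinearMap.adjoint_inner_right,
    ContinuousLinearMap.comp_apply, S.V_htens, S.V_htens, inner_ind, inner_ind, S.kernel_eq]

lemma Split.V_comp_mapRight (hσ : ScottContinuous σ) {a : H →L[ℂ] H} (ha : Intertwines σ σ a) :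
    S.V hσ ∘L mapRight E σ σ n a =
      mapRight E (ind E hσ l) (ind E hσ l) k (mapRight E σ σ l a) ∘L S.V hσ :=
  HTensor.clm_ext fun w h => by
    rw [ContinuousLinearMap.comp_apply, ContinuousLinearMap.comp_apply, mapRight_htens ha,
      S.V_htens, S.V_htens, mapRight_htens (intertwines_mapRight ha hσ hσ), mapRight_htens ha]

lemma mul_mem_relCommutant {A B : Endo M E k} (hA : A ∈ relCommutant M E k)
    (hB : B ∈ relCommutant M E k) : A * B ∈ relCommutant M E k :=
  mem_relCommutant_iff.mpr fun a => by
    rw [mul_assoc, mem_relCommutant_iff.mp hB, ← mul_assoc, mem_relCommutant_iff.mp hA, mul_assoc]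

lemma one_mem_relCommutant : (1 : Endo M E k) ∈ relCommutant M E k := fun _ _ => rfl

/-- The relative commutant as a star subalgebra. -/
def relComm (M E : Type u) [CStarAlgebra M] [PartialOrder M] [StarOrderedRing M] [WStarAlgebra M]
    [NormedAddCommGroup E] [NormedSpace ℂ E] [CompleteSpace E] [Module M E] [Module Mᵐᵒᵖ E]
    [WStarCorrespondence M E] (k : ℕ) : StarSubalgebra ℂ (Endo M E k) :=
  StarSubalgebra.centralizer ℂ (Set.range (lmulHom E k))

lemma mem_relComm_iff {A : Endo M E k} : A ∈ relComm M E k ↔ A ∈ relCommutant M E k := by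
  rw [mem_relCommutant_iff, relComm, StarSubalgebra.mem_centralizer_iff]
  constructor
  · intro h a
    exact (h (lmulE E k a) ⟨a, rfl⟩).1.symm
  · rintro h _ ⟨a, rfl⟩
    refine ⟨(h a).symm, ?_⟩
    rw [← map_star]
    exact (h (star a)).symm

/-- A' ⊗ 1 and 1 ⊗ B commute, since B ⊗ 1 intertwines the induced representation
(`mapRight_comp_amp`); the factors can therefore be regrouped. -/
lemma Split.tensor_mul (A A' : Endo M E k) {B B' : Endo M E l} (hB : B ∈ relCommutant M E l)
    (hB' : B' ∈ relCommutant M E l) :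
    S.tensor A B * S.tensor A' B' = S.tensor (A * A') (B * B') := by
  refine Endo.eq_of_amp fun π => ?_
  have hσ := π.normal
  have hiB := intertwines_amp hσ hB
  have hiB' := intertwines_amp hσ hB'
  rw [amp_mul, S.amp_tensor hσ _ (mul_mem_relCommutant hB hB')]
  refine (S.V_conj_eq_iff hσ).mpr ?_
  rw [amp_mul, amp_mul]
  change S.V hσ ∘L (amp hσ n (S.tensor A B) ∘L amp hσ n (S.tensor A' B')) = _
  rw [← ContinuousLinearMap.comp_assoc, S.V_comp_amp_tensor hσ A hB, ContinuousLinearMap.comp_assoc,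
    S.V_comp_amp_tensor hσ A' hB']
  have h1 : mapRight E (ind E hσ l) (ind E hσ l) k (amp hσ l B * amp hσ l B') = _ :=
    mapRight_comp hiB hiB'
  rw [h1]
  have h2 := mapRight_comp_amp (k := k) hiB (ind_normal hσ l) (ind_normal hσ l) A'
  change (amp (ind_normal hσ l) k A ∘L mapRight E (ind E hσ l) (ind E hσ l) k (amp hσ l B)) ∘L
    (amp (ind_normal hσ l) k A' ∘L mapRight E (ind E hσ l) (ind E hσ l) k (amp hσ l B')) ∘L
      S.V hσ = (amp (ind_normal hσ l) k A ∘L (amp (ind_normal hσ l) k A' ∘L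
      mapRight E (ind E hσ l) (ind E hσ l) k (amp hσ l B)) ∘L
        mapRight E (ind E hσ l) (ind E hσ l) k (amp hσ l B')) ∘L S.V hσ
  rw [← h2]
  rfl

lemma Split.tensor_one : S.tensor (1 : Endo M E k) (1 : Endo M E l) = 1 := by
  refine Endo.eq_of_coeff fun w w' => ?_
  rw [S.coeff_tensor _ one_mem_relCommutant]
  change (lmul (kernel k 1 (S.left w) (S.left w')) (tens (S.right w'))).val (S.right w) =
    kernel n 1 w w'
  rw [val_lmul_tens, S.kernel_eq]

lemma star_mem_relCommutant {A : Endo M E k} (hA : A ∈ relCommutant M E k) :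
    star A ∈ relCommutant M E k :=
  mem_relComm_iff.mp (star_mem (mem_relComm_iff.mpr hA))

lemma Split.star_tensor (A : Endo M E k) {B : Endo M E l} (hB : B ∈ relCommutant M E l) :
    star (S.tensor A B) = S.tensor (star A) (star B) := by
  refine Endo.eq_of_amp fun π => ?_
  have hσ := π.normal
  have hiB := intertwines_amp hσ hB
  have hBs := star_mem_relCommutant hB
  rw [amp_star, S.amp_tensor hσ _ hB, S.amp_tensor hσ _ hBs, Split.op, Split.op,
    ContinuousLinearMap.star_eq_adjoint]
  simp only [ContinuousLinearMap.adjoint_comp, ContinuousLinearMap.adjoint_adjoint]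
  rw [adjoint_mapRight hiB, amp_star, amp_star, ContinuousLinearMap.star_eq_adjoint,
    ContinuousLinearMap.star_eq_adjoint, ContinuousLinearMap.comp_assoc]
  have h2 := mapRight_comp_amp (k := k) hiB.adjoint (ind_normal hσ l) (ind_normal hσ l) (star A)
  rw [amp_star, ContinuousLinearMap.star_eq_adjoint] at h2
  rw [← h2]

lemma Split.tensor_add_left (A A' : Endo M E k) {B : Endo M E l} (hB : B ∈ relCommutant M E l) :
    S.tensor (A + A') B = S.tensor A B + S.tensor A' B := by
  refine Endo.eq_of_amp fun π => ?_
  rw [amp_add, S.amp_tensor _ _ hB, S.amp_tensor _ _ hB, S.amp_tensor _ _ hB, Split.op, amp_add]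
  simp only [ContinuousLinearMap.add_comp, ContinuousLinearMap.comp_add]
  rfl

lemma Split.tensor_smul_left (c : ℂ) (A : Endo M E k) {B : Endo M E l}
    (hB : B ∈ relCommutant M E l) : S.tensor (c • A) B = c • S.tensor A B := by
  refine Endo.eq_of_amp fun π => ?_
  rw [map_smul, S.amp_tensor _ _ hB, S.amp_tensor _ _ hB, Split.op, map_smul]
  simp only [ContinuousLinearMap.smul_comp, ContinuousLinearMap.comp_smul]
  rfl

lemma Split.tensor_mem (A : Endo M E k) {B : Endo M E l} (hA : A ∈ relCommutant M E k)
    (hB : B ∈ relCommutant M E l) : S.tensor A B ∈ relCommutant M E n := by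
  refine mem_relCommutant_iff.mpr fun a => Endo.eq_of_amp fun π => ?_
  have hσ := π.normal
  have hiB := intertwines_amp hσ hB
  rw [amp_mul, amp_mul]
  change amp hσ n (S.tensor A B) ∘L ind E hσ n a = ind E hσ n a ∘L amp hσ n (S.tensor A B)
  have h1 : S.V hσ ∘L (amp hσ n (S.tensor A B) ∘L ind E hσ n a) =
      S.V hσ ∘L (ind E hσ n a ∘L amp hσ n (S.tensor A B)) := by
    have h2 := mapRight_comp_amp (k := k) hiB (ind_normal hσ l) (ind_normal hσ l)
      (lmulE E k a)
    have h3 := intertwines_amp (ind_normal (E := E) hσ l) hA a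
    have h5 : (amp (ind_normal hσ l) k A ∘L
        mapRight E (ind E hσ l) (ind E hσ l) k (amp hσ l B)) ∘L ind E (ind_normal hσ l) k a =
        ind E (ind_normal hσ l) k a ∘L (amp (ind_normal hσ l) k A ∘L
        mapRight E (ind E hσ l) (ind E hσ l) k (amp hσ l B)) := by
      rw [ContinuousLinearMap.comp_assoc, ind_apply, h2, ← ContinuousLinearMap.comp_assoc,
        ← ContinuousLinearMap.comp_assoc]
      exact congrArg (fun T => T ∘L mapRight E (ind E hσ l) (ind E hσ l) k (amp hσ l B)) h3
    calc S.V hσ ∘L (amp hσ n (S.tensor A B) ∘L ind E hσ n a)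
        = (S.V hσ ∘L amp hσ n (S.tensor A B)) ∘L ind E hσ n a := rfl
      _ = (amp (ind_normal hσ l) k A ∘L mapRight E (ind E hσ l) (ind E hσ l) k (amp hσ l B)) ∘L
          (S.V hσ ∘L ind E hσ n a) := by rw [S.V_comp_amp_tensor hσ A hB]; rfl
      _ = ((amp (ind_normal hσ l) k A ∘L mapRight E (ind E hσ l) (ind E hσ l) k (amp hσ l B)) ∘L
          ind E (ind_normal hσ l) k a) ∘L S.V hσ := by rw [S.V_comp_ind]; rfl
      _ = ind E (ind_normal hσ l) k a ∘L (S.V hσ ∘L amp hσ n (S.tensor A B)) := by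
        rw [h5, S.V_comp_amp_tensor hσ A hB]; rfl
      _ = (S.V hσ ∘L ind E hσ n a) ∘L amp hσ n (S.tensor A B) := by rw [S.V_comp_ind]; rfl
      _ = S.V hσ ∘L (ind E hσ n a ∘L amp hσ n (S.tensor A B)) := rfl
  have h4 := congrArg (fun T => ContinuousLinearMap.adjoint (S.V hσ) ∘L T) h1
  simp only [← ContinuousLinearMap.comp_assoc, S.adjoint_comp_V hσ] at h4
  exact h4

end Split

end WStar

namespace WStar

open Filter Topology WStarCorrespondence TensPow

variable {M E : Type u} [CStarAlgebra M] [PartialOrder M] [StarOrderedRing M] [WStarAlgebra M]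
  [NormedAddCommGroup E] [NormedSpace ℂ E] [CompleteSpace E] [Module M E] [Module Mᵐᵒᵖ E]
  [WStarCorrespondence M E] {n k l : ℕ}

/-! ### The relative commutant and the order on tensor products -/

section RelCommutant

lemma add_mem_relCommutant {A B : Endo M E k} (hA : A ∈ relCommutant M E k)
    (hB : B ∈ relCommutant M E k) : A + B ∈ relCommutant M E k :=
  mem_relCommutant_iff.mpr fun a => by
    rw [add_mul, mem_relCommutant_iff.mp hA, mem_relCommutant_iff.mp hB, mul_add]

lemma zero_mem_relCommutant : (0 : Endo M E k) ∈ relCommutant M E k :=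
  mem_relCommutant_iff.mpr fun a => by rw [zero_mul, mul_zero]

lemma sum_mem_relCommutant {ι : Type*} (s : Finset ι) {A : ι → Endo M E k}
    (hA : ∀ i ∈ s, A i ∈ relCommutant M E k) : ∑ i ∈ s, A i ∈ relCommutant M E k :=
  Finset.sum_induction A (· ∈ relCommutant M E k) (fun _ _ => add_mem_relCommutant)
    zero_mem_relCommutant hA

lemma sqrt_mem_relCommutant {A : Endo M E k} (hA : A ∈ relCommutant M E k) :
    CFC.sqrt A ∈ relCommutant M E k :=
  mem_relCommutant_iff.mpr fun a =>
    (Commute.cfcₙ_nnreal (show Commute A (lmulE E k a) from mem_relCommutant_iff.mp hA a) _)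

lemma inverse_mem_relCommutant {A : Endo M E k} (hA : A ∈ relCommutant M E k) :
    Ring.inverse A ∈ relCommutant M E k := by
  by_cases hu : IsUnit A
  · refine mem_relCommutant_iff.mpr fun a => ?_
    have h := mem_relCommutant_iff.mp hA a
    calc Ring.inverse A * lmulE E k a
        = Ring.inverse A * (lmulE E k a * A) * Ring.inverse A := by
          rw [mul_assoc, mul_assoc, Ring.mul_inverse_cancel A hu, mul_one]
      _ = Ring.inverse A * A * lmulE E k a * Ring.inverse A := by rw [← h]; simp only [mul_assoc]
      _ = _ := by rw [Ring.inverse_mul_cancel A hu, one_mul]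
  · rw [Ring.inverse_non_unit A hu]
    exact zero_mem_relCommutant

end RelCommutant

section SplitOrder

variable (S : Split M E n k l)

/-- A ⊗ B is the square of A^{1/2} ⊗ B^{1/2}; the root of B stays in the relative commutant, so that
this tensor product makes sense. -/
lemma Split.tensor_nonneg {A : Endo M E k} {B : Endo M E l} (hA : 0 ≤ A) (hB : 0 ≤ B)
    (hBc : B ∈ relCommutant M E l) : 0 ≤ S.tensor A B := by
  have hs := sqrt_mem_relCommutant hBc
  have hA' : star (CFC.sqrt A) * CFC.sqrt A = A := by
    rw [(IsSelfAdjoint.of_nonneg (CFC.sqrt_nonneg A)).star_eq, CFC.sqrt_mul_sqrt_self A hA]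
  have hB' : star (CFC.sqrt B) * CFC.sqrt B = B := by
    rw [(IsSelfAdjoint.of_nonneg (CFC.sqrt_nonneg B)).star_eq, CFC.sqrt_mul_sqrt_self B hB]
  have h : S.tensor A B =
      star (S.tensor (CFC.sqrt A) (CFC.sqrt B)) * S.tensor (CFC.sqrt A) (CFC.sqrt B) := by
    rw [S.star_tensor _ hs, S.tensor_mul _ _ (star_mem_relCommutant hs) hs, hA', hB']
  rw [h]
  exact star_mul_self_nonneg _

lemma Split.tensor_sub_left (A A' : Endo M E k) {B : Endo M E l} (hB : B ∈ relCommutant M E l) :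
    S.tensor (A - A') B = S.tensor A B - S.tensor A' B := by
  rw [eq_sub_iff_add_eq, ← S.tensor_add_left _ _ hB, sub_add_cancel]

lemma Split.tensor_mono_left {A A' : Endo M E k} {B : Endo M E l} (hA : A ≤ A') (hB : 0 ≤ B)
    (hBc : B ∈ relCommutant M E l) : S.tensor A B ≤ S.tensor A' B := by
  rw [← sub_nonneg, ← S.tensor_sub_left _ _ hBc]
  exact S.tensor_nonneg (sub_nonneg.mpr hA) hB hBc

lemma val_lmul_add (a : M) (f g : TensPow M E k) (u : Fin k → E) :
    (lmul a (f + g)).val u = (lmul a f).val u + (lmul a g).val u := by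
  rw [lmul_add]; rfl

lemma Split.tensor_add_right (A : Endo M E k) {B B' : Endo M E l} (hB : B ∈ relCommutant M E l)
    (hB' : B' ∈ relCommutant M E l) : S.tensor A (B + B') = S.tensor A B + S.tensor A B' :=
  Endo.eq_of_coeff fun w w' => by
    rw [S.coeff_tensor _ (add_mem_relCommutant hB hB')]
    refine (val_lmul_add _ (B.1 _) (B'.1 _) _).trans ?_
    rw [← S.coeff_tensor _ hB, ← S.coeff_tensor _ hB']
    rfl

lemma Split.tensor_zero_right (A : Endo M E k) : S.tensor A (0 : Endo M E l) = 0 := by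
  have h := S.tensor_add_right A zero_mem_relCommutant (zero_mem_relCommutant (M := M) (E := E))
  rw [add_zero] at h
  exact left_eq_add.mp h

lemma Split.tensor_sum_right (A : Endo M E k) {ι : Type*} (s : Finset ι) {B : ι → Endo M E l}
    (hB : ∀ i ∈ s, B i ∈ relCommutant M E l) :
    S.tensor A (∑ i ∈ s, B i) = ∑ i ∈ s, S.tensor A (B i) := by
  classical
  induction s using Finset.induction_on with
  | empty => rw [Finset.sum_empty, Finset.sum_empty, S.tensor_zero_right]
  | insert i s his ih =>
    have h1 : ∀ j ∈ s, B j ∈ relCommutant M E l := fun j hj => hB j (Finset.mem_insert_of_mem hj)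
    rw [Finset.sum_insert his, Finset.sum_insert his, S.tensor_add_right A
      (hB i (Finset.mem_insert_self i s)) (sum_mem_relCommutant s h1), ih h1]

lemma Split.tensor_one_inverse {B : Endo M E l} (hB : B ∈ relCommutant M E l) (hu : IsUnit B) :
    S.tensor 1 B * S.tensor 1 (Ring.inverse B) = 1 ∧
      S.tensor 1 (Ring.inverse B) * S.tensor 1 B = 1 := by
  have hi := inverse_mem_relCommutant hB
  rw [S.tensor_mul _ _ hB hi, S.tensor_mul _ _ hi hB, mul_one, Ring.mul_inverse_cancel B hu,
    Ring.inverse_mul_cancel B hu, S.tensor_one]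
  exact ⟨rfl, rfl⟩

end SplitOrder

/-! ### Identification with `tensor` and `idTensor` -/

section Tensor

lemma tensor_eq (A : Endo M E k) {B : Endo M E l} (hB : B ∈ relCommutant M E l) :
    tensor A B = (Split.append M E k l).tensor A B := by
  have h1 : IsTensor A B ((Split.append M E k l).tensor A B) := fun u u' v v' => by
    have h2 := (Split.append M E k l).coeff_tensor A hB (Fin.append u v) (Fin.append u' v')
    have e1 : ∀ (u : Fin k → E) (v : Fin l → E),
      (Split.append M E k l).left (Fin.append u v) = u := (Split.append M E k l).left_join
    have e2 : ∀ (u : Fin k → E) (v : Fin l → E),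
      (Split.append M E k l).right (Fin.append u v) = v := (Split.append M E k l).right_join
    rwa [e1, e1, e2, e2] at h2
  have h2 : ∃ C, IsTensor A B C := ⟨_, h1⟩
  rw [tensor, dif_pos h2]
  refine Endo.eq_of_coeff fun w w' => ?_
  rw [← Fin.append_castAdd_natAdd (f := w), ← Fin.append_castAdd_natAdd (f := w'),
    h2.choose_spec, h1]

lemma rho_coinsert {H : Type u} [NormedAddCommGroup H] [InnerProductSpace ℂ H] [CompleteSpace H]
    {σ : M →⋆ₐ[ℂ] (H →L[ℂ] H)} (hσ : ScottContinuous σ) (ξ : E) (f : TensPow M E (k + 1)) :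
    rho σ (coinsert ξ f) = ContinuousLinearMap.adjoint (htensL (ind E hσ k) ![ξ]) ∘L
      (Split.cons M E k).V hσ ∘L rho σ f := by
  refine rho_eq_of_adjoint_htensL fun u => ?_
  have h1 : (Split.cons M E k).V hσ ∘L htensL σ (Fin.cons ξ u : Fin (k + 1) → E) =
      htensL (ind E hσ k) ![ξ] ∘L htensL σ u := by
    ext h
    exact (Split.cons M E k).V_htens hσ (Fin.cons ξ u : Fin (k + 1) → E) h
  have h2 : htensL σ (Fin.cons ξ u : Fin (k + 1) → E) =
      ContinuousLinearMap.adjoint ((Split.cons M E k).V hσ) ∘L htensL (ind E hσ k) ![ξ] ∘L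
        htensL σ u := by
    rw [← h1, ← ContinuousLinearMap.comp_assoc, Split.adjoint_comp_V]; rfl
  have h3 := adjoint_htensL_rho σ f (Fin.cons ξ u : Fin (k + 1) → E)
  rw [h2, ContinuousLinearMap.adjoint_comp, ContinuousLinearMap.adjoint_comp,
    ContinuousLinearMap.adjoint_adjoint] at h3
  exact h3

/-- Under the unitary V the operator L_ξ^* is the adjoint of insertion into the first factor
(`rho_coinsert`). The commutation is the adjoint of (1 ⊗ A^*)(ξ ⊗ x) = ξ ⊗ A^*x. -/
lemma isIdTensor_tensor {A : Endo M E k} (hA : A ∈ relCommutant M E k) :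
    IsIdTensor A ((Split.cons M E k).tensor 1 A) := by
  refine fun ξ f => eq_of_rho fun π => ?_
  have hσ := π.normal
  have hiA := intertwines_amp hσ hA
  have hiA' : Intertwines (ind E hσ k) (ind E hσ k) (ContinuousLinearMap.adjoint (amp hσ k A)) :=
    hiA.adjoint
  have h1 : ContinuousLinearMap.adjoint (htensL (ind E hσ k) (![ξ] : Fin 1 → E)) ∘L
      mapRight E (ind E hσ k) (ind E hσ k) 1 (amp hσ k A) =
      amp hσ k A ∘L ContinuousLinearMap.adjoint (htensL (ind E hσ k) (![ξ] : Fin 1 → E)) := by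
    have h2 : mapRight E (ind E hσ k) (ind E hσ k) 1 (ContinuousLinearMap.adjoint (amp hσ k A)) ∘L
        htensL (ind E hσ k) (![ξ] : Fin 1 → E) = htensL (ind E hσ k) (![ξ] : Fin 1 → E) ∘L
          ContinuousLinearMap.adjoint (amp hσ k A) :=
      ContinuousLinearMap.ext fun x => mapRight_htens hiA' _ x
    have h3 := congrArg ContinuousLinearMap.adjoint h2
    rwa [ContinuousLinearMap.adjoint_comp, ContinuousLinearMap.adjoint_comp,
      ContinuousLinearMap.adjoint_adjoint, adjoint_mapRight hiA',
      ContinuousLinearMap.adjoint_adjoint] at h3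
  have h4 : (Split.cons M E k).V hσ ∘L amp hσ (k + 1) ((Split.cons M E k).tensor 1 A) =
      mapRight E (ind E hσ k) (ind E hσ k) 1 (amp hσ k A) ∘L (Split.cons M E k).V hσ := by
    rw [Split.V_comp_amp_tensor _ hσ 1 hA, amp_one]
    rfl
  rw [rho_coinsert hσ, ← amp_comp_rho hσ A, rho_coinsert hσ, ← amp_comp_rho hσ]
  calc _ = ContinuousLinearMap.adjoint (htensL (ind E hσ k) (![ξ] : Fin 1 → E)) ∘L
        ((Split.cons M E k).V hσ ∘L amp hσ (k + 1) ((Split.cons M E k).tensor 1 A)) ∘L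
        rho π.σ f := rfl
    _ = (ContinuousLinearMap.adjoint (htensL (ind E hσ k) (![ξ] : Fin 1 → E)) ∘L
      mapRight E (ind E hσ k) (ind E hσ k) 1 (amp hσ k A)) ∘L (Split.cons M E k).V hσ ∘L
        rho π.σ f := by rw [h4]; rfl
    _ = _ := by rw [h1]; rfl

lemma idTensor_eq {A : Endo M E k} (hA : A ∈ relCommutant M E k) :
    idTensor A = (Split.cons M E k).tensor 1 A := by
  have h1 := isIdTensor_tensor hA
  have h2 : ∃ B, IsIdTensor A B := ⟨_, h1⟩
  rw [idTensor, dif_pos h2]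
  refine Endo.eq_of_coeff fun w w' => ?_
  have e : ∀ B : Endo M E (k + 1), coeff B w w' =
      (coinsert (w 0) (B.1 (tens w'))).val (Fin.tail w) := fun B => by
    change _ = (B.1 (tens w')).val (Fin.cons (w 0) (Fin.tail w))
    rw [Fin.cons_self_tail]; rfl
  rw [e, e, h2.choose_spec, h1]

lemma coeff_cast {m : ℕ} (h : k = m) (A : Endo M E k) (u v : Fin m → E) :
    coeff (h ▸ A : Endo M E m) u v = coeff A (fun i => u (Fin.cast h i)) fun i => v (Fin.cast h i) := by
  subst h
  rfl

/-- `tensor` produces degree 1 + l while `idTensor` lives in degree l + 1. The cast only reindexes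
tuples, and the two splittings then agree. -/
lemma cast_tensor_one_eq (A : Endo M E 1) {B : Endo M E l} (hB : B ∈ relCommutant M E l)
    (h : 1 + l = l + 1) : (h ▸ tensor A B : Endo M E (l + 1)) = (Split.cons M E l).tensor A B := by
  refine Endo.eq_of_coeff fun w w' => ?_
  rw [coeff_cast, tensor_eq A hB, Split.coeff_tensor _ A hB, Split.coeff_tensor _ A hB]
  have e1 : ∀ w : Fin (l + 1) → E, (Split.append M E 1 l).left (fun i => w (Fin.cast h i)) =
      (Split.cons M E l).left w := fun w => funext fun i => by
    rw [Subsingleton.elim i 0]; rfl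
  have e2 : ∀ w : Fin (l + 1) → E, (Split.append M E 1 l).right (fun i => w (Fin.cast h i)) =
      (Split.cons M E l).right w := fun w => funext fun i => by
    change w _ = w i.succ
    congr 1
    ext
    simp
  rw [e1, e1, e2, e2]

end Tensor

end WStar

namespace WStar

open Filter Topology WStarCorrespondence TensPow

variable {M E : Type u} [CStarAlgebra M] [PartialOrder M] [StarOrderedRing M] [WStarAlgebra M]
  [NormedAddCommGroup E] [NormedSpace ℂ E] [CompleteSpace E] [Module M E] [Module Mᵐᵒᵖ E]
  [WStarCorrespondence M E]
  {H : Type u} [NormedAddCommGroup H] [InnerProductSpace ℂ H] [CompleteSpace H]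
  {σ : M →⋆ₐ[ℂ] (H →L[ℂ] H)} {k l : ℕ}

section MapRightLinear

variable {H₂ : Type u} [NormedAddCommGroup H₂] [InnerProductSpace ℂ H₂] [CompleteSpace H₂]
  {τ : M →⋆ₐ[ℂ] (H₂ →L[ℂ] H₂)}

lemma Intertwines.add {S T : H →L[ℂ] H₂} (hS : Intertwines σ τ S) (hT : Intertwines σ τ T) :
    Intertwines σ τ (S + T) := fun a => by
  rw [ContinuousLinearMap.add_comp, ContinuousLinearMap.comp_add, hS a, hT a]

lemma Intertwines.smul {T : H →L[ℂ] H₂} (hT : Intertwines σ τ T) (c : ℂ) :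
    Intertwines σ τ (c • T) := fun a => by
  rw [ContinuousLinearMap.smul_comp, ContinuousLinearMap.comp_smul, hT a]

lemma mapRight_add {S T : H →L[ℂ] H₂} (hS : Intertwines σ τ S) (hT : Intertwines σ τ T) :
    mapRight E σ τ k (S + T) = mapRight E σ τ k S + mapRight E σ τ k T :=
  HTensor.clm_ext fun u h => by
    rw [mapRight_htens (hS.add hT), add_apply, add_apply, mapRight_htens hS, mapRight_htens hT,
      htens_add]

lemma mapRight_smul {T : H →L[ℂ] H₂} (hT : Intertwines σ τ T) (c : ℂ) :
    mapRight E σ τ k (c • T) = c • mapRight E σ τ k T :=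
  HTensor.clm_ext fun u h => by
    rw [mapRight_htens (hT.smul c), smul_apply, smul_apply, mapRight_htens hT, htens_smul]

end MapRightLinear

/-! ### The tensorial powers z^{(k)} -/

section TensorialPow

lemma unitMap_htens (σ : M →⋆ₐ[ℂ] (H →L[ℂ] H)) (u : Fin 0 → E) (x : H) :
    unitMap σ (htens σ u x) = x := by
  have h : ∃ S : HTensor E σ 0 →L[ℂ] H, ∀ (u : Fin 0 → E) (x : H), S (htens σ u x) = x := by
    obtain ⟨L, hL, -⟩ := exists_lift_isometry (E := E) (σ := σ) (k := 0)
      (fun _ => (LinearMap.id : H →ₗ[ℂ] H)) (fun u v h g => by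
        simp only [kernel, map_one, LinearMap.id_apply]
        rfl)
    exact ⟨L, fun u x => hL u x⟩
  rw [unitMap, dif_pos h]
  exact h.choose_spec u x

variable {z : HTensor E σ 1 →L[ℂ] H}

lemma intertwines_of_mem_intertwiners (hσ : ScottContinuous σ) (hz : z ∈ intertwiners E σ) :
    Intertwines (ind E hσ 1) σ z := fun a => HTensor.clm_ext fun u h => by
  have hu : u = Fin.cons (u 0) ![] := by
    funext i
    rw [Subsingleton.elim i 0]
    rfl
  rw [hu, ContinuousLinearMap.comp_apply, ind_htens_cons, ContinuousLinearMap.comp_apply]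
  exact hz a (u 0) h

lemma intertwines_unitMap (hσ : ScottContinuous σ) :
    Intertwines (ind E hσ 0) σ (unitMap σ) := fun a => HTensor.clm_ext fun u h => by
  rw [ContinuousLinearMap.comp_apply, ind_htens_zero, ContinuousLinearMap.comp_apply,
    unitMap_htens, unitMap_htens]

lemma idTensorH_htens (hσ : ScottContinuous σ) {T : HTensor E σ k →L[ℂ] H}
    (hT : Intertwines (ind E hσ k) σ T) : IsIdTensorH T (idTensorH T) := by
  have h : ∃ S, IsIdTensorH T S := by
    refine ⟨mapRight E (ind E hσ k) σ 1 T ∘L (Split.cons M E k).V hσ, fun ξ u h => ?_⟩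
    rw [ContinuousLinearMap.comp_apply, Split.V_htens, mapRight_htens hT]
    rfl
  rw [idTensorH, dif_pos h]
  exact h.choose_spec

lemma idTensorH_eq (hσ : ScottContinuous σ) {T : HTensor E σ k →L[ℂ] H}
    (hT : Intertwines (ind E hσ k) σ T) :
    idTensorH T = mapRight E (ind E hσ k) σ 1 T ∘L (Split.cons M E k).V hσ :=
  HTensor.clm_ext fun u h => by
    rw [ContinuousLinearMap.comp_apply, Split.V_htens, mapRight_htens hT]
    conv_lhs => rw [← Fin.cons_self_tail u]
    exact idTensorH_htens hσ hT _ _ _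

lemma intertwines_tensorialPow (hσ : ScottContinuous σ) (hz : z ∈ intertwiners E σ) (k : ℕ) :
    Intertwines (ind E hσ k) σ (tensorialPow z k) := by
  induction k with
  | zero => exact intertwines_unitMap hσ
  | succ k ih =>
    rw [tensorialPow, idTensorH_eq hσ ih]
    exact (intertwines_of_mem_intertwiners hσ hz).comp
      ((intertwines_mapRight ih (ind_normal hσ k) hσ).comp
        fun a => (Split.cons M E k).V_comp_ind hσ a)

lemma tensorialPow_htens (hσ : ScottContinuous σ) (hz : z ∈ intertwiners E σ) (w : Fin k → E)
    (h : H) : tensorialPow z k (htens σ w h) =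
      (List.ofFn w).foldr (fun ξ x => z (htens σ ![ξ] x)) h := by
  induction k with
  | zero => exact unitMap_htens σ w h
  | succ k ih =>
    rw [List.ofFn_succ, List.foldr_cons]
    conv_lhs => rw [← Fin.cons_self_tail w]
    rw [tensorialPow, ContinuousLinearMap.comp_apply,
      idTensorH_htens hσ (intertwines_tensorialPow hσ hz k), ih]
    rfl

/-- On elementary tensors z^{(k)} is a right fold of the maps x ↦ z(ξ ⊗ x), and a fold over a
concatenation factors. -/
lemma tensorialPow_add (hσ : ScottContinuous σ) (hz : z ∈ intertwiners E σ) :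
    tensorialPow z (k + l) = tensorialPow z k ∘L
      mapRight E (ind E hσ l) σ k (tensorialPow z l) ∘L (Split.append M E k l).V hσ :=
  HTensor.clm_ext fun w h => by
    rw [ContinuousLinearMap.comp_apply, ContinuousLinearMap.comp_apply, Split.V_htens,
      mapRight_htens (intertwines_tensorialPow hσ hz l), tensorialPow_htens hσ hz,
      tensorialPow_htens hσ hz, tensorialPow_htens hσ hz, ← List.foldr_append,
      ← List.ofFn_fin_append]
    congr 2
    funext i
    refine Fin.addCases (fun i => ?_) (fun i => ?_) i
    · rw [Fin.append_left]; rfl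
    · rw [Fin.append_right]; rfl

end TensorialPow

/-! ### The maps a ↦ z^{(k)}(S ⊗ a)z^{(k)*} -/

section CpTerm

variable {z : HTensor E σ 1 →L[ℂ] H}

lemma cpTerm_eq (hσ : ScottContinuous σ) (z : HTensor E σ 1 →L[ℂ] H) (S : Endo M E k)
    {a : H →L[ℂ] H} (ha : Intertwines σ σ a) : cpTerm z S a = tensorialPow z k ∘L
      (amp hσ k S ∘L mapRight E σ σ k a) ∘L ContinuousLinearMap.adjoint (tensorialPow z k) := by
  rw [cpTerm, tensorOp_eq hσ S ha]

lemma cpTerm_cast (h : k = l) (S : Endo M E k) (a : H →L[ℂ] H) :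
    cpTerm z (h ▸ S : Endo M E l) a = cpTerm z S a := by
  subst h
  rfl

lemma intertwines_cpTerm (hσ : ScottContinuous σ) (hz : z ∈ intertwiners E σ) {S : Endo M E k}
    (hS : S ∈ relCommutant M E k) {a : H →L[ℂ] H} (ha : Intertwines σ σ a) :
    Intertwines σ σ (cpTerm z S a) := by
  rw [cpTerm_eq hσ z S ha]
  have hT := intertwines_tensorialPow hσ hz k
  exact hT.comp (((intertwines_amp hσ hS).comp (intertwines_mapRight ha hσ hσ)).comp hT.adjoint)

/-- Write z^{(k+l)} = z^{(k)}(1 ⊗ z^{(l)})V. Moving A ⊗ 1 to the left past 1 ⊗ z^{(l)} leaves 1 ⊗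
z^{(l)}(B ⊗ a)z^{(l)*} in the middle. Tensor words thereby become iterated maps. -/
lemma cpTerm_tensor (hσ : ScottContinuous σ) (hz : z ∈ intertwiners E σ) (A : Endo M E k)
    {B : Endo M E l} (hB : B ∈ relCommutant M E l) {a : H →L[ℂ] H} (ha : Intertwines σ σ a) :
    cpTerm z (tensor A B) a = cpTerm z A (cpTerm z B a) := by
  set V := (Split.append M E k l).V hσ with hV
  set T := tensorialPow z l with hTdef
  have hT : Intertwines (ind E hσ l) σ T := intertwines_tensorialPow hσ hz l
  have hBi := intertwines_amp hσ hB
  have hai := intertwines_mapRight (E := E) (k := l) ha hσ hσ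
  rw [cpTerm_eq hσ z _ ha, cpTerm_eq hσ z A (intertwines_cpTerm hσ hz hB ha),
    cpTerm_eq hσ z B ha, tensor_eq A hB, tensorialPow_add hσ hz, ← hV, ← hTdef,
    ContinuousLinearMap.adjoint_comp, ContinuousLinearMap.adjoint_comp, adjoint_mapRight hT,
    mapRight_comp hT ((hBi.comp hai).comp hT.adjoint),
    mapRight_comp (hBi.comp hai) hT.adjoint, mapRight_comp hBi hai]
  have h1 := (Split.append M E k l).V_comp_amp_tensor hσ A hB
  have h2 := (Split.append M E k l).V_comp_mapRight hσ ha
  have h3 := (Split.append M E k l).V_comp_adjoint hσ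
  have h4 := mapRight_comp_amp hT (ind_normal (E := E) hσ l) hσ A
  rw [← hV] at h1 h2 h3
  set Q := tensorialPow z k
  set R := mapRight E (ind E hσ l) σ k T
  set R' := mapRight E σ (ind E hσ l) k (ContinuousLinearMap.adjoint T)
  set V' := ContinuousLinearMap.adjoint V
  set Q' := ContinuousLinearMap.adjoint Q
  set A' := amp (ind_normal (E := E) hσ l) k A
  set B' := mapRight E (ind E hσ l) (ind E hσ l) k (amp hσ l B)
  set a' := mapRight E (ind E hσ l) (ind E hσ l) k (mapRight E σ σ l a)
  set C := amp hσ (k + l) ((Split.append M E k l).tensor A B)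
  set c := mapRight E σ σ (k + l) a
  calc (Q ∘L R ∘L V) ∘L (C ∘L c) ∘L (V' ∘L R') ∘L Q'
      = Q ∘L R ∘L (V ∘L C) ∘L c ∘L V' ∘L R' ∘L Q' := rfl
    _ = Q ∘L R ∘L ((A' ∘L B') ∘L V) ∘L c ∘L V' ∘L R' ∘L Q' := by rw [h1]
    _ = Q ∘L (R ∘L A') ∘L B' ∘L (V ∘L c) ∘L V' ∘L R' ∘L Q' := rfl
    _ = Q ∘L (amp hσ k A ∘L R) ∘L B' ∘L (a' ∘L V) ∘L V' ∘L R' ∘L Q' := by rw [h2, h4]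
    _ = Q ∘L (amp hσ k A ∘L R) ∘L B' ∘L a' ∘L (V ∘L V') ∘L R' ∘L Q' := rfl
    _ = Q ∘L (amp hσ k A ∘L R) ∘L B' ∘L a' ∘L 1 ∘L R' ∘L Q' := by rw [h3]
    _ = Q ∘L (amp hσ k A ∘L R ∘L (B' ∘L a') ∘L R') ∘L Q' := rfl

lemma cpTerm_add_left (hσ : ScottContinuous σ) (S S' : Endo M E k) {a : H →L[ℂ] H}
    (ha : Intertwines σ σ a) : cpTerm z (S + S') a = cpTerm z S a + cpTerm z S' a := by
  rw [cpTerm_eq hσ z _ ha, cpTerm_eq hσ z _ ha, cpTerm_eq hσ z _ ha, amp_add,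
    ContinuousLinearMap.add_comp, ContinuousLinearMap.add_comp, ContinuousLinearMap.comp_add]

lemma cpTerm_zero_left (hσ : ScottContinuous σ) {a : H →L[ℂ] H} (ha : Intertwines σ σ a) :
    cpTerm z (0 : Endo M E k) a = 0 := by
  rw [cpTerm_eq hσ z _ ha, amp_zero, ContinuousLinearMap.zero_comp, ContinuousLinearMap.zero_comp,
    ContinuousLinearMap.comp_zero]

lemma cpTerm_sum_left (hσ : ScottContinuous σ) {ι : Type*} (s : Finset ι) (S : ι → Endo M E k)
    {a : H →L[ℂ] H} (ha : Intertwines σ σ a) :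
    cpTerm z (∑ i ∈ s, S i) a = ∑ i ∈ s, cpTerm z (S i) a := by
  classical
  induction s using Finset.induction_on with
  | empty => rw [Finset.sum_empty, Finset.sum_empty, cpTerm_zero_left hσ ha]
  | insert i s hi ih => rw [Finset.sum_insert hi, Finset.sum_insert hi, cpTerm_add_left hσ _ _ ha, ih]

lemma cpTerm_add_right (hσ : ScottContinuous σ) (S : Endo M E k) {a b : H →L[ℂ] H}
    (ha : Intertwines σ σ a) (hb : Intertwines σ σ b) :
    cpTerm z S (a + b) = cpTerm z S a + cpTerm z S b := by
  rw [cpTerm_eq hσ z _ (ha.add hb), cpTerm_eq hσ z _ ha, cpTerm_eq hσ z _ hb, mapRight_add ha hb,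
    ContinuousLinearMap.comp_add, ContinuousLinearMap.add_comp, ContinuousLinearMap.comp_add]

lemma cpTerm_smul_right (hσ : ScottContinuous σ) (S : Endo M E k) {a : H →L[ℂ] H}
    (ha : Intertwines σ σ a) (c : ℂ) : cpTerm z S (c • a) = c • cpTerm z S a := by
  rw [cpTerm_eq hσ z _ (ha.smul c), cpTerm_eq hσ z _ ha, mapRight_smul ha,
    ContinuousLinearMap.comp_smul, ContinuousLinearMap.smul_comp, ContinuousLinearMap.comp_smul]

lemma cpTerm_one_zero (hσ : ScottContinuous σ) {a : H →L[ℂ] H} (ha : Intertwines σ σ a) :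
    cpTerm z (1 : Endo M E 0) a = a := by
  rw [cpTerm_eq hσ z _ ha, amp_one]
  ext h
  let u : Fin 0 → E := ![]
  have h1 : ContinuousLinearMap.adjoint (unitMap σ) h = htens σ u h :=
    HTensor.ext_inner fun v g => by
      rw [ContinuousLinearMap.adjoint_inner_right, unitMap_htens, inner_htens]
      change _ = inner ℂ g (σ 1 h)
      rw [map_one]
      rfl
  change unitMap σ (mapRight E σ σ 0 a (ContinuousLinearMap.adjoint (unitMap σ) h)) = a h
  rw [h1, mapRight_htens ha, unitMap_htens]

/-- For `S ≥ 0` the map `a ↦ z^{(k)} (S ⊗ a) z^{(k)*}` has a Stinespring form. -/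
lemma exists_cpTerm_eq_conj (hσ : ScottContinuous σ) (z : HTensor E σ 1 →L[ℂ] H) {S : Endo M E k}
    (hS : 0 ≤ S) : ∃ Q : HTensor E σ k →L[ℂ] H, ∀ a, Intertwines σ σ a →
      cpTerm z S a = Q ∘L mapRight E σ σ k a ∘L ContinuousLinearMap.adjoint Q := by
  set B := CFC.sqrt S with hB
  have hBB : B * B = S := CFC.sqrt_mul_sqrt_self S hS
  have hBs : star B = B := IsSelfAdjoint.of_nonneg (CFC.sqrt_nonneg S)
  refine ⟨tensorialPow z k ∘L amp hσ k B, fun a ha => ?_⟩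
  have h1 := mapRight_comp_amp ha hσ hσ B
  have h2 : ContinuousLinearMap.adjoint (amp hσ k B) = amp hσ k B := by
    rw [← ContinuousLinearMap.star_eq_adjoint, ← amp_star, hBs]
  have h3 : amp hσ k S = amp hσ k B ∘L amp hσ k B := by rw [← hBB, amp_mul]; rfl
  rw [cpTerm_eq hσ z S ha, ContinuousLinearMap.adjoint_comp, h2, h3]
  set Q := tensorialPow z k
  set Q' := ContinuousLinearMap.adjoint Q
  set b := amp hσ k B
  set a' := mapRight E σ σ k a
  calc Q ∘L ((b ∘L b) ∘L a') ∘L Q' = (Q ∘L b) ∘L (b ∘L a') ∘L Q' := rfl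
    _ = (Q ∘L b) ∘L (a' ∘L b) ∘L Q' := by rw [h1]

end CpTerm

end WStar

namespace WStar

open Filter Topology WStarCorrespondence TensPow

/-! ### Sums over compositions and the lower bound S_{k+1} ≥ c(I_E ⊗ S_k) -/

section Compositions

/-- Splits off the first block, j + 1. The summand is a function of the list of blocks, so that no
transport between degrees enters the bijection. -/
lemma sum_composition_succ {A : Type*} [AddCommMonoid A] (F : List ℕ → A) (n : ℕ) :
    ∑ c : Composition (n + 1), F c.blocks =
      ∑ j ∈ Finset.range (n + 1), ∑ c : Composition (n - j), F ((j + 1) :: c.blocks) := by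
  classical
  rw [Finset.sum_sigma']
  symm
  refine Finset.sum_bij (fun (p : (j : ℕ) × Composition (n - j)) hp =>
    (⟨(p.1 + 1) :: p.2.blocks, fun {i} hi => ?_, ?_⟩ : Composition (n + 1)))
    (fun _ _ => Finset.mem_univ _) ?_ ?_ (fun _ _ => rfl)
  · rcases List.mem_cons.mp hi with rfl | hi
    · exact Nat.succ_pos _
    · exact p.2.blocks_pos hi
  · have : p.1 < n + 1 := Finset.mem_range.mp (Finset.mem_sigma.mp hp).1
    rw [List.sum_cons, p.2.blocks_sum]
    omega
  · rintro ⟨i, c⟩ _ ⟨j, d⟩ _ h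
    have h' := congrArg Composition.blocks h
    simp only [List.cons.injEq] at h'
    obtain rfl : i = j := by omega
    exact congrArg _ (Composition.ext h'.2)
  · rintro ⟨w, hw, hs⟩ -
    cases w with
    | nil => simp at hs
    | cons i w =>
      have hi : 0 < i := hw List.mem_cons_self
      rw [List.sum_cons] at hs
      refine ⟨⟨i - 1, ⟨w, fun h => hw (List.mem_cons_of_mem _ h), by omega⟩⟩, ?_, ?_⟩
      · simp only [Finset.mem_sigma, Finset.mem_range, Finset.mem_univ, and_true]
        omega
      · ext1
        change (i - 1 + 1) :: w = i :: w
        rw [Nat.sub_add_cancel hi]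

lemma sum_composition_zero {A : Type*} [AddCommMonoid A] (F : List ℕ → A) :
    ∑ c : Composition 0, F c.blocks = F [] := by
  rw [Finset.sum_congr rfl fun (c : Composition 0) _ => congrArg F
    (List.length_eq_zero_iff.mp (c.length_eq_zero.mpr rfl)), Finset.sum_const, Finset.card_univ,
    composition_card]
  exact one_smul ℕ _

end Compositions

variable {M E : Type u} [CStarAlgebra M] [PartialOrder M] [StarOrderedRing M] [WStarAlgebra M]
  [NormedAddCommGroup E] [NormedSpace ℂ E] [CompleteSpace E] [Module M E] [Module Mᵐᵒᵖ E]
  [WStarCorrespondence M E] {X Z : (k : ℕ) → Endo M E k} {k : ℕ}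

lemma IsAdmissible.nonneg (hX : IsAdmissible X) {k : ℕ} (hk : 1 ≤ k) : 0 ≤ X k :=
  (isPos_iff _).mp (hX.pos k hk)

section CompositionSum

lemma wordTensor_mem_nonneg (hX : IsAdmissible X) (w : List ℕ) (hw : ∀ i ∈ w, 1 ≤ i) :
    wordTensor X w ∈ relCommutant M E w.sum ∧ 0 ≤ wordTensor X w := by
  induction w with
  | nil =>
    have h1 : (0 : Endo M E 0) ≤ 1 := zero_le_one
    exact ⟨one_mem_relCommutant, h1⟩
  | cons i w ih =>
    have hi := hw i List.mem_cons_self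
    obtain ⟨h1, h2⟩ := ih fun j hj => hw j (List.mem_cons_of_mem _ hj)
    change tensor (X i) (wordTensor X w) ∈ relCommutant M E (i + w.sum) ∧
      0 ≤ tensor (X i) (wordTensor X w)
    rw [tensor_eq _ h1]
    exact ⟨Split.tensor_mem _ _ (hX.mem i hi) h1, Split.tensor_nonneg _ (hX.nonneg hi) h2 h1⟩

lemma cast_mem_nonneg {m n : ℕ} (h : m = n) {A : Endo M E m}
    (hA : A ∈ relCommutant M E m ∧ 0 ≤ A) :
    (h ▸ A : Endo M E n) ∈ relCommutant M E n ∧ 0 ≤ (h ▸ A : Endo M E n) := by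
  subst h
  exact hA

lemma compositionSum_summand (hX : IsAdmissible X) (c : Composition k) :
    (c.blocks_sum ▸ wordTensor X c.blocks : Endo M E k) ∈ relCommutant M E k ∧
      0 ≤ (c.blocks_sum ▸ wordTensor X c.blocks : Endo M E k) :=
  cast_mem_nonneg c.blocks_sum (wordTensor_mem_nonneg hX c.blocks fun _ hi => c.one_le_blocks hi)

lemma compositionSum_mem (hX : IsAdmissible X) (k : ℕ) :
    compositionSum X k ∈ relCommutant M E k :=
  sum_mem_relCommutant _ fun c _ => (compositionSum_summand hX c).1

lemma compositionSum_nonneg (hX : IsAdmissible X) (k : ℕ) : 0 ≤ compositionSum X k :=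
  Finset.sum_nonneg fun c _ => (compositionSum_summand hX c).2

/-- `wordTensor X w` moved to the degree `k`, and `0` if `w` does not have the sum `k`. -/
def wordTensorAt (X : (k : ℕ) → Endo M E k) (k : ℕ) (w : List ℕ) : Endo M E k :=
  if h : w.sum = k then h ▸ wordTensor X w else 0

lemma compositionSum_eq (X : (k : ℕ) → Endo M E k) (k : ℕ) :
    compositionSum X k = ∑ c : Composition k, wordTensorAt X k c.blocks :=
  Finset.sum_congr rfl fun c _ => by rw [wordTensorAt, dif_pos c.blocks_sum]

lemma compositionSum_zero (X : (k : ℕ) → Endo M E k) : compositionSum X 0 = 1 := by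
  rw [compositionSum_eq, sum_composition_zero, wordTensorAt, dif_pos (List.sum_nil)]
  rfl

lemma cast_tensor_cast (A : Endo M E 1) {m : ℕ} (B : Endo M E m)
    (hB : B ∈ relCommutant M E m) (h : m = k) (h' : 1 + m = k + 1) :
    (h' ▸ tensor A B : Endo M E (k + 1)) = (Split.cons M E k).tensor A (h ▸ B) := by
  subst h
  exact cast_tensor_one_eq A hB h'

/-- The left side collects the compositions of k + 1 with first block 1; all the other words
contribute positive operators. -/
lemma tensor_compositionSum_le (hX : IsAdmissible X) (k : ℕ) :
    (Split.cons M E k).tensor (X 1) (compositionSum X k) ≤ compositionSum X (k + 1) := by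
  rw [compositionSum_eq X (k + 1), sum_composition_succ, Finset.sum_range_succ',
    compositionSum, Split.tensor_sum_right _ _ _ fun c _ => (compositionSum_summand hX c).1]
  have h0 : ∑ c : Composition k, (Split.cons M E k).tensor (X 1)
      (c.blocks_sum ▸ wordTensor X c.blocks) =
      ∑ c : Composition (k - 0), wordTensorAt X (k + 1) ((0 + 1) :: c.blocks) := by
    refine Finset.sum_congr rfl fun c _ => ?_
    have h1 : ((0 + 1) :: c.blocks).sum = k + 1 := by
      rw [List.sum_cons, c.blocks_sum]; omega
    rw [wordTensorAt, dif_pos h1]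
    exact (cast_tensor_cast (X 1) (wordTensor X c.blocks)
      (wordTensor_mem_nonneg hX _ fun _ hi => c.one_le_blocks hi).1 c.blocks_sum h1).symm
  rw [h0]
  refine le_add_of_nonneg_left (Finset.sum_nonneg fun j hj => Finset.sum_nonneg fun c _ => ?_)
  have hj' := Finset.mem_range.mp hj
  have h1 : ((j + 1 + 1) :: c.blocks).sum = k + 1 := by
    rw [List.sum_cons, c.blocks_sum]; omega
  rw [wordTensorAt, dif_pos h1]
  refine (cast_mem_nonneg h1 (wordTensor_mem_nonneg hX _ fun i hi => ?_)).2
  rcases List.mem_cons.mp hi with rfl | hi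
  · omega
  · exact c.one_le_blocks hi

/-- A positive invertible element has its spectrum bounded away from 0. The zero algebra is
separated because spectra are empty there. -/
lemma exists_pos_smul_one_le (hX : IsAdmissible X) :
    ∃ c : ℝ, 0 < c ∧ (c : ℂ) • (1 : Endo M E 1) ≤ X 1 := by
  cases subsingleton_or_nontrivial (Endo M E 1) with
  | inl h => exact ⟨1, one_pos, (Subsingleton.elim _ _).le⟩
  | inr h0 =>
    have h : IsStrictlyPositive (X 1) := ⟨hX.nonneg le_rfl, hX.isUnit⟩
    obtain ⟨c, hc, hle⟩ := (CFC.exists_pos_algebraMap_le_iff h.isSelfAdjoint).2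
      fun x hx => h.spectrum_pos hx
    refine ⟨c, hc, ?_⟩
    rwa [IsScalarTower.algebraMap_apply ℝ ℂ (Endo M E 1), Algebra.algebraMap_eq_smul_one] at hle

lemma smul_idTensor_compositionSum_le (hX : IsAdmissible X) {c : ℝ}
    (hc : (c : ℂ) • (1 : Endo M E 1) ≤ X 1) (k : ℕ) :
    (c : ℂ) • idTensor (compositionSum X k) ≤ compositionSum X (k + 1) := by
  have hm := compositionSum_mem hX k
  rw [idTensor_eq hm, ← Split.tensor_smul_left _ _ _ hm]
  exact (Split.tensor_mono_left _ hc (compositionSum_nonneg hX k) hm).trans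
    (tensor_compositionSum_le hX k)

end CompositionSum

section IdTensor

lemma idTensor_mem {A : Endo M E k} (hA : A ∈ relCommutant M E k) :
    idTensor A ∈ relCommutant M E (k + 1) := by
  rw [idTensor_eq hA]
  exact Split.tensor_mem _ _ one_mem_relCommutant hA

lemma idTensor_mul {A B : Endo M E k} (hA : A ∈ relCommutant M E k) (hB : B ∈ relCommutant M E k) :
    idTensor (A * B) = idTensor A * idTensor B := by
  rw [idTensor_eq hA, idTensor_eq hB, idTensor_eq (mul_mem_relCommutant hA hB),
    Split.tensor_mul _ _ _ hA hB, one_mul]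

lemma idTensor_one : idTensor (1 : Endo M E k) = 1 := by
  rw [idTensor_eq one_mem_relCommutant, Split.tensor_one]

lemma isUnit_idTensor {A : Endo M E k} (hA : A ∈ relCommutant M E k) (hu : IsUnit A) :
    IsUnit (idTensor A) := by
  rw [idTensor_eq hA]
  obtain ⟨h1, h2⟩ := (Split.cons M E k).tensor_one_inverse hA hu
  exact ⟨⟨_, _, h1, h2⟩, rfl⟩

lemma idTensor_nonneg {A : Endo M E k} (hA : A ∈ relCommutant M E k) (h : 0 ≤ A) :
    0 ≤ idTensor A := by
  rw [idTensor_eq hA]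
  exact Split.tensor_nonneg _ zero_le_one h hA

lemma star_idTensor {A : Endo M E k} (hA : A ∈ relCommutant M E k) :
    star (idTensor A) = idTensor (star A) := by
  rw [idTensor_eq hA, idTensor_eq (star_mem_relCommutant hA), Split.star_tensor _ _ hA, star_one]

end IdTensor

lemma isStrictlyPositive_compositionSum (hX : IsAdmissible X) (k : ℕ) :
    IsStrictlyPositive (compositionSum X k) := by
  induction k with
  | zero =>
    rw [compositionSum_zero]
    exact ⟨zero_le_one, isUnit_one⟩
  | succ k ih =>
    obtain ⟨c, hc, hle⟩ := exists_pos_smul_one_le hX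
    have hm := compositionSum_mem hX k
    refine IsStrictlyPositive.of_le ?_ (smul_idTensor_compositionSum_le hX hle k)
    refine ⟨smul_nonneg (by exact_mod_cast hc.le) (idTensor_nonneg hm ih.nonneg), ?_⟩
    have hc' : IsUnit (c : ℂ) := isUnit_iff_ne_zero.mpr (by exact_mod_cast hc.ne')
    rw [Algebra.smul_def]
    exact (hc'.map (algebraMap ℂ (Endo M E (k + 1)))).mul (isUnit_idTensor hm ih.isUnit)

/-! ### The canonical weight sequence and its boundedness -/

section Weight

/-- The square root of `compositionSum X k`. -/
def rootSum (X : (k : ℕ) → Endo M E k) (k : ℕ) : Endo M E k := CFC.sqrt (compositionSum X k)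

lemma isStrictlyPositive_rootSum (hX : IsAdmissible X) (k : ℕ) :
    IsStrictlyPositive (rootSum X k) :=
  (isStrictlyPositive_compositionSum hX k).sqrt

lemma rootSum_mul_self (hX : IsAdmissible X) (k : ℕ) :
    rootSum X k * rootSum X k = compositionSum X k :=
  CFC.sqrt_mul_sqrt_self _ (compositionSum_nonneg hX k)

lemma rootSum_mem (hX : IsAdmissible X) (k : ℕ) : rootSum X k ∈ relCommutant M E k :=
  sqrt_mem_relCommutant (compositionSum_mem hX k)

lemma rootSum_zero (X : (k : ℕ) → Endo M E k) : rootSum X 0 = 1 := by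
  rw [rootSum, compositionSum_zero, CFC.sqrt_one]

/-- The inverse of the square root of `compositionSum X k`. -/
def invRootSum (X : (k : ℕ) → Endo M E k) (k : ℕ) : Endo M E k := Ring.inverse (rootSum X k)

lemma isStrictlyPositive_invRootSum (hX : IsAdmissible X) (k : ℕ) :
    IsStrictlyPositive (invRootSum X k) :=
  (isStrictlyPositive_rootSum hX k).ringInverse

lemma invRootSum_mem (hX : IsAdmissible X) (k : ℕ) : invRootSum X k ∈ relCommutant M E k :=
  inverse_mem_relCommutant (rootSum_mem hX k)

lemma rootSum_mul_invRootSum (hX : IsAdmissible X) (k : ℕ) :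
    rootSum X k * invRootSum X k = 1 :=
  Ring.mul_inverse_cancel _ (isStrictlyPositive_rootSum hX k).isUnit

lemma invRootSum_mul_rootSum (hX : IsAdmissible X) (k : ℕ) :
    invRootSum X k * rootSum X k = 1 :=
  Ring.inverse_mul_cancel _ (isStrictlyPositive_rootSum hX k).isUnit

lemma ringInverse_invRootSum (hX : IsAdmissible X) (k : ℕ) :
    Ring.inverse (invRootSum X k) = rootSum X k := by
  rw [invRootSum]
  obtain ⟨v, hv⟩ := (isStrictlyPositive_rootSum hX k).isUnit
  rw [← hv, Ring.inverse_unit, Ring.inverse_unit, inv_inv]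

/-- The weight sequence with `R_k² = compositionSum X k`. -/
def canonicalWeight (X : (k : ℕ) → Endo M E k) : (k : ℕ) → Endo M E k
  | 0 => 1
  | k + 1 => invRootSum X (k + 1) * idTensor (rootSum X k)

/-- The product telescopes, since (I_E ⊗ R_k)(I_E ⊗ R_k⁻¹) = 1. -/
lemma weightPow_canonicalWeight (hX : IsAdmissible X) (k : ℕ) :
    weightPow (canonicalWeight X) k = invRootSum X k := by
  induction k with
  | zero => rw [invRootSum, rootSum_zero, Ring.inverse_one]; rfl
  | succ k ih =>
    rw [weightPow, ih, canonicalWeight, mul_assoc,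
      ← idTensor_mul (rootSum_mem hX k) (invRootSum_mem hX k), rootSum_mul_invRootSum hX k,
      idTensor_one, mul_one]

lemma invWeight_canonicalWeight (hX : IsAdmissible X) (k : ℕ) :
    invWeight (canonicalWeight X) k = rootSum X k := by
  rw [invWeight, weightPow_canonicalWeight hX, ringInverse_invRootSum hX]

lemma norm_one_le : ‖(1 : Endo M E k)‖ ≤ 1 := ContinuousLinearMap.norm_id_le

lemma norm_conj_le_one {W T S : Endo M E k} (hW : star W = W) (hT : 0 ≤ T) (hTS : T ≤ S)
    (h : W * S * W = 1) : ‖W * T * W‖ ≤ 1 := by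
  have h1 := star_left_conjugate_nonneg hT W
  have h2 := star_left_conjugate_le_conjugate hTS W
  rw [hW] at h1 h2
  rw [h] at h2
  exact (CStarAlgebra.norm_le_norm_of_nonneg_of_le h1 h2).trans norm_one_le

/-- Here Z_{k+1}Z_{k+1}^* = R_{k+1}⁻¹(I_E ⊗ S_k)R_{k+1}⁻¹. Conjugating c(I_E ⊗ S_k) ≤ S_{k+1} by
R_{k+1}⁻¹ turns the right side into 1. -/
lemma norm_canonicalWeight_le (hX : IsAdmissible X) {c : ℝ} (hc : 0 < c)
    (hle : (c : ℂ) • (1 : Endo M E 1) ≤ X 1) (k : ℕ) :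
    ‖canonicalWeight X (k + 1)‖ ^ 2 ≤ c⁻¹ := by
  have hs := smul_idTensor_compositionSum_le hX hle k
  have hn := idTensor_nonneg (compositionSum_mem hX k) (compositionSum_nonneg hX k)
  have hR2 := rootSum_mul_self hX (k + 1)
  have hRW := rootSum_mul_invRootSum hX (k + 1)
  have hWR := invRootSum_mul_rootSum hX (k + 1)
  have hWs : star (invRootSum X (k + 1)) = invRootSum X (k + 1) :=
    IsSelfAdjoint.of_nonneg (isStrictlyPositive_invRootSum hX (k + 1)).nonneg
  have hRs : star (rootSum X k) = rootSum X k :=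
    IsSelfAdjoint.of_nonneg (isStrictlyPositive_rootSum hX k).nonneg
  have hm := rootSum_mem hX k
  have h1 : canonicalWeight X (k + 1) * star (canonicalWeight X (k + 1)) =
      invRootSum X (k + 1) * idTensor (compositionSum X k) * invRootSum X (k + 1) := by
    rw [canonicalWeight, star_mul, star_idTensor hm, hRs, hWs, mul_assoc,
      ← mul_assoc (idTensor _), ← idTensor_mul hm hm, rootSum_mul_self hX k, mul_assoc]
  generalize canonicalWeight X (k + 1) = Y at h1 ⊢
  generalize invRootSum X (k + 1) = W at *
  generalize rootSum X (k + 1) = R at *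
  generalize compositionSum X (k + 1) = S' at *
  generalize idTensor (compositionSum X k) = T at *
  have h3 : W * S' * W = 1 := by
    rw [← hR2, ← mul_assoc, hWR, one_mul, hRW]
  have h4 := norm_conj_le_one hWs
    (smul_nonneg (show (0 : ℂ) ≤ c by exact_mod_cast hc.le) hn) hs h3
  rw [mul_smul_comm, smul_mul_assoc, ← h1, norm_smul, CStarRing.norm_self_mul_star,
    Complex.norm_real, Real.norm_of_nonneg hc.le] at h4
  rw [sq, inv_eq_one_div, le_div_iff₀' hc]
  exact h4

lemma canonicalWeight_mem (hX : IsAdmissible X) (k : ℕ) :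
    canonicalWeight X k ∈ relCommutant M E k := by
  cases k with
  | zero => exact one_mem_relCommutant
  | succ k =>
    exact mul_mem_relCommutant (invRootSum_mem hX (k + 1)) (idTensor_mem (rootSum_mem hX k))

lemma isWeightSequence_canonicalWeight (hX : IsAdmissible X) :
    IsWeightSequence (canonicalWeight X) where
  mem := canonicalWeight_mem hX
  zero := rfl
  bdd := by
    obtain ⟨c, hc, hle⟩ := exists_pos_smul_one_le hX
    refine ⟨max 1 √c⁻¹, ?_⟩
    rintro _ ⟨k, rfl⟩
    cases k with
    | zero => exact norm_one_le.trans (le_max_left _ _)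
    | succ k =>
      exact le_max_of_le_right (Real.le_sqrt_of_sq_le (norm_canonicalWeight_le hX hc hle k))
  isUnit k := by
    cases k with
    | zero => exact isUnit_one
    | succ k =>
      exact (isStrictlyPositive_invRootSum hX (k + 1)).isUnit.mul
        (isUnit_idTensor (rootSum_mem hX k) (isStrictlyPositive_rootSum hX k).isUnit)

lemma weightPow_mem (hZ : IsWeightSequence Z) (k : ℕ) : weightPow Z k ∈ relCommutant M E k := by
  induction k with
  | zero => exact one_mem_relCommutant
  | succ k ih => exact mul_mem_relCommutant (hZ.mem _) (idTensor_mem ih)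

lemma isUnit_weightPow (hZ : IsWeightSequence Z) (k : ℕ) : IsUnit (weightPow Z k) := by
  induction k with
  | zero => exact isUnit_one
  | succ k ih => exact (hZ.isUnit _).mul (isUnit_idTensor (weightPow_mem hZ k) ih)

/-- Z_{k+1} is recovered from Z^{(k+1)} = Z_{k+1}(I_E ⊗ Z^{(k)}) by cancelling the invertible second
factor. -/
lemma eq_of_weightPow_eq {Z' : (k : ℕ) → Endo M E k} (hZ : IsWeightSequence Z)
    (hZ' : IsWeightSequence Z') (h : ∀ k, weightPow Z k = weightPow Z' k) : Z = Z' := by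
  funext k
  cases k with
  | zero => rw [hZ.zero, hZ'.zero]
  | succ k =>
    have h1 := h (k + 1)
    rw [weightPow, weightPow, h k] at h1
    exact (isUnit_idTensor (weightPow_mem hZ' k) (isUnit_weightPow hZ' k)).mul_right_cancel h1

/-- The inverse of a positive invertible operator is positive, so R_k is the unique positive square
root of R_k². -/
lemma weightPow_eq_of_invWeight_mul_self (hZ : IsWeightSequence Z) {k : ℕ}
    (hpos : 0 ≤ weightPow Z k) {S : Endo M E k} (h : invWeight Z k * invWeight Z k = S) :
    weightPow Z k = Ring.inverse (CFC.sqrt S) := by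
  have h1 : IsStrictlyPositive (weightPow Z k) := ⟨hpos, isUnit_weightPow hZ k⟩
  rw [CFC.sqrt_unique h h1.ringInverse.nonneg, invWeight]
  obtain ⟨v, hv⟩ := h1.isUnit
  rw [← hv, Ring.inverse_unit, Ring.inverse_unit, inv_inv]

end Weight

end WStar

namespace WStar

open Filter Topology WStarCorrespondence TensPow

/-! ### A renewal theorem in ordered normed groups -/

section Renewal

variable {A : Type*} [NormedAddCommGroup A] [PartialOrder A] [IsOrderedAddMonoid A]
  [OrderClosedTopology A]

/-- A renewal equation `s_{n+1} = ∑_{j ≤ n} φ_j(s_{n-j})` with positive kernel `φ` of norm less than one: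
if `t - ∑ φ_j(t) = s_0`, then `∑ s_n = t`. -/
theorem hasSum_renewal (K : AddSubgroup A) (hmono : ∀ x y : A, 0 ≤ x → x ≤ y → ‖x‖ ≤ ‖y‖)
    (φ : ℕ → A → A) (hK : ∀ j, ∀ x ∈ K, φ j x ∈ K)
    (hadd : ∀ j, ∀ x ∈ K, ∀ y ∈ K, φ j (x + y) = φ j x + φ j y)
    (hpos : ∀ j, ∀ x ∈ K, 0 ≤ x → 0 ≤ φ j x) {r : ℝ} (hr : r < 1)
    (hnorm : ∀ (F : Finset ℕ), ∀ x ∈ K, 0 ≤ x → ‖∑ j ∈ F, φ j x‖ ≤ r * ‖x‖)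
    {s : ℕ → A} {t : A} (hsK : s 0 ∈ K) (hs0 : 0 ≤ s 0)
    (hs : ∀ n, s (n + 1) = ∑ j ∈ Finset.range (n + 1), φ j (s (n - j)))
    (htK : t ∈ K) (ht0 : 0 ≤ t) (ht : HasSum (fun j => φ j t) (t - s 0)) : HasSum s t := by
  have hφ0 : ∀ j, φ j 0 = 0 := fun j => by
    have := hadd j 0 K.zero_mem 0 K.zero_mem
    rw [add_zero] at this
    exact left_eq_add.mp this
  have hsub : ∀ j, ∀ x ∈ K, ∀ y ∈ K, φ j (x - y) = φ j x - φ j y := fun j x hx y hy => by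
    have := hadd j (x - y) (K.sub_mem hx hy) y hy
    rw [sub_add_cancel] at this
    rw [this, add_sub_cancel_right]
  have hφm : ∀ j, ∀ x ∈ K, ∀ y ∈ K, x ≤ y → φ j x ≤ φ j y := fun j x hx y hy hxy => by
    have := hpos j (y - x) (K.sub_mem hy hx) (sub_nonneg.mpr hxy)
    rwa [hsub j y hy x hx, sub_nonneg] at this
  have hsn : ∀ n, s n ∈ K ∧ 0 ≤ s n := fun n => by
    induction n using Nat.strong_induction_on with
    | _ n ih =>
      cases n with
      | zero => exact ⟨hsK, hs0⟩
      | succ n =>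
        rw [hs]
        exact ⟨K.sum_mem fun j _ => hK j _ (ih _ (by omega)).1,
          Finset.sum_nonneg fun j _ => hpos j _ (ih _ (by omega)).1 (ih _ (by omega)).2⟩
  set P : ℕ → A := fun N => ∑ n ∈ Finset.range N, s n with hP
  have hPK : ∀ N, P N ∈ K := fun N => K.sum_mem fun n _ => (hsn n).1
  have hPs : ∀ N, P (N + 1) = P N + s N := fun N => Finset.sum_range_succ _ _
  have hP0 : P 0 = 0 := Finset.sum_range_zero _
  -- The recursion summed over n. The term j = N is missing because P 0 = 0.
  have hP1 : ∀ N, P (N + 1) = s 0 + ∑ j ∈ Finset.range N, φ j (P (N - j)) := fun N => by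
    induction N with
    | zero => rw [hPs, hP0, zero_add, Finset.sum_range_zero, add_zero]
    | succ N ih =>
      have h1 : ∑ j ∈ Finset.range N, φ j (P (N - j)) =
          ∑ j ∈ Finset.range (N + 1), φ j (P (N - j)) := by
        rw [Finset.sum_range_succ, Nat.sub_self, hP0, hφ0, add_zero]
      rw [hPs (N + 1), ih, hs, h1, add_assoc, ← Finset.sum_add_distrib]
      congr 1
      refine Finset.sum_congr rfl fun j hj => ?_
      have : N + 1 - j = N - j + 1 := by
        have := Finset.mem_range.mp hj
        omega
      rw [← hadd j _ (hPK _) _ (hsn _).1, ← hPs, this]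
  set D : ℕ → A := fun N => t - P N with hD
  have hDK : ∀ N, D N ∈ K := fun N => K.sub_mem htK (hPK N)
  -- τ is the tail of the series for t - s 0; the error D = t - P then obeys the same recursion with
  -- τ as a positive source.
  set τ : ℕ → A := fun N => (t - s 0) - ∑ j ∈ Finset.range N, φ j t with hτ
  have hτ0 : ∀ N, 0 ≤ τ N := fun N =>
    sub_nonneg.mpr (sum_le_hasSum _ (fun j _ => hpos j t htK ht0) ht)
  have hD1 : ∀ N, D (N + 1) = ∑ j ∈ Finset.range N, φ j (D (N - j)) + τ N := fun N => by
    simp only [hD, hτ]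
    rw [hP1, Finset.sum_congr rfl fun j _ => hsub j t htK (P (N - j)) (hPK _),
      Finset.sum_sub_distrib]
    abel
  have hD0 : ∀ N, 0 ≤ D N := fun N => by
    induction N using Nat.strong_induction_on with
    | _ N ih =>
      cases N with
      | zero => simpa only [hD, hP0, sub_zero] using ht0
      | succ N =>
        rw [hD1]
        exact add_nonneg (Finset.sum_nonneg fun j _ => hpos j _ (hDK _) (ih _ (by omega))) (hτ0 N)
  have hDa : Antitone D := antitone_nat_of_succ_le fun N => by
    simp only [hD, hPs]
    exact sub_le_sub_left (le_add_of_nonneg_right (hsn N).2) t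
  have hDt : ∀ N, D N ≤ t := fun N => by
    have := hDa (Nat.zero_le N)
    simpa only [hD, hP0, sub_zero] using this
  -- Cut the sum at m. For j < m replace D (N - j) by the larger D (N - m); for j ≥ m replace it by
  -- t, and these terms together with τ N make up τ m.
  have hbound : ∀ m N, m ≤ N → ‖D (N + 1)‖ ≤ r * ‖D (N - m)‖ + ‖τ m‖ := fun m N hm => by
    have h1 : D (N + 1) ≤ ∑ j ∈ Finset.range m, φ j (D (N - m)) + τ m := by
      rw [hD1, ← Finset.sum_range_add_sum_Ico _ hm, add_assoc]
      refine add_le_add (Finset.sum_le_sum fun j hj => hφm j _ (hDK _) _ (hDK _) (hDa ?_)) ?_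
      · have := Finset.mem_range.mp hj
        omega
      · refine (add_le_add_left (Finset.sum_le_sum fun j _ =>
          hφm j _ (hDK (N - j)) _ htK (hDt _)) _).trans_eq ?_
        simp only [hτ]
        rw [← Finset.sum_range_add_sum_Ico _ hm]
        abel
    exact (hmono _ _ (hD0 _) h1).trans ((norm_add_le _ _).trans
      (add_le_add_left (hnorm _ _ (hDK _) (hD0 _)) _))
  have hna : Antitone fun N => ‖D N‖ := fun m n h => hmono _ _ (hD0 n) (hDa h)
  have hlim := tendsto_atTop_ciInf hna ⟨0, by rintro _ ⟨n, rfl⟩; exact norm_nonneg _⟩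
  set d : ℝ := ⨅ N, ‖D N‖
  have hd0 : 0 ≤ d := ge_of_tendsto' hlim fun N => norm_nonneg _
  have hdm : ∀ m, d ≤ r * d + ‖τ m‖ := fun m => by
    have h1 : Tendsto (fun N => ‖D (N + m + 1)‖) atTop (𝓝 d) :=
      hlim.comp (tendsto_add_atTop_nat (m + 1))
    have h2 : Tendsto (fun N => r * ‖D N‖ + ‖τ m‖) atTop (𝓝 (r * d + ‖τ m‖)) :=
      (hlim.const_mul r).add_const _
    refine le_of_tendsto_of_tendsto' h1 h2 fun N => ?_
    have := hbound m (N + m) (Nat.le_add_left _ _)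
    rwa [Nat.add_sub_cancel] at this
  have hτl : Tendsto (fun m => ‖τ m‖) atTop (𝓝 0) := by
    have := (tendsto_const_nhds (x := t - s 0)).sub ht.tendsto_sum_nat
    rw [sub_self] at this
    simpa only [norm_zero] using this.norm
  -- Letting N and then m tend to infinity gives d ≤ r·d for the limit d of the error norms, and r <
  -- 1.
  have hd : d = 0 := by
    have : d ≤ r * d := by
      have := ge_of_tendsto' ((tendsto_const_nhds (x := r * d)).add hτl) hdm
      rwa [add_zero] at this
    nlinarith
  rw [hd] at hlim
  rw [HasSum, SummationFilter.unconditional_filter, Metric.tendsto_atTop]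
  intro ε hε
  obtain ⟨N, hN⟩ := (hlim.eventually (gt_mem_nhds hε)).exists
  -- For every finite F containing range N one has 0 ≤ t - ∑_F s ≤ D N, so the convergence is
  -- unconditional.
  refine ⟨Finset.range N, fun F hF => lt_of_le_of_lt ?_ hN⟩
  rw [dist_comm, dist_eq_norm]
  refine hmono _ _ (sub_nonneg.mpr ?_) (sub_le_sub_left ?_ t)
  · obtain ⟨n, hn⟩ := F.exists_nat_subset_range
    exact (Finset.sum_le_sum_of_subset_of_nonneg hn fun i _ _ => (hsn i).2).trans
      (sub_nonneg.mp (hD0 n))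
  · exact Finset.sum_le_sum_of_subset_of_nonneg hF fun i _ _ => (hsn i).2

end Renewal

variable {M E : Type u} [CStarAlgebra M] [PartialOrder M] [StarOrderedRing M] [WStarAlgebra M]
  [NormedAddCommGroup E] [NormedSpace ℂ E] [CompleteSpace E] [Module M E] [Module Mᵐᵒᵖ E]
  [WStarCorrespondence M E]
  {H : Type u} [NormedAddCommGroup H] [InnerProductSpace ℂ H] [CompleteSpace H]
  {σ : M →⋆ₐ[ℂ] (H →L[ℂ] H)} {k : ℕ} {z : HTensor E σ 1 →L[ℂ] H}

/-! ### Positivity and norm estimates for series of completely positive maps -/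

section Positivity

lemma isClosed_commutant (σ : M →⋆ₐ[ℂ] (H →L[ℂ] H)) :
    IsClosed (commutant σ : Set (H →L[ℂ] H)) := Set.isClosed_centralizer _

instance (σ : M →⋆ₐ[ℂ] (H →L[ℂ] H)) : CompleteSpace (commutant σ) :=
  (isClosed_commutant σ).completeSpace_coe

lemma sqrt_mem_commutant {a : H →L[ℂ] H} (ha : a ∈ commutant σ) :
    CFC.sqrt a ∈ commutant σ := by
  rw [StarSubalgebra.mem_centralizer_iff] at ha ⊢
  intro b hb
  obtain ⟨h1, h2⟩ := ha b hb
  exact ⟨(Commute.cfcₙ_nnreal (show Commute a b from h1.symm) _).symm,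
    (Commute.cfcₙ_nnreal (show Commute a (star b) from h2.symm) _).symm⟩

lemma mapRight_nonneg {a : H →L[ℂ] H} (ha : a ∈ commutant σ) (h0 : 0 ≤ a) :
    0 ≤ mapRight E σ σ k a := by
  have hb := intertwines_of_mem_commutant (sqrt_mem_commutant ha)
  have hbs : ContinuousLinearMap.adjoint (CFC.sqrt a) = CFC.sqrt a :=
    IsSelfAdjoint.of_nonneg (CFC.sqrt_nonneg a)
  have h1 : CFC.sqrt a ∘L CFC.sqrt a = a := CFC.sqrt_mul_sqrt_self a h0
  have h2 := mapRight_comp (E := E) (k := k) hb.adjoint hb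
  rw [← adjoint_mapRight hb, hbs, h1] at h2
  rw [h2]
  exact star_mul_self_nonneg (mapRight E σ σ k (CFC.sqrt a))

lemma cpTerm_nonneg (hσ : ScottContinuous σ) {S : Endo M E k} (hS : 0 ≤ S) {a : H →L[ℂ] H}
    (ha : a ∈ commutant σ) (h0 : 0 ≤ a) : 0 ≤ cpTerm z S a := by
  obtain ⟨Q, hQ⟩ := exists_cpTerm_eq_conj hσ z hS
  rw [hQ a (intertwines_of_mem_commutant ha), op_nonneg_iff]
  intro h
  rw [ContinuousLinearMap.comp_apply, ← ContinuousLinearMap.adjoint_inner_left]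
  exact op_nonneg_iff.mp (mapRight_nonneg ha h0) _

lemma sum_inner_cpTerm_nonneg (hσ : ScottContinuous σ) {S : Endo M E k} (hS : 0 ≤ S) {n : ℕ}
    (a : Fin n → commutant σ) (h : Fin n → H) :
    0 ≤ ∑ i, ∑ j, inner ℂ (h i) (cpTerm z S ((star (a i) * a j : commutant σ) : H →L[ℂ] H) (h j)) := by
  obtain ⟨Q, hQ⟩ := exists_cpTerm_eq_conj hσ z hS
  have ha : ∀ i, Intertwines σ σ (a i : H →L[ℂ] H) := fun i =>
    intertwines_of_mem_commutant (a i).2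
  let y : Fin n → HTensor E σ k := fun j =>
    mapRight E σ σ k (a j : H →L[ℂ] H) (ContinuousLinearMap.adjoint Q (h j))
  have key : ∀ i j, inner ℂ (h i) (cpTerm z S ((star (a i) * a j : commutant σ) : H →L[ℂ] H) (h j)) =
      inner ℂ (y i) (y j) := fun i j => by
    have h1 : Intertwines σ σ (ContinuousLinearMap.adjoint (a i : H →L[ℂ] H) ∘L (a j : H →L[ℂ] H)) :=
      (ha i).adjoint.comp (ha j)
    have h2 : ((star (a i) * a j : commutant σ) : H →L[ℂ] H) =
      ContinuousLinearMap.adjoint (a i : H →L[ℂ] H) ∘L (a j : H →L[ℂ] H) := rfl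
    rw [h2, hQ _ h1, mapRight_comp (ha i).adjoint (ha j), ← adjoint_mapRight (ha i),
      ContinuousLinearMap.comp_apply, ← ContinuousLinearMap.adjoint_inner_left,
      ContinuousLinearMap.comp_apply, ContinuousLinearMap.comp_apply,
      ContinuousLinearMap.adjoint_inner_right]
  simp_rw [key]
  rw [← ofReal_norm_sum_sq]
  exact Complex.zero_le_real.mpr (sq_nonneg _)

/-- In the form Q_i(1 ⊗ a)Q_i^* the Cauchy–Schwarz inequality bounds ⟨h, Tg⟩ by ‖a‖ times the roots
of ∑‖Q_i^*h‖² and ∑‖Q_i^*g‖², and ∑‖Q_i^*h‖² = ⟨h, Bh⟩ is the value at a = 1. Norm convergence at 1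
therefore implies it at every a. -/
lemma norm_sum_cpTerm_le (hσ : ScottContinuous σ) (z : HTensor E σ 1 →L[ℂ] H) {ι : Type*}
    (F : Finset ι) {k : ι → ℕ} {S : ∀ i, Endo M E (k i)} (hS : ∀ i, 0 ≤ S i) {a : H →L[ℂ] H}
    (ha : Intertwines σ σ a) :
    ‖∑ i ∈ F, cpTerm z (S i) a‖ ≤ ‖a‖ * ‖∑ i ∈ F, cpTerm z (S i) 1‖ := by
  choose Q hQ using fun i => exists_cpTerm_eq_conj hσ z (hS i)
  set B := ∑ i ∈ F, cpTerm z (S i) 1 with hB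
  set T := ∑ i ∈ F, cpTerm z (S i) a with hT
  let q : ι → H → ℝ := fun i h => ‖ContinuousLinearMap.adjoint (Q i) h‖
  have h1 : ∀ h, ∑ i ∈ F, q i h ^ 2 ≤ ‖B‖ * ‖h‖ ^ 2 := fun h => by
    have e : ((∑ i ∈ F, q i h ^ 2 : ℝ) : ℂ) = inner ℂ h (B h) := by
      rw [hB, sum_apply, inner_sum]
      push_cast
      refine Finset.sum_congr rfl fun i _ => ?_
      rw [hQ i 1 intertwines_one, mapRight_one, ContinuousLinearMap.comp_apply,
        ← ContinuousLinearMap.adjoint_inner_left]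
      exact (inner_self_eq_norm_sq_to_K (𝕜 := ℂ) (ContinuousLinearMap.adjoint (Q i) h)).symm
    have e2 : ∑ i ∈ F, q i h ^ 2 = ‖(inner ℂ h (B h) : ℂ)‖ := by
      rw [← e, Complex.norm_real, Real.norm_of_nonneg (Finset.sum_nonneg fun i _ => sq_nonneg _)]
    rw [e2]
    calc ‖(inner ℂ h (B h) : ℂ)‖ ≤ ‖h‖ * ‖B h‖ := norm_inner_le_norm _ _
      _ ≤ ‖h‖ * (‖B‖ * ‖h‖) := by gcongr; exact B.le_opNorm h
      _ = ‖B‖ * ‖h‖ ^ 2 := by ring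
  have h2 : ∀ h g, ‖(inner ℂ h (T g) : ℂ)‖ ≤ ‖a‖ * (‖B‖ * (‖h‖ * ‖g‖)) := fun h g => by
    have e1 : ∀ i, ‖(inner ℂ h (cpTerm z (S i) a g) : ℂ)‖ ≤ ‖a‖ * (q i h * q i g) := fun i => by
      rw [hQ i a ha, ContinuousLinearMap.comp_apply, ← ContinuousLinearMap.adjoint_inner_left]
      refine (norm_inner_le_norm _ _).trans ?_
      have := (mapRight E σ σ (k i) a).le_of_opNorm_le (norm_mapRight_le ha)
        (ContinuousLinearMap.adjoint (Q i) g)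
      calc _ ≤ q i h * (‖a‖ * q i g) := mul_le_mul_of_nonneg_left this (norm_nonneg _)
        _ = _ := by ring
    calc ‖(inner ℂ h (T g) : ℂ)‖ ≤ ∑ i ∈ F, ‖a‖ * (q i h * q i g) := by
          rw [hT, sum_apply, inner_sum]
          exact (norm_sum_le _ _).trans (Finset.sum_le_sum fun i _ => e1 i)
      _ = ‖a‖ * ∑ i ∈ F, q i h * q i g := (Finset.mul_sum _ _ _).symm
      _ ≤ ‖a‖ * (√(∑ i ∈ F, q i h ^ 2) * √(∑ i ∈ F, q i g ^ 2)) := by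
          gcongr
          exact Real.sum_mul_le_sqrt_mul_sqrt _ _ _
      _ ≤ ‖a‖ * (√(‖B‖ * ‖h‖ ^ 2) * √(‖B‖ * ‖g‖ ^ 2)) := by
          gcongr
          · exact h1 h
          · exact h1 g
      _ = ‖a‖ * (‖B‖ * (‖h‖ * ‖g‖)) := by
          rw [Real.sqrt_mul (norm_nonneg _), Real.sqrt_mul (norm_nonneg _),
            Real.sqrt_sq (norm_nonneg _), Real.sqrt_sq (norm_nonneg _), mul_mul_mul_comm,
            Real.mul_self_sqrt (norm_nonneg _)]
  refine ContinuousLinearMap.opNorm_le_bound _ (by positivity) fun g => ?_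
  have h3 := h2 (T g) g
  rw [inner_self_eq_norm_sq_to_K] at h3
  have h4 : ‖T g‖ * ‖T g‖ ≤ ‖T g‖ * (‖a‖ * ‖B‖ * ‖g‖) := by
    have : ‖((‖T g‖ : ℂ)) ^ 2‖ = ‖T g‖ * ‖T g‖ := by
      rw [norm_pow, Complex.norm_real, norm_norm, sq]
    calc ‖T g‖ * ‖T g‖ ≤ ‖a‖ * (‖B‖ * (‖T g‖ * ‖g‖)) := by rw [← this]; exact h3
      _ = _ := by ring
  rcases (norm_nonneg (T g)).eq_or_lt with h0 | h0
  · rw [← h0]; positivity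
  · exact le_of_mul_le_mul_left h4 h0

end Positivity

end WStar

/-! ### Existence: the potential on the disc -/

namespace WStar

open Filter Topology WStarCorrespondence TensPow

variable {M E : Type u} [CStarAlgebra M] [PartialOrder M] [StarOrderedRing M] [WStarAlgebra M]
  [NormedAddCommGroup E] [NormedSpace ℂ E] [CompleteSpace E] [Module M E] [Module Mᵐᵒᵖ E]
  [WStarCorrespondence M E]
  {H : Type u} [NormedAddCommGroup H] [InnerProductSpace ℂ H] [CompleteSpace H]
  {σ : M →⋆ₐ[ℂ] (H →L[ℂ] H)} {k : ℕ} {z : HTensor E σ 1 →L[ℂ] H}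

/-- A series of maps `a ↦ z^{(k)} (S ⊗ a) z^{(k)*}` with `S ≥ 0` that converges at `1` converges
everywhere, to a completely positive map. -/
lemma exists_clm_of_hasSum_cpTerm (hσ : ScottContinuous σ) (hz : z ∈ intertwiners E σ)
    {k : ℕ → ℕ} {S : ∀ i, Endo M E (k i)} (hS : ∀ i, 0 ≤ S i)
    (hSc : ∀ i, S i ∈ relCommutant M E (k i)) {T : H →L[ℂ] H}
    (hT : HasSum (fun i => cpTerm z (S i) 1) T) :
    ∃ Φ : commutant σ →L[ℂ] commutant σ,
      (∀ a : commutant σ, HasSum (fun i => cpTerm z (S i) (a : H →L[ℂ] H)) (Φ a : H →L[ℂ] H)) ∧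
        ‖Φ‖ ≤ ‖T‖ ∧ IsCompletelyPositive Φ := by
  have hi : ∀ a : commutant σ, Intertwines σ σ (a : H →L[ℂ] H) := fun a =>
    intertwines_of_mem_commutant a.2
  have hsum : ∀ a : commutant σ, Summable fun i => cpTerm z (S i) (a : H →L[ℂ] H) := fun a => by
    rw [summable_iff_vanishing_norm]
    intro ε hε
    obtain ⟨s, hs⟩ := (summable_iff_vanishing_norm.mp hT.summable) (ε / (‖a‖ + 1)) (by positivity)
    refine ⟨s, fun F hF => (norm_sum_cpTerm_le hσ z F hS (hi a)).trans_lt ?_⟩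
    have h1 := hs F hF
    rw [lt_div_iff₀ (by positivity)] at h1
    calc ‖(a : H →L[ℂ] H)‖ * ‖∑ i ∈ F, cpTerm z (S i) 1‖
        ≤ ‖∑ i ∈ F, cpTerm z (S i) 1‖ * (‖a‖ + 1) := by
          rw [mul_comm]
          exact mul_le_mul_of_nonneg_left (le_add_of_nonneg_right zero_le_one) (norm_nonneg _)
      _ < ε := h1
  have hmem : ∀ a : commutant σ, ∑' i, cpTerm z (S i) (a : H →L[ℂ] H) ∈ commutant σ := fun a =>
    (isClosed_commutant σ).mem_of_tendsto (hsum a).hasSum (Eventually.of_forall fun F =>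
      sum_mem fun i _ => mem_commutant_of_intertwines (intertwines_cpTerm hσ hz (hSc i) (hi a)))
  have hbound : ∀ a : commutant σ, ‖∑' i, cpTerm z (S i) (a : H →L[ℂ] H)‖ ≤ ‖T‖ * ‖a‖ := fun a => by
    refine le_of_tendsto_of_tendsto' (hsum a).hasSum.norm (hT.norm.mul_const ‖a‖) fun F => ?_
    rw [mul_comm]
    exact norm_sum_cpTerm_le hσ z F hS (hi a)
  let Φ₀ : commutant σ →ₗ[ℂ] commutant σ :=
    { toFun := fun a => ⟨∑' i, cpTerm z (S i) (a : H →L[ℂ] H), hmem a⟩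
      map_add' := fun a b => Subtype.ext ((((hsum a).hasSum.add (hsum b).hasSum).congr_fun
        fun i => (cpTerm_add_right hσ (S i) (hi a) (hi b))).tsum_eq)
      map_smul' := fun c a => Subtype.ext ((((hsum a).hasSum.const_smul c).congr_fun
        fun i => (cpTerm_smul_right hσ (S i) (hi a) c)).tsum_eq) }
  let Φ : commutant σ →L[ℂ] commutant σ := Φ₀.mkContinuous ‖T‖ hbound
  have hΦ : ∀ a : commutant σ,
      HasSum (fun i => cpTerm z (S i) (a : H →L[ℂ] H)) (Φ a : H →L[ℂ] H) := fun a => (hsum a).hasSum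
  refine ⟨Φ, hΦ, Φ₀.mkContinuous_norm_le (norm_nonneg T) hbound, fun n a h => ?_⟩
  have h1 : HasSum (fun l => ∑ i, ∑ j,
      inner ℂ (h i) (cpTerm z (S l) ((star (a i) * a j : commutant σ) : H →L[ℂ] H) (h j)))
      (∑ i, ∑ j, inner ℂ (h i) ((Φ (star (a i) * a j) : H →L[ℂ] H) (h j))) := by
    refine hasSum_sum fun i _ => hasSum_sum fun j _ => ?_
    exact (hΦ (star (a i) * a j)).mapL
      ((innerSL ℂ (h i)).comp (ContinuousLinearMap.apply ℂ H (h j)))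
  exact h1.nonneg fun l => sum_inner_cpTerm_nonneg hσ (hS l) a h

variable {X : (k : ℕ) → Endo M E k}

lemma cpTerm_compositionSum (hσ : ScottContinuous σ) {a : H →L[ℂ] H} (ha : Intertwines σ σ a)
    (X : (k : ℕ) → Endo M E k) (k : ℕ) : cpTerm z (compositionSum X k) a =
      ∑ c : Composition k, cpTerm z (wordTensor X c.blocks) a := by
  rw [compositionSum, cpTerm_sum_left hσ _ _ ha]
  exact Finset.sum_congr rfl fun c _ => cpTerm_cast c.blocks_sum _ _

lemma cpTerm_sum_right (hσ : ScottContinuous σ) (S : Endo M E k) {ι : Type*} (s : Finset ι)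
    {a : ι → H →L[ℂ] H} (ha : ∀ i, Intertwines σ σ (a i)) :
    cpTerm z S (∑ i ∈ s, a i) = ∑ i ∈ s, cpTerm z S (a i) := by
  classical
  have h0 : Intertwines σ σ (0 : H →L[ℂ] H) :=
    intertwines_of_mem_commutant (zero_mem (commutant σ))
  have hs : ∀ s : Finset ι, Intertwines σ σ (∑ i ∈ s, a i) := fun s =>
    intertwines_of_mem_commutant (sum_mem fun i _ => mem_commutant_of_intertwines (ha i))
  induction s using Finset.induction_on with
  | empty =>
    rw [Finset.sum_empty, Finset.sum_empty]
    have := cpTerm_smul_right (z := z) hσ S h0 0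
    rwa [zero_smul, zero_smul] at this
  | insert i s hi ih =>
    rw [Finset.sum_insert hi, Finset.sum_insert hi, cpTerm_add_right hσ S (ha i) (hs s), ih]

/-- The renewal equation: the first block j + 1 of a composition of n + 1 acts as the outer map, by
`cpTerm_tensor`, and the rest is a composition of n - j. -/
lemma cpTerm_compositionSum_succ (hX : IsAdmissible X) (hσ : ScottContinuous σ)
    (hz : z ∈ intertwiners E σ) {a : H →L[ℂ] H} (ha : Intertwines σ σ a) (n : ℕ) :
    cpTerm z (compositionSum X (n + 1)) a = ∑ j ∈ Finset.range (n + 1),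
      cpTerm z (X (j + 1)) (cpTerm z (compositionSum X (n - j)) a) := by
  have hw : ∀ {m : ℕ} (c : Composition m), wordTensor X c.blocks ∈ relCommutant M E _ :=
    fun c => (wordTensor_mem_nonneg hX c.blocks fun _ hi => c.one_le_blocks hi).1
  rw [cpTerm_compositionSum hσ ha, sum_composition_succ fun w => cpTerm z (wordTensor X w) a]
  refine Finset.sum_congr rfl fun j _ => ?_
  rw [cpTerm_compositionSum hσ ha, cpTerm_sum_right hσ _ _ fun c =>
    intertwines_cpTerm hσ hz (hw c) ha]
  exact Finset.sum_congr rfl fun c _ => cpTerm_tensor hσ hz _ (hw c) ha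

lemma four_smul_eq_polarization {A : Type*} [Ring A] [StarRing A] [Algebra ℂ A] [StarModule ℂ A]
    (a : A) : (4 : ℂ) • a = star (a + 1) * (a + 1) - star (a - 1) * (a - 1) +
      Complex.I • (star (a + Complex.I • 1) * (a + Complex.I • 1)) -
      Complex.I • (star (a - Complex.I • 1) * (a - Complex.I • 1)) := by
  simp only [star_add, star_sub, star_smul, star_one, Complex.star_def, Complex.conj_I, mul_add,
    add_mul, mul_sub, sub_mul, smul_mul_assoc, mul_smul_comm, one_mul, mul_one, smul_add, smul_sub,
    smul_smul]
  match_scalars <;> ring_nf <;> norm_num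

/-- The potential of the prepotential is the sum of `z^{(k)} (S_k ⊗ a) z^{(k)*}`, where `S_k` is the sum
over all compositions of `k`. -/
theorem exists_potential (hX : IsAdmissible X) (hσ : ScottContinuous σ) (hz : z ∈ disc X σ) :
    ∃ Φ Θ : commutant σ →L[ℂ] commutant σ, IsPrepotential X z Φ ∧
      (∀ a : commutant σ, HasSum (fun k => cpTerm z (compositionSum X k) (a : H →L[ℂ] H))
        (Θ a : H →L[ℂ] H)) ∧
      IsCompletelyPositive Φ ∧ IsCompletelyPositive Θ ∧ IsPotential Θ Φ := by
  obtain ⟨hz, T, hT, hT1⟩ := hz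
  have hX0 : ∀ j, 0 ≤ X (j + 1) := fun j => hX.nonneg (Nat.le_add_left 1 j)
  have hXc : ∀ j, X (j + 1) ∈ relCommutant M E (j + 1) := fun j => hX.mem _ (Nat.le_add_left 1 j)
  obtain ⟨Φ, hΦ, hΦT, hΦcp⟩ := exists_clm_of_hasSum_cpTerm hσ hz hX0 hXc hT
  have hΦ1 : ‖Φ‖ < 1 := hΦT.trans_lt hT1
  let Θ : commutant σ →L[ℂ] commutant σ := ∑' l : ℕ, Φ ^ l
  have hΘs : HasSum (fun l : ℕ => Φ ^ l) Θ := (summable_geometric_of_norm_lt_one hΦ1).hasSum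
  have hΘ1 : (1 - Φ) * Θ = 1 := mul_neg_geom_series Φ hΦ1
  have hΘ2 : Θ * (1 - Φ) = 1 := geom_series_mul_neg Φ hΦ1
  have hTe : ‖T‖ < 1 := hT1
  have hΦpos : ∀ a : commutant σ, 0 ≤ (a : H →L[ℂ] H) → 0 ≤ (Φ a : H →L[ℂ] H) := fun a ha =>
    (hΦ a).nonneg fun j => cpTerm_nonneg hσ (hX0 j) a.2 ha
  have hΘpos : ∀ a : commutant σ, 0 ≤ (a : H →L[ℂ] H) → 0 ≤ (Θ a : H →L[ℂ] H) := fun a ha => by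
    have h1 : HasSum (fun l : ℕ => ((Φ ^ l) a : H →L[ℂ] H)) (Θ a : H →L[ℂ] H) :=
      (hΘs.mapL (ContinuousLinearMap.apply ℂ (commutant σ) a)).map
        (commutant σ).subtype continuous_subtype_val
    refine h1.nonneg fun l => ?_
    induction l with
    | zero => exact ha
    | succ l ih =>
      rw [pow_succ']
      exact hΦpos _ ih
  have hpart : ∀ F : Finset ℕ, ‖∑ j ∈ F, cpTerm z (X (j + 1)) 1‖ ≤ ‖T‖ := fun F =>
    CStarAlgebra.norm_le_norm_of_nonneg_of_le
      (Finset.sum_nonneg fun j _ => cpTerm_nonneg hσ (hX0 j) (one_mem _) zero_le_one)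
      (sum_le_hasSum F (fun j _ => cpTerm_nonneg hσ (hX0 j) (one_mem _) zero_le_one) hT)
  -- The renewal theorem with limit t = Θ(a); its hypothesis on t is Θ(a) - a = Φ(Θ(a)). The maps
  -- are additive only on σ(M)', which is therefore the subgroup used.
  have hren : ∀ a : commutant σ, 0 ≤ (a : H →L[ℂ] H) →
      HasSum (fun k => cpTerm z (compositionSum X k) (a : H →L[ℂ] H)) (Θ a : H →L[ℂ] H) :=
    fun a ha => by
    have hai := intertwines_of_mem_commutant a.2
    have hs0 : cpTerm z (compositionSum X 0) (a : H →L[ℂ] H) = a := by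
      rw [compositionSum_zero, cpTerm_one_zero hσ hai]
    refine hasSum_renewal (commutant σ).toSubalgebra.toSubmodule.toAddSubgroup
      (fun x y h0 h => CStarAlgebra.norm_le_norm_of_nonneg_of_le h0 h)
      (fun j x => cpTerm z (X (j + 1)) x)
      (fun j x hx => mem_commutant_of_intertwines
        (intertwines_cpTerm hσ hz (hXc j) (intertwines_of_mem_commutant hx)))
      (fun j x hx y hy => cpTerm_add_right hσ _ (intertwines_of_mem_commutant hx)
        (intertwines_of_mem_commutant hy))
      (fun j x hx h0 => cpTerm_nonneg hσ (hX0 j) hx h0) hT1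
      (fun F x hx _ => ?_) ?_ ?_ (fun n => cpTerm_compositionSum_succ hX hσ hz hai n)
      (Θ a).2 (hΘpos a ha) ?_
    · rw [mul_comm]
      exact (norm_sum_cpTerm_le hσ z F hX0 (intertwines_of_mem_commutant hx)).trans
        (mul_le_mul_of_nonneg_left (hpart F) (norm_nonneg _))
    · rw [hs0]
      exact a.2
    · rw [hs0]
      exact ha
    · rw [hs0]
      have h1 := congrArg (fun Ψ : commutant σ →L[ℂ] commutant σ => Ψ a) hΘ1
      have h2 : (Θ a : H →L[ℂ] H) - Φ (Θ a) = a := congrArg Subtype.val h1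
      have h3 : (Θ a : H →L[ℂ] H) - a = Φ (Θ a) :=
        sub_eq_iff_eq_add.mpr (sub_eq_iff_eq_add'.mp h2)
      rw [h3]
      exact hΦ (Θ a)
  -- Convergence at 1 gives convergence at every a, to a completely positive map Ψ. It agrees with Θ
  -- on the elements b*b, and these span.
  have hone := hren 1 zero_le_one
  obtain ⟨Ψ, hΨ, -, hΨcp⟩ := exists_clm_of_hasSum_cpTerm hσ hz
    (fun k => compositionSum_nonneg hX k) (fun k => compositionSum_mem hX k) hone
  have hΨΘ : Ψ = Θ := by
    have h1 : ∀ b : commutant σ, Ψ (star b * b) = Θ (star b * b) := fun b =>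
      Subtype.ext ((hΨ (star b * b)).unique (hren _ (star_mul_self_nonneg (b : H →L[ℂ] H))))
    refine ContinuousLinearMap.ext fun a => ?_
    have h4 : Ψ ((4 : ℂ) • a) = Θ ((4 : ℂ) • a) := by
      rw [four_smul_eq_polarization]
      simp only [map_add, map_sub, map_smul, h1]
    rw [map_smul, map_smul] at h4
    exact smul_right_injective _ four_ne_zero h4
  exact ⟨Φ, Θ, hΦ, hΨΘ ▸ hΨ, hΦcp, hΨΘ ▸ hΨcp, hΘs, hΘ1, hΘ2⟩

theorem isCanonicalWeight_canonicalWeight (hX : IsAdmissible X) :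
    IsCanonicalWeight X (canonicalWeight X) := by
  have hR : ∀ k, invWeight (canonicalWeight X) k * invWeight (canonicalWeight X) k =
      compositionSum X k := fun k => by
    rw [invWeight_canonicalWeight hX, rootSum_mul_self hX]
  refine ⟨isWeightSequence_canonicalWeight hX, canonicalWeight_mem hX, fun m _ => ?_, ?_, ?_⟩
  · rw [weightPow_canonicalWeight hX, isPos_iff]
    exact (isStrictlyPositive_invRootSum hX m).nonneg
  · intro H _ _ _ σ hσ z hz
    obtain ⟨Φ, Θ, -, hΘ, -⟩ := exists_potential hX hσ hz
    simp_rw [hR]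
    exact (hΘ 1).summable
  · intro H _ _ _ σ hσ z hz
    obtain ⟨Φ, Θ, hΦ, hΘ, h⟩ := exists_potential hX hσ hz
    refine ⟨Φ, Θ, hΦ, fun a => ?_, h⟩
    simp_rw [hR]
    exact hΘ a

end WStar

namespace WStar

open Filter Topology WStarCorrespondence TensPow

/-! ### Finite direct sums of representations -/

section DirectSum

variable (K : ℕ → Type u) [∀ n, NormedAddCommGroup (K n)] [∀ n, InnerProductSpace ℂ (K n)]
  [∀ n, CompleteSpace (K n)]

/-- `ι` are the inclusions of a direct sum `G = K 0 ⊕ ⋯ ⊕ K N`. -/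
structure IsDirectSum {G : Type u} [NormedAddCommGroup G] [InnerProductSpace ℂ G] [CompleteSpace G]
    (N : ℕ) (ι : ∀ n, K n →L[ℂ] G) : Prop where
  adjoint_comp_self : ∀ n ≤ N, ContinuousLinearMap.adjoint (ι n) ∘L ι n = 1
  adjoint_comp_of_ne : ∀ m n, m ≠ n → ContinuousLinearMap.adjoint (ι m) ∘L ι n = 0
  eq_zero_of_lt : ∀ n, N < n → ι n = 0
  sum_comp_adjoint :
    ∑ n ∈ Finset.range (N + 1), ι n ∘L ContinuousLinearMap.adjoint (ι n) = 1

theorem exists_isDirectSum (N : ℕ) : ∃ (G : Type u) (_ : NormedAddCommGroup G)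
    (_ : InnerProductSpace ℂ G) (_ : CompleteSpace G) (ι : ∀ n, K n →L[ℂ] G),
    IsDirectSum K N ι := by
  classical
  let G := PiLp 2 fun i : Fin (N + 1) => K i
  let p : ∀ i : Fin (N + 1), G →L[ℂ] K i := fun i =>
    PiLp.proj (𝕜 := ℂ) 2 (fun i : Fin (N + 1) => K i) i
  have hp : ∀ i x, ContinuousLinearMap.adjoint (p i) x =
      PiLp.single 2 (β := fun i : Fin (N + 1) => K i) i x := fun i x =>
    ext_inner_left ℂ fun y => by
      rw [ContinuousLinearMap.adjoint_inner_right, PiLp.inner_apply,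
        Finset.sum_eq_single i (fun j _ hj => by
          rw [PiLp.single_eq_of_ne 2 hj, inner_zero_right]) (by simp), PiLp.single_eq_same]
      rfl
  -- Indexed by all n, with value 0 beyond N, so that the shift can raise degrees without a bound
  -- check.
  let ι : ∀ n, K n →L[ℂ] G := fun n =>
    if h : n < N + 1 then ContinuousLinearMap.adjoint (p ⟨n, h⟩) else 0
  have hι : ∀ n (h : n < N + 1), ι n = ContinuousLinearMap.adjoint (p ⟨n, h⟩) := fun n h =>
    dif_pos h
  have hι0 : ∀ n, N < n → ι n = 0 := fun n h => dif_neg (by omega)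
  refine ⟨G, inferInstance, inferInstance, inferInstance, ι, ⟨fun n hn => ?_, fun m n hmn => ?_,
    hι0, ?_⟩⟩
  · rw [hι n (Nat.lt_succ_of_le hn), ContinuousLinearMap.adjoint_adjoint]
    ext x
    rw [ContinuousLinearMap.comp_apply, hp]
    exact PiLp.single_eq_same 2 _ _
  · by_cases hm : m < N + 1
    · by_cases hn : n < N + 1
      · rw [hι m hm, hι n hn, ContinuousLinearMap.adjoint_adjoint]
        ext x
        rw [ContinuousLinearMap.comp_apply, hp]
        exact PiLp.single_eq_of_ne 2 (β := fun i : Fin (N + 1) => K i) (i := ⟨n, hn⟩)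
          (i' := ⟨m, hm⟩) (fun h => hmn (congrArg Fin.val h)) x
      · rw [hι0 n (by omega), ContinuousLinearMap.comp_zero]
    · rw [hι0 m (by omega), map_zero, ContinuousLinearMap.zero_comp]
  · rw [Finset.sum_range]
    ext x i
    have h1 : ∀ j : Fin (N + 1), (ι j ∘L ContinuousLinearMap.adjoint (ι j)) x =
        PiLp.single 2 (β := fun i : Fin (N + 1) => K i) j (x j) := fun j => by
      rw [hι j j.2, ContinuousLinearMap.adjoint_adjoint, ContinuousLinearMap.comp_apply, hp]
      rfl
    rw [sum_apply, Finset.sum_congr rfl fun j _ => h1 j]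
    change p i (∑ j, PiLp.single 2 (β := fun i : Fin (N + 1) => K i) j (x j)) = p i x
    refine (map_sum (p i) _ _).trans ((Finset.sum_eq_single i (fun j _ hj =>
      PiLp.single_eq_of_ne 2 (β := fun i : Fin (N + 1) => K i) hj.symm (x j)) ?_).trans
        (PiLp.single_eq_same 2 (β := fun i : Fin (N + 1) => K i) _ _))
    exact fun h => absurd (Finset.mem_univ i) h

variable {K} {M : Type u} [CStarAlgebra M] [PartialOrder M] [StarOrderedRing M]
  {G : Type u} [NormedAddCommGroup G] [InnerProductSpace ℂ G] [CompleteSpace G]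
  {N : ℕ} {ι : ∀ n, K n →L[ℂ] G}

lemma IsDirectSum.comp_comp_apply (hι : IsDirectSum K N ι) (T : ∀ n, K n →L[ℂ] K n) (m : ℕ) :
    (∑ n ∈ Finset.range (N + 1), ι n ∘L T n ∘L ContinuousLinearMap.adjoint (ι n)) ∘L ι m =
      ι m ∘L T m := by
  by_cases hm : m ≤ N
  · rw [ContinuousLinearMap.finsetSum_comp, Finset.sum_eq_single m]
    · rw [ContinuousLinearMap.comp_assoc, ContinuousLinearMap.comp_assoc,
        hι.adjoint_comp_self m hm]
      rfl
    · intro n _ hn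
      rw [ContinuousLinearMap.comp_assoc, ContinuousLinearMap.comp_assoc,
        hι.adjoint_comp_of_ne n m hn, ContinuousLinearMap.comp_zero, ContinuousLinearMap.comp_zero]
    · intro h
      exact absurd (Finset.mem_range.mpr (Nat.lt_succ_of_le hm)) h
  · rw [hι.eq_zero_of_lt m (by omega), ContinuousLinearMap.comp_zero,
      ContinuousLinearMap.zero_comp]

lemma IsDirectSum.exists_rep [WStarAlgebra M] (hι : IsDirectSum K N ι)
    (σ : ∀ n, M →⋆ₐ[ℂ] (K n →L[ℂ] K n)) (hσ : ∀ n, ScottContinuous (σ n)) :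
    ∃ τ : M →⋆ₐ[ℂ] (G →L[ℂ] G), ScottContinuous τ ∧ ∀ n, Intertwines (σ n) τ (ι n) := by
  let f : M → G →L[ℂ] G := fun a =>
    ∑ n ∈ Finset.range (N + 1), ι n ∘L σ n a ∘L ContinuousLinearMap.adjoint (ι n)
  have hf : ∀ a m, f a ∘L ι m = ι m ∘L σ m a := fun a m => hι.comp_comp_apply (fun n => σ n a) m
  have h1 : f 1 = 1 := by
    simp only [f, map_one]
    exact hι.sum_comp_adjoint
  have hmul : ∀ a b, f (a * b) = f a * f b := fun a b => by
    change f (a * b) = f a ∘L f b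
    conv_rhs => rw [show f b = ∑ n ∈ Finset.range (N + 1),
      ι n ∘L σ n b ∘L ContinuousLinearMap.adjoint (ι n) from rfl]
    rw [ContinuousLinearMap.comp_finsetSum]
    refine Finset.sum_congr rfl fun n _ => ?_
    calc ι n ∘L σ n (a * b) ∘L ContinuousLinearMap.adjoint (ι n)
        = (ι n ∘L σ n a) ∘L σ n b ∘L ContinuousLinearMap.adjoint (ι n) := by rw [map_mul]; rfl
      _ = f a ∘L ι n ∘L σ n b ∘L ContinuousLinearMap.adjoint (ι n) := by rw [← hf]; rfl
  have hadd : ∀ a b, f (a + b) = f a + f b := fun a b => by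
    simp only [f, map_add, ContinuousLinearMap.add_comp, ContinuousLinearMap.comp_add,
      Finset.sum_add_distrib]
  have hsmul : ∀ (c : ℂ) a, f (c • a) = c • f a := fun c a => by
    simp only [f, map_smul, ContinuousLinearMap.smul_comp, ContinuousLinearMap.comp_smul,
      Finset.smul_sum]
  have hstar : ∀ a, f (star a) = star (f a) := fun a => by
    simp only [f, star_sum, map_star]
    refine Finset.sum_congr rfl fun n _ => ?_
    simp only [ContinuousLinearMap.star_eq_adjoint, ContinuousLinearMap.adjoint_comp,
      ContinuousLinearMap.adjoint_adjoint]
    rfl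
  let τ : M →⋆ₐ[ℂ] (G →L[ℂ] G) :=
    { toFun := f
      map_one' := h1
      map_mul' := hmul
      map_zero' := by
        have := hsmul 0 0
        rwa [zero_smul, zero_smul] at this
      map_add' := hadd
      commutes' := fun c => by
        rw [Algebra.algebraMap_eq_smul_one, hsmul, h1, Algebra.algebraMap_eq_smul_one]
      map_star' := hstar }
  refine ⟨τ, scottContinuous_of_isNormalFun fun h => ?_, fun n a => (hf a n).symm⟩
  have h2 : (fun a => inner ℂ h (τ a h)) = fun a => ∑ n ∈ Finset.range (N + 1),
      inner ℂ (ContinuousLinearMap.adjoint (ι n) h)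
        (σ n a (ContinuousLinearMap.adjoint (ι n) h)) := by
    funext a
    change inner ℂ h (f a h) = _
    rw [sum_apply, inner_sum]
    refine Finset.sum_congr rfl fun n _ => ?_
    rw [ContinuousLinearMap.adjoint_inner_left]
    rfl
  rw [h2]
  exact IsNormalFun.sum _ fun n _ => isNormalFun_inner (hσ n) _ _

end DirectSum

/-! ### Shifts on truncated Fock spaces as points of the disc -/

section Fock

variable {M E : Type u} [CStarAlgebra M] [PartialOrder M] [StarOrderedRing M] [WStarAlgebra M]
  [NormedAddCommGroup E] [NormedSpace ℂ E] [CompleteSpace E] [Module M E] [Module Mᵐᵒᵖ E]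
  [WStarCorrespondence M E]
  {H : Type u} [NormedAddCommGroup H] [InnerProductSpace ℂ H] [CompleteSpace H]
  {σ : M →⋆ₐ[ℂ] (H →L[ℂ] H)} {k : ℕ} {z : HTensor E σ 1 →L[ℂ] H}

lemma mem_intertwiners_of_intertwines (hσ : ScottContinuous σ)
    (hz : Intertwines (ind E hσ 1) σ z) : z ∈ intertwiners E σ := fun a ξ h => by
  have h1 : htens σ ![a • ξ] h = ind E hσ 1 a (htens σ ![ξ] h) :=
    (ind_htens_cons hσ a ξ ![] h).symm
  rw [h1, hz.apply]

lemma smul_mem_intertwiners (hz : z ∈ intertwiners E σ) (c : ℂ) : c • z ∈ intertwiners E σ :=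
  fun a ξ h => by
    rw [smul_apply, smul_apply, hz a ξ h, map_smul]

lemma tensorialPow_smul (hσ : ScottContinuous σ) (hz : z ∈ intertwiners E σ) (c : ℂ) (k : ℕ) :
    tensorialPow (c • z) k = c ^ k • tensorialPow z k := by
  induction k with
  | zero => rw [pow_zero, one_smul]; rfl
  | succ k ih =>
    refine HTensor.clm_ext fun w h => ?_
    rw [← Fin.cons_self_tail w, tensorialPow, tensorialPow, ContinuousLinearMap.comp_apply,
      idTensorH_htens hσ (intertwines_tensorialPow hσ (smul_mem_intertwiners hz c) k), ih,
      smul_apply, smul_apply, smul_apply, htens_smul, map_smul, smul_smul, ← pow_succ',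
      ContinuousLinearMap.comp_apply, idTensorH_htens hσ (intertwines_tensorialPow hσ hz k)]

lemma cpTerm_smul_intertwiner (hσ : ScottContinuous σ) (hz : z ∈ intertwiners E σ) (t : ℝ)
    (S : Endo M E k) (a : H →L[ℂ] H) :
    cpTerm ((t : ℂ) • z) S a = ((t ^ (2 * k) : ℝ) : ℂ) • cpTerm z S a := by
  rw [cpTerm, cpTerm, tensorialPow_smul hσ hz, map_smulₛₗ, ContinuousLinearMap.smul_comp,
    ContinuousLinearMap.comp_smul, ContinuousLinearMap.comp_smul, smul_smul, map_pow,
    Complex.conj_ofReal, ← pow_add, ← two_mul]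
  push_cast
  rfl

variable {G : Type u} [NormedAddCommGroup G] [InnerProductSpace ℂ G] [CompleteSpace G] {N : ℕ}
  {ι : ∀ n, HTensor E σ n →L[ℂ] G} {τ : M →⋆ₐ[ℂ] (G →L[ℂ] G)}

/-- The shift `ξ ⊗ ι_n(x) ↦ ι_{n+1}(ξ ⊗ x)` on a truncated Fock space. -/
def fockShift (hσ : ScottContinuous σ) (N : ℕ) (ι : ∀ n, HTensor E σ n →L[ℂ] G)
    (τ : M →⋆ₐ[ℂ] (G →L[ℂ] G)) : HTensor E τ 1 →L[ℂ] G :=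
  ∑ n ∈ Finset.range N, ι (n + 1) ∘L ContinuousLinearMap.adjoint ((Split.cons M E n).V hσ) ∘L
    mapRight E τ (ind E hσ n) 1 (ContinuousLinearMap.adjoint (ι n))

lemma fockShift_mem (hσ : ScottContinuous σ) (hτ : ScottContinuous τ)
    (hιτ : ∀ n, Intertwines (ind E hσ n) τ (ι n)) :
    fockShift hσ N ι τ ∈ intertwiners E τ := by
  refine mem_intertwiners_of_intertwines hτ fun a => ?_
  rw [fockShift, ContinuousLinearMap.finsetSum_comp, ContinuousLinearMap.comp_finsetSum]
  refine Finset.sum_congr rfl fun n _ => ?_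
  have h1 : Intertwines (ind E hσ (n + 1)) (ind E (ind_normal hσ n) 1) ((Split.cons M E n).V hσ) :=
    fun a => (Split.cons M E n).V_comp_ind hσ a
  exact (hιτ (n + 1)).comp (h1.adjoint.comp
    (intertwines_mapRight (hιτ n).adjoint hτ (ind_normal hσ n))) a

lemma adjoint_V_htens (hσ : ScottContinuous σ) (ξ : E) (u : Fin k → E) (h : H) :
    ContinuousLinearMap.adjoint ((Split.cons M E k).V hσ)
      (htens (ind E hσ k) ![ξ] (htens σ u h)) = htens σ (Fin.cons ξ u : Fin (k + 1) → E) h := by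
  have h1 : (Split.cons M E k).V hσ (htens σ (Fin.cons ξ u : Fin (k + 1) → E) h) =
      htens (ind E hσ k) ![ξ] (htens σ u h) := Split.V_htens _ hσ _ h
  rw [← h1, ← ContinuousLinearMap.comp_apply, Split.adjoint_comp_V]
  rfl

lemma htens_zero (u : Fin k → E) : htens σ u (0 : H) = 0 := (htensL σ u).map_zero

lemma fockShift_apply (hσ : ScottContinuous σ) (hιτ : ∀ n, Intertwines (ind E hσ n) τ (ι n))
    (ξ : E) (g : G) : fockShift hσ N ι τ (htens τ ![ξ] g) = ∑ n ∈ Finset.range N,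
      ι (n + 1) (ContinuousLinearMap.adjoint ((Split.cons M E n).V hσ)
        (htens (ind E hσ n) ![ξ] (ContinuousLinearMap.adjoint (ι n) g))) := by
  rw [fockShift, sum_apply]
  refine Finset.sum_congr rfl fun n _ => ?_
  rw [ContinuousLinearMap.comp_apply, ContinuousLinearMap.comp_apply,
    mapRight_htens (hιτ n).adjoint]

lemma fockShift_htens (hι : IsDirectSum (fun n => HTensor E σ n) N ι) (hσ : ScottContinuous σ)
    (hιτ : ∀ n, Intertwines (ind E hσ n) τ (ι n)) (ξ : E) (u : Fin k → E) (h : H) :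
    fockShift hσ N ι τ (htens τ ![ξ] (ι k (htens σ u h))) =
      ι (k + 1) (htens σ (Fin.cons ξ u : Fin (k + 1) → E) h) := by
  rw [fockShift_apply hσ hιτ, Finset.sum_eq_single k]
  · by_cases hk : k ≤ N
    · rw [← ContinuousLinearMap.comp_apply (ContinuousLinearMap.adjoint (ι k)),
        hι.adjoint_comp_self k hk, one_apply_eq_self, adjoint_V_htens]
    · rw [hι.eq_zero_of_lt (k + 1) (by omega), zero_apply, zero_apply]
  · intro n _ hn
    rw [← ContinuousLinearMap.comp_apply (ContinuousLinearMap.adjoint (ι n)),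
      hι.adjoint_comp_of_ne n k hn, zero_apply, htens_zero, map_zero, map_zero]
  · intro hk
    rw [Finset.mem_range] at hk
    rw [hι.eq_zero_of_lt (k + 1) (by omega), zero_apply]

lemma tensorialPow_fockShift (hι : IsDirectSum (fun n => HTensor E σ n) N ι)
    (hσ : ScottContinuous σ) (hτ : ScottContinuous τ)
    (hιτ : ∀ n, Intertwines (ind E hσ n) τ (ι n)) (k : ℕ) (w : Fin k → E) (h : H) :
    tensorialPow (fockShift hσ N ι τ) k (htens τ w (ι 0 (htens σ ![] h))) = ι k (htens σ w h) := by
  have hz := fockShift_mem (N := N) hσ hτ hιτ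
  induction k with
  | zero =>
    rw [tensorialPow, unitMap_htens]
    congr 2
    exact Subsingleton.elim _ _
  | succ k ih =>
    rw [← Fin.cons_self_tail w, tensorialPow, ContinuousLinearMap.comp_apply,
      idTensorH_htens hτ (intertwines_tensorialPow hτ hz k), ih, fockShift_htens hι hσ hιτ]

/-- Each application of the shift raises the degree by one, so the range of z^{(k)} has no component
in degrees below k. For k > N this leaves nothing. -/
lemma adjoint_tensorialPow_fockShift (hι : IsDirectSum (fun n => HTensor E σ n) N ι)
    (hσ : ScottContinuous σ) (hτ : ScottContinuous τ)
    (hιτ : ∀ n, Intertwines (ind E hσ n) τ (ι n)) (k : ℕ) (w : Fin k → E) (g : G) (m : ℕ)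
    (hm : m < k) : ContinuousLinearMap.adjoint (ι m)
      (tensorialPow (fockShift hσ N ι τ) k (htens τ w g)) = 0 := by
  have hz := fockShift_mem (N := N) hσ hτ hιτ
  induction k generalizing m with
  | zero => omega
  | succ k ih =>
    rw [← Fin.cons_self_tail w, tensorialPow, ContinuousLinearMap.comp_apply,
      idTensorH_htens hτ (intertwines_tensorialPow hτ hz k), fockShift_apply hσ hιτ, map_sum]
    refine Finset.sum_eq_zero fun n _ => ?_
    by_cases hn : m = n + 1
    · rw [ih _ n (by omega), htens_zero, map_zero, map_zero, map_zero]
    · rw [← ContinuousLinearMap.comp_apply (ContinuousLinearMap.adjoint (ι m)),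
        hι.adjoint_comp_of_ne m (n + 1) hn, zero_apply]

lemma tensorialPow_fockShift_eq_zero (hι : IsDirectSum (fun n => HTensor E σ n) N ι)
    (hσ : ScottContinuous σ) (hτ : ScottContinuous τ)
    (hιτ : ∀ n, Intertwines (ind E hσ n) τ (ι n)) (hk : N < k) :
    tensorialPow (fockShift hσ N ι τ) k = 0 := by
  refine HTensor.clm_ext fun w g => ?_
  set y := tensorialPow (fockShift hσ N ι τ) k (htens τ w g) with hy
  have h1 : y = (1 : G →L[ℂ] G) y := rfl
  rw [zero_apply, h1, ← hι.sum_comp_adjoint, sum_apply]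
  refine Finset.sum_eq_zero fun n hn => ?_
  rw [Finset.mem_range] at hn
  rw [ContinuousLinearMap.comp_apply, hy,
    adjoint_tensorialPow_fockShift hι hσ hτ hιτ k w g n (by omega), map_zero]

lemma exists_smul_fockShift_mem_disc (hι : IsDirectSum (fun n => HTensor E σ n) N ι)
    (hσ : ScottContinuous σ) (hτ : ScottContinuous τ)
    (hιτ : ∀ n, Intertwines (ind E hσ n) τ (ι n)) (X : (k : ℕ) → Endo M E k) :
    ∃ t : ℝ, 0 < t ∧ (t : ℂ) • fockShift hσ N ι τ ∈ disc X τ := by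
  have hz := fockShift_mem (N := N) hσ hτ hιτ
  set z := fockShift hσ N ι τ with hzdef
  set C := ∑ j ∈ Finset.range N, ‖cpTerm z (X (j + 1)) 1‖ with hC
  have hC0 : 0 ≤ C := Finset.sum_nonneg fun _ _ => norm_nonneg _
  -- With t = (1 + C)⁻¹ ≤ 1 the term of index j carries the factor t^{2(j+1)} ≤ t, so the norms add
  -- up to at most C/(1 + C) < 1.
  have ht0 : 0 < (1 + C)⁻¹ := by positivity
  have ht1 : (1 + C)⁻¹ ≤ 1 := inv_le_one_of_one_le₀ (by linarith)
  refine ⟨(1 + C)⁻¹, ht0, smul_mem_intertwiners hz _,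
    ∑ j ∈ Finset.range N, cpTerm (((1 + C)⁻¹ : ℝ) • z : HTensor E τ 1 →L[ℂ] G) (X (j + 1)) 1, ?_, ?_⟩
  · refine hasSum_sum_of_ne_finset_zero fun j hj => ?_
    rw [Finset.mem_range] at hj
    rw [cpTerm_smul_intertwiner hτ hz, cpTerm,
      tensorialPow_fockShift_eq_zero hι hσ hτ hιτ (k := j + 1) (by omega),
      ContinuousLinearMap.zero_comp, smul_zero]
  · refine (norm_sum_le _ _).trans_lt ?_
    have h1 : ∀ j ∈ Finset.range N,
        ‖cpTerm ((((1 + C)⁻¹ : ℝ) : ℂ) • z) (X (j + 1)) 1‖ ≤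
          (1 + C)⁻¹ * ‖cpTerm z (X (j + 1)) 1‖ := fun j _ => by
      rw [cpTerm_smul_intertwiner hτ hz, norm_smul, Complex.norm_real,
        Real.norm_of_nonneg (by positivity)]
      exact mul_le_mul_of_nonneg_right (pow_le_of_le_one ht0.le ht1 (by omega)) (norm_nonneg _)
    refine (Finset.sum_le_sum h1).trans_lt ?_
    rw [← Finset.mul_sum, ← hC, inv_mul_lt_iff₀ (by positivity)]
    linarith

lemma intertwines_htensL_empty (hσ : ScottContinuous σ) :
    Intertwines σ (ind E hσ 0) (htensL σ ![]) := fun a => by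
  ext h
  exact (ind_htens_zero hσ a ![] h).symm

/-- Let κ embed H as the degree zero part. Then z^{(k)}(1 ⊗ κ) = ι k, because k shifts carry the
vacuum vectors onto degree k; inserting a = κκ^* isolates S ⊗ 1 there. -/
lemma cpTerm_fockShift (hι : IsDirectSum (fun n => HTensor E σ n) N ι)
    (hσ : ScottContinuous σ) (hτ : ScottContinuous τ)
    (hιτ : ∀ n, Intertwines (ind E hσ n) τ (ι n)) (S : Endo M E k) :
    cpTerm (fockShift hσ N ι τ) S ((ι 0 ∘L htensL σ ![]) ∘L
      ContinuousLinearMap.adjoint (ι 0 ∘L htensL σ ![])) =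
        ι k ∘L amp hσ k S ∘L ContinuousLinearMap.adjoint (ι k) := by
  have hκ : Intertwines σ τ (ι 0 ∘L htensL σ ![]) :=
    (hιτ 0).comp (intertwines_htensL_empty hσ)
  have hY : tensorialPow (fockShift hσ N ι τ) k ∘L mapRight E σ τ k (ι 0 ∘L htensL σ ![]) = ι k :=
    HTensor.clm_ext fun w h => by
      rw [ContinuousLinearMap.comp_apply, mapRight_htens hκ]
      exact tensorialPow_fockShift hι hσ hτ hιτ k w h
  have h1 := mapRight_comp_amp hκ hσ hτ S
  rw [cpTerm_eq hτ _ S (hκ.comp hκ.adjoint), mapRight_comp hκ hκ.adjoint, ← adjoint_mapRight hκ,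
    ← hY, ContinuousLinearMap.adjoint_comp]
  set T := tensorialPow (fockShift hσ N ι τ) k
  set m := mapRight E σ τ k (ι 0 ∘L htensL σ ![])
  calc T ∘L (amp hτ k S ∘L m ∘L ContinuousLinearMap.adjoint m) ∘L ContinuousLinearMap.adjoint T
      = T ∘L (amp hτ k S ∘L m) ∘L ContinuousLinearMap.adjoint m ∘L ContinuousLinearMap.adjoint T := rfl
    _ = T ∘L (m ∘L amp hσ k S) ∘L ContinuousLinearMap.adjoint m ∘L
        ContinuousLinearMap.adjoint T := by rw [h1]
    _ = (T ∘L m) ∘L amp hσ k S ∘L ContinuousLinearMap.adjoint m ∘L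
        ContinuousLinearMap.adjoint T := rfl

end Fock

end WStar

/-! ### Uniqueness: the squares R_k² are determined by the potential -/

namespace WStar

open Filter Topology WStarCorrespondence TensPow

variable {M E : Type u} [CStarAlgebra M] [PartialOrder M] [StarOrderedRing M] [WStarAlgebra M]
  [NormedAddCommGroup E] [NormedSpace ℂ E] [CompleteSpace E] [Module M E] [Module Mᵐᵒᵖ E]
  [WStarCorrespondence M E]
  {H : Type u} [NormedAddCommGroup H] [InnerProductSpace ℂ H] [CompleteSpace H]
  {σ : M →⋆ₐ[ℂ] (H →L[ℂ] H)} {X R R' : (k : ℕ) → Endo M E k}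

lemma IsPrepotential.unique {z : HTensor E σ 1 →L[ℂ] H} {Φ Φ' : commutant σ →L[ℂ] commutant σ}
    (h : IsPrepotential X z Φ) (h' : IsPrepotential X z Φ') : Φ = Φ' :=
  ContinuousLinearMap.ext fun a => Subtype.ext ((h a).unique (h' a))

lemma IsPotential.unique {Φ Θ Θ' : commutant σ →L[ℂ] commutant σ} (h : IsPotential Θ Φ)
    (h' : IsPotential Θ' Φ) : Θ = Θ' := h.1.unique h'.1

/-- The squares `R_k²` are determined by the property that `Θ^R` is the potential of `Φ`. -/
theorem ThetaIsPotential.mul_self_eq (h : ThetaIsPotential X R) (h' : ThetaIsPotential X R')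
    (k : ℕ) : R k * R k = R' k * R' k := by
  refine Endo.eq_of_amp fun π => ?_
  have hσ := π.normal
  -- Degrees up to k suffice to see R_k, and the truncation leaves only finitely many nonzero terms
  -- in the series defining the disc.
  obtain ⟨G, _, _, _, ι, hι⟩ := exists_isDirectSum (fun n => HTensor E π.σ n) k
  obtain ⟨τ, hτ, hιτ⟩ := hι.exists_rep (fun n => ind E hσ n) (fun n => ind_normal hσ n)
  obtain ⟨t, ht, hz⟩ := exists_smul_fockShift_mem_disc hι hσ hτ hιτ X
  obtain ⟨Φ, Θ, hΦ, hΘ, -, -, hp⟩ := h G τ hτ _ hz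
  obtain ⟨Φ', Θ', hΦ', hΘ', -, -, hp'⟩ := h' G τ hτ _ hz
  obtain rfl := hΦ.unique hΦ'
  obtain rfl := hp.unique hp'
  have hs := fockShift_mem (N := k) hσ hτ hιτ
  have hκ : Intertwines π.σ τ (ι 0 ∘L htensL π.σ ![]) :=
    (hιτ 0).comp (intertwines_htensL_empty hσ)
  let e : commutant τ := ⟨(ι 0 ∘L htensL π.σ ![]) ∘L
    ContinuousLinearMap.adjoint (ι 0 ∘L htensL π.σ ![]),
    mem_commutant_of_intertwines (hκ.comp hκ.adjoint)⟩
  -- Compression to degree k: applied to the series for Θ(e), it kills every term but the k-th,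
  -- which becomes t^{2k}(R_k² ⊗ 1).
  let P : (G →L[ℂ] G) →L[ℂ] (HTensor E π.σ k →L[ℂ] HTensor E π.σ k) :=
    (ContinuousLinearMap.compL ℂ _ _ _ (ContinuousLinearMap.adjoint (ι k))).comp
      ((ContinuousLinearMap.compL ℂ _ _ _).flip (ι k))
  have hP : ∀ T, P T = ContinuousLinearMap.adjoint (ι k) ∘L T ∘L ι k := fun _ => rfl
  have key : ∀ Q : (k : ℕ) → Endo M E k,
      IsThetaR Q ((t : ℂ) • fockShift hσ k ι τ) Θ →
      P (Θ e : G →L[ℂ] G) = ((t ^ (2 * k) : ℝ) : ℂ) • amp hσ k (Q k * Q k) := fun Q hQ => by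
    have h1 : ∀ j, P (cpTerm ((t : ℂ) • fockShift hσ k ι τ) (Q j * Q j) (e : G →L[ℂ] G)) =
        ((t ^ (2 * j) : ℝ) : ℂ) • (ContinuousLinearMap.adjoint (ι k) ∘L ι j) ∘L
          amp hσ j (Q j * Q j) ∘L (ContinuousLinearMap.adjoint (ι j) ∘L ι k) := fun j => by
      rw [cpTerm_smul_intertwiner hτ hs, map_smul, cpTerm_fockShift hι hσ hτ hιτ, hP]
      rfl
    have h2 := (hQ e).mapL P
    refine h2.unique ?_
    convert hasSum_single k fun j hj => ?_ using 1
    · rw [h1, hι.adjoint_comp_self k le_rfl]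
      rfl
    · rw [h1, hι.adjoint_comp_of_ne k j hj.symm, ContinuousLinearMap.zero_comp, smul_zero]
  have h3 := (key R hΘ).symm.trans (key R' hΘ')
  have ht' : ((t ^ (2 * k) : ℝ) : ℂ) ≠ 0 := by
    exact_mod_cast (pow_pos ht _).ne'
  exact smul_right_injective _ ht' h3

end WStar

end

theorem mainTheorem2 {M E : Type u} [CStarAlgebra M] [PartialOrder M] [StarOrderedRing M]
    [WStarAlgebra M] [NormedAddCommGroup E] [NormedSpace ℂ E] [CompleteSpace E] [Module M E]
    [Module Mᵐᵒᵖ E] [WStarCorrespondence M E]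
    (X : (k : ℕ) → WStar.Endo M E k) (hX : WStar.IsAdmissible X) :
    ∃ Z : (k : ℕ) → WStar.Endo M E k,
      WStar.IsCanonicalWeight X Z ∧
      (∀ Z' : (k : ℕ) → WStar.Endo M E k, WStar.IsCanonicalWeight X Z' → Z' = Z) ∧
      (∀ m, IsUnit (WStar.weightPow Z m)) ∧
      (∀ k, 1 ≤ k → WStar.IsPos (WStar.invWeight Z k) ∧
        WStar.invWeight Z k * WStar.invWeight Z k = WStar.compositionSum X k) := by
  have hZ := WStar.isCanonicalWeight_canonicalWeight hX
  have hR : ∀ k, WStar.invWeight (WStar.canonicalWeight X) k *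
      WStar.invWeight (WStar.canonicalWeight X) k = WStar.compositionSum X k := fun k => by
    rw [WStar.invWeight_canonicalWeight hX, WStar.rootSum_mul_self hX]
  refine ⟨WStar.canonicalWeight X, hZ, fun Z' hZ' => ?_, WStar.isUnit_weightPow hZ.weight,
    fun k _ => ⟨?_, hR k⟩⟩
  -- The potential fixes R_k², positivity of Z^{(k)} selects the positive root, and the Z^{(k)}
  -- determine the sequence. In degree zero both powers are 1 by definition.
  · refine WStar.eq_of_weightPow_eq hZ'.weight hZ.weight fun k => ?_
    cases k with
    | zero => rfl
    | succ k =>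
      have h1 := hZ'.potential.mul_self_eq hZ.potential (k + 1)
      rw [hR] at h1
      rw [WStar.weightPow_eq_of_invWeight_mul_self hZ'.weight
        ((WStar.isPos_iff _).mp (hZ'.pos (k + 1) (Nat.le_add_left 1 k))) h1,
        WStar.weightPow_canonicalWeight hX]
      rfl
  · rw [WStar.invWeight_canonicalWeight hX, WStar.isPos_iff]
    exact (WStar.isStrictlyPositive_rootSum hX k).nonneg
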